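/- **Conventions.** Manifolds are smooth, finite-dimensional, Hausdorff, second countable, of pure dimension; vector bundles are smooth, real, of constant rank. A ($\mathbb Z$-graded) superdomain of dimension $\{p_i\}_{i\in\mathbb Z}$ is an open set $U\subseteq\mathbb R^{p_0}$ with the sheaf of graded algebras locally given by $C^\infty(U)[\xi_i^k : i\ne 0,\ 1\le k\le p_i]$, where $\xi_i^k$ has degree $-i$ and $\xi_i^k\xi_j^l=(-1)^{ij}\xi_j^l\xi_i^k$; a supermanifold is a (Hausdorff, second countable) space with a sheaf of graded algebras $C^\infty(\mathcal M)$ that is locally isomorphic to a superdomain of a fixed dimension. Morphisms are continuous maps $\mu_0$ together with degree-preserving algebra pullbacks $\mu^*$ of the sheaves that commute with evaluation on the support. A vector field of degree $j$ is a degree $j$ graded derivation $\phi$ of $C^\infty(\mathcal M)$; it is homological if $j=1$ and $[\phi,\phi]=2\phi^2=0$. Vector fields $\phi$ on $\mathcal M$ and $\psi$ on $\mathcal N$ are $\mu$-related, for $\mu:\mathcal M\to\mathcal N$, if $\mu^*(\psi f)=\phi(\mu^*f)$ for all $f$. A supergroupoid $\mathcal G\rightrightarrows\mathcal M$ is a groupoid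 object in supermanifolds whose source $s$ and target $t$ are surjective submersions (surjective on supports, with surjective tangent maps at all points of the support); $\mathcal G^{(2)}=\mathcal G\times_{s,t}\mathcal G$, with projections $p_1,p_2$ and multiplication $m:\mathcal G^{(2)}\to\mathcal G$. A vector field $\psi$ on $\mathcal G$ is multiplicative if there is a vector field $\psi^{(2)}$ on $\mathcal G^{(2)}$ that is $p_1$-, $p_2$- and $m$-related to $\psi$. A base vector field of $\psi$ is a vector field $\psi^{(0)}$ on $\mathcal M$ that is $s$- and $t$-related to $\psi$. A $Q$-groupoid is a supergroupoid with a multiplicative homological vector field (and its homological base vector field); a morphism of $Q$-groupoids is a groupoid morphism that relates the homological vector fields, on arrows and on the base. For a vector bundle $E\to M$, $[-1]E$ is the space $M$ with the sheaf $\bigwedge\Gamma(E^*)$, and a bundle map $\varphi$ induces $[-1]\varphi$ by pullback of sections. If $A\to M$ is a Lie algebroid with anchor $\rho$, its differential $d_A$ is the degree $1$ derivation of $\bigwedge\Gamma(A^*)$ with $(d_Af)(X)=\rho(X)f$ and $(d_A\alpha)(X,Y)=\rho(X)(\alpha(Y))-\rho(Y)(\alpha(X))-\alpha([X,Y])$ for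 functions $f$ and sections $\alpha$ of $A^*$. A bundle map $\varphi:A\to A'$ over $\varphi_0$ is a Lie algebroid morphism if it intertwines the anchors via $T\varphi_0$ and, whenever locally $\varphi\circ X=\sum_i a_i\,(X'_i\circ\varphi_0)$ and $\varphi\circ Y=\sum_j b_j\,(Y'_j\circ\varphi_0)$ with $X,Y$ sections of $A$, $X_i',Y_j'$ sections of $A'$ and $a_i,b_j$ smooth functions, one has $\varphi\circ[X,Y]=\sum_{i,j}a_ib_j\,[X'_i,Y'_j]\circ\varphi_0+\sum_j\rho(X)(b_j)\,Y'_j\circ\varphi_0-\sum_i\rho(Y)(a_i)\,X'_i\circ\varphi_0$. An $\mathcal{LA}$-groupoid is a square with vector bundles $\Omega\to G$ and $A\to M$ carrying Lie algebroid structures, and a groupoid $\Omega\rightrightarrows A$ in the category of vector bundles, covering $G\rightrightarrows M$, whose source and target are surjective submersions and whose structure maps (source, target, multiplication, identity, inverse) are Lie algebroid morphisms; here $\Omega^{(2)}\to G^{(2)}$ carries the induced Lie algebroid structure, i.e. the one for which both projections to $\Omega$ are Lie algebroid morphisms. A morphism of $\mathcal{LA}$-groupoids is a morphism of such groupoids consisting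 of Lie algebroid morphisms $\Omega\to\Omega'$, $A\to A'$. **Theorem.** Every Lie algebroid $A$ has a unique differential $d_A$ as above. Let $\Omega$ be an $\mathcal{LA}$-groupoid over $G$, $A$, $M$. Then $[-1]\Omega\rightrightarrows[-1]A$, with structure maps $[-1]s$, $[-1]t$, $[-1]m$, $[-1]e$, $[-1]i$ and with $([-1]\Omega)^{(2)}=[-1](\Omega^{(2)})$, is a supergroupoid; together with the Lie algebroid differential $d_\Omega$ it is a $Q$-groupoid with base vector field $d_A$, so that $d_\Omega$ is a multiplicative homological vector field. Moreover, if $f$ is a morphism of $\mathcal{LA}$-groupoids then $[-1]f$ is a morphism of $Q$-groupoids, and this defines a faithful functor $[-1]$ from $\mathcal{LA}$-groupoids to $Q$-groupoids. -/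

import Mathlib

open CategoryTheory TopologicalSpace Topology Bundle
open scoped Manifold ContDiff

noncomputable section

/-! ### Vector bundles -/

/-- A smooth real vector bundle of constant rank over a smooth (Hausdorff, second countable,
pure-dimensional, boundaryless) manifold. -/
structure SmoothVB where
  base : Type
  dim : ℕ
  rank : ℕ
  [topBase : TopologicalSpace base]
  [charted : ChartedSpace (EuclideanSpace ℝ (Fin dim)) base]
  [manifold : IsManifold (𝓡 dim) ∞ base]
  [t2 : T2Space base]
  [secondCountable : SecondCountableTopology base]
  fib : base → Type
  [fibAdd : ∀ x, AddCommGroup (fib x)]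
  [fibModule : ∀ x, Module ℝ (fib x)]
  [fibTop : ∀ x, TopologicalSpace (fib x)]
  [totTop : TopologicalSpace (TotalSpace (EuclideanSpace ℝ (Fin rank)) fib)]
  [fiberBundle : FiberBundle (EuclideanSpace ℝ (Fin rank)) fib]
  [vectorBundle : VectorBundle ℝ (EuclideanSpace ℝ (Fin rank)) fib]
  [smoothBundle : ContMDiffVectorBundle ∞ (EuclideanSpace ℝ (Fin rank)) fib (𝓡 dim)]

namespace SmoothVB

attribute [instance] topBase charted manifold t2 secondCountable fibAdd fibModule fibTop totTop
  fiberBundle vectorBundle smoothBundle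

/-- The model fibre. -/
abbrev Fm (E : SmoothVB) : Type := EuclideanSpace ℝ (Fin E.rank)

/-- The total space. -/
abbrev Tot (E : SmoothVB) : Type := TotalSpace E.Fm E.fib

/-- Global smooth sections. -/
abbrev Sec (E : SmoothVB) : Type := ContMDiffSection (𝓡 E.dim) E.Fm ∞ E.fib

/-- Tangent spaces of the base. -/
abbrev Tan (E : SmoothVB) (x : E.base) : Type := TangentSpace (𝓡 E.dim) x

/-- Smooth real functions on the base, smoothness at a point. -/
abbrev SmoothAt (E : SmoothVB) (f : E.base → ℝ) (x : E.base) : Prop :=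
  ContMDiffAt (𝓡 E.dim) 𝓘(ℝ, ℝ) ∞ f x

/-- Smoothness in a neighbourhood of a point. -/
def SmoothNear (E : SmoothVB) (f : E.base → ℝ) (x : E.base) : Prop := ∀ᶠ y in 𝓝 x, E.SmoothAt f y

/-- The derivative of the function `f` at `x` in the direction `v`. -/
def dirDeriv (E : SmoothVB) (f : E.base → ℝ) {x : E.base} (v : E.Tan x) : ℝ :=
  mfderiv (𝓡 E.dim) 𝓘(ℝ, ℝ) f x v

/-- The product of a smooth function and a smooth section. -/
def smulSec (E : SmoothVB) (f : E.base → ℝ) (hf : ContMDiff (𝓡 E.dim) 𝓘(ℝ, ℝ) ∞ f) (X : E.Sec) :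
    E.Sec :=
  ⟨fun x => f x • X x, hf.smul_section X.contMDiff⟩

/-- A smooth bundle map, possibly covering a nontrivial map of the bases. -/
@[ext]
structure Hom (E E' : SmoothVB) where
  base : E.base → E'.base
  fib : ∀ x, E.fib x →ₗ[ℝ] E'.fib (base x)
  smooth_base : ContMDiff (𝓡 E.dim) (𝓡 E'.dim) ∞ base
  smooth_tot : ContMDiff ((𝓡 E.dim).prod 𝓘(ℝ, E.Fm)) ((𝓡 E'.dim).prod 𝓘(ℝ, E'.Fm)) ∞
    (fun v : E.Tot => (⟨base v.1, fib v.1 v.2⟩ : E'.Tot))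

instance : Category SmoothVB where
  Hom := Hom
  id E := ⟨id, fun _ => LinearMap.id, contMDiff_id, contMDiff_id⟩
  comp f g := ⟨g.base ∘ f.base, fun x => (g.fib (f.base x)).comp (f.fib x),
    g.smooth_base.comp f.smooth_base, g.smooth_tot.comp f.smooth_tot⟩

/-- A bundle map that is a surjective submersion: a surjective submersion of the bases which is
surjective on every fibre (equivalently, the map of total spaces is a surjective submersion). -/
structure IsSurjSubmersion {E E' : SmoothVB} (φ : E ⟶ E') : Prop where
  surj : Function.Surjective φ.base
  submersion : Manifold.IsSubmersion (𝓡 E.dim) (𝓡 E'.dim) ∞ φ.base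
  fib_surj : ∀ x, Function.Surjective (φ.fib x)

end SmoothVB

/-! ### Lie algebroids -/

/-- A Lie algebroid structure on the vector bundle `E`. -/
structure LieAlgebroid (E : SmoothVB) where
  anchor : ∀ x, E.fib x →ₗ[ℝ] E.Tan x
  anchor_smooth : ContMDiff ((𝓡 E.dim).prod 𝓘(ℝ, E.Fm)) (𝓡 E.dim).tangent ∞
    (fun v : E.Tot => (⟨v.1, anchor v.1 v.2⟩ : TangentBundle (𝓡 E.dim) E.base))
  bracket : E.Sec →ₗ[ℝ] E.Sec →ₗ[ℝ] E.Sec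
  bracket_self : ∀ X, bracket X X = 0
  jacobi : ∀ X Y Z,
    bracket X (bracket Y Z) + bracket Y (bracket Z X) + bracket Z (bracket X Y) = 0
  leibniz : ∀ (X Y : E.Sec) (f : E.base → ℝ) (hf : ContMDiff (𝓡 E.dim) 𝓘(ℝ, ℝ) ∞ f) (x : E.base),
    bracket X (E.smulSec f hf Y) x = f x • bracket X Y x + E.dirDeriv f (anchor x (X x)) • Y x
  anchor_bracket : ∀ (X Y : E.Sec) (f : E.base → ℝ), ContMDiff (𝓡 E.dim) 𝓘(ℝ, ℝ) ∞ f → ∀ x,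
    E.dirDeriv f (anchor x (bracket X Y x)) =
      E.dirDeriv (fun y => E.dirDeriv f (anchor y (Y y))) (anchor x (X x)) -
      E.dirDeriv (fun y => E.dirDeriv f (anchor y (X y))) (anchor x (Y x))

/-- `φ` is a morphism of Lie algebroids: it is compatible with the anchors and, whenever
`φ ∘ X = ∑ aᵢ (X'ᵢ ∘ φ₀)` and `φ ∘ Y = ∑ bⱼ (Y'ⱼ ∘ φ₀)` near `x`, where `φ₀` is the base map,
one has
`φ [X, Y] = ∑ aᵢ bⱼ [X'ᵢ, Y'ⱼ] ∘ φ₀ + ∑ ρ(X)(bⱼ) Y'ⱼ ∘ φ₀ - ∑ ρ(Y)(aᵢ) X'ᵢ ∘ φ₀` at `x`. -/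
structure IsLieAlgebroidHom {E E' : SmoothVB} (A : LieAlgebroid E) (A' : LieAlgebroid E')
    (φ : E ⟶ E') : Prop where
  anchor : ∀ x (v : E.fib x),
    A'.anchor (φ.base x) (φ.fib x v) = mfderiv (𝓡 E.dim) (𝓡 E'.dim) φ.base x (A.anchor x v)
  bracket : ∀ (x : E.base) (X Y : E.Sec) (k l : ℕ)
    (a : Fin k → E.base → ℝ) (X' : Fin k → E'.Sec) (b : Fin l → E.base → ℝ) (Y' : Fin l → E'.Sec),
    (∀ i, E.SmoothNear (a i) x) → (∀ j, E.SmoothNear (b j) x) →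
    (∀ᶠ y in 𝓝 x, φ.fib y (X y) = ∑ i, a i y • X' i (φ.base y)) →
    (∀ᶠ y in 𝓝 x, φ.fib y (Y y) = ∑ j, b j y • Y' j (φ.base y)) →
    φ.fib x (A.bracket X Y x) =
      ∑ i, ∑ j, (a i x * b j x) • A'.bracket (X' i) (Y' j) (φ.base x) +
      ∑ j, E.dirDeriv (b j) (A.anchor x (X x)) • Y' j (φ.base x) -
      ∑ i, E.dirDeriv (a i) (A.anchor x (Y x)) • X' i (φ.base x)

namespace SmoothVB

variable {E E' : SmoothVB}

theorem SmoothNear.self {f : E.base → ℝ} {x : E.base} (h : E.SmoothNear f x) : E.SmoothAt f x :=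
  h.self_of_nhds

theorem SmoothNear.mdiff {f : E.base → ℝ} {x : E.base} (h : E.SmoothNear f x) :
    MDifferentiableAt (𝓡 E.dim) 𝓘(ℝ, ℝ) f x :=
  h.self.mdifferentiableAt (by simp)

theorem dirDeriv_congr {f g : E.base → ℝ} {x : E.base} (h : f =ᶠ[𝓝 x] g) (v : E.Tan x) :
    E.dirDeriv f v = E.dirDeriv g v := by
  unfold dirDeriv
  rw [h.mfderiv_eq]
  rfl

theorem exists_cutoff {x : E.base} {s : Set E.base} (hs : s ∈ 𝓝 x) :
    ∃ χ : E.base → ℝ, ContMDiff (𝓡 E.dim) 𝓘(ℝ, ℝ) ∞ χ ∧ tsupport χ ⊆ s ∧ ∀ᶠ y in 𝓝 x, χ y = 1 := by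
  obtain ⟨f, -, hf⟩ := (SmoothBumpFunction.nhds_basis_tsupport (I := 𝓡 E.dim) x).mem_iff.1 hs
  exact ⟨f, f.contMDiff, hf, f.eventuallyEq_one⟩

theorem SmoothNear.globalize {f : E.base → ℝ} {x : E.base} (h : E.SmoothNear f x) :
    ∃ g : E.base → ℝ, ContMDiff (𝓡 E.dim) 𝓘(ℝ, ℝ) ∞ g ∧ f =ᶠ[𝓝 x] g := by
  obtain ⟨u, hu, huo, hxu⟩ := eventually_nhds_iff.1 h
  obtain ⟨χ, hχ, hsupp, h1⟩ := exists_cutoff (E := E) (huo.mem_nhds hxu)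
  refine ⟨fun y => χ y * f y, ?_, ?_⟩
  · refine contMDiff_of_tsupport fun y hy => ?_
    have hy' : y ∈ tsupport χ := closure_mono (Function.support_mul_subset_left χ f) hy
    exact (hχ y).mul (hu y (hsupp hy'))
  · filter_upwards [h1] with y hy
    simp [hy]

theorem exists_frame (E : SmoothVB) (x : E.base) :
    ∃ (Z : Fin E.rank → E.Sec) (c : Fin E.rank → E.Tot → ℝ),
      (∀ᶠ y in 𝓝 x, ∀ v : E.fib y, v = ∑ l, c l ⟨y, v⟩ • Z l y) ∧
      (∀ᶠ y in 𝓝 x, ∀ l (a : Fin E.rank → ℝ), c l ⟨y, ∑ m, a m • Z m y⟩ = a l) ∧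
      ∀ᶠ y in 𝓝 x, ∀ l (v : E.fib y),
        ContMDiffAt ((𝓡 E.dim).prod 𝓘(ℝ, E.Fm)) 𝓘(ℝ, ℝ) ∞ (c l) ⟨y, v⟩ := by
  let e := trivializationAt E.Fm E.fib x
  have hx : x ∈ e.baseSet := FiberBundle.mem_baseSet_trivializationAt E.Fm E.fib x
  let b := (EuclideanSpace.basisFun (Fin E.rank) ℝ).toBasis
  obtain ⟨χ, hχ, hsupp, h1⟩ := exists_cutoff (E := E) (e.open_baseSet.mem_nhds hx)
  have hsm : ∀ l, ContMDiff (𝓡 E.dim) ((𝓡 E.dim).prod 𝓘(ℝ, E.Fm)) ∞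
      (fun y => TotalSpace.mk' E.Fm y ((χ • e.localFrame b l) y)) := fun l =>
    ContMDiffOn.smul_section_of_tsupport hχ.contMDiffOn e.open_baseSet hsupp
      (e.contMDiffOn_localFrame_baseSet (I := 𝓡 E.dim) (n := ∞) b l)
  have hbase := e.open_baseSet.mem_nhds hx
  refine ⟨fun l => ⟨_, hsm l⟩, fun l v => (e v).2 l, ?_, ?_, ?_⟩
  · filter_upwards [h1, hbase] with y hy hye v
    refine ((e.basisAt b hye).sum_repr v).symm.trans (Finset.sum_congr rfl fun l _ => ?_)
    change _ = (e ⟨y, v⟩).2 l • (χ y • e.localFrame b l y)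
    rw [hy, one_smul, e.localFrame_apply_of_mem_baseSet b hye]
    simp [Trivialization.basisAt, b]
  · filter_upwards [h1, hbase] with y hy hye l a
    have hZ : ∑ m, a m • (χ • e.localFrame b m) y = ∑ m, a m • e.basisAt b hye m := by
      refine Finset.sum_congr rfl fun m _ => ?_
      rw [Pi.smul_apply', hy, one_smul, e.localFrame_apply_of_mem_baseSet b hye]
    change (e ⟨y, ∑ m, a m • (χ • e.localFrame b m) y⟩).2 l = a l
    rw [hZ]
    have h2 : ∀ w : E.fib y, (e ⟨y, w⟩).2 l = (e.basisAt b hye).repr w l := fun w => by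
      simp [Trivialization.basisAt, b]
    rw [h2, Module.Basis.repr_sum_self]
  · filter_upwards [hbase] with y hye l v
    have hv : (⟨y, v⟩ : E.Tot) ∈ e.source := e.mem_source.2 hye
    have h3 : ContMDiffAt ((𝓡 E.dim).prod 𝓘(ℝ, E.Fm)) ((𝓡 E.dim).prod 𝓘(ℝ, E.Fm)) ∞ e
        (⟨y, v⟩ : E.Tot) :=
      (Trivialization.contMDiffOn (IB := 𝓡 E.dim) (n := ∞) e).contMDiffAt (e.open_source.mem_nhds hv)
    have h4 : ContMDiffAt ((𝓡 E.dim).prod 𝓘(ℝ, E.Fm)) 𝓘(ℝ, E.Fm) ∞ (fun w => (e w).2)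
        (⟨y, v⟩ : E.Tot) := h3.snd
    exact (EuclideanSpace.proj (𝕜 := ℝ) l).contDiff.contMDiff.contMDiffAt.comp _ h4

theorem smoothNear_coeff {x : E.base} {N : E.base → ℝ} (φ : E ⟶ E') (X : E.Sec)
    (c : E'.Tot → ℝ)
    (hc : ∀ᶠ y in 𝓝 (φ.base x), ∀ v : E'.fib y,
      ContMDiffAt ((𝓡 E'.dim).prod 𝓘(ℝ, E'.Fm)) 𝓘(ℝ, ℝ) ∞ c ⟨y, v⟩)
    (hN : ∀ᶠ y in 𝓝 x, N y = c ⟨φ.base y, φ.fib y (X y)⟩) : E.SmoothNear N x := by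
  have h1 := (φ.smooth_base.continuous.tendsto x).eventually hc
  filter_upwards [h1, hN.eventually_nhds] with y hy hNy
  have h2 : E.SmoothAt (fun z => c ⟨φ.base z, φ.fib z (X z)⟩) y :=
    ContMDiffAt.comp y (hy (φ.fib y (X y))) ((φ.smooth_tot.comp X.contMDiff) y)
  exact h2.congr_of_eventuallyEq hNy

theorem SmoothNear.comp {f : E'.base → ℝ} {x : E.base} (φ : E ⟶ E')
    (h : E'.SmoothNear f (φ.base x)) : E.SmoothNear (fun y => f (φ.base y)) x := by
  filter_upwards [(φ.smooth_base.continuous.tendsto x).eventually h] with y hy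
  exact ContMDiffAt.comp y hy (φ.smooth_base y)

/-- Product and chain rule for a change of coefficients. -/
theorem dirDeriv_change {x : E.base} (φ : E ⟶ E') {k : ℕ} (C : Fin k → E.base → ℝ)
    (H : Fin k → E'.base → ℝ) (hC : ∀ i, E.SmoothNear (C i) x)
    (hH : ∀ i, E'.SmoothNear (H i) (φ.base x)) (v : E.Tan x) :
    E.dirDeriv (fun y => ∑ i, C i y * H i (φ.base y)) v =
      ∑ i, (E.dirDeriv (C i) v * H i (φ.base x) +
        C i x * E'.dirDeriv (H i) (mfderiv (𝓡 E.dim) (𝓡 E'.dim) φ.base x v)) := by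
  have hφ : MDifferentiableAt (𝓡 E.dim) (𝓡 E'.dim) φ.base x :=
    (φ.smooth_base x).mdifferentiableAt (by simp)
  have h1 : ∀ i, HasMFDerivAt (𝓡 E.dim) 𝓘(ℝ, ℝ) (fun y => H i (φ.base y)) x _ := fun i =>
    (hH i).mdiff.hasMFDerivAt.comp x hφ.hasMFDerivAt
  have h2 := fun i => (hC i).mdiff.hasMFDerivAt.mul (h1 i)
  have h3 := HasMFDerivAt.sum (t := Finset.univ) fun i _ => h2 i
  have h4 : (fun y => ∑ i, C i y * H i (φ.base y)) = ∑ i, C i * fun y => H i (φ.base y) := by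
    ext y; simp
  unfold dirDeriv
  rw [h4, h3.mfderiv]
  have h5 : ∀ (L : Fin k → (EuclideanSpace ℝ (Fin E.dim) →L[ℝ] ℝ)) (w), (∑ i, L i) w = ∑ i, L i w :=
    fun L w => by simp
  refine (h5 _ v).trans (Finset.sum_congr rfl fun i _ => ?_)
  change C i x * _ + H i (φ.base x) * _ = _
  rw [add_comm, mul_comm (H i _)]
  rfl

@[simp]
theorem dirDeriv_sum (f : E.base → ℝ) {x : E.base} {k : ℕ} (a : Fin k → ℝ) (v : Fin k → E.Tan x) :
    E.dirDeriv f (∑ i, a i • v i) = ∑ i, a i * E.dirDeriv f (v i) := by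
  unfold dirDeriv
  rw [map_sum]
  exact Finset.sum_congr rfl fun i _ => (mfderiv (𝓡 E.dim) 𝓘(ℝ, ℝ) f x).map_smul _ _

/-- Evaluation of sections at a point. -/
def evalSec (E : SmoothVB) (x : E.base) : E.Sec →+ E.fib x where
  toFun X := X x
  map_zero' := rfl
  map_add' _ _ := rfl

end SmoothVB

namespace LieAlgebroid

variable {E : SmoothVB} (A : LieAlgebroid E)

theorem bracket_skew (X Y : E.Sec) : A.bracket X Y = - A.bracket Y X := by
  have h := A.bracket_self (X + Y)
  simp only [map_add, LinearMap.add_apply, A.bracket_self, zero_add, add_zero] at h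
  exact eq_neg_of_add_eq_zero_right h

theorem bracket_local (X Y : E.Sec) (x : E.base) (h : ∀ᶠ y in 𝓝 x, Y y = 0) :
    A.bracket X Y x = 0 := by
  obtain ⟨χ, hχ, hsupp, h1⟩ := SmoothVB.exists_cutoff (E := E) h
  have hs : ContMDiff (𝓡 E.dim) 𝓘(ℝ, ℝ) ∞ (fun y => 1 - χ y) := contMDiff_const.sub hχ
  have hY : E.smulSec _ hs Y = Y := by
    ext y
    change (1 - χ y) • Y y = Y y
    by_cases hy : y ∈ tsupport χ
    · rw [hsupp hy, smul_zero]
    · rw [image_eq_zero_of_notMem_tsupport hy, sub_zero, one_smul]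
  have := A.leibniz X Y _ hs x
  rw [hY, h.self_of_nhds, h1.self_of_nhds] at this
  simpa using this

theorem bracket_sum_right (X Y : E.Sec) (x : E.base) {l : ℕ} (b : Fin l → E.base → ℝ)
    (Y' : Fin l → E.Sec) (hb : ∀ j, E.SmoothNear (b j) x)
    (h : ∀ᶠ y in 𝓝 x, Y y = ∑ j, b j y • Y' j y) :
    A.bracket X Y x = ∑ j, b j x • A.bracket X (Y' j) x +
      ∑ j, E.dirDeriv (b j) (A.anchor x (X x)) • Y' j x := by
  choose g hg hbg using fun j => (hb j).globalize
  have h0 : A.bracket X (Y - ∑ j, E.smulSec (g j) (hg j) (Y' j)) x = 0 := by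
    apply A.bracket_local
    have hall : ∀ᶠ y in 𝓝 x, ∀ j, b j y = g j y := Filter.eventually_all.2 hbg
    filter_upwards [h, hall] with y hy hy'
    have h1 := map_sum (E.evalSec y) (fun j => E.smulSec (g j) (hg j) (Y' j)) Finset.univ
    change (∑ j, E.smulSec (g j) (hg j) (Y' j)) y = ∑ j, g j y • Y' j y at h1
    change Y y - (∑ j, E.smulSec (g j) (hg j) (Y' j)) y = 0
    rw [h1, hy, sub_eq_zero]
    exact Finset.sum_congr rfl fun j _ => by rw [hy']
  rw [map_sub, map_sum] at h0
  have h2 := map_sum (E.evalSec x) (fun j => A.bracket X (E.smulSec (g j) (hg j) (Y' j))) Finset.univ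
  have h3 : A.bracket X Y x = ∑ j, A.bracket X (E.smulSec (g j) (hg j) (Y' j)) x :=
    (sub_eq_zero.1 h0).trans h2
  rw [h3, ← Finset.sum_add_distrib]
  refine Finset.sum_congr rfl fun j _ => ?_
  rw [A.leibniz, (hbg j).self_of_nhds, SmoothVB.dirDeriv_congr (hbg j)]

theorem anchor_sum (x : E.base) {k : ℕ} (a : Fin k → ℝ) (v : Fin k → E.fib x) :
    A.anchor x (∑ i, a i • v i) = ∑ i, a i • A.anchor x (v i) := by
  simp

theorem bracket_sum (X Y : E.Sec) (x : E.base) {k l : ℕ} (a : Fin k → E.base → ℝ)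
    (X' : Fin k → E.Sec) (b : Fin l → E.base → ℝ) (Y' : Fin l → E.Sec)
    (ha : ∀ i, E.SmoothNear (a i) x) (hb : ∀ j, E.SmoothNear (b j) x)
    (hX : ∀ᶠ y in 𝓝 x, X y = ∑ i, a i y • X' i y) (hY : ∀ᶠ y in 𝓝 x, Y y = ∑ j, b j y • Y' j y) :
    A.bracket X Y x = ∑ i, ∑ j, (a i x * b j x) • A.bracket (X' i) (Y' j) x +
      ∑ j, E.dirDeriv (b j) (A.anchor x (X x)) • Y' j x -
      ∑ i, E.dirDeriv (a i) (A.anchor x (Y x)) • X' i x := by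
  have h1 : ∀ j, A.bracket X (Y' j) x = ∑ i, a i x • A.bracket (X' i) (Y' j) x -
      ∑ i, E.dirDeriv (a i) (A.anchor x (Y' j x)) • X' i x := fun j => by
    have h := A.bracket_sum_right (Y' j) X x a X' ha hX
    rw [A.bracket_skew]
    change -(A.bracket (Y' j) X x) = _
    rw [h, neg_add, ← sub_eq_add_neg, ← Finset.sum_neg_distrib]
    congr 1
    refine Finset.sum_congr rfl fun i _ => ?_
    rw [A.bracket_skew (Y' j)]
    change -(a i x • -(A.bracket (X' i) (Y' j) x)) = _
    rw [smul_neg, neg_neg]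
  have h2 : A.anchor x (Y x) = ∑ j, b j x • A.anchor x (Y' j x) := by
    rw [hY.self_of_nhds, A.anchor_sum]
  rw [A.bracket_sum_right X Y x b Y' hb hY, h2]
  simp only [h1, SmoothVB.dirDeriv_sum, smul_sub, Finset.smul_sum, Finset.sum_sub_distrib,
    Finset.sum_smul, smul_smul]
  rw [Finset.sum_comm, Finset.sum_comm (f := fun i j =>
    (b j x * E.dirDeriv (a i) (A.anchor x (Y' j x))) • X' i x)]
  simp only [mul_comm (b _ x) (a _ x)]
  abel

end LieAlgebroid

/-- The bilinear bookkeeping behind a change of generating families. -/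
theorem bracket_change_aux {V : Type} [AddCommGroup V] [Module ℝ V] {k m l : ℕ}
    (C YC : Fin k → ℝ) (D XD : Fin m → ℝ) (H : Fin k → Fin l → ℝ) (K : Fin m → Fin l → ℝ)
    (R : Fin k → Fin m → Fin l → ℝ) (S : Fin k → Fin m → Fin l → ℝ)
    (B : Fin l → Fin l → V) (z : Fin l → V) :
    ∑ i, ∑ j, (C i * D j) • (∑ p, ∑ q, (H i p * K j q) • B p q + ∑ q, R i j q • z q -
        ∑ p, S i j p • z p) +
      ∑ j, XD j • ∑ q, K j q • z q - ∑ i, YC i • ∑ p, H i p • z p =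
    ∑ p, ∑ q, ((∑ i, C i * H i p) * (∑ j, D j * K j q)) • B p q +
      ∑ q, (∑ j, (XD j * K j q + D j * ∑ i, C i * R i j q)) • z q -
      ∑ p, (∑ i, (YC i * H i p + C i * ∑ j, D j * S i j p)) • z p := by
  have e1 : ∑ i, ∑ j, (C i * D j) • ∑ p, ∑ q, (H i p * K j q) • B p q =
      ∑ p, ∑ q, ((∑ i, C i * H i p) * (∑ j, D j * K j q)) • B p q := by
    simp_rw [Finset.sum_mul_sum, Finset.sum_smul, Finset.smul_sum, smul_smul]
    calc _ = ∑ i, ∑ p, ∑ j, ∑ q, (C i * D j * (H i p * K j q)) • B p q :=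
          Finset.sum_congr rfl fun i _ => Finset.sum_comm
      _ = ∑ p, ∑ i, ∑ j, ∑ q, (C i * D j * (H i p * K j q)) • B p q := Finset.sum_comm
      _ = ∑ p, ∑ i, ∑ q, ∑ j, (C i * D j * (H i p * K j q)) • B p q :=
          Finset.sum_congr rfl fun p _ => Finset.sum_congr rfl fun i _ => Finset.sum_comm
      _ = ∑ p, ∑ q, ∑ i, ∑ j, (C i * D j * (H i p * K j q)) • B p q :=
          Finset.sum_congr rfl fun p _ => Finset.sum_comm
      _ = _ := by simp_rw [mul_mul_mul_comm]
  have e2 : ∑ i, ∑ j, (C i * D j) • ∑ q, R i j q • z q =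
      ∑ q, (∑ j, D j * ∑ i, C i * R i j q) • z q := by
    simp_rw [Finset.mul_sum, Finset.sum_smul, Finset.smul_sum, smul_smul]
    calc _ = ∑ j, ∑ i, ∑ q, (C i * D j * R i j q) • z q := Finset.sum_comm
      _ = ∑ j, ∑ q, ∑ i, (C i * D j * R i j q) • z q :=
          Finset.sum_congr rfl fun j _ => Finset.sum_comm
      _ = ∑ q, ∑ j, ∑ i, (C i * D j * R i j q) • z q := Finset.sum_comm
      _ = _ := by simp_rw [mul_comm (C _) (D _), mul_assoc]
  have e3 : ∑ i, ∑ j, (C i * D j) • ∑ p, S i j p • z p =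
      ∑ p, (∑ i, C i * ∑ j, D j * S i j p) • z p := by
    simp_rw [Finset.mul_sum, Finset.sum_smul, Finset.smul_sum, smul_smul]
    calc _ = ∑ i, ∑ p, ∑ j, (C i * D j * S i j p) • z p :=
          Finset.sum_congr rfl fun j _ => Finset.sum_comm
      _ = ∑ p, ∑ i, ∑ j, (C i * D j * S i j p) • z p := Finset.sum_comm
      _ = _ := by simp_rw [mul_assoc]
  have e4 : ∑ j, XD j • ∑ q, K j q • z q = ∑ q, (∑ j, XD j * K j q) • z q := by
    simp_rw [Finset.sum_smul, Finset.smul_sum, smul_smul]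
    exact Finset.sum_comm
  have e5 : ∑ i, YC i • ∑ p, H i p • z p = ∑ p, (∑ i, YC i * H i p) • z p := by
    simp_rw [Finset.sum_smul, Finset.smul_sum, smul_smul]
    exact Finset.sum_comm
  simp only [smul_sub, smul_add, Finset.sum_sub_distrib, Finset.sum_add_distrib, add_smul,
    e1, e2, e3, e4, e5]
  abel


theorem IsLieAlgebroidHom.id {E : SmoothVB} (A : LieAlgebroid E) : IsLieAlgebroidHom A A (𝟙 E) where
  anchor x v := by
    change A.anchor x v = mfderiv (𝓡 E.dim) (𝓡 E.dim) _root_.id x (A.anchor x v)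
    rw [mfderiv_id]
    rfl
  bracket x X Y _ _ a X' b Y' ha hb hX hY := A.bracket_sum X Y x a X' b Y' ha hb hX hY

theorem IsLieAlgebroidHom.comp {E E' E'' : SmoothVB} {A : LieAlgebroid E} {A' : LieAlgebroid E'}
    {A'' : LieAlgebroid E''} {φ : E ⟶ E'} {ψ : E' ⟶ E''} (hφ : IsLieAlgebroidHom A A' φ)
    (hψ : IsLieAlgebroidHom A' A'' ψ) : IsLieAlgebroidHom A A'' (φ ≫ ψ) where
  anchor x v := by
    change A''.anchor (ψ.base (φ.base x)) (ψ.fib (φ.base x) (φ.fib x v)) =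
      mfderiv (𝓡 E.dim) (𝓡 E''.dim) (ψ.base ∘ φ.base) x (A.anchor x v)
    rw [hψ.anchor, hφ.anchor, mfderiv_comp x ((ψ.smooth_base _).mdifferentiableAt (by simp))
      ((φ.smooth_base x).mdifferentiableAt (by simp))]
    rfl
  bracket x X Y k l a X'' b Y'' ha hb hX hY := by
    obtain ⟨Z', c', hspan', -, hc'⟩ := E'.exists_frame (φ.base x)
    obtain ⟨Z, c, hspan, hcoef, hc⟩ := E''.exists_frame (ψ.base (φ.base x))
    have tφ := φ.smooth_base.continuous.tendsto x
    have tψ := ψ.smooth_base.continuous.tendsto (φ.base x)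
    let C : E.Sec → Fin E'.rank → E.base → ℝ := fun W i y => c' i ⟨φ.base y, φ.fib y (W y)⟩
    let H : Fin E'.rank → Fin E''.rank → E'.base → ℝ := fun i p y =>
      c p ⟨ψ.base y, ψ.fib y (Z' i y)⟩
    let u : E''.Sec → Fin E''.rank → E''.base → ℝ := fun W p y => c p ⟨y, W y⟩
    have hC : ∀ W i, E.SmoothNear (C W i) x := fun W i =>
      SmoothVB.smoothNear_coeff φ W (c' i) (hc'.mono fun y hy => hy i)
        (Filter.Eventually.of_forall fun _ => rfl)
    have hH : ∀ i p, E'.SmoothNear (H i p) (φ.base x) := fun i p =>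
      SmoothVB.smoothNear_coeff ψ (Z' i) (c p) (hc.mono fun y hy => hy p)
        (Filter.Eventually.of_forall fun _ => rfl)
    have hu : ∀ W p, E''.SmoothNear (u W p) (ψ.base (φ.base x)) := fun W p =>
      SmoothVB.smoothNear_coeff (𝟙 E'') W (c p) (hc.mono fun y hy => hy p)
        (Filter.Eventually.of_forall fun _ => rfl)
    have dC : ∀ W : E.Sec, ∀ᶠ y in 𝓝 x, φ.fib y (W y) = ∑ i, C W i y • Z' i (φ.base y) :=
      fun W => (tφ.eventually hspan').mono fun y hy => hy _
    have dH : ∀ i, ∀ᶠ y in 𝓝 (φ.base x), ψ.fib y (Z' i y) = ∑ p, H i p y • Z p (ψ.base y) :=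
      fun i => (tψ.eventually hspan).mono fun y hy => hy _
    have du : ∀ W : E''.Sec, ∀ᶠ y in 𝓝 (ψ.base (φ.base x)), W y = ∑ p, u W p y • Z p y :=
      fun W => hspan.mono fun y hy => hy _
    -- the coefficients of `ψ φ W` in the frame `Z`, computed in two ways
    have key : ∀ (W : E.Sec) (n : ℕ) (g : Fin n → E.base → ℝ) (W' : Fin n → E''.Sec),
        (∀ᶠ y in 𝓝 x, ψ.fib (φ.base y) (φ.fib y (W y)) = ∑ i, g i y • W' i (ψ.base (φ.base y))) →
        ∀ p, (fun y => ∑ i, C W i y * H i p (φ.base y)) =ᶠ[𝓝 x]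
          fun y => ∑ i, g i y * u (W' i) p (ψ.base (φ.base y)) := by
      intro W n g W' hW p
      filter_upwards [hW, dC W, tφ.eventually (Filter.eventually_all.2 dH),
        tφ.eventually (tψ.eventually hcoef),
        tφ.eventually (tψ.eventually (Filter.eventually_all.2 fun i => du (W' i)))]
        with y h1 h2 h3 h4 h5
      have e1 : ψ.fib (φ.base y) (φ.fib y (W y)) =
          ∑ q, (∑ i, C W i y * H i q (φ.base y)) • Z q (ψ.base (φ.base y)) := by
        rw [h2, map_sum]
        simp only [map_smul, h3, Finset.smul_sum, smul_smul, Finset.sum_smul]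
        exact Finset.sum_comm
      have e2 : ψ.fib (φ.base y) (φ.fib y (W y)) =
          ∑ q, (∑ i, g i y * u (W' i) q (ψ.base (φ.base y))) • Z q (ψ.base (φ.base y)) := by
        rw [h1]
        conv_lhs => enter [2, i]; rw [h5 i]
        simp only [Finset.smul_sum, smul_smul, Finset.sum_smul]
        exact Finset.sum_comm
      have e3 := h4 p (fun q => ∑ i, C W i y * H i q (φ.base y))
      have e4 := h4 p (fun q => ∑ i, g i y * u (W' i) q (ψ.base (φ.base y)))
      rw [← e1] at e3
      rw [← e2] at e4
      exact e3.symm.trans e4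
    have aφ : ∀ W : E.Sec, mfderiv (𝓡 E.dim) (𝓡 E'.dim) φ.base x (A.anchor x (W x)) =
        ∑ i, C W i x • A'.anchor (φ.base x) (Z' i (φ.base x)) := fun W => by
      rw [← hφ.anchor, (dC W).self_of_nhds, A'.anchor_sum]
    have aψ : ∀ (W : E.Sec) (n : ℕ) (g : Fin n → E.base → ℝ) (W' : Fin n → E''.Sec),
        (∀ᶠ y in 𝓝 x, ψ.fib (φ.base y) (φ.fib y (W y)) = ∑ i, g i y • W' i (ψ.base (φ.base y))) →
        mfderiv (𝓡 E.dim) (𝓡 E''.dim) (φ ≫ ψ).base x (A.anchor x (W x)) =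
        ∑ i, g i x • A''.anchor (ψ.base (φ.base x)) (W' i (ψ.base (φ.base x))) :=
        fun W n g W' hW => by
      change mfderiv (𝓡 E.dim) (𝓡 E''.dim) (ψ.base ∘ φ.base) x (A.anchor x (W x)) = _
      rw [mfderiv_comp x ((ψ.smooth_base _).mdifferentiableAt (by simp))
        ((φ.smooth_base x).mdifferentiableAt (by simp)), ← A''.anchor_sum, ← hW.self_of_nhds,
        hψ.anchor, hφ.anchor]
      rfl
    -- both sides equal the same expression in the frame `Z`
    have lhs : ψ.fib (φ.base x) (φ.fib x (A.bracket X Y x)) =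
        ∑ p, ∑ q, ((∑ i, C X i x * H i p (φ.base x)) * (∑ j, C Y j x * H j q (φ.base x))) •
            A''.bracket (Z p) (Z q) (ψ.base (φ.base x)) +
          ∑ q, E.dirDeriv (fun y => ∑ i, C Y i y * H i q (φ.base y)) (A.anchor x (X x)) •
            Z q (ψ.base (φ.base x)) -
          ∑ p, E.dirDeriv (fun y => ∑ i, C X i y * H i p (φ.base y)) (A.anchor x (Y x)) •
            Z p (ψ.base (φ.base x)) := by
      rw [hφ.bracket x X Y _ _ (C X) Z' (C Y) Z' (hC X) (hC Y) (dC X) (dC Y)]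
      simp only [map_add, map_sub, map_sum, map_smul]
      simp only [(dH _).self_of_nhds]
      simp only [fun i j => hψ.bracket (φ.base x) (Z' i) (Z' j) _ _ (H i) Z (H j) Z (hH i) (hH j)
        (dH i) (dH j)]
      rw [bracket_change_aux]
      simp only [fun q (f : Fin E'.rank → E.base → ℝ) (hf : ∀ i, E.SmoothNear (f i) x) =>
        SmoothVB.dirDeriv_change φ f (fun i => H i q) hf (fun i => hH i q), hC, aφ,
        SmoothVB.dirDeriv_sum, implies_true]
    have rhs : ∑ i, ∑ j, (a i x * b j x) • A''.bracket (X'' i) (Y'' j) (ψ.base (φ.base x)) +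
        ∑ j, E.dirDeriv (b j) (A.anchor x (X x)) • Y'' j (ψ.base (φ.base x)) -
        ∑ i, E.dirDeriv (a i) (A.anchor x (Y x)) • X'' i (ψ.base (φ.base x)) =
        ∑ p, ∑ q, ((∑ i, a i x * u (X'' i) p (ψ.base (φ.base x))) *
            (∑ j, b j x * u (Y'' j) q (ψ.base (φ.base x)))) •
            A''.bracket (Z p) (Z q) (ψ.base (φ.base x)) +
          ∑ q, E.dirDeriv (fun y => ∑ j, b j y * u (Y'' j) q (ψ.base (φ.base y)))
            (A.anchor x (X x)) • Z q (ψ.base (φ.base x)) -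
          ∑ p, E.dirDeriv (fun y => ∑ i, a i y * u (X'' i) p (ψ.base (φ.base y)))
            (A.anchor x (Y x)) • Z p (ψ.base (φ.base x)) := by
      have hd : ∀ (n : ℕ) (g : Fin n → E.base → ℝ) (W' : Fin n → E''.Sec) (q : Fin E''.rank),
          (∀ i, E.SmoothNear (g i) x) → ∀ v : E.Tan x,
          E.dirDeriv (fun y => ∑ j, g j y * u (W' j) q (ψ.base (φ.base y))) v =
          ∑ i, (E.dirDeriv (g i) v * u (W' i) q (ψ.base (φ.base x)) + g i x *
            E''.dirDeriv (u (W' i) q) (mfderiv (𝓡 E.dim) (𝓡 E''.dim) (φ ≫ ψ).base x v)) :=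
        fun n g W' q hg v => SmoothVB.dirDeriv_change (φ ≫ ψ) g (fun i => u (W' i) q) hg
          (fun i => hu (W' i) q) v
      simp only [fun i j => A''.bracket_sum (X'' i) (Y'' j) (ψ.base (φ.base x)) (u (X'' i))
        (fun p => Z p) (u (Y'' j)) (fun p => Z p) (hu (X'' i)) (hu (Y'' j)) (du _) (du _)]
      have e1 : ∀ i, X'' i (ψ.base (φ.base x)) = ∑ p, u (X'' i) p (ψ.base (φ.base x)) •
        Z p (ψ.base (φ.base x)) := fun i => (du _).self_of_nhds
      have e2 : ∀ i, Y'' i (ψ.base (φ.base x)) = ∑ p, u (Y'' i) p (ψ.base (φ.base x)) •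
        Z p (ψ.base (φ.base x)) := fun i => (du _).self_of_nhds
      have e3 : ∀ v : E.Tan x, ∑ j, E.dirDeriv (b j) v • Y'' j (ψ.base (φ.base x)) = ∑ j,
          E.dirDeriv (b j) v • ∑ p, u (Y'' j) p (ψ.base (φ.base x)) • Z p (ψ.base (φ.base x)) :=
        fun v => Finset.sum_congr rfl fun j _ => by rw [← e2 j]
      have e4 : ∀ v : E.Tan x, ∑ j, E.dirDeriv (a j) v • X'' j (ψ.base (φ.base x)) = ∑ j,
          E.dirDeriv (a j) v • ∑ p, u (X'' j) p (ψ.base (φ.base x)) • Z p (ψ.base (φ.base x)) :=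
        fun v => Finset.sum_congr rfl fun j _ => by rw [← e1 j]
      rw [e3, e4, bracket_change_aux]
      simp only [hd _ b Y'' _ hb, hd _ a X'' _ ha, aψ X _ a X'' hX, aψ Y _ b Y'' hY,
        SmoothVB.dirDeriv_sum]
    change ψ.fib (φ.base x) (φ.fib x (A.bracket X Y x)) =
      ∑ i, ∑ j, (a i x * b j x) • A''.bracket (X'' i) (Y'' j) (ψ.base (φ.base x)) +
        ∑ j, E.dirDeriv (b j) (A.anchor x (X x)) • Y'' j (ψ.base (φ.base x)) -
        ∑ i, E.dirDeriv (a i) (A.anchor x (Y x)) • X'' i (ψ.base (φ.base x))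
    rw [lhs, rhs]
    have kX := key X _ a X'' hX
    have kY := key Y _ b Y'' hY
    simp only [fun p v => SmoothVB.dirDeriv_congr (kX p) v,
      fun p v => SmoothVB.dirDeriv_congr (kY p) v]
    have kX' : ∀ p, ∑ i, C X i x * H i p (φ.base x) = ∑ i, a i x * u (X'' i) p (ψ.base (φ.base x)) :=
      fun p => (kX p).self_of_nhds
    have kY' : ∀ p, ∑ i, C Y i x * H i p (φ.base x) = ∑ i, b i x * u (Y'' i) p (ψ.base (φ.base x)) :=
      fun p => (kY p).self_of_nhds
    simp only [kX', kY']

/-! ### Supermanifolds -/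

/-- A topological space with a presheaf of real algebras, whose sections have homogeneous parts of
every degree `k : ℤ` and are evaluated to real functions. Supermanifolds are those that satisfy
`IsSupermanifold`. -/
structure GradedSpace where
  carrier : Type
  [top : TopologicalSpace carrier]
  func : Opens carrier → Type
  [ring : ∀ U, Ring (func U)]
  [algebra : ∀ U, Algebra ℝ (func U)]
  res : ∀ {U V : Opens carrier}, V ≤ U → func U →ₐ[ℝ] func V
  res_self : ∀ (U : Opens carrier) (a : func U), res le_rfl a = a
  res_res : ∀ {U V W : Opens carrier} (h : V ≤ U) (h' : W ≤ V) (a : func U),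
    res h' (res h a) = res (h'.trans h) a
  deg : ∀ U : Opens carrier, ℤ → Submodule ℝ (func U)
  ev : ∀ U : Opens carrier, func U →ₐ[ℝ] (U → ℝ)

namespace GradedSpace

attribute [instance] top ring algebra

/-- A morphism: a continuous map together with pullbacks of functions that are compatible with
restriction, degree and evaluation. -/
structure Hom (X Y : GradedSpace) where
  base : X.carrier → Y.carrier
  continuous_base : Continuous base
  pull : ∀ U : Opens Y.carrier, Y.func U →ₐ[ℝ] X.func ⟨base ⁻¹' U, U.isOpen.preimage continuous_base⟩
  pull_res : ∀ {U V : Opens Y.carrier} (h : V ≤ U) (a : Y.func U),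
    pull V (Y.res h a) = X.res (fun _ hx => h hx) (pull U a)
  pull_deg : ∀ (U : Opens Y.carrier) (k : ℤ), ∀ a ∈ Y.deg U k, pull U a ∈ X.deg _ k
  pull_ev : ∀ (U : Opens Y.carrier) (a : Y.func U) (x : X.carrier) (hx : base x ∈ U),
    X.ev _ (pull U a) ⟨x, hx⟩ = Y.ev U a ⟨base x, hx⟩

theorem Hom.ext' {X Y : GradedSpace} {f g : Hom X Y} (h : f.base = g.base)
    (h' : ∀ U a, HEq (f.pull U a) (g.pull U a)) : f = g := by
  cases f
  cases g
  dsimp only at h h'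
  subst h
  congr
  funext U
  exact AlgHom.ext fun a => eq_of_heq (h' U a)

instance : Category GradedSpace where
  Hom := Hom
  id _ :=
    { base := id
      continuous_base := continuous_id
      pull := fun _ => AlgHom.id ℝ _
      pull_res := fun _ _ => rfl
      pull_deg := fun _ _ _ ha => ha
      pull_ev := fun _ _ _ _ => rfl }
  comp f g :=
    { base := g.base ∘ f.base
      continuous_base := g.continuous_base.comp f.continuous_base
      pull := fun U => (f.pull ⟨g.base ⁻¹' U, U.isOpen.preimage g.continuous_base⟩).comp (g.pull U)
      pull_res := fun h a => (congrArg _ (g.pull_res h a)).trans (f.pull_res _ _)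
      pull_deg := fun U k a ha => f.pull_deg _ k _ (g.pull_deg U k a ha)
      pull_ev := fun U a x hx => (f.pull_ev _ _ x hx).trans (g.pull_ev U a _ hx) }
  id_comp _ := rfl
  comp_id _ := rfl
  assoc _ _ _ := rfl

end GradedSpace

/-- The coordinates of nonzero degree of the coordinate superspace of dimension `p`: there are `p i`
coordinates of degree `-i`, for each `i ≠ 0`. -/
abbrev SuperCoord (p : ℤ → ℕ) : Type := Σ i : {i : ℤ // i ≠ 0}, Fin (p i)

/-- The commutation relations `ξ ξ' = (-1) ^ (|ξ| |ξ'|) ξ' ξ` between the coordinates. -/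
inductive SuperCoordRel (p : ℤ → ℕ) : FreeAlgebra ℝ (SuperCoord p) → FreeAlgebra ℝ (SuperCoord p) → Prop
  | comm (c d : SuperCoord p) : SuperCoordRel p (FreeAlgebra.ι ℝ c * FreeAlgebra.ι ℝ d)
      (((c.1.1 * d.1.1).negOnePow : ℤ) • (FreeAlgebra.ι ℝ d * FreeAlgebra.ι ℝ c))

/-- Polynomials with real coefficients in the graded-commuting coordinates of nonzero degree. -/
abbrev SuperPoly (p : ℤ → ℕ) : Type := RingQuot (SuperCoordRel p)

namespace SuperPoly

variable (p : ℤ → ℕ)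

/-- A coordinate. -/
def coord (c : SuperCoord p) : SuperPoly p := RingQuot.mkAlgHom ℝ (SuperCoordRel p) (FreeAlgebra.ι ℝ c)

/-- The polynomials of degree `k`, spanned by the monomials of degree `k`. -/
def deg (k : ℤ) : Submodule ℝ (SuperPoly p) :=
  Submodule.span ℝ {w | ∃ L : List (SuperCoord p),
    (L.map fun c => -c.1.1).sum = k ∧ w = (L.map (coord p)).prod}

/-- The constant term. -/
def aug : SuperPoly p →ₐ[ℝ] ℝ :=
  RingQuot.liftAlgHom ℝ ⟨FreeAlgebra.lift ℝ fun _ => 0, by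
    rintro _ _ ⟨c, d⟩
    simp⟩

end SuperPoly

namespace GradedSpace

/-- A chart of dimension `p`: an isomorphism, over an open subset of `X`, with a superdomain of
dimension `p`. The functions of degree `k` on the superdomain are the functions with values in the
polynomials of degree `k` in the coordinates of nonzero degree that are locally of the form
`∑ fᵢ wᵢ`, where the `fᵢ` are smooth functions and the `wᵢ` are polynomials. -/
structure Chart (X : GradedSpace) (p : ℤ → ℕ) where
  toHomeo : OpenPartialHomeomorph X.carrier (EuclideanSpace ℝ (Fin (p 0)))
  fn : ∀ U : Opens X.carrier, (U : Set X.carrier) ⊆ toHomeo.source →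
    X.func U →ₐ[ℝ] (U → SuperPoly p)
  fn_injective : ∀ U hU, Function.Injective (fn U hU)
  fn_res : ∀ {U V : Opens X.carrier} (h : V ≤ U) (hU) (a : X.func U) (x : V),
    fn V (fun _ hx => hU (h hx)) (X.res h a) x = fn U hU a ⟨x, h x.2⟩
  fn_deg : ∀ (U : Opens X.carrier) (hU) (k : ℤ) (g : U → SuperPoly p),
    (∃ a ∈ X.deg U k, fn U hU a = g) ↔
      (∀ x, g x ∈ SuperPoly.deg p k) ∧
      ∀ x : U, ∃ V : Opens X.carrier, x.1 ∈ V ∧ V ≤ U ∧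
        ∃ (n : ℕ) (f : Fin n → EuclideanSpace ℝ (Fin (p 0)) → ℝ) (w : Fin n → SuperPoly p),
          (∀ i, ContDiffOn ℝ ∞ (f i) (toHomeo '' V)) ∧
          ∀ y : U, y.1 ∈ V → g y = ∑ i, f i (toHomeo y) • w i
  fn_ev : ∀ (U : Opens X.carrier) (hU) (a : X.func U) (x : U),
    X.ev U a x = SuperPoly.aug p (fn U hU a x)

/-- A supermanifold: a (Hausdorff, second countable) space with a sheaf of graded, graded-commutative
algebras that is locally isomorphic to a superdomain of some fixed dimension. -/
structure IsSupermanifold (X : GradedSpace) : Prop where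
  t2 : T2Space X.carrier
  secondCountable : SecondCountableTopology X.carrier
  one_mem : ∀ U, 1 ∈ X.deg U 0
  mul_mem : ∀ U (k l : ℤ), ∀ a ∈ X.deg U k, ∀ b ∈ X.deg U l, a * b ∈ X.deg U (k + l)
  isInternal : ∀ U, DirectSum.IsInternal (X.deg U)
  comm : ∀ U (k l : ℤ), ∀ a ∈ X.deg U k, ∀ b ∈ X.deg U l,
    a * b = ((k * l).negOnePow : ℤ) • (b * a)
  res_deg : ∀ {U V : Opens X.carrier} (h : V ≤ U) (k : ℤ), ∀ a ∈ X.deg U k, X.res h a ∈ X.deg V k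
  res_ev : ∀ {U V : Opens X.carrier} (h : V ≤ U) (a : X.func U) (x : V),
    X.ev V (X.res h a) x = X.ev U a ⟨x, h x.2⟩
  sheaf : ∀ (k : ℤ) (ι : Type) (U : ι → Opens X.carrier) (a : ∀ i, X.func (U i)),
    (∀ i, a i ∈ X.deg (U i) k) →
    (∀ i j, X.res (inf_le_left : U i ⊓ U j ≤ U i) (a i) = X.res inf_le_right (a j)) →
    ∃! b : X.func (⨆ i, U i), b ∈ X.deg _ k ∧ ∀ i, X.res (le_iSup U i) b = a i
  locally_superdomain : ∃ p : ℤ → ℕ, ∀ x, ∃ c : Chart X p, x ∈ c.toHomeo.source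

/-- A tangent vector at `x`: a derivation at `x` of the germs of functions at `x`. -/
structure TangentVector (X : GradedSpace) (x : X.carrier) where
  toFun : ∀ U : Opens X.carrier, x ∈ U → X.func U →ₗ[ℝ] ℝ
  res : ∀ {U V : Opens X.carrier} (h : V ≤ U) (hx : x ∈ V) (a : X.func U),
    toFun V hx (X.res h a) = toFun U (h hx) a
  leibniz : ∀ (U : Opens X.carrier) (hx : x ∈ U) (a b : X.func U),
    toFun U hx (a * b) = toFun U hx a * X.ev U b ⟨x, hx⟩ + X.ev U a ⟨x, hx⟩ * toFun U hx b

/-- A surjective submersion: surjective on the supports, and with a surjective tangent map at every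
point. -/
structure IsSurjSubmersion {X Y : GradedSpace} (f : X ⟶ Y) : Prop where
  surj : Function.Surjective f.base
  tangent_surj : ∀ (x : X.carrier) (w : TangentVector Y (f.base x)), ∃ v : TangentVector X x,
    ∀ (U : Opens Y.carrier) (hx : f.base x ∈ U) (a : Y.func U),
      v.toFun ⟨f.base ⁻¹' U, U.isOpen.preimage f.continuous_base⟩ hx (f.pull U a) = w.toFun U hx a

/-- A vector field of degree `j`: a degree `j` derivation of the sheaf of functions. -/
structure VectorField (X : GradedSpace) (j : ℤ) where
  toFun : ∀ U : Opens X.carrier, X.func U →ₗ[ℝ] X.func U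
  res : ∀ {U V : Opens X.carrier} (h : V ≤ U) (a : X.func U),
    toFun V (X.res h a) = X.res h (toFun U a)
  map_deg : ∀ (U : Opens X.carrier) (k : ℤ), ∀ a ∈ X.deg U k, toFun U a ∈ X.deg U (k + j)
  leibniz : ∀ (U : Opens X.carrier) (k : ℤ), ∀ a ∈ X.deg U k, ∀ b : X.func U,
    toFun U (a * b) = toFun U a * b + ((j * k).negOnePow : ℤ) • (a * toFun U b)

/-- The zero vector field. -/
instance (X : GradedSpace) (j : ℤ) : Inhabited (VectorField X j) :=
  ⟨⟨fun _ => 0, fun _ _ => by simp, fun _ _ _ _ => by simp, fun _ _ _ _ _ => by simp⟩⟩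

/-- The graded bracket `[φ, φ] = φ φ - (-1) ^ (1 * 1) φ φ` of a vector field of degree `1` with
itself vanishes. -/
def VectorField.IsHomological {X : GradedSpace} (φ : VectorField X 1) : Prop :=
  ∀ (U : Opens X.carrier) (a : X.func U), φ.toFun U (φ.toFun U a) + φ.toFun U (φ.toFun U a) = 0

/-- The vector fields `φ` on `X` and `ψ` on `Y` are `f`-related. -/
def Related {X Y : GradedSpace} {j : ℤ} (f : X ⟶ Y) (φ : VectorField X j) (ψ : VectorField Y j) :
    Prop :=
  ∀ (U : Opens Y.carrier) (a : Y.func U), f.pull U (ψ.toFun U a) = φ.toFun _ (f.pull U a)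

end GradedSpace

/-! ### Groupoid objects -/

/-- The data of an internal groupoid `G ⇉ M`: the objects `G`, `M`, the objects `G2`, `G3` of pairs
and triples of composable arrows, and the structure maps. Here `p1`, `p2` are the components of a
pair, `q12` and `q23` the pairs of the first two and of the last two components of a triple, and
`s`, `t`, `m`, `e`, `i` are source, target, multiplication, identity and inverse. -/
structure GroupoidDiagram (C : Type*) [Category C] where
  G : C
  M : C
  G2 : C
  G3 : C
  s : G ⟶ M
  t : G ⟶ M
  p1 : G2 ⟶ G
  p2 : G2 ⟶ G
  q12 : G3 ⟶ G2
  q23 : G3 ⟶ G2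
  m : G2 ⟶ G
  e : M ⟶ G
  i : G ⟶ G

/-- The square with `p1 ≫ s = p2 ≫ t` is a fibre product in the full subcategory of the objects
satisfying `P`. -/
def IsFibreProduct {C : Type*} [Category C] (P : C → Prop) {W X Y Z : C} (p1 : W ⟶ X) (p2 : W ⟶ Y)
    (s : X ⟶ Z) (t : Y ⟶ Z) : Prop :=
  p1 ≫ s = p2 ≫ t ∧ ∀ T, P T → ∀ (x : T ⟶ X) (y : T ⟶ Y), x ≫ s = y ≫ t →
    ∃! z : T ⟶ W, z ≫ p1 = x ∧ z ≫ p2 = y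

namespace GroupoidDiagram

variable {C : Type*} [Category C]

/-- `D` is a groupoid object in the full subcategory of the objects satisfying `P`. Pairs `(g, h)`
are composable if `s g = t h`. -/
structure IsGroupoidObject (P : C → Prop) (D : GroupoidDiagram C) : Prop where
  mem_G : P D.G
  mem_M : P D.M
  mem_G2 : P D.G2
  mem_G3 : P D.G3
  fibreProduct2 : IsFibreProduct P D.p1 D.p2 D.s D.t
  fibreProduct3 : IsFibreProduct P D.q12 D.q23 D.p2 D.p1
  m_s : D.m ≫ D.s = D.p2 ≫ D.s
  m_t : D.m ≫ D.t = D.p1 ≫ D.t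
  e_s : D.e ≫ D.s = 𝟙 D.M
  e_t : D.e ≫ D.t = 𝟙 D.M
  i_s : D.i ≫ D.s = D.t
  i_t : D.i ≫ D.t = D.s
  /-- `(g h) k = g (h k)` -/
  assoc : ∀ c d : D.G3 ⟶ D.G2, c ≫ D.p1 = D.q12 ≫ D.m → c ≫ D.p2 = D.q23 ≫ D.p2 →
    d ≫ D.p1 = D.q12 ≫ D.p1 → d ≫ D.p2 = D.q23 ≫ D.m → c ≫ D.m = d ≫ D.m
  /-- `g 1 = g` -/
  mul_one : ∀ c : D.G ⟶ D.G2, c ≫ D.p1 = 𝟙 D.G → c ≫ D.p2 = D.s ≫ D.e → c ≫ D.m = 𝟙 D.G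
  /-- `1 g = g` -/
  one_mul : ∀ c : D.G ⟶ D.G2, c ≫ D.p1 = D.t ≫ D.e → c ≫ D.p2 = 𝟙 D.G → c ≫ D.m = 𝟙 D.G
  /-- `g g⁻¹ = 1` -/
  mul_inv : ∀ c : D.G ⟶ D.G2, c ≫ D.p1 = 𝟙 D.G → c ≫ D.p2 = D.i → c ≫ D.m = D.t ≫ D.e
  /-- `g⁻¹ g = 1` -/
  inv_mul : ∀ c : D.G ⟶ D.G2, c ≫ D.p1 = D.i → c ≫ D.p2 = 𝟙 D.G → c ≫ D.m = D.s ≫ D.e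

/-- Morphisms of internal groupoids; `f2` is the map of composable pairs induced by `f1`. -/
@[ext]
structure Hom (D D' : GroupoidDiagram C) where
  f1 : D.G ⟶ D'.G
  f0 : D.M ⟶ D'.M
  f2 : D.G2 ⟶ D'.G2
  hs : f1 ≫ D'.s = D.s ≫ f0
  ht : f1 ≫ D'.t = D.t ≫ f0
  hp1 : f2 ≫ D'.p1 = D.p1 ≫ f1
  hp2 : f2 ≫ D'.p2 = D.p2 ≫ f1
  hm : f2 ≫ D'.m = D.m ≫ f1
  he : f0 ≫ D'.e = D.e ≫ f1
  hi : f1 ≫ D'.i = D.i ≫ f1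

theorem square_comp {X X' X'' Y Y' Y'' : C} {f : X ⟶ X'} {f' : X' ⟶ X''} {g : Y ⟶ Y'} {g' : Y' ⟶ Y''}
    {a : X ⟶ Y} {a' : X' ⟶ Y'} {a'' : X'' ⟶ Y''} (h : f ≫ a' = a ≫ g) (h' : f' ≫ a'' = a' ≫ g') :
    (f ≫ f') ≫ a'' = a ≫ g ≫ g' := by
  rw [Category.assoc, h', ← Category.assoc, h, Category.assoc]

instance : Category (GroupoidDiagram C) where
  Hom := Hom
  id D := ⟨𝟙 _, 𝟙 _, 𝟙 _, by simp, by simp, by simp, by simp, by simp, by simp, by simp⟩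
  comp f g := ⟨f.f1 ≫ g.f1, f.f0 ≫ g.f0, f.f2 ≫ g.f2, square_comp f.hs g.hs, square_comp f.ht g.ht,
    square_comp f.hp1 g.hp1, square_comp f.hp2 g.hp2, square_comp f.hm g.hm, square_comp f.he g.he,
    square_comp f.hi g.hi⟩
  id_comp f := Hom.ext (Category.id_comp _) (Category.id_comp _) (Category.id_comp _)
  comp_id f := Hom.ext (Category.comp_id _) (Category.comp_id _) (Category.comp_id _)
  assoc f g h := Hom.ext (Category.assoc _ _ _) (Category.assoc _ _ _) (Category.assoc _ _ _)

/-- The image of internal groupoid data under a functor. -/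
def map {C' : Type*} [Category C'] (F : C ⥤ C') : GroupoidDiagram C ⥤ GroupoidDiagram C' where
  obj D := ⟨F.obj D.G, F.obj D.M, F.obj D.G2, F.obj D.G3, F.map D.s, F.map D.t, F.map D.p1,
    F.map D.p2, F.map D.q12, F.map D.q23, F.map D.m, F.map D.e, F.map D.i⟩
  map f := ⟨F.map f.f1, F.map f.f0, F.map f.f2,
    by rw [← F.map_comp, ← F.map_comp, f.hs], by rw [← F.map_comp, ← F.map_comp, f.ht],
    by rw [← F.map_comp, ← F.map_comp, f.hp1], by rw [← F.map_comp, ← F.map_comp, f.hp2],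
    by rw [← F.map_comp, ← F.map_comp, f.hm], by rw [← F.map_comp, ← F.map_comp, f.he],
    by rw [← F.map_comp, ← F.map_comp, f.hi]⟩
  map_id _ := Hom.ext (F.map_id _) (F.map_id _) (F.map_id _)
  map_comp _ _ := Hom.ext (F.map_comp _ _) (F.map_comp _ _) (F.map_comp _ _)

end GroupoidDiagram

/-! ### `Q`-groupoids -/

/-- A vector field on the arrows of a (super)groupoid is multiplicative if it is related, under the
two projections and the multiplication, to a vector field on the composable pairs. -/
def IsMultiplicative (D : GroupoidDiagram GradedSpace) {j : ℤ} (ψ : GradedSpace.VectorField D.G j) :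
    Prop :=
  ∃ ψ2 : GradedSpace.VectorField D.G2 j, GradedSpace.Related D.p1 ψ2 ψ ∧
    GradedSpace.Related D.p2 ψ2 ψ ∧ GradedSpace.Related D.m ψ2 ψ

/-- A supergroupoid: a groupoid object in supermanifolds, with surjective submersions as source and
target. -/
structure IsSupergroupoid (D : GroupoidDiagram GradedSpace) : Prop where
  isGroupoidObject : D.IsGroupoidObject GradedSpace.IsSupermanifold
  s_submersion : GradedSpace.IsSurjSubmersion D.s
  t_submersion : GradedSpace.IsSurjSubmersion D.t

/-- A `Q`-groupoid: a supergroupoid with a multiplicative homological vector field `ψ`, whose base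
vector field is `ψ0`. -/
structure IsQGroupoid (D : GroupoidDiagram GradedSpace) (ψ : GradedSpace.VectorField D.G 1)
    (ψ0 : GradedSpace.VectorField D.M 1) : Prop where
  isSupergroupoid : IsSupergroupoid D
  homological : ψ.IsHomological
  multiplicative : IsMultiplicative D ψ
  base_homological : ψ0.IsHomological
  s_related : GradedSpace.Related D.s ψ ψ0
  t_related : GradedSpace.Related D.t ψ ψ0

structure QGroupoid where
  diag : GroupoidDiagram GradedSpace
  field : GradedSpace.VectorField diag.G 1
  baseField : GradedSpace.VectorField diag.M 1
  isQ : IsQGroupoid diag field baseField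

/-- Morphisms of groupoid objects in `Q`-manifolds: groupoid morphisms that relate the homological
vector fields. -/
instance : Category QGroupoid where
  Hom D D' := {f : D.diag ⟶ D'.diag // GradedSpace.Related f.f1 D.field D'.field ∧
    GradedSpace.Related f.f0 D.baseField D'.baseField}
  id D := ⟨𝟙 D.diag, fun _ _ => rfl, fun _ _ => rfl⟩
  comp f g := ⟨f.1 ≫ g.1,
    fun U a => (congrArg _ (g.2.1 U a)).trans (f.2.1 _ _),
    fun U a => (congrArg _ (g.2.2 U a)).trans (f.2.2 _ _)⟩
  id_comp _ := Subtype.ext (Category.id_comp _)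
  comp_id _ := Subtype.ext (Category.comp_id _)
  assoc _ _ _ := Subtype.ext (Category.assoc _ _ _)

/-! ### The functor `[-1]` on vector bundles -/

namespace SmoothVB

/-- The exterior algebra of the dual of the fibre at `x`. -/
abbrev Ext (E : SmoothVB) (x : E.base) : Type := ExteriorAlgebra ℝ (Module.Dual ℝ (E.fib x))

/-- Smoothness of a function on an open subset of the base. -/
def IsSmoothFun (E : SmoothVB) (U : Opens E.base) (f : U → ℝ) : Prop :=
  ContMDiffOn (𝓡 E.dim) 𝓘(ℝ, ℝ) ∞ (Function.extend Subtype.val f 0) U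

/-- Smoothness of a section of the dual bundle over an open subset of the base: the corresponding
fibrewise linear function on the total space is smooth. -/
def IsSmoothCovec (E : SmoothVB) (U : Opens E.base) (α : ∀ x : U, Module.Dual ℝ (E.fib x.1)) : Prop :=
  ∀ F : E.Tot → ℝ, (∀ (x : U) (v : E.fib x.1), F ⟨x.1, v⟩ = α x v) →
    ContMDiffOn ((𝓡 E.dim).prod 𝓘(ℝ, E.Fm)) 𝓘(ℝ, ℝ) ∞ F {v | v.1 ∈ U}

/-- The functions and the `1`-forms, among the sections of the exterior algebra bundle. -/
def formGenerators (E : SmoothVB) (U : Opens E.base) : Set (∀ x : U, E.Ext x.1) :=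
  {η | ∃ f, E.IsSmoothFun U f ∧ η = fun x => algebraMap ℝ _ (f x)} ∪
  {η | ∃ α, E.IsSmoothCovec U α ∧ η = fun x => ExteriorAlgebra.ι ℝ (α x)}

/-- Restriction of not necessarily smooth sections of the exterior algebra bundle. -/
def restr (E : SmoothVB) {U V : Opens E.base} (h : V ≤ U) :
    (∀ x : U, E.Ext x.1) →ₐ[ℝ] (∀ x : V, E.Ext x.1) where
  toFun η x := η ⟨x.1, h x.2⟩
  map_one' := rfl
  map_mul' _ _ := rfl
  map_zero' := rfl
  map_add' _ _ := rfl
  commutes' _ := rfl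

theorem IsSmoothFun.restr {E : SmoothVB} {U V : Opens E.base} (h : V ≤ U) {f : U → ℝ}
    (hf : E.IsSmoothFun U f) : E.IsSmoothFun V fun x => f ⟨x.1, h x.2⟩ := by
  refine (ContMDiffOn.mono hf h).congr fun x hx => ?_
  rw [show x = ((⟨x, hx⟩ : V) : E.base) from rfl, Subtype.val_injective.extend_apply]
  exact (Subtype.val_injective.extend_apply f 0 ⟨x, h hx⟩).symm

theorem IsSmoothCovec.restr {E : SmoothVB} {U V : Opens E.base} (h : V ≤ U)
    {α : ∀ x : U, Module.Dual ℝ (E.fib x.1)} (hα : E.IsSmoothCovec U α) :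
    E.IsSmoothCovec V fun x => α ⟨x.1, h x.2⟩ := by
  classical
  intro F hF
  let F' : E.Tot → ℝ := fun v => if hv : v.1 ∈ U then α ⟨v.1, hv⟩ v.2 else 0
  have h1 := hα F' fun x v => by simp [F', x.2]
  refine (h1.mono fun v hv => h hv).congr fun v hv => ?_
  rw [show v = ⟨v.1, v.2⟩ from rfl, hF ⟨v.1, hv⟩ v.2]
  simp [F', h hv]

theorem restr_mem_adjoin (E : SmoothVB) {U V : Opens E.base} (h : V ≤ U) {η : ∀ x : U, E.Ext x.1}
    (hη : η ∈ Algebra.adjoin ℝ (E.formGenerators U)) :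
    E.restr h η ∈ Algebra.adjoin ℝ (E.formGenerators V) := by
  have h1 : E.restr h η ∈ (Algebra.adjoin ℝ (E.formGenerators U)).map (E.restr h) :=
    Subalgebra.mem_map.2 ⟨η, hη, rfl⟩
  rw [AlgHom.map_adjoin] at h1
  refine Algebra.adjoin_mono ?_ h1
  rintro _ ⟨_, ⟨f, hf, rfl⟩ | ⟨α, hα, rfl⟩, rfl⟩
  · exact Or.inl ⟨_, hf.restr h, rfl⟩
  · exact Or.inr ⟨_, hα.restr h, rfl⟩

/-- The algebra of smooth sections over `U` of the exterior algebra of the dual bundle: the sections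
which are locally generated by functions and `1`-forms. -/
def forms (E : SmoothVB) (U : Opens E.base) : Subalgebra ℝ (∀ x : U, E.Ext x.1) where
  carrier := {η | ∀ x : U, ∃ (V : Opens E.base) (h : V ≤ U), x.1 ∈ V ∧
    E.restr h η ∈ Algebra.adjoin ℝ (E.formGenerators V)}
  mul_mem' {η θ} hη hθ x := by
    obtain ⟨V, h, hx, h1⟩ := hη x
    obtain ⟨W, h', hx', h2⟩ := hθ x
    refine ⟨V ⊓ W, inf_le_left.trans h, ⟨hx, hx'⟩, ?_⟩
    rw [map_mul]
    exact mul_mem (E.restr_mem_adjoin (inf_le_left : V ⊓ W ≤ V) h1)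
      (E.restr_mem_adjoin (inf_le_right : V ⊓ W ≤ W) h2)
  add_mem' {η θ} hη hθ x := by
    obtain ⟨V, h, hx, h1⟩ := hη x
    obtain ⟨W, h', hx', h2⟩ := hθ x
    refine ⟨V ⊓ W, inf_le_left.trans h, ⟨hx, hx'⟩, ?_⟩
    rw [map_add]
    exact add_mem (E.restr_mem_adjoin (inf_le_left : V ⊓ W ≤ V) h1)
      (E.restr_mem_adjoin (inf_le_right : V ⊓ W ≤ W) h2)
  algebraMap_mem' r x := ⟨U, le_rfl, x.2, Subalgebra.algebraMap_mem _ r⟩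

theorem restr_mem_forms (E : SmoothVB) {U V : Opens E.base} (h : V ≤ U) {η : ∀ x : U, E.Ext x.1}
    (hη : η ∈ E.forms U) : E.restr h η ∈ E.forms V := by
  intro x
  obtain ⟨W, h', hx, h1⟩ := hη ⟨x.1, h x.2⟩
  exact ⟨V ⊓ W, inf_le_left, ⟨x.2, hx⟩, E.restr_mem_adjoin (inf_le_right : V ⊓ W ≤ W) h1⟩

/-- The elements of degree `k` of the exterior algebra; there are none but `0` for `k < 0`. -/
def extDeg (E : SmoothVB) (x : E.base) : ℤ → Submodule ℝ (E.Ext x)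
  | Int.ofNat n => ⋀[ℝ]^n (Module.Dual ℝ (E.fib x))
  | Int.negSucc _ => ⊥

/-- The graded space `[-1]E`: functions are smooth sections of the exterior algebra of the dual. -/
def shiftObj (E : SmoothVB) : GradedSpace where
  carrier := E.base
  func U := E.forms U
  res {U V} h := ((E.restr h).comp (E.forms U).val).codRestrict (E.forms V)
    fun η => E.restr_mem_forms h η.2
  res_self _ _ := rfl
  res_res _ _ _ := rfl
  deg U k :=
    { carrier := {η | ∀ x : U, η.1 x ∈ E.extDeg x.1 k}
      zero_mem' := fun _ => Submodule.zero_mem _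
      add_mem' := fun h h' x => Submodule.add_mem _ (h x) (h' x)
      smul_mem' := fun c _ h x => Submodule.smul_mem _ c (h x) }
  ev U :=
    (AlgHom.pi fun x : U => (ExteriorAlgebra.algebraMapInv).comp
      (Pi.evalAlgHom ℝ (fun x : U => E.Ext x.1) x)).comp (E.forms U).val

/-- Pullback of sections of the exterior algebra along a bundle map. -/
def pullAux {E E' : SmoothVB} (φ : E ⟶ E') (U : Opens E'.base) :
    (∀ x : U, E'.Ext x.1) →ₐ[ℝ]
      (∀ x : (⟨φ.base ⁻¹' U, U.isOpen.preimage φ.smooth_base.continuous⟩ : Opens E.base),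
        E.Ext x.1) :=
  AlgHom.pi fun x => (ExteriorAlgebra.map (φ.fib x.1).dualMap).comp
    (Pi.evalAlgHom ℝ (fun x : U => E'.Ext x.1) ⟨φ.base x.1, x.2⟩)

theorem pullAux_mem_adjoin {E E' : SmoothVB} (φ : E ⟶ E') (U : Opens E'.base)
    {η : ∀ x : U, E'.Ext x.1} (hη : η ∈ Algebra.adjoin ℝ (E'.formGenerators U)) :
    pullAux φ U η ∈ Algebra.adjoin ℝ (E.formGenerators _) := by
  classical
  have h1 : pullAux φ U η ∈ (Algebra.adjoin ℝ (E'.formGenerators U)).map (pullAux φ U) :=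
    Subalgebra.mem_map.2 ⟨η, hη, rfl⟩
  rw [AlgHom.map_adjoin] at h1
  refine Algebra.adjoin_mono ?_ h1
  rintro _ ⟨_, ⟨f, hf, rfl⟩ | ⟨α, hα, rfl⟩, rfl⟩
  · refine Or.inl ⟨fun x => f ⟨φ.base x.1, x.2⟩, ?_, ?_⟩
    · refine (ContMDiffOn.comp hf φ.smooth_base.contMDiffOn fun x hx => hx).congr fun x hx => ?_
      exact (Subtype.val_injective.extend_apply _ _ (⟨x, hx⟩ : Subtype _)).trans
        (Subtype.val_injective.extend_apply f 0 ⟨φ.base x, hx⟩).symm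
    · funext x
      exact AlgHom.commutes _ _
  · refine Or.inr ⟨fun x => (φ.fib x.1).dualMap (α ⟨φ.base x.1, x.2⟩), ?_, ?_⟩
    · intro F hF
      let F' : E'.Tot → ℝ := fun v => if hv : v.1 ∈ U then α ⟨v.1, hv⟩ v.2 else 0
      have h2 := hα F' fun x v => by simp [F', x.2]
      refine (h2.comp φ.smooth_tot.contMDiffOn fun v hv => hv).congr fun v hv => ?_
      rw [show v = ⟨v.1, v.2⟩ from rfl, hF ⟨v.1, hv⟩ v.2]
      have hv' : φ.base v.1 ∈ U := hv
      simp [F', hv']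
    · funext x
      exact ExteriorAlgebra.map_apply_ι _ _

theorem pullAux_mem_forms {E E' : SmoothVB} (φ : E ⟶ E') (U : Opens E'.base)
    {η : ∀ x : U, E'.Ext x.1} (hη : η ∈ E'.forms U) : pullAux φ U η ∈ E.forms _ := by
  intro x
  obtain ⟨V, h, hx, h1⟩ := hη ⟨φ.base x.1, x.2⟩
  exact ⟨⟨φ.base ⁻¹' V, V.isOpen.preimage φ.smooth_base.continuous⟩, fun y hy => h hy, hx,
    pullAux_mem_adjoin φ V h1⟩

theorem map_extDeg {E E' : SmoothVB} {x : E.base} {y : E'.base}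
    (f : Module.Dual ℝ (E'.fib y) →ₗ[ℝ] Module.Dual ℝ (E.fib x)) (k : ℤ) (w : E'.Ext y)
    (hw : w ∈ E'.extDeg y k) : ExteriorAlgebra.map f w ∈ E.extDeg x k := by
  cases k with
  | ofNat n =>
    have h1 : ExteriorAlgebra.map f w ∈ (⋀[ℝ]^n (Module.Dual ℝ (E'.fib y))).map
        (ExteriorAlgebra.map f).toLinearMap := ⟨w, hw, rfl⟩
    change _ ∈ LinearMap.range (ExteriorAlgebra.ι ℝ) ^ n
    rw [Submodule.map_pow] at h1
    refine SetLike.le_def.1 (pow_le_pow_left' ?_ n) h1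
    rintro _ ⟨_, ⟨v, rfl⟩, rfl⟩
    exact ⟨f v, (ExteriorAlgebra.map_apply_ι _ _).symm⟩
  | negSucc n =>
    have : w = 0 := hw
    rw [this, map_zero]
    exact Submodule.zero_mem _

theorem algebraMapInv_map {E E' : SmoothVB} {x : E.base} {y : E'.base}
    (f : Module.Dual ℝ (E'.fib y) →ₗ[ℝ] Module.Dual ℝ (E.fib x)) (w : E'.Ext y) :
    ExteriorAlgebra.algebraMapInv (ExteriorAlgebra.map f w) = ExteriorAlgebra.algebraMapInv w := by
  have h : (ExteriorAlgebra.algebraMapInv).comp (ExteriorAlgebra.map f) =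
      (ExteriorAlgebra.algebraMapInv : E'.Ext y →ₐ[ℝ] ℝ) := by
    ext v
    simp [ExteriorAlgebra.algebraMapInv]
  exact DFunLike.congr_fun h w

theorem map_dualMap_id {V : Type} [AddCommGroup V] [Module ℝ V]
    (w : ExteriorAlgebra ℝ (Module.Dual ℝ V)) :
    ExteriorAlgebra.map (LinearMap.id : V →ₗ[ℝ] V).dualMap w = w := by
  rw [LinearMap.dualMap_id, ExteriorAlgebra.map_id]
  rfl

theorem map_dualMap_comp {V W Z : Type} [AddCommGroup V] [Module ℝ V] [AddCommGroup W] [Module ℝ W]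
    [AddCommGroup Z] [Module ℝ Z] (f : V →ₗ[ℝ] W) (g : W →ₗ[ℝ] Z)
    (w : ExteriorAlgebra ℝ (Module.Dual ℝ Z)) :
    ExteriorAlgebra.map (g ∘ₗ f).dualMap w =
      ExteriorAlgebra.map f.dualMap (ExteriorAlgebra.map g.dualMap w) := by
  rw [← LinearMap.dualMap_comp_dualMap, ← ExteriorAlgebra.map_comp_map]
  rfl

/-- The action of the functor `[-1]` on bundle maps. -/
def shiftMap {E E' : SmoothVB} (φ : E ⟶ E') : GradedSpace.Hom E.shiftObj E'.shiftObj where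
  base := φ.base
  continuous_base := φ.smooth_base.continuous
  pull U := ((pullAux φ U).comp (E'.forms U).val).codRestrict (E.forms _)
    fun η => pullAux_mem_forms φ U η.2
  pull_res _ _ := rfl
  pull_deg _ k _ ha x := map_extDeg _ k _ (ha ⟨φ.base x.1, x.2⟩)
  pull_ev _ _ _ _ := algebraMapInv_map _ _

theorem shiftMap_pull_apply {E E' : SmoothVB} (φ : E ⟶ E') (U : Opens E'.base) (a : E'.forms U)
    (x : E.base) (hx : φ.base x ∈ U) :
    ((shiftMap φ).pull U a).1 ⟨x, hx⟩ =
      ExteriorAlgebra.map (φ.fib x).dualMap (a.1 ⟨φ.base x, hx⟩) := rfl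

theorem shiftMap_id (E : SmoothVB) : shiftMap (𝟙 E) = 𝟙 E.shiftObj := by
  refine GradedSpace.Hom.ext' rfl fun U a => heq_of_eq (Subtype.ext (funext fun x => ?_))
  refine (shiftMap_pull_apply (𝟙 E) U a x.1 x.2).trans ?_
  exact map_dualMap_id (V := E.fib x.1) _

theorem shiftMap_comp {E E' E'' : SmoothVB} (f : E ⟶ E') (g : E' ⟶ E'') :
    shiftMap (f ≫ g) = CategoryStruct.comp (X := E.shiftObj) (shiftMap f) (shiftMap g) := by
  refine GradedSpace.Hom.ext' rfl fun U a => heq_of_eq (Subtype.ext (funext fun x => ?_))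
  refine (shiftMap_pull_apply (f ≫ g) U a x.1 x.2).trans ?_
  refine (map_dualMap_comp (f.fib x.1) (g.fib (f.base x.1)) _).trans ?_
  exact ((shiftMap_pull_apply f ⟨g.base ⁻¹' (U.1 : Set E''.base), U.isOpen.preimage g.smooth_base.continuous⟩
    ((shiftMap g).pull U a) x.1 x.2).trans
      (congrArg _ (shiftMap_pull_apply g U a (f.base x.1) x.2))).symm

/-- The functor `[-1]` from vector bundles to graded spaces. -/
def shift : SmoothVB ⥤ GradedSpace where
  obj := shiftObj
  map φ := shiftMap φ
  map_id := shiftMap_id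
  map_comp := shiftMap_comp

end SmoothVB

/-! ### The Lie algebroid differential -/

namespace SmoothVB

/-- A smooth function as a function on `[-1]E`. -/
def funForm (E : SmoothVB) (U : Opens E.base) (f : U → ℝ) (hf : E.IsSmoothFun U f) :
    E.shiftObj.func U :=
  (⟨fun x => algebraMap ℝ _ (f x), fun x => ⟨U, le_rfl, x.2,
    Algebra.subset_adjoin (Or.inl ⟨f, hf, rfl⟩)⟩⟩ : E.forms U)

/-- A smooth section of the dual bundle as a function on `[-1]E`. -/
def covecForm (E : SmoothVB) (U : Opens E.base) (α : ∀ x : U, Module.Dual ℝ (E.fib x.1))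
    (hα : E.IsSmoothCovec U α) : E.shiftObj.func U :=
  (⟨fun x => ExteriorAlgebra.ι ℝ (α x), fun x => ⟨U, le_rfl, x.2,
    Algebra.subset_adjoin (Or.inr ⟨α, hα, rfl⟩)⟩⟩ : E.forms U)

/-- The value at `x` of a function on `[-1]E`. -/
def val (E : SmoothVB) {U : Opens E.base} (η : E.shiftObj.func U) (x : U) : E.Ext x.1 :=
  (show E.forms U from η).1 x

/-- The contraction of forms with a vector. It is an antiderivation, with `contract v α = α v` on
`1`-forms. -/
def contract (E : SmoothVB) {x : E.base} (v : E.fib x) : E.Ext x →ₗ[ℝ] E.Ext x :=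
  CliffordAlgebra.contractLeft (Module.Dual.eval ℝ (E.fib x) v)

/-- The derivative in the direction `v` at `x ∈ U` of a function on the open set `U`. -/
def dirDerivOn (E : SmoothVB) {U : Opens E.base} (f : U → ℝ) {x : U} (v : E.Tan x.1) : ℝ :=
  E.dirDeriv (Function.extend Subtype.val f 0) v

end SmoothVB

namespace LieAlgebroid

variable {E : SmoothVB} (A : LieAlgebroid E)

/-- `d` is the Lie algebroid differential: the derivation of degree `1` of the algebra of forms with
`(d f)(v) = ρ(v)(f)` and `(d α)(X, Y) = ρ(X)(α(Y)) - ρ(Y)(α(X)) - α([X, Y])` for functions `f` and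
`1`-forms `α`. -/
structure IsDifferential (d : GradedSpace.VectorField E.shiftObj 1) : Prop where
  map_fun : ∀ (U : Opens E.base) (f : U → ℝ) (hf : E.IsSmoothFun U f) (x : U) (v : E.fib x.1),
    E.contract v (E.val (d.toFun U (E.funForm U f hf)) x) =
      algebraMap ℝ _ (E.dirDerivOn f (A.anchor x.1 v))
  map_covec : ∀ (U : Opens E.base) (α : ∀ x : U, Module.Dual ℝ (E.fib x.1))
    (hα : E.IsSmoothCovec U α) (X Y : E.Sec) (x : U),
    E.contract (Y x.1) (E.contract (X x.1) (E.val (d.toFun U (E.covecForm U α hα)) x)) =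
      algebraMap ℝ _ (E.dirDerivOn (fun y => α y (Y y.1)) (A.anchor x.1 (X x.1)) -
        E.dirDerivOn (fun y => α y (X y.1)) (A.anchor x.1 (Y x.1)) -
        α x (A.bracket X Y x.1))

/-- The Lie algebroid differential, characterized by `IsDifferential`. -/
def differential : GradedSpace.VectorField E.shiftObj 1 :=
  Classical.epsilon A.IsDifferential

end LieAlgebroid

/-! ### `LA`-groupoids -/

/-- An `LA`-groupoid: a groupoid object in vector bundles (with surjective submersions as source and
target) with Lie algebroid structures such that all structure maps are Lie algebroid morphisms.
For `Ω ⇉ A` covering `G ⇉ M`, the bundle of arrows `diag.G` is `Ω → G` and `diag.M` is `A → M`.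
The Lie algebroid structure on the composable pairs is the one induced by `algG`: it is uniquely
determined by the requirement that the projections `p1`, `p2` be morphisms. -/
structure LAGroupoid where
  diag : GroupoidDiagram SmoothVB
  isGroupoidObject : diag.IsGroupoidObject fun _ => True
  s_submersion : SmoothVB.IsSurjSubmersion diag.s
  t_submersion : SmoothVB.IsSurjSubmersion diag.t
  algG : LieAlgebroid diag.G
  algM : LieAlgebroid diag.M
  algG2 : LieAlgebroid diag.G2
  p1_hom : IsLieAlgebroidHom algG2 algG diag.p1
  p2_hom : IsLieAlgebroidHom algG2 algG diag.p2
  s_hom : IsLieAlgebroidHom algG algM diag.s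
  t_hom : IsLieAlgebroidHom algG algM diag.t
  m_hom : IsLieAlgebroidHom algG2 algG diag.m
  e_hom : IsLieAlgebroidHom algM algG diag.e
  i_hom : IsLieAlgebroidHom algG algG diag.i

namespace LAGroupoid

/-- Morphisms of `LA`-groupoids: groupoid morphisms that are morphisms of Lie algebroids. -/
instance : Category LAGroupoid where
  Hom Γ Γ' := {f : Γ.diag ⟶ Γ'.diag // IsLieAlgebroidHom Γ.algG Γ'.algG f.f1 ∧
    IsLieAlgebroidHom Γ.algM Γ'.algM f.f0}
  id Γ := ⟨𝟙 Γ.diag, IsLieAlgebroidHom.id _, IsLieAlgebroidHom.id _⟩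
  comp f g := ⟨f.1 ≫ g.1, f.2.1.comp g.2.1, f.2.2.comp g.2.2⟩
  id_comp _ := Subtype.ext (Category.id_comp _)
  comp_id _ := Subtype.ext (Category.comp_id _)
  assoc _ _ _ := Subtype.ext (Category.assoc _ _ _)

/-- The supergroupoid data `[-1]Ω ⇉ [-1]A` of an `LA`-groupoid. -/
def shiftDiag (Γ : LAGroupoid) : GroupoidDiagram GradedSpace :=
  (GroupoidDiagram.map SmoothVB.shift).obj Γ.diag

/-- The map of supergroupoid data induced by a morphism of `LA`-groupoids. -/
def shiftDiagMap {Γ Γ' : LAGroupoid} (f : Γ ⟶ Γ') : Γ.shiftDiag ⟶ Γ'.shiftDiag :=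
  (GroupoidDiagram.map SmoothVB.shift).map f.1

/-- The functor `[-1]`, which sends `Ω ⇉ A` to `[-1]Ω ⇉ [-1]A` with the Lie algebroid differentials
of `Ω` and `A`, given that these are `Q`-groupoids and that it sends morphisms to morphisms. -/
def shiftFunctor
    (hobj : ∀ Γ : LAGroupoid, IsQGroupoid Γ.shiftDiag Γ.algG.differential Γ.algM.differential)
    (hmap : ∀ (Γ Γ' : LAGroupoid) (f : Γ ⟶ Γ'),
      GradedSpace.Related (shiftDiagMap f).f1 Γ.algG.differential Γ'.algG.differential ∧
      GradedSpace.Related (shiftDiagMap f).f0 Γ.algM.differential Γ'.algM.differential) :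
    LAGroupoid ⥤ QGroupoid where
  obj Γ := ⟨Γ.shiftDiag, Γ.algG.differential, Γ.algM.differential, hobj Γ⟩
  map f := ⟨shiftDiagMap f, hmap _ _ f⟩
  map_id Γ := Subtype.ext ((GroupoidDiagram.map SmoothVB.shift).map_id Γ.diag)
  map_comp f g := Subtype.ext ((GroupoidDiagram.map SmoothVB.shift).map_comp f.1 g.1)

end LAGroupoid

end

/-!
A function on `[-1]E` is a section of the exterior algebra of the dual bundle, so it is locally a
polynomial in functions on the base and `1`-forms. All statements about `[-1]` are reduced to these
generators (`SmoothVB.func_induction`), or to coordinates of the base and a coframe.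

*Differentials.* The Lie algebroid differential is unique because it is given on generators. For its
existence, let `X₁, …, Xᵣ` be a local frame with dual coframe `ξ¹, …, ξʳ`. The operator
`∑ ξⁱ ρ(Xᵢ) - ½ ∑ ξⁱ ξʲ ι_{[Xᵢ, Xⱼ]}`, with coefficients differentiated in the frame, is the
differential over the domain of the frame (`LieAlgebroid.frameDifferential`), and by uniqueness these
operators glue. Its square vanishes on functions, because the anchor preserves brackets, and on
`1`-forms, by the Jacobi identity; being a derivation, it vanishes
(`LieAlgebroid.isHomological_differential`). A morphism of Lie algebroids relates the differentials,
again by a computation on generators (`IsLieAlgebroidHom.related`).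

*Fibre products.* A groupoid object is described by the fibre products of composable pairs and
triples, and the main point is that `[-1]` preserves these (`IsFibreProduct.shiftMap`): they are
fibre products `W` of bundles `X`, `Y` over `Z` along a map `t : Y ⟶ Z` that is locally a projection
and fibrewise surjective, but the universal property of `[-1]W` has to be verified against arbitrary
supermanifolds `T`. A morphism from `T` to `[-1]W` over a map `z` of the supports consists, in a chart
of `T`, of homomorphisms from the germs at the points `z y` of functions on `[-1]W` to the algebra of
polynomials in the graded coordinates (`GermHom`), which depend smoothly on `y`. The image of a
function differs from its value at `z y` by a nilpotent element, because a function that does not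
vanish at `z y` is invertible near this point (`GermHom.evalAt_fn`). By Hadamard's lemma, such a
homomorphism is therefore determined by its values on coordinates and a coframe
(`GermHom.eq_of_coords`), and by Taylor's formula these values can be prescribed
(`GermHom.ofTaylor`). The universal property of `W`, tested on bundles over open subsets of
Euclidean spaces, shows that coordinates and frames of `X` together with complementary ones of `Y`
are coordinates and frames of `W` (`IsFibreProduct.exists_adaptedChart`). Hence homomorphisms on germs for `X` and `Y` that
agree over `Z` come from a unique one for `W`; the families obtained in this way are smooth and, by
uniqueness, glue to a morphism.

*Submersions.* Every tangent vector of `[-1]E` is the sum of a derivative in the direction of a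
tangent vector of the base and of the contraction with a vector in the fibre
(`GradedSpace.TangentVector.exists_eq_tangentVector`), so surjective submersions are preserved.

The groupoid identities and the multiplicativity of the differential then follow formally, and
faithfulness holds because functions and `1`-forms separate bundle maps
(`SmoothVB.shiftMap_injective`).
-/

open CategoryTheory TopologicalSpace Topology Bundle
open scoped Manifold ContDiff TensorProduct

noncomputable section



/-! ### Antiderivations of the exterior algebra -/

namespace ExteriorAlgebra

variable {V : Type} [AddCommGroup V] [Module ℝ V]

/-- The parity involution of the exterior algebra. -/
abbrev invol : ExteriorAlgebra ℝ V →ₐ[ℝ] ExteriorAlgebra ℝ V := CliffordAlgebra.involute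

theorem invol_ι (v : V) : invol (ι ℝ v) = -ι ℝ v := CliffordAlgebra.involute_ι v

theorem invol_invol (a : ExteriorAlgebra ℝ V) : invol (invol a) = a :=
  CliffordAlgebra.involute_involute a

theorem ι_mul_eq_invol_mul (v : V) (a : ExteriorAlgebra ℝ V) : ι ℝ v * a = invol a * ι ℝ v := by
  induction a using ExteriorAlgebra.induction with
  | algebraMap r => rw [AlgHom.commutes, Algebra.commutes]
  | ι w => rw [invol_ι, neg_mul]; exact eq_neg_of_add_eq_zero_left (ι_add_mul_swap v w)
  | mul a b ha hb => rw [← mul_assoc, ha, mul_assoc, hb, map_mul, mul_assoc]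
  | add a b ha hb => rw [mul_add, ha, hb, map_add, add_mul]

theorem ι_mul_invol (v : V) (a : ExteriorAlgebra ℝ V) : ι ℝ v * invol a = a * ι ℝ v := by
  rw [ι_mul_eq_invol_mul, invol_invol]

theorem ι_mul_ι_commute (u v : V) (a : ExteriorAlgebra ℝ V) :
    ι ℝ u * ι ℝ v * a = a * (ι ℝ u * ι ℝ v) := by
  rw [mul_assoc, ι_mul_eq_invol_mul v, ← mul_assoc, ι_mul_invol, mul_assoc]

theorem contractLeft_mul (d : Module.Dual ℝ V) (a b : ExteriorAlgebra ℝ V) :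
    CliffordAlgebra.contractLeft d (a * b) =
      CliffordAlgebra.contractLeft d a * b + invol a * CliffordAlgebra.contractLeft d b := by
  induction a using ExteriorAlgebra.induction generalizing b with
  | algebraMap r =>
    rw [CliffordAlgebra.contractLeft_algebraMap_mul, CliffordAlgebra.contractLeft_algebraMap,
      AlgHom.commutes, zero_mul, zero_add]
  | ι w =>
    have h := CliffordAlgebra.contractLeft_ι_mul (Q := (0 : QuadraticForm ℝ V)) (d := d) w b
    have h' := CliffordAlgebra.contractLeft_ι (Q := (0 : QuadraticForm ℝ V)) (d := d) w
    change _ = CliffordAlgebra.contractLeft d (CliffordAlgebra.ι 0 w) * b + _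
    rw [h', invol_ι, ← Algebra.smul_def, neg_mul, ← sub_eq_add_neg]
    exact h
  | mul a c ha hc =>
    rw [mul_assoc, ha, hc, ha, map_mul]
    noncomm_ring
  | add a c ha hc =>
    rw [add_mul, map_add, ha, hc, map_add, map_add]
    noncomm_ring

theorem invol_of_mem {n : ℕ} {a : ExteriorAlgebra ℝ V} (ha : a ∈ ⋀[ℝ]^n V) :
    invol a = (-1 : ℝ) ^ n • a := by
  change a ∈ LinearMap.range (ι ℝ) ^ n at ha
  induction ha using Submodule.pow_induction_on_left' with
  | algebraMap r => simp
  | add x y i hx hy h1 h2 => rw [map_add, h1, h2, smul_add]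
  | mem_mul m hm i x hx h =>
    obtain ⟨v, rfl⟩ := hm
    rw [map_mul, h, invol_ι, pow_succ', mul_smul]
    simp

theorem contractLeft_mem {n : ℕ} (d : Module.Dual ℝ V) {a : ExteriorAlgebra ℝ V}
    (ha : a ∈ ⋀[ℝ]^(n + 1) V) : CliffordAlgebra.contractLeft d a ∈ ⋀[ℝ]^n V := by
  induction n generalizing a with
  | zero =>
    change a ∈ LinearMap.range (ι ℝ) ^ (0 + 1) at ha
    rw [zero_add, pow_one] at ha
    obtain ⟨v, rfl⟩ := ha
    have h' := CliffordAlgebra.contractLeft_ι (Q := (0 : QuadraticForm ℝ V)) (d := d) v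
    change CliffordAlgebra.contractLeft d (CliffordAlgebra.ι 0 v) ∈ LinearMap.range (ι ℝ) ^ 0
    rw [h', pow_zero]
    exact Submodule.algebraMap_mem _
  | succ n ih =>
    change a ∈ LinearMap.range (ι ℝ) ^ (n + 1 + 1) at ha
    rw [pow_succ'] at ha
    induction ha using Submodule.mul_induction_on' with
    | mem_mul_mem m hm b hb =>
      obtain ⟨v, rfl⟩ := hm
      have h' := CliffordAlgebra.contractLeft_ι_mul (Q := (0 : QuadraticForm ℝ V)) (d := d) v b
      have h1 : CliffordAlgebra.contractLeft d (ι ℝ v * b) =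
        d v • b - ι ℝ v * CliffordAlgebra.contractLeft d b := h'
      rw [h1]
      refine Submodule.sub_mem _ (Submodule.smul_mem _ _ hb) ?_
      change _ ∈ LinearMap.range (ι ℝ) ^ (n + 1)
      rw [pow_succ']
      exact Submodule.mul_mem_mul ⟨v, rfl⟩ (ih hb)
    | add x _ y _ hx hy => rw [map_add]; exact Submodule.add_mem _ hx hy

/-- Euler's identity for the exterior algebra of a dual space. -/
theorem sum_ι_coord_mul_contractLeft {κ : Type} [Fintype κ] (b : Module.Basis κ ℝ V) {n : ℕ}
    {a : ExteriorAlgebra ℝ (Module.Dual ℝ V)} (ha : a ∈ ⋀[ℝ]^n (Module.Dual ℝ V)) :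
    ∑ j, ι ℝ (b.coord j) * CliffordAlgebra.contractLeft (Module.Dual.eval ℝ V (b j)) a =
      (n : ℝ) • a := by
  classical
  change a ∈ LinearMap.range (ι ℝ) ^ n at ha
  induction ha using Submodule.pow_induction_on_left' with
  | algebraMap r => simp [CliffordAlgebra.contractLeft_algebraMap]
  | add x y i hx hy h1 h2 =>
    simp only [map_add, mul_add, Finset.sum_add_distrib, h1, h2, smul_add]
  | mem_mul m hm i x hx h =>
    obtain ⟨v, rfl⟩ := hm
    have h1 : ∀ j, ι ℝ (b.coord j) *
        CliffordAlgebra.contractLeft (Module.Dual.eval ℝ V (b j)) (ι ℝ v * x) =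
        v (b j) • (ι ℝ (b.coord j) * x) + ι ℝ v * (ι ℝ (b.coord j) *
          CliffordAlgebra.contractLeft (Module.Dual.eval ℝ V (b j)) x) := fun j => by
      have h' : CliffordAlgebra.contractLeft (Module.Dual.eval ℝ V (b j)) (ι ℝ v) =
        algebraMap ℝ (ExteriorAlgebra ℝ (Module.Dual ℝ V)) (v (b j)) :=
        CliffordAlgebra.contractLeft_ι (Q := (0 : QuadraticForm ℝ (Module.Dual ℝ V))) _ v
      rw [contractLeft_mul, h', ← Algebra.smul_def, mul_add, mul_smul_comm, ← mul_assoc,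
        ι_mul_invol, mul_assoc]
    have h2 : ∑ j, v (b j) • b.coord j = v := by
      refine b.ext fun j => ?_
      simp
    simp only [h1, Finset.sum_add_distrib, ← Finset.mul_sum, h]
    have h3 : ∑ j, v (b j) • (ι ℝ (b.coord j) * x) = ι ℝ v * x := by
      have h4 : ∑ j, v (b j) • ι ℝ (b.coord j) = ι ℝ v := by
        rw [← congrArg (ι ℝ) h2, map_sum]
        simp only [map_smul]
      rw [← h4, Finset.sum_mul]
      simp only [smul_mul_assoc]
    rw [h3, mul_smul_comm, Nat.cast_succ, add_smul, one_smul, add_comm]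

theorem eq_zero_of_contractLeft {κ : Type} [Fintype κ] (b : Module.Basis κ ℝ V) {n : ℕ}
    {a : ExteriorAlgebra ℝ (Module.Dual ℝ V)} (ha : a ∈ ⋀[ℝ]^(n + 1) (Module.Dual ℝ V))
    (h : ∀ j, CliffordAlgebra.contractLeft (Module.Dual.eval ℝ V (b j)) a = 0) : a = 0 := by
  have h1 := sum_ι_coord_mul_contractLeft b ha
  simp only [h, mul_zero, Finset.sum_const_zero] at h1
  exact (smul_eq_zero.1 h1.symm).resolve_left (by positivity)

end ExteriorAlgebra



/-! ### Polynomials in graded-commuting coordinates -/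

namespace SuperPoly

variable {p : ℤ → ℕ}

theorem coord_mul_coord (c d : SuperCoord p) :
    coord p c * coord p d = ((c.1.1 * d.1.1).negOnePow : ℤ) • (coord p d * coord p c) := by
  have h := RingQuot.mkAlgHom_rel ℝ (SuperCoordRel.comm (p := p) c d)
  rw [map_mul, map_zsmul, map_mul] at h
  exact h

theorem adjoin_coord : Algebra.adjoin ℝ (Set.range (coord p)) = ⊤ := by
  have h1 := congrArg (Subalgebra.map (RingQuot.mkAlgHom ℝ (SuperCoordRel p)))
    (FreeAlgebra.adjoin_range_ι (R := ℝ) (X := SuperCoord p))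
  rw [AlgHom.map_adjoin, Algebra.map_top, ← Set.range_comp] at h1
  refine h1.trans ?_
  rw [AlgHom.range_eq_top]
  exact RingQuot.mkAlgHom_surjective ℝ _

theorem hom_ext {A : Type*} [Semiring A] [Algebra ℝ A] {f g : SuperPoly p →ₐ[ℝ] A}
    (h : ∀ c, f (coord p c) = g (coord p c)) : f = g := by
  refine AlgHom.ext_of_adjoin_eq_top adjoin_coord ?_
  rintro _ ⟨c, rfl⟩
  exact h c

theorem lift_aux {A : Type*} [Ring A] [Algebra ℝ A] (f : SuperCoord p → A)
    (h : ∀ c d, f c * f d = ((c.1.1 * d.1.1).negOnePow : ℤ) • (f d * f c)) :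
    ∀ ⦃x y : FreeAlgebra ℝ (SuperCoord p)⦄, SuperCoordRel p x y →
      FreeAlgebra.lift ℝ f x = FreeAlgebra.lift ℝ f y := by
  rintro _ _ ⟨c, d⟩
  rw [map_mul, map_zsmul, map_mul, FreeAlgebra.lift_ι_apply, FreeAlgebra.lift_ι_apply, h]

/-- The universal property of the algebra of polynomials in graded-commuting coordinates. -/
def lift {A : Type*} [Ring A] [Algebra ℝ A] (f : SuperCoord p → A)
    (h : ∀ c d, f c * f d = ((c.1.1 * d.1.1).negOnePow : ℤ) • (f d * f c)) :
    SuperPoly p →ₐ[ℝ] A :=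
  RingQuot.liftAlgHom ℝ ⟨FreeAlgebra.lift ℝ f, lift_aux f h⟩

theorem lift_coord {A : Type*} [Ring A] [Algebra ℝ A] (f : SuperCoord p → A)
    (h : ∀ c d, f c * f d = ((c.1.1 * d.1.1).negOnePow : ℤ) • (f d * f c)) (c : SuperCoord p) :
    lift f h (coord p c) = f c := by
  unfold lift coord
  rw [RingQuot.liftAlgHom_mkAlgHom_apply, FreeAlgebra.lift_ι_apply]

open Classical in
/-- The projection to the polynomials in the coordinates of even degree, which kills the
coordinates of odd degree. -/
def toEven (p : ℤ → ℕ) : SuperPoly p →ₐ[ℝ] MvPolynomial (SuperCoord p) ℝ :=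
  lift (fun c => if Even c.1.1 then MvPolynomial.X c else 0) fun c d => by
    by_cases hc : Even c.1.1
    · rw [Int.negOnePow_even _ (hc.mul_right _), mul_comm]
      simp
    · simp [hc]

theorem toEven_coord_even {c : SuperCoord p} (hc : Even c.1.1) :
    toEven p (coord p c) = MvPolynomial.X c := by
  rw [toEven, lift_coord, if_pos hc]

theorem toEven_coord_odd {c : SuperCoord p} (hc : ¬ Even c.1.1) : toEven p (coord p c) = 0 := by
  rw [toEven, lift_coord, if_neg hc]

/-- The evaluation at real values of the even coordinates; the odd coordinates are sent to `0`. -/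
def evalAt (a : SuperCoord p → ℝ) : SuperPoly p →ₐ[ℝ] ℝ := (MvPolynomial.aeval a).comp (toEven p)

theorem aug_coord (c : SuperCoord p) : aug p (coord p c) = 0 := by
  unfold aug coord
  rw [RingQuot.liftAlgHom_mkAlgHom_apply, FreeAlgebra.lift_ι_apply]

theorem aug_eq_evalAt : aug p = evalAt fun _ => 0 := by
  refine hom_ext fun c => ?_
  rw [aug_coord]
  by_cases hc : Even c.1.1
  · simp [evalAt, toEven_coord_even hc]
  · simp [evalAt, toEven_coord_odd hc]

theorem coord_even_commute {c : SuperCoord p} (hc : Even c.1.1) (x : SuperPoly p) :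
    coord p c * x = x * coord p c := by
  have hx : x ∈ Algebra.adjoin ℝ (Set.range (coord p)) := by rw [adjoin_coord]; trivial
  induction hx using Algebra.adjoin_induction with
  | mem x hx =>
    obtain ⟨d, rfl⟩ := hx
    rw [coord_mul_coord, Int.negOnePow_even _ (hc.mul_right _)]
    simp
  | algebraMap r => rw [Algebra.commutes]
  | add x y _ _ hx hy => rw [mul_add, hx, hy, add_mul]
  | mul x y _ _ hx hy => rw [← mul_assoc, hx, mul_assoc, hy, mul_assoc]

theorem coord_odd_mul_self {c : SuperCoord p} (hc : ¬ Even c.1.1) : coord p c * coord p c = 0 := by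
  have h := coord_mul_coord c c
  rw [Int.negOnePow_odd _ (Int.not_even_iff_odd.1 hc |>.mul (Int.not_even_iff_odd.1 hc))] at h
  have h' : coord p c * coord p c = -(coord p c * coord p c) := by simpa using h
  have h2 : (2 : ℝ) • (coord p c * coord p c) = 0 := by
    rw [two_smul]
    exact add_eq_zero_iff_eq_neg.2 h'
  exact (smul_eq_zero.1 h2).resolve_left two_ne_zero

theorem exists_coord_mul_eq (c : SuperCoord p) (x : SuperPoly p) :
    ∃ y, coord p c * x = y * coord p c := by
  have hx : x ∈ Algebra.adjoin ℝ (Set.range (coord p)) := by rw [adjoin_coord]; trivial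
  induction hx using Algebra.adjoin_induction with
  | mem x hx =>
    obtain ⟨d, rfl⟩ := hx
    exact ⟨((c.1.1 * d.1.1).negOnePow : ℤ) • coord p d, by rw [coord_mul_coord, smul_mul_assoc]⟩
  | algebraMap r => exact ⟨_, (Algebra.commutes _ _).symm⟩
  | add x y _ _ hx hy =>
    obtain ⟨a, ha⟩ := hx
    obtain ⟨b, hb⟩ := hy
    exact ⟨a + b, by rw [mul_add, ha, hb, add_mul]⟩
  | mul x y _ _ hx hy =>
    obtain ⟨a, ha⟩ := hx
    obtain ⟨b, hb⟩ := hy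
    exact ⟨a * b, by rw [← mul_assoc, ha, mul_assoc, hb, mul_assoc]⟩

/-- The ideal generated by some of the coordinates. -/
def coordIdeal (S : Set (SuperCoord p)) : Ideal (SuperPoly p) := Ideal.span (coord p '' S)

theorem mul_mem_coordIdeal {S : Set (SuperCoord p)} {x : SuperPoly p} (hx : x ∈ coordIdeal S)
    (y : SuperPoly p) : x * y ∈ coordIdeal S := by
  induction hx using Submodule.span_induction with
  | mem x hx =>
    obtain ⟨c, hc, rfl⟩ := hx
    obtain ⟨z, hz⟩ := exists_coord_mul_eq c y
    rw [hz]
    exact Ideal.mul_mem_left _ _ (Ideal.subset_span ⟨c, hc, rfl⟩)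
  | zero => rw [zero_mul]; exact Ideal.zero_mem _
  | add x y _ _ hx hy => rw [add_mul]; exact Ideal.add_mem _ hx hy
  | smul a x _ hx => rw [smul_eq_mul, mul_assoc]; exact Ideal.mul_mem_left _ _ hx

theorem pow_eq_zero_of_mem_coordIdeal (S : Finset (SuperCoord p)) (hS : ∀ c ∈ S, ¬ Even c.1.1)
    {x : SuperPoly p} (hx : x ∈ coordIdeal (S : Set (SuperCoord p))) : x ^ 2 ^ S.card = 0 := by
  classical
  induction S using Finset.induction_on generalizing x with
  | empty =>
    have : x = 0 := by simpa [coordIdeal] using hx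
    simp [this]
  | insert c S hc ih =>
    have h1 : coordIdeal ((insert c S : Finset (SuperCoord p)) : Set (SuperCoord p)) =
        coordIdeal {c} ⊔ coordIdeal (S : Set (SuperCoord p)) := by
      unfold coordIdeal
      rw [Finset.coe_insert, Set.image_insert_eq, Set.image_singleton, Ideal.span_insert]
    rw [h1] at hx
    obtain ⟨y, hy, z, hz, rfl⟩ := Submodule.mem_sup.1 hx
    have hz' := ih (fun d hd => hS d (Finset.mem_insert_of_mem hd)) hz
    have h2 : ∀ m : ℕ, (y + z) ^ m - z ^ m ∈ coordIdeal {c} := by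
      intro m
      induction m with
      | zero => simp
      | succ m hm =>
        have : (y + z) ^ (m + 1) - z ^ (m + 1) = (y + z) * ((y + z) ^ m - z ^ m) + y * z ^ m := by
          rw [pow_succ', pow_succ', mul_sub, add_mul y z (z ^ m)]
          abel
        rw [this]
        exact Ideal.add_mem _ (Ideal.mul_mem_left _ _ hm) (mul_mem_coordIdeal hy _)
    have h3 := h2 (2 ^ S.card)
    rw [hz', sub_zero] at h3
    rw [Finset.card_insert_of_notMem hc, pow_succ, pow_mul]
    unfold coordIdeal at h3
    rw [Set.image_singleton] at h3
    obtain ⟨w, hw⟩ := Ideal.mem_span_singleton'.1 h3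
    obtain ⟨v, hv⟩ := exists_coord_mul_eq c w
    rw [← hw, sq, mul_assoc, ← mul_assoc (coord p c) w, hv, mul_assoc v,
      coord_odd_mul_self (hS c (Finset.mem_insert_self c S)), mul_zero, mul_zero]

open Classical in
/-- The inclusion of the polynomials in the coordinates of even degree, which are central. -/
def ofEven (p : ℤ → ℕ) : MvPolynomial (SuperCoord p) ℝ →ₐ[ℝ] SuperPoly p :=
  (Subalgebra.center ℝ (SuperPoly p)).val.comp (MvPolynomial.aeval fun c =>
    if hc : Even c.1.1 then ⟨coord p c, Subalgebra.mem_center_iff.2 fun b =>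
      (coord_even_commute hc b).symm⟩ else 0)

theorem sub_ofEven_toEven_mem {S T : Set (SuperCoord p)} (hT : ∀ c ∈ S, ¬ Even c.1.1 → c ∈ T)
    {x : SuperPoly p} (hx : x ∈ Algebra.adjoin ℝ (coord p '' S)) :
    x - ofEven p (toEven p x) ∈ coordIdeal T := by
  induction hx using Algebra.adjoin_induction with
  | mem x hx =>
    obtain ⟨c, hc, rfl⟩ := hx
    by_cases h : Even c.1.1
    · simp [toEven_coord_even h, ofEven, h]
    · rw [toEven_coord_odd h, map_zero, sub_zero]
      exact Ideal.subset_span ⟨c, hT c hc h, rfl⟩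
  | algebraMap r => simp
  | add x y _ _ hx hy =>
    rw [map_add, map_add, add_sub_add_comm]
    exact Ideal.add_mem _ hx hy
  | mul x y _ _ hx hy =>
    have : x * y - ofEven p (toEven p (x * y)) = x * (y - ofEven p (toEven p y)) +
        (x - ofEven p (toEven p x)) * ofEven p (toEven p y) := by
      rw [map_mul, map_mul, mul_sub, sub_mul]
      abel
    rw [this]
    exact Ideal.add_mem _ (Ideal.mul_mem_left _ _ hy) (mul_mem_coordIdeal hx _)

/-- A polynomial that vanishes for all real values of the even coordinates is nilpotent, of an
order that depends only on the coordinates which occur in it. -/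
theorem pow_eq_zero_of_evalAt (S : Finset (SuperCoord p)) {x : SuperPoly p}
    (hx : x ∈ Algebra.adjoin ℝ (coord p '' S)) (h : ∀ a, evalAt a x = 0) : x ^ 2 ^ S.card = 0 := by
  classical
  have h1 : toEven p x = 0 := by
    refine MvPolynomial.funext fun a => ?_
    rw [map_zero]
    have := h a
    rwa [evalAt, AlgHom.comp_apply, MvPolynomial.aeval_eq_eval] at this
  have h2 := sub_ofEven_toEven_mem (T := ((S.filter fun c => ¬ Even c.1.1 : Finset _) : Set _))
    (fun c hc hc' => Finset.mem_coe.2 (Finset.mem_filter.2 ⟨hc, hc'⟩)) hx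
  rw [h1, map_zero, sub_zero] at h2
  have h3 := pow_eq_zero_of_mem_coordIdeal _ (fun c hc => (Finset.mem_filter.1 hc).2) h2
  exact pow_eq_zero_of_le (Nat.pow_le_pow_right (by norm_num)
    (Finset.card_le_card (Finset.filter_subset _ _))) h3

theorem exists_finset_mem_adjoin (x : SuperPoly p) :
    ∃ S : Finset (SuperCoord p), x ∈ Algebra.adjoin ℝ (coord p '' S) := by
  classical
  have hx : x ∈ Algebra.adjoin ℝ (Set.range (coord p)) := by rw [adjoin_coord]; trivial
  have mono : ∀ {S T : Finset (SuperCoord p)}, S ⊆ T →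
      Algebra.adjoin ℝ (coord p '' S) ≤ Algebra.adjoin ℝ (coord p '' T) := fun h =>
    Algebra.adjoin_mono (Set.image_mono (by exact_mod_cast h))
  induction hx using Algebra.adjoin_induction with
  | mem x hx =>
    obtain ⟨d, rfl⟩ := hx
    exact ⟨{d}, Algebra.subset_adjoin ⟨d, by simp, rfl⟩⟩
  | algebraMap r => exact ⟨∅, Subalgebra.algebraMap_mem _ _⟩
  | add x y _ _ hx hy =>
    obtain ⟨S, hS⟩ := hx
    obtain ⟨T, hT⟩ := hy
    exact ⟨S ∪ T, add_mem (mono Finset.subset_union_left hS) (mono Finset.subset_union_right hT)⟩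
  | mul x y _ _ hx hy =>
    obtain ⟨S, hS⟩ := hx
    obtain ⟨T, hT⟩ := hy
    exact ⟨S ∪ T, mul_mem (mono Finset.subset_union_left hS) (mono Finset.subset_union_right hT)⟩

theorem exists_finset_forall_mem_adjoin {n : ℕ} (w : Fin n → SuperPoly p) :
    ∃ S : Finset (SuperCoord p), ∀ i, w i ∈ Algebra.adjoin ℝ (coord p '' S) := by
  classical
  choose S hS using fun i => exists_finset_mem_adjoin (w i)
  refine ⟨Finset.univ.biUnion S, fun i => Algebra.adjoin_mono (Set.image_mono ?_) (hS i)⟩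
  exact_mod_cast Finset.subset_biUnion_of_mem S (Finset.mem_univ i)

/-! #### The grading -/

theorem prod_coord_mem_deg (L : List (SuperCoord p)) :
    (L.map (coord p)).prod ∈ deg p (L.map fun c => -c.1.1).sum :=
  Submodule.subset_span ⟨L, rfl, rfl⟩

theorem one_mem_deg : (1 : SuperPoly p) ∈ deg p 0 := by
  simpa using prod_coord_mem_deg (p := p) []

theorem algebraMap_mem_deg (r : ℝ) : algebraMap ℝ (SuperPoly p) r ∈ deg p 0 := by
  rw [Algebra.algebraMap_eq_smul_one]
  exact Submodule.smul_mem _ _ one_mem_deg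

theorem mul_mem_deg {k l : ℤ} {x y : SuperPoly p} (hx : x ∈ deg p k) (hy : y ∈ deg p l) :
    x * y ∈ deg p (k + l) := by
  induction hx using Submodule.span_induction with
  | mem x hx =>
    obtain ⟨L, hL, rfl⟩ := hx
    induction hy using Submodule.span_induction with
    | mem y hy =>
      obtain ⟨L', hL', rfl⟩ := hy
      exact Submodule.subset_span ⟨L ++ L', by simp [← hL, ← hL'], by simp⟩
    | zero => rw [mul_zero]; exact Submodule.zero_mem _
    | add x y _ _ hx hy => rw [mul_add]; exact Submodule.add_mem _ hx hy
    | smul a x _ hx => rw [mul_smul_comm]; exact Submodule.smul_mem _ _ hx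
  | zero => rw [zero_mul]; exact Submodule.zero_mem _
  | add x y _ _ hx hy => rw [add_mul]; exact Submodule.add_mem _ hx hy
  | smul a x _ hx => rw [smul_mul_assoc]; exact Submodule.smul_mem _ _ hx

theorem coord_mul_prod (c : SuperCoord p) (L : List (SuperCoord p)) :
    coord p c * (L.map (coord p)).prod =
      ((-c.1.1 * (L.map fun c => -c.1.1).sum).negOnePow : ℤ) •
        ((L.map (coord p)).prod * coord p c) := by
  induction L with
  | nil => simp
  | cons d L ih =>
    rw [List.map_cons, List.prod_cons, ← mul_assoc, coord_mul_coord, smul_mul_assoc, mul_assoc, ih,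
      List.map_cons, List.sum_cons, mul_add, Int.negOnePow_add, mul_smul_comm, smul_smul,
      Units.val_mul, neg_mul_neg, ← mul_assoc]

theorem mul_comm_of_mem_deg {k l : ℤ} {x y : SuperPoly p} (hx : x ∈ deg p k) (hy : y ∈ deg p l) :
    x * y = ((k * l).negOnePow : ℤ) • (y * x) := by
  induction hx using Submodule.span_induction with
  | mem x hx =>
    obtain ⟨L, hL, rfl⟩ := hx
    induction hy using Submodule.span_induction with
    | mem y hy =>
      obtain ⟨L', hL', rfl⟩ := hy
      rw [← hL, ← hL']
      clear hL hL'
      induction L with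
      | nil => simp
      | cons d L ih =>
        rw [List.map_cons, List.prod_cons, mul_assoc, ih, mul_smul_comm, ← mul_assoc,
          coord_mul_prod, smul_mul_assoc, smul_smul, List.map_cons, List.sum_cons, add_mul,
          Int.negOnePow_add, Units.val_mul, mul_comm (Units.val _), mul_assoc]
    | zero => simp
    | add x y _ _ hx hy => rw [mul_add, hx, hy, add_mul]; exact (zsmul_add _ _ _).symm
    | smul a x _ hx => rw [mul_smul_comm, hx, smul_mul_assoc, smul_comm]
  | zero => simp
  | add x y _ _ hx hy => rw [add_mul, hx, hy, mul_add]; exact (zsmul_add _ _ _).symm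
  | smul a x _ hx => rw [smul_mul_assoc, hx, mul_smul_comm, smul_comm]

theorem commute_of_mem_deg_zero {l : ℤ} {x y : SuperPoly p} (hx : x ∈ deg p 0) (hy : y ∈ deg p l) :
    x * y = y * x := by
  rw [mul_comm_of_mem_deg hx hy]
  simp

theorem aug_eq_zero_of_mem_deg {k : ℤ} (hk : k ≠ 0) {x : SuperPoly p} (hx : x ∈ deg p k) :
    aug p x = 0 := by
  induction hx using Submodule.span_induction with
  | mem x hx =>
    obtain ⟨L, hL, rfl⟩ := hx
    cases L with
    | nil => exact absurd hL.symm hk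
    | cons c L => rw [List.map_cons, List.prod_cons, map_mul, aug_coord, zero_mul]
  | zero => simp
  | add x y _ _ hx hy => rw [map_add, hx, hy, add_zero]
  | smul a x _ hx => rw [map_smul, hx, smul_zero]

/-- The algebra of polynomials of degree `0`. -/
def degZero (p : ℤ → ℕ) : Subalgebra ℝ (SuperPoly p) where
  carrier := deg p 0
  mul_mem' hx hy := by simpa using mul_mem_deg hx hy
  add_mem' hx hy := Submodule.add_mem _ hx hy
  algebraMap_mem' r := algebraMap_mem_deg r

instance : CommRing (degZero p) :=
  { (degZero p).toRing with
    mul_comm := fun x y => Subtype.ext (commute_of_mem_deg_zero x.2 y.2) }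

end SuperPoly



/-! ### Germs of smooth functions on vector spaces -/

section Hadamard

variable {V : Type} [NormedAddCommGroup V] [NormedSpace ℝ V]

/-- Integrals of smooth functions over a compact interval depend smoothly on parameters. -/
theorem contDiff_intervalIntegral_param [FiniteDimensional ℝ V] {F : Type} [NormedAddCommGroup F] [NormedSpace ℝ F]
    [CompleteSpace F] {h : V × ℝ → F} (hh : ContDiff ℝ ∞ h) :
    ContDiff ℝ ∞ fun x => ∫ s in (0 : ℝ)..1, h (x, s) := by
  rw [contDiff_infty]
  intro n
  induction n generalizing F with
  | zero =>
    have h0 : Continuous fun x => ∫ s in (0 : ℝ)..1, h (x, s) :=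
      intervalIntegral.continuous_parametric_intervalIntegral_of_continuous'
        (f := fun x s => h (x, s)) hh.continuous 0 1
    exact contDiff_zero.2 h0
  | succ n ih =>
    let h' : V × ℝ → V →L[ℝ] F := fun z => (fderiv ℝ h z).comp (ContinuousLinearMap.inl ℝ V ℝ)
    have hh' : ContDiff ℝ ∞ h' := (hh.fderiv_right (m := ∞) (by simp)).clm_comp contDiff_const
    refine contDiff_succ_iff_hasFDerivAt.2 ⟨fun x => ∫ s in (0 : ℝ)..1, h' (x, s), ih hh', ?_⟩
    intro x₀
    obtain ⟨C, hC⟩ := ((isCompact_closedBall x₀ (1 : ℝ)).prod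
      (isCompact_Icc (a := (0 : ℝ)) (b := 1))).exists_bound_of_continuousOn
        hh'.continuous.continuousOn
    have c1 : ∀ x : V, Continuous fun s : ℝ => h (x, s) := fun x =>
      hh.continuous.comp (Continuous.prodMk_right x)
    have c2 : ∀ x : V, Continuous fun s : ℝ => h' (x, s) := fun x =>
      hh'.continuous.comp (Continuous.prodMk_right x)
    refine intervalIntegral.hasFDerivAt_integral_of_dominated_of_fderiv_le
      (F := fun x s => h (x, s)) (F' := fun x s => h' (x, s)) (bound := fun _ => C)
      (Metric.closedBall_mem_nhds x₀ one_pos)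
      (Filter.Eventually.of_forall fun x => (c1 x).aestronglyMeasurable)
      ((c1 x₀).intervalIntegrable _ _) ((c2 x₀).aestronglyMeasurable) ?_
      (continuous_const.intervalIntegrable _ _) ?_
    · refine Filter.Eventually.of_forall fun s hs x hx => hC (x, s) ⟨hx, ?_⟩
      rw [Set.uIoc_of_le zero_le_one] at hs
      exact ⟨hs.1.le, hs.2⟩
    · refine Filter.Eventually.of_forall fun s hs x hx => ?_
      have h1 : HasFDerivAt h (fderiv ℝ h (x, s)) (x, s) :=
        (hh.differentiable (by simp)).differentiableAt.hasFDerivAt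
      exact h1.comp x (hasFDerivAt_prodMk_left x s)

variable {ι : Type} [Fintype ι] (b : Module.Basis ι ℝ V)

/-- Smoothness near a point. -/
def SmoothGermAt (f : V → ℝ) (q : V) : Prop := ∀ᶠ x in 𝓝 q, ContDiffAt ℝ ∞ f x

theorem ContDiffAt.smoothGermAt_of_isOpen {f : V → ℝ} {q : V} {s : Set V} (hs : s ∈ 𝓝 q)
    (h : ContDiffOn ℝ ∞ f s) : SmoothGermAt f q := by
  obtain ⟨u, hu, huo, hqu⟩ := mem_nhds_iff.1 hs
  filter_upwards [huo.mem_nhds hqu] with x hx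
  exact h.contDiffAt (Filter.mem_of_superset (huo.mem_nhds hx) hu)

theorem SmoothGermAt.globalize [FiniteDimensional ℝ V] {f : V → ℝ} {q : V} (hf : SmoothGermAt f q) :
    ∃ g : V → ℝ, ContDiff ℝ ∞ g ∧ f =ᶠ[𝓝 q] g := by
  obtain ⟨u, hu, huo, hxu⟩ := eventually_nhds_iff.1 hf
  obtain ⟨ε, hε, hball⟩ := Metric.nhds_basis_closedBall.mem_iff.1 (huo.mem_nhds hxu)
  let χ : ContDiffBump q := ⟨ε / 2, ε, by positivity, by linarith⟩
  have hχ : tsupport χ ⊆ u := χ.tsupport_eq.trans_subset hball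
  refine ⟨fun y => χ y * f y, ?_, ?_⟩
  · rw [contDiff_iff_contDiffAt]
    intro y
    by_cases hy : y ∈ tsupport χ
    · exact χ.contDiffAt.mul (hu y (hχ hy))
    · have h0 : (fun y => χ y * f y) =ᶠ[𝓝 y] fun _ => 0 := by
        filter_upwards [(isClosed_tsupport _).isOpen_compl.mem_nhds hy] with z hz
        rw [image_eq_zero_of_notMem_tsupport hz, zero_mul]
      exact contDiffAt_const.congr_of_eventuallyEq h0
  · filter_upwards [χ.eventuallyEq_one] with y hy
    rw [hy, Pi.one_apply, one_mul]

/-- Hadamard's lemma: a germ of a smooth function is its value at the point plus a combination,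
with smooth coefficients, of the coordinates centred at the point. -/
theorem SmoothGermAt.hadamard [FiniteDimensional ℝ V] {f : V → ℝ} {q : V} (hf : SmoothGermAt f q) :
    ∃ G : ι → V → ℝ, (∀ i, ContDiff ℝ ∞ (G i)) ∧
      ∀ᶠ x in 𝓝 q, f x = f q + ∑ i, (b.coord i x - b.coord i q) * G i x := by
  obtain ⟨g, hg, hfg⟩ := hf.globalize
  refine ⟨fun i x => ∫ s in (0 : ℝ)..1, fderiv ℝ g (q + s • (x - q)) (b i), fun i => ?_, ?_⟩
  · refine contDiff_intervalIntegral_param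
      (h := fun z : V × ℝ => fderiv ℝ g (q + z.2 • (z.1 - q)) (b i)) ?_
    refine ContDiff.clm_apply ?_ contDiff_const
    refine (hg.fderiv_right (m := ∞) (by simp)).comp ?_
    exact contDiff_const.add (contDiff_snd.smul (contDiff_fst.sub contDiff_const))
  · have key : ∀ x, g x = g q + ∑ i, (b.coord i x - b.coord i q) *
        ∫ s in (0 : ℝ)..1, fderiv ℝ g (q + s • (x - q)) (b i) := by
      intro x
      have hc : Continuous fun s : ℝ => fderiv ℝ g (q + s • (x - q)) :=
        (hg.continuous_fderiv (by simp)).comp (by fun_prop)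
      have hd : ∀ s : ℝ, HasDerivAt (fun s : ℝ => g (q + s • (x - q)))
          (fderiv ℝ g (q + s • (x - q)) (x - q)) s := by
        intro s
        have h1 : HasDerivAt (fun s : ℝ => q + s • (x - q)) (x - q) s := by
          simpa using ((hasDerivAt_id s).smul_const (x - q)).const_add q
        exact ((hg.differentiable (by simp)).differentiableAt.hasFDerivAt).comp_hasDerivAt s h1
      have h2 := intervalIntegral.integral_eq_sub_of_hasDerivAt (a := 0) (b := 1)
        (fun s _ => hd s) ((hc.clm_apply continuous_const).intervalIntegrable _ _)
      simp only [one_smul, zero_smul, add_zero, add_sub_cancel] at h2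
      have h3 : ∀ s : ℝ, fderiv ℝ g (q + s • (x - q)) (x - q) =
          ∑ i, (b.coord i x - b.coord i q) * fderiv ℝ g (q + s • (x - q)) (b i) := by
        intro s
        have h4 := congrArg (fderiv ℝ g (q + s • (x - q))) (b.sum_repr (x - q))
        rw [map_sum] at h4
        rw [← h4]
        refine Finset.sum_congr rfl fun i _ => ?_
        rw [map_smul, map_sub, Finsupp.sub_apply]
        rfl
      simp only [h3] at h2
      rw [intervalIntegral.integral_finsetSum] at h2
      · simp only [intervalIntegral.integral_const_mul] at h2
        linarith
      · intro i _
        exact (continuous_const.mul (hc.clm_apply continuous_const)).intervalIntegrable _ _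
    filter_upwards [hfg] with x hx
    rw [hx, hfg.self_of_nhds]
    exact key x

theorem SmoothGermAt.fderiv_apply {f : V → ℝ} {q : V} (hf : SmoothGermAt f q) (v : V) :
    SmoothGermAt (fun x => fderiv ℝ f x v) q := by
  filter_upwards [hf] with x hx
  exact (hx.fderiv_right (m := ∞) (by simp)).clm_apply contDiffAt_const

theorem SmoothGermAt.mul {f g : V → ℝ} {q : V} (hf : SmoothGermAt f q) (hg : SmoothGermAt g q) :
    SmoothGermAt (fun x => f x * g x) q := by
  filter_upwards [hf, hg] with x hx hy using hx.mul hy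

end Hadamard

/-! ### Taylor expansion at nilpotent arguments -/

section Taylor

variable {V : Type} [NormedAddCommGroup V] [NormedSpace ℝ V]
variable {ι : Type} [Fintype ι] (b : Module.Basis ι ℝ V)
variable {R : Type} [CommRing R] [Algebra ℝ R] (n : ι → R) (q : V)

/-- The homogeneous part of order `k` of the Taylor expansion at `q` of a function, with the
elements `n i` in place of the increments of the coordinates. -/
def taylorCoeff : ℕ → (V → ℝ) → R
  | 0, f => algebraMap ℝ R (f q)
  | k + 1, f => ((k : ℝ) + 1)⁻¹ • ∑ i, n i * taylorCoeff k (fun x => fderiv ℝ f x (b i))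

theorem succ_smul_taylorCoeff (k : ℕ) (f : V → ℝ) :
    ((k : ℝ) + 1) • taylorCoeff b n q (k + 1) f =
      ∑ i, n i * taylorCoeff b n q k (fun x => fderiv ℝ f x (b i)) := by
  rw [taylorCoeff, smul_smul, mul_inv_cancel₀ (by positivity), one_smul]

theorem taylorCoeff_congr (k : ℕ) {f g : V → ℝ} (h : f =ᶠ[𝓝 q] g) :
    taylorCoeff b n q k f = taylorCoeff b n q k g := by
  induction k generalizing f g with
  | zero => rw [taylorCoeff, taylorCoeff, h.self_of_nhds]
  | succ k ih =>
    rw [taylorCoeff, taylorCoeff]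
    congr 1
    refine Finset.sum_congr rfl fun i _ => ?_
    have h1 : (fun x => fderiv ℝ f x (b i)) =ᶠ[𝓝 q] fun x => fderiv ℝ g x (b i) := by
      filter_upwards [h.fderiv (𝕜 := ℝ)] with x hx
      rw [hx]
    rw [ih h1]

theorem taylorCoeff_mem_pow (k : ℕ) (f : V → ℝ) :
    taylorCoeff b n q k f ∈ Ideal.span (Set.range n) ^ k := by
  induction k generalizing f with
  | zero => simp
  | succ k ih =>
    rw [taylorCoeff, Algebra.smul_def]
    refine Ideal.mul_mem_left _ _ (Ideal.sum_mem _ fun i _ => ?_)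
    rw [pow_succ']
    exact Ideal.mul_mem_mul (Ideal.subset_span ⟨i, rfl⟩) (ih _)

theorem taylorCoeff_const (k : ℕ) (r : ℝ) : taylorCoeff b n q (k + 1) (fun _ => r) = 0 := by
  induction k with
  | zero => simp [taylorCoeff]
  | succ k ih =>
    rw [taylorCoeff]
    simp only [fderiv_fun_const, Pi.zero_apply, zero_apply]
    have : taylorCoeff b n q (k + 1) (fun _ => (0 : ℝ)) = 0 := by
      clear ih
      induction k with
      | zero => simp [taylorCoeff]
      | succ k ih => rw [taylorCoeff]; simp [ih]
    simp [this]

variable {q}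

theorem taylorCoeff_add (k : ℕ) {f g : V → ℝ} (hf : SmoothGermAt f q) (hg : SmoothGermAt g q) :
    taylorCoeff b n q k (fun x => f x + g x) = taylorCoeff b n q k f + taylorCoeff b n q k g := by
  induction k generalizing f g with
  | zero => simp [taylorCoeff]
  | succ k ih =>
    rw [taylorCoeff, taylorCoeff, taylorCoeff, ← smul_add, ← Finset.sum_add_distrib]
    congr 1
    refine Finset.sum_congr rfl fun i _ => ?_
    rw [← mul_add, ← ih (hf.fderiv_apply _) (hg.fderiv_apply _)]
    congr 1
    refine taylorCoeff_congr b n q k ?_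
    filter_upwards [hf, hg] with x hx hy
    rw [fderiv_fun_add (hx.differentiableAt (by simp)) (hy.differentiableAt (by simp))]
    rfl

/-- The Leibniz rule for the homogeneous parts of Taylor expansions. -/
theorem taylorCoeff_mul (k : ℕ) {f g : V → ℝ} (hf : SmoothGermAt f q) (hg : SmoothGermAt g q) :
    taylorCoeff b n q k (fun x => f x * g x) =
      ∑ ij ∈ Finset.HasAntidiagonal.antidiagonal k, taylorCoeff b n q ij.1 f * taylorCoeff b n q ij.2 g := by
  induction k generalizing f g with
  | zero => simp [taylorCoeff]
  | succ k ih =>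
    have hk : ((k : ℝ) + 1) ≠ 0 := by positivity
    refine smul_right_injective R hk ?_
    change ((k : ℝ) + 1) • _ = ((k : ℝ) + 1) • _
    rw [succ_smul_taylorCoeff]
    have h1 : ∀ i, taylorCoeff b n q k (fun x => fderiv ℝ (fun x => f x * g x) x (b i)) =
        ∑ ij ∈ Finset.HasAntidiagonal.antidiagonal k,
          taylorCoeff b n q ij.1 (fun x => fderiv ℝ f x (b i)) * taylorCoeff b n q ij.2 g +
        ∑ ij ∈ Finset.HasAntidiagonal.antidiagonal k,
          taylorCoeff b n q ij.1 f * taylorCoeff b n q ij.2 (fun x => fderiv ℝ g x (b i)) := by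
      intro i
      rw [← ih (hf.fderiv_apply _) hg, ← ih hf (hg.fderiv_apply _),
        ← taylorCoeff_add b n k ((hf.fderiv_apply _).mul hg) (hf.mul (hg.fderiv_apply _))]
      refine taylorCoeff_congr b n q k ?_
      filter_upwards [hf, hg] with x hx hy
      rw [fderiv_fun_mul (hx.differentiableAt (by simp)) (hy.differentiableAt (by simp))]
      simp only [add_apply, smul_apply, smul_eq_mul]
      ring
    have h2 : ∀ ij ∈ Finset.HasAntidiagonal.antidiagonal (k + 1),
        ((k : ℝ) + 1) • (taylorCoeff b n q ij.1 f * taylorCoeff b n q ij.2 g) =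
        ((ij.1 : ℝ) • taylorCoeff b n q ij.1 f) * taylorCoeff b n q ij.2 g +
        taylorCoeff b n q ij.1 f * ((ij.2 : ℝ) • taylorCoeff b n q ij.2 g) := by
      intro ij hij
      have h3 : (ij.1 : ℝ) + ij.2 = k + 1 := by exact_mod_cast Finset.HasAntidiagonal.mem_antidiagonal.1 hij
      rw [← h3, add_smul, smul_mul_assoc, mul_smul_comm]
    rw [Finset.smul_sum, Finset.sum_congr rfl h2, Finset.sum_add_distrib]
    rw [Finset.Nat.sum_antidiagonal_succ, Finset.Nat.sum_antidiagonal_succ']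
    simp only [Nat.cast_zero, zero_smul, zero_mul, mul_zero, zero_add, Nat.cast_add,
      Nat.cast_one, succ_smul_taylorCoeff, h1, mul_add, Finset.sum_add_distrib, Finset.mul_sum,
      Finset.sum_mul]
    rw [Finset.sum_comm, Finset.sum_comm (s := Finset.univ) (t := Finset.HasAntidiagonal.antidiagonal k)]
    congr 1
    · refine Finset.sum_congr rfl fun ij _ => Finset.sum_congr rfl fun i _ => ?_
      ring
    · refine Finset.sum_congr rfl fun ij _ => Finset.sum_congr rfl fun i _ => ?_
      ring

/-- The value of a smooth function at the point `q + n`, where the coordinates `n i` of the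
increment are nilpotent: the sum of the Taylor expansion. -/
def taylorEval (b : Module.Basis ι ℝ V) (n : ι → R) (q : V) (N : ℕ) (f : V → ℝ) : R :=
  ∑ k ∈ Finset.range N, taylorCoeff b n q k f

theorem taylorEval_mul {N : ℕ} (hN : Ideal.span (Set.range n) ^ N = ⊥) {f g : V → ℝ}
    (hf : SmoothGermAt f q) (hg : SmoothGermAt g q) :
    taylorEval b n q N (fun x => f x * g x) = taylorEval b n q N f * taylorEval b n q N g := by
  have h0 : ∀ f k, N ≤ k → taylorCoeff b n q k f = 0 := fun f k hk => by
    have := Ideal.pow_le_pow_right hk (taylorCoeff_mem_pow b n q k f)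
    rwa [hN] at this
  let P : (V → ℝ) → Polynomial R := fun f =>
    ∑ k ∈ Finset.range N, Polynomial.monomial k (taylorCoeff b n q k f)
  have hP : ∀ f k, (P f).coeff k = taylorCoeff b n q k f := fun f k => by
    simp only [P, Polynomial.finsetSum_coeff, Polynomial.coeff_monomial, Finset.sum_ite_eq',
      Finset.mem_range]
    split_ifs with h
    · rfl
    · exact (h0 f k (not_lt.1 h)).symm
  have hE : ∀ f, (P f).eval 1 = taylorEval b n q N f := fun f => by
    simp [P, taylorEval, Polynomial.eval_finsetSum]
  rw [← hE, ← hE, ← hE, ← Polynomial.eval_mul]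
  congr 1
  ext k
  rw [Polynomial.coeff_mul, hP, taylorCoeff_mul b n k hf hg]
  simp only [hP]

theorem taylorEval_add (N : ℕ) {f g : V → ℝ} (hf : SmoothGermAt f q) (hg : SmoothGermAt g q) :
    taylorEval b n q N (fun x => f x + g x) = taylorEval b n q N f + taylorEval b n q N g := by
  simp only [taylorEval, taylorCoeff_add b n _ hf hg, Finset.sum_add_distrib]

theorem taylorEval_congr (N : ℕ) {f g : V → ℝ} (h : f =ᶠ[𝓝 q] g) :
    taylorEval b n q N f = taylorEval b n q N g := by
  simp only [taylorEval, taylorCoeff_congr b n q _ h]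

theorem taylorEval_const (N : ℕ) (r : ℝ) :
    taylorEval b n q (N + 1) (fun _ => r) = algebraMap ℝ R r := by
  rw [taylorEval, Finset.sum_range_succ']
  simp only [taylorCoeff_const, Finset.sum_const_zero, zero_add]
  rfl

theorem taylorEval_coord [FiniteDimensional ℝ V] (N : ℕ) (j : ι) :
    taylorEval b n q (N + 2) (b.coord j) = algebraMap ℝ R (b.coord j q) + n j := by
  classical
  have h1 : ∀ i, (fun x => fderiv ℝ (b.coord j) x (b i)) = fun _ => if i = j then 1 else 0 := by
    intro i
    ext x
    have h2 : HasFDerivAt (b.coord j) (LinearMap.toContinuousLinearMap (b.coord j)) x :=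
      (LinearMap.toContinuousLinearMap (b.coord j)).hasFDerivAt
    rw [h2.fderiv]
    simp [Finsupp.single_apply]
  rw [taylorEval, Finset.sum_range_succ', Finset.sum_range_succ']
  have h3 : ∀ k, taylorCoeff b n q (k + 1 + 1) (b.coord j) = 0 := fun k => by
    rw [taylorCoeff]
    simp only [h1, taylorCoeff_const, mul_zero, Finset.sum_const_zero, smul_zero]
  simp only [h3, Finset.sum_const_zero, zero_add]
  have h4 : taylorCoeff b n q 1 (b.coord j) = n j := by
    change ((0 : ℕ) + 1 : ℝ)⁻¹ • ∑ i, n i * taylorCoeff b n q 0 _ = n j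
    have h5 : ∀ i, fderiv ℝ (b.coord j) q (b i) = if i = j then 1 else 0 := fun i =>
      congrFun (h1 i) q
    simp only [taylorCoeff, h5]
    simp
  rw [h4, add_comm]
  rfl

end Taylor



namespace SmoothVB

variable {E : SmoothVB}

/-! ### Smooth functions and covector fields on open sets -/

theorem extend_apply_of_mem {U : Opens E.base} (f : U → ℝ) {x : E.base} (hx : x ∈ U) :
    Function.extend Subtype.val f 0 x = f ⟨x, hx⟩ :=
  Subtype.val_injective.extend_apply f 0 ⟨x, hx⟩

theorem extend_eventuallyEq {U : Opens E.base} {f : U → ℝ} {F : E.base → ℝ} {V : Opens E.base}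
    (h : V ≤ U) (hF : ∀ (x : E.base) (hx : x ∈ V), f ⟨x, h hx⟩ = F x) {x : E.base} (hx : x ∈ V) :
    Function.extend Subtype.val f 0 =ᶠ[𝓝 x] F := by
  filter_upwards [V.isOpen.mem_nhds hx] with y hy
  rw [extend_apply_of_mem f (h hy), hF y hy]

theorem IsSmoothFun.smoothAt {U : Opens E.base} {f : U → ℝ} (hf : E.IsSmoothFun U f) {x : E.base}
    (hx : x ∈ U) : E.SmoothAt (Function.extend Subtype.val f 0) x :=
  ContMDiffOn.contMDiffAt hf (U.isOpen.mem_nhds hx)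

theorem IsSmoothFun.smoothNear {U : Opens E.base} {f : U → ℝ} (hf : E.IsSmoothFun U f) {x : E.base}
    (hx : x ∈ U) : E.SmoothNear (Function.extend Subtype.val f 0) x := by
  filter_upwards [U.isOpen.mem_nhds hx] with y hy using hf.smoothAt hy

theorem isSmoothFun_of_smoothAt {U : Opens E.base} {f : U → ℝ} {F : E.base → ℝ}
    (hF : ∀ x ∈ U, E.SmoothAt F x) (h : ∀ (x : E.base) (hx : x ∈ U), f ⟨x, hx⟩ = F x) :
    E.IsSmoothFun U f := fun x hx =>
  ((hF x hx).congr_of_eventuallyEq (extend_eventuallyEq le_rfl h hx)).contMDiffWithinAt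

theorem isSmoothFun_of_locally {U : Opens E.base} {f : U → ℝ}
    (h : ∀ x ∈ U, ∃ (V : Opens E.base) (hV : V ≤ U), x ∈ V ∧ E.IsSmoothFun V fun y => f ⟨y, hV y.2⟩) :
    E.IsSmoothFun U f := by
  intro x hx
  obtain ⟨V, hV, hxV, h1⟩ := h x hx
  refine ((h1.smoothAt hxV).congr_of_eventuallyEq ?_).contMDiffWithinAt
  exact extend_eventuallyEq hV
    (fun y hy => (extend_apply_of_mem (fun y : V => f ⟨y, hV y.2⟩) hy).symm) hxV

/-- The algebra of smooth functions on an open set. -/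
def smoothFun (E : SmoothVB) (U : Opens E.base) : Subalgebra ℝ (U → ℝ) where
  carrier := {f | E.IsSmoothFun U f}
  mul_mem' {f g} hf hg := isSmoothFun_of_smoothAt
    (fun x hx => ContMDiffAt.mul (hf.smoothAt hx) (hg.smoothAt hx))
    fun x hx => by
      change f ⟨x, hx⟩ * g ⟨x, hx⟩ = Function.extend Subtype.val f 0 x * Function.extend Subtype.val g 0 x
      rw [extend_apply_of_mem, extend_apply_of_mem]
  add_mem' {f g} hf hg := isSmoothFun_of_smoothAt
    (fun x hx => ContMDiffAt.add (hf.smoothAt hx) (hg.smoothAt hx))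
    fun x hx => by
      change f ⟨x, hx⟩ + g ⟨x, hx⟩ = Function.extend Subtype.val f 0 x + Function.extend Subtype.val g 0 x
      rw [extend_apply_of_mem, extend_apply_of_mem]
  algebraMap_mem' r := isSmoothFun_of_smoothAt (F := fun _ => r) (fun _ _ => contMDiffAt_const)
    fun _ _ => rfl

theorem IsSmoothFun.mul {U : Opens E.base} {f g : U → ℝ} (hf : E.IsSmoothFun U f)
    (hg : E.IsSmoothFun U g) : E.IsSmoothFun U fun x => f x * g x :=
  (E.smoothFun U).mul_mem hf hg

theorem IsSmoothFun.add {U : Opens E.base} {f g : U → ℝ} (hf : E.IsSmoothFun U f)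
    (hg : E.IsSmoothFun U g) : E.IsSmoothFun U fun x => f x + g x :=
  (E.smoothFun U).add_mem hf hg

theorem isSmoothFun_const {U : Opens E.base} (r : ℝ) : E.IsSmoothFun U fun _ => r :=
  (E.smoothFun U).algebraMap_mem r

theorem IsSmoothFun.sum {U : Opens E.base} {ι : Type*} (s : Finset ι) {f : ι → U → ℝ}
    (hf : ∀ i ∈ s, E.IsSmoothFun U (f i)) : E.IsSmoothFun U fun x => ∑ i ∈ s, f i x := by
  have h := (E.smoothFun U).sum_mem (t := s) (f := f) hf
  rwa [show (fun x => ∑ i ∈ s, f i x) = ∑ i ∈ s, f i from by ext x; simp]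

/-- Smoothness of a real function on the total space at a point. -/
abbrev TotSmoothAt (E : SmoothVB) (F : E.Tot → ℝ) (v : E.Tot) : Prop :=
  ContMDiffAt ((𝓡 E.dim).prod 𝓘(ℝ, E.Fm)) 𝓘(ℝ, ℝ) ∞ F v

open Classical in
/-- The fibrewise linear function on the total space of a field of covectors, extended by `0`. -/
def covecFun {U : Opens E.base} (α : ∀ x : U, Module.Dual ℝ (E.fib x.1)) (v : E.Tot) : ℝ :=
  if h : v.1 ∈ U then α ⟨v.1, h⟩ v.2 else 0

theorem covecFun_of_mem {U : Opens E.base} (α : ∀ x : U, Module.Dual ℝ (E.fib x.1)) {x : E.base}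
    (hx : x ∈ U) (v : E.fib x) : covecFun α ⟨x, v⟩ = α ⟨x, hx⟩ v := by
  simp [covecFun, hx]

theorem isOpen_over (U : Opens E.base) : IsOpen {v : E.Tot | v.1 ∈ U} :=
  U.isOpen.preimage (FiberBundle.continuous_proj E.Fm E.fib)

theorem covecFun_eventuallyEq {U : Opens E.base} {α : ∀ x : U, Module.Dual ℝ (E.fib x.1)}
    {F : E.Tot → ℝ} {V : Opens E.base} (h : V ≤ U)
    (hF : ∀ (x : E.base) (hx : x ∈ V) (v : E.fib x), α ⟨x, h hx⟩ v = F ⟨x, v⟩) {v : E.Tot}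
    (hv : v.1 ∈ V) : covecFun α =ᶠ[𝓝 v] F := by
  filter_upwards [(isOpen_over V).mem_nhds hv] with w hw
  rw [show w = ⟨w.1, w.2⟩ from rfl, covecFun_of_mem α (h hw), hF w.1 hw]

theorem IsSmoothCovec.totSmoothAt {U : Opens E.base} {α : ∀ x : U, Module.Dual ℝ (E.fib x.1)}
    (hα : E.IsSmoothCovec U α) {v : E.Tot} (hv : v.1 ∈ U) : E.TotSmoothAt (covecFun α) v :=
  (hα (covecFun α) fun x w => covecFun_of_mem α x.2 w).contMDiffAt ((isOpen_over U).mem_nhds hv)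

theorem isSmoothCovec_of_totSmoothAt {U : Opens E.base}
    {α : ∀ x : U, Module.Dual ℝ (E.fib x.1)} {F : E.Tot → ℝ}
    (hF : ∀ (x : E.base) (_ : x ∈ U) (v : E.fib x), E.TotSmoothAt F ⟨x, v⟩)
    (h : ∀ (x : E.base) (hx : x ∈ U) (v : E.fib x), α ⟨x, hx⟩ v = F ⟨x, v⟩) :
    E.IsSmoothCovec U α := by
  intro G hG v hv
  refine ((hF v.1 hv v.2).congr_of_eventuallyEq ?_).contMDiffWithinAt
  filter_upwards [(isOpen_over U).mem_nhds hv] with w hw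
  rw [show w = ⟨w.1, w.2⟩ from rfl, ← h w.1 hw, ← hG ⟨w.1, hw⟩]

theorem isSmoothCovec_of_locally {U : Opens E.base} {α : ∀ x : U, Module.Dual ℝ (E.fib x.1)}
    (h : ∀ x ∈ U, ∃ (V : Opens E.base) (hV : V ≤ U), x ∈ V ∧
      E.IsSmoothCovec V fun y => α ⟨y, hV y.2⟩) : E.IsSmoothCovec U α := by
  refine isSmoothCovec_of_totSmoothAt (F := covecFun α) (fun x hx v => ?_)
    fun x hx v => (covecFun_of_mem α hx v).symm
  obtain ⟨V, hV, hxV, h1⟩ := h x hx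
  refine (h1.totSmoothAt (v := ⟨x, v⟩) hxV).congr_of_eventuallyEq ?_
  exact covecFun_eventuallyEq hV
    (fun y hy w => (covecFun_of_mem (fun y : V => α ⟨y, hV y.2⟩) hy w).symm) hxV

theorem SmoothAt.comp_proj {f : E.base → ℝ} {v : E.Tot} (hf : E.SmoothAt f v.1) :
    E.TotSmoothAt (fun w => f w.1) v :=
  ContMDiffAt.comp v hf (Bundle.contMDiffAt_proj E.fib)

theorem IsSmoothCovec.smul {U : Opens E.base} {f : U → ℝ} (hf : E.IsSmoothFun U f)
    {α : ∀ x : U, Module.Dual ℝ (E.fib x.1)} (hα : E.IsSmoothCovec U α) :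
    E.IsSmoothCovec U fun x => f x • α x := by
  refine isSmoothCovec_of_totSmoothAt
    (F := fun v => Function.extend Subtype.val f 0 v.1 * covecFun α v) (fun x hx v => ?_)
    fun x hx v => ?_
  · exact (SmoothAt.comp_proj (v := ⟨x, v⟩) (hf.smoothAt hx)).mul (hα.totSmoothAt hx)
  · change f ⟨x, hx⟩ * α ⟨x, hx⟩ v = Function.extend Subtype.val f 0 x * covecFun α ⟨x, v⟩
    rw [extend_apply_of_mem f hx, covecFun_of_mem α hx]

theorem IsSmoothCovec.add {U : Opens E.base} {α β : ∀ x : U, Module.Dual ℝ (E.fib x.1)}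
    (hα : E.IsSmoothCovec U α) (hβ : E.IsSmoothCovec U β) :
    E.IsSmoothCovec U fun x => α x + β x := by
  refine isSmoothCovec_of_totSmoothAt
    (F := fun v => covecFun α v + covecFun β v) (fun x hx v => ?_) fun x hx v => ?_
  · exact (hα.totSmoothAt hx).add (hβ.totSmoothAt hx)
  · rw [covecFun_of_mem α hx, covecFun_of_mem β hx]
    rfl

theorem isSmoothCovec_zero {U : Opens E.base} : E.IsSmoothCovec U fun _ => 0 :=
  isSmoothCovec_of_totSmoothAt (F := fun _ => 0) (fun _ _ _ => contMDiffAt_const) fun _ _ _ => rfl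

theorem IsSmoothCovec.sum {U : Opens E.base} {ι : Type*} (s : Finset ι)
    {α : ι → ∀ x : U, Module.Dual ℝ (E.fib x.1)} (hα : ∀ i ∈ s, E.IsSmoothCovec U (α i)) :
    E.IsSmoothCovec U fun x => ∑ i ∈ s, α i x := by
  classical
  induction s using Finset.induction_on with
  | empty => simpa using isSmoothCovec_zero
  | insert i s hi ih =>
    simp only [Finset.sum_insert hi]
    exact (hα i (Finset.mem_insert_self i s)).add
      (ih fun j hj => hα j (Finset.mem_insert_of_mem hj))

/-- The pairing of a smooth covector field with a smooth section is smooth. -/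
theorem IsSmoothCovec.apply_section {U : Opens E.base} {α : ∀ x : U, Module.Dual ℝ (E.fib x.1)}
    (hα : E.IsSmoothCovec U α) (X : ∀ x : E.base, E.fib x)
    (hX : ∀ x ∈ U, ContMDiffAt (𝓡 E.dim) ((𝓡 E.dim).prod 𝓘(ℝ, E.Fm)) ∞
      (fun y => (⟨y, X y⟩ : E.Tot)) x) : E.IsSmoothFun U fun x => α x (X x.1) :=
  isSmoothFun_of_smoothAt (F := fun x => covecFun α ⟨x, X x⟩)
    (fun x hx => ContMDiffAt.comp x (hα.totSmoothAt (v := ⟨x, X x⟩) hx) (hX x hx))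
    fun _ hx => (covecFun_of_mem α hx _).symm

theorem IsSmoothCovec.apply_sec {U : Opens E.base} {α : ∀ x : U, Module.Dual ℝ (E.fib x.1)}
    (hα : E.IsSmoothCovec U α) (X : E.Sec) : E.IsSmoothFun U fun x => α x (X x.1) :=
  hα.apply_section X fun x _ => X.contMDiff x

/-! ### Functions on the shifted bundle -/

instance (U : Opens E.base) : Ring (E.shiftObj.func U) := E.shiftObj.ring U

instance (U : Opens E.base) : Algebra ℝ (E.shiftObj.func U) := E.shiftObj.algebra U

@[ext]
theorem func_ext {U : Opens E.base} {a b : E.shiftObj.func U} (h : ∀ x, E.val a x = E.val b x) :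
    a = b := Subtype.ext (funext h)

theorem val_mul {U : Opens E.base} (a b : E.shiftObj.func U) (x : U) :
    E.val (a * b) x = E.val a x * E.val b x := rfl

theorem val_add {U : Opens E.base} (a b : E.shiftObj.func U) (x : U) :
    E.val (a + b) x = E.val a x + E.val b x := rfl

theorem val_neg {U : Opens E.base} (a : E.shiftObj.func U) (x : U) :
    E.val (-a) x = -E.val a x := rfl

theorem val_one {U : Opens E.base} (x : U) : E.val (1 : E.shiftObj.func U) x = 1 := rfl

theorem val_smul {U : Opens E.base} (r : ℝ) (a : E.shiftObj.func U) (x : U) :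
    E.val (r • a) x = r • E.val a x := rfl

theorem val_res {U V : Opens E.base} (h : V ≤ U) (a : E.shiftObj.func U) (x : V) :
    E.val (E.shiftObj.res h a) x = E.val a ⟨x.1, h x.2⟩ := rfl

theorem val_funForm {U : Opens E.base} (f : U → ℝ) (hf : E.IsSmoothFun U f) (x : U) :
    E.val (E.funForm U f hf) x = algebraMap ℝ _ (f x) := rfl

theorem val_covecForm {U : Opens E.base} (α : ∀ x : U, Module.Dual ℝ (E.fib x.1))
    (hα : E.IsSmoothCovec U α) (x : U) :
    E.val (E.covecForm U α hα) x = ExteriorAlgebra.ι ℝ (α x) := rfl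

theorem mem_deg_iff {U : Opens E.base} {k : ℤ} {a : E.shiftObj.func U} :
    a ∈ E.shiftObj.deg U k ↔ ∀ x, E.val a x ∈ E.extDeg x.1 k := Iff.rfl

/-- Evaluation at a point, as an algebra homomorphism. -/
def valHom (E : SmoothVB) {U : Opens E.base} (x : U) : E.shiftObj.func U →ₐ[ℝ] E.Ext x.1 where
  toFun a := E.val a x
  map_one' := rfl
  map_mul' _ _ := rfl
  map_zero' := rfl
  map_add' _ _ := rfl
  commutes' _ := rfl

theorem mem_forms_of_mem_adjoin {U : Opens E.base} {η : ∀ x : U, E.Ext x.1}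
    (h : η ∈ Algebra.adjoin ℝ (E.formGenerators U)) : η ∈ E.forms U :=
  fun x => ⟨U, le_rfl, x.2, h⟩

/-- A section of the exterior algebra bundle that is locally smooth is smooth. -/
theorem mem_forms_of_locally {U : Opens E.base} {η : ∀ x : U, E.Ext x.1}
    (h : ∀ x ∈ U, ∃ (V : Opens E.base) (hV : V ≤ U), x ∈ V ∧ E.restr hV η ∈ E.forms V) :
    η ∈ E.forms U := by
  intro x
  obtain ⟨V, hV, hx, h1⟩ := h x.1 x.2
  obtain ⟨W, hW, hxW, h2⟩ := h1 ⟨x.1, hx⟩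
  exact ⟨W, hW.trans hV, hxW, h2⟩

/-- To prove a local property of germs of functions on the shifted bundle, it suffices to consider
smooth functions and covector fields. -/
theorem func_induction (x : E.base) {P : ∀ U : Opens E.base, E.shiftObj.func U → Prop}
    (hres : ∀ (U V : Opens E.base) (h : V ≤ U) (_ : x ∈ V) (a : E.shiftObj.func U),
      P V (E.shiftObj.res h a) → P U a)
    (hfun : ∀ U : Opens E.base, x ∈ U → ∀ f hf, P U (E.funForm U f hf))
    (hcov : ∀ U : Opens E.base, x ∈ U → ∀ α hα, P U (E.covecForm U α hα))
    (hadd : ∀ U : Opens E.base, x ∈ U → ∀ a b, P U a → P U b → P U (a + b))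
    (hmul : ∀ U : Opens E.base, x ∈ U → ∀ a b, P U a → P U b → P U (a * b))
    {U : Opens E.base} (hx : x ∈ U) (a : E.shiftObj.func U) : P U a := by
  obtain ⟨V, hV, hxV, h1⟩ := a.2 ⟨x, hx⟩
  refine hres U V hV hxV a ?_
  have key : ∀ η (_ : η ∈ Algebra.adjoin ℝ (E.formGenerators V)) (hη' : η ∈ E.forms V),
      P V (⟨η, hη'⟩ : E.forms V) := by
    intro η hη
    induction hη using Algebra.adjoin_induction with
    | mem η hη =>
      intro hη'
      obtain ⟨f, hf, rfl⟩ | ⟨α, hα, rfl⟩ := hη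
      · exact hfun V hxV f hf
      · exact hcov V hxV α hα
    | algebraMap r => exact fun _ => hfun V hxV (fun _ => r) (isSmoothFun_const r)
    | add η θ h1 h2 ih1 ih2 =>
      intro _
      exact hadd V hxV _ _ (ih1 (mem_forms_of_mem_adjoin h1)) (ih2 (mem_forms_of_mem_adjoin h2))
    | mul η θ h1 h2 ih1 ih2 =>
      intro _
      exact hmul V hxV _ _ (ih1 (mem_forms_of_mem_adjoin h1)) (ih2 (mem_forms_of_mem_adjoin h2))
  exact key _ h1 _

/-! ### Local frames -/

/-- A smooth local frame of a vector bundle over an open set: a basis of every fibre, such that the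
coordinates are smooth covector fields, and smooth covector fields take smooth values on the frame. -/
structure LocalFrame (E : SmoothVB) (W : Opens E.base) (ι : Type) [Fintype ι] where
  basis : ∀ x : W, Module.Basis ι ℝ (E.fib x.1)
  smooth_coord : ∀ j, E.IsSmoothCovec W fun x => (basis x).coord j
  smooth_apply : ∀ {U : Opens E.base} (h : U ≤ W) {α : ∀ x : U, Module.Dual ℝ (E.fib x.1)},
    E.IsSmoothCovec U α → ∀ j, E.IsSmoothFun U fun x => α x (basis ⟨x.1, h x.2⟩ j)

/-- Every point has a neighbourhood with a frame that extends to global sections. -/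
theorem exists_localFrame (E : SmoothVB) (x : E.base) :
    ∃ (W : Opens E.base) (F : LocalFrame E W (Fin E.rank)) (Z : Fin E.rank → E.Sec),
      x ∈ W ∧ ∀ (y : W) j, F.basis y j = Z j y := by
  obtain ⟨Z, c, h1, h2, h3⟩ := E.exists_frame x
  obtain ⟨s, hs, hso, hxs⟩ := eventually_nhds_iff.1 (h1.and (h2.and h3))
  let W : Opens E.base := ⟨s, hso⟩
  have hli : ∀ y : W, LinearIndependent ℝ fun j => Z j y.1 := by
    intro y
    rw [Fintype.linearIndependent_iff]
    intro g hg i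
    have h4 := (hs y.1 y.2).2.1 i g
    have h5 := (hs y.1 y.2).2.1 i 0
    rw [hg] at h4
    simp only [Pi.zero_apply, zero_smul, Finset.sum_const_zero] at h5
    exact h4.symm.trans h5
  have hsp : ∀ y : W, ⊤ ≤ Submodule.span ℝ (Set.range fun j => Z j y.1) := by
    intro y v _
    rw [(hs y.1 y.2).1 v]
    exact Submodule.sum_mem _ fun j _ => Submodule.smul_mem _ _ (Submodule.subset_span ⟨j, rfl⟩)
  let b : ∀ y : W, Module.Basis (Fin E.rank) ℝ (E.fib y.1) := fun y =>
    Module.Basis.mk (hli y) (hsp y)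
  have hb : ∀ y j, b y j = Z j y.1 := fun y j => Module.Basis.mk_apply _ _ j
  refine ⟨W, ⟨b, fun j => ?_, fun {U} h {α} hα j => ?_⟩, Z, hxs, hb⟩
  · refine isSmoothCovec_of_totSmoothAt (F := c j) (fun y hy v => (hs y hy).2.2 j v) fun y hy v => ?_
    have h4 := (hs y hy).2.1 j fun i => (b ⟨y, hy⟩).coord i v
    have h5 : ∑ i, (b ⟨y, hy⟩).coord i v • Z i y = v := by
      conv_rhs => rw [← (b ⟨y, hy⟩).sum_repr v]
      exact Finset.sum_congr rfl fun i _ => by rw [hb]; rfl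
    rw [h5] at h4
    exact h4.symm
  · have h4 := hα.apply_sec (Z j)
    convert h4 using 2 with y
    rw [hb]

instance finite_exteriorAlgebra (M : Type) [AddCommGroup M] [Module ℝ M] [Module.Finite ℝ M] :
    Module.Finite ℝ (ExteriorAlgebra ℝ M) :=
  Module.Finite.of_basis (Module.finBasis ℝ M).ExteriorAlgebra

namespace LocalFrame

variable {W : Opens E.base} {ι : Type} [Fintype ι] (F : LocalFrame E W ι)

/-- The identification of the exterior algebra of a fibre, given by the frame. -/
def expand (x : W) : ExteriorAlgebra ℝ (ι → ℝ) →ₐ[ℝ] E.Ext x.1 :=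
  ExteriorAlgebra.map ((F.basis x).constr ℝ : (ι → ℝ) ≃ₗ[ℝ] Module.Dual ℝ (E.fib x.1)).toLinearMap

theorem expand_bijective (x : W) : Function.Bijective (F.expand x) := by
  constructor
  · refine ExteriorAlgebra.map_injective
      ⟨((F.basis x).constr ℝ : (ι → ℝ) ≃ₗ[ℝ] Module.Dual ℝ (E.fib x.1)).symm.toLinearMap, ?_⟩
    ext v
    simp
  · exact ExteriorAlgebra.map_surjective_iff.2 (LinearEquiv.surjective _)

theorem sum_apply_smul_coord (x : W) (α : Module.Dual ℝ (E.fib x.1)) :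
    ∑ j, α (F.basis x j) • (F.basis x).coord j = α := by
  classical
  refine (F.basis x).ext fun j => ?_
  simp

theorem constr_single [DecidableEq ι] (x : W) (j : ι) :
    ((F.basis x).constr ℝ : (ι → ℝ) ≃ₗ[ℝ] Module.Dual ℝ (E.fib x.1)) (Pi.single j 1) =
      (F.basis x).coord j := by
  refine (F.basis x).ext fun i => ?_
  rw [Module.Basis.constr_basis]
  simp [Pi.single_apply, Finsupp.single_apply]

theorem isSmoothCovec_constr (v : ι → ℝ) :
    E.IsSmoothCovec W fun x =>
      ((F.basis x).constr ℝ : (ι → ℝ) ≃ₗ[ℝ] Module.Dual ℝ (E.fib x.1)) v := by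
  have h : ∀ x : W, ((F.basis x).constr ℝ : (ι → ℝ) ≃ₗ[ℝ] Module.Dual ℝ (E.fib x.1)) v =
      ∑ j, v j • (F.basis x).coord j := fun x => by
    rw [← F.sum_apply_smul_coord x (((F.basis x).constr ℝ) v)]
    simp only [Module.Basis.constr_basis]
  simp only [h]
  exact IsSmoothCovec.sum _ fun j _ => (F.smooth_coord j).smul (isSmoothFun_const (v j))

variable {U : Opens E.base} (hU : U ≤ W)

/-- The algebra homomorphism from tensors to not necessarily smooth forms. -/
def toPi : E.smoothFun U ⊗[ℝ] ExteriorAlgebra ℝ (ι → ℝ) →ₐ[ℝ] ∀ x : U, E.Ext x.1 :=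
  Algebra.TensorProduct.lift
    (AlgHom.pi fun x => (Algebra.ofId ℝ _).comp ((Pi.evalAlgHom ℝ (fun _ : U => ℝ) x).comp
      (E.smoothFun U).val))
    (AlgHom.pi fun x => F.expand ⟨x.1, hU x.2⟩)
    fun f w => show Commute _ _ from
      funext fun x => Algebra.commutes (R := ℝ) (f.1 x) (F.expand ⟨x.1, hU x.2⟩ w)

theorem toPi_tmul (f : E.smoothFun U) (w : ExteriorAlgebra ℝ (ι → ℝ)) (x : U) :
    F.toPi hU (f ⊗ₜ w) x = f.1 x • F.expand ⟨x.1, hU x.2⟩ w := by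
  rw [toPi, Algebra.TensorProduct.lift_tmul, Algebra.smul_def]
  rfl

theorem toPi_injective : Function.Injective (F.toPi hU) := by
  rw [injective_iff_map_eq_zero]
  intro z hz
  let b := Module.finBasis ℝ (ExteriorAlgebra ℝ (ι → ℝ))
  obtain ⟨c, rfl⟩ := (TensorProduct.equivFinsuppOfBasisRight (M := E.smoothFun U) b).symm.surjective z
  have h1 : (TensorProduct.equivFinsuppOfBasisRight (M := E.smoothFun U) b).symm c =
      ∑ i, c i ⊗ₜ b i := by
    rw [TensorProduct.equivFinsuppOfBasisRight_symm_apply, Finsupp.sum_fintype _ _ (by simp)]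
  have h2 : c = 0 := by
    ext i x
    have h3 := congrFun hz x
    rw [h1, map_sum, Finset.sum_apply] at h3
    simp only [toPi_tmul, ← map_smul, ← map_sum] at h3
    have h4 := (F.expand_bijective _).1 (h3.trans (map_zero _).symm)
    exact Fintype.linearIndependent_iff.1 b.linearIndependent _ h4 i
  rw [h2, map_zero]

theorem toPi_mem (z : E.smoothFun U ⊗[ℝ] ExteriorAlgebra ℝ (ι → ℝ)) :
    F.toPi hU z ∈ E.forms U := by
  have h1 : ∀ w, F.toPi hU (1 ⊗ₜ w) ∈ E.forms U := by
    intro w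
    have h2 : ∀ w, F.toPi hU (1 ⊗ₜ w) = fun x : U => F.expand ⟨x.1, hU x.2⟩ w := fun w => by
      funext x
      rw [toPi_tmul]
      exact one_smul _ _
    rw [h2]
    induction w using ExteriorAlgebra.induction with
    | algebraMap r =>
      have : (fun x : U => F.expand ⟨x.1, hU x.2⟩ (algebraMap ℝ _ r)) = algebraMap ℝ _ r := by
        funext x
        exact AlgHom.commutes _ _
      rw [this]
      exact Subalgebra.algebraMap_mem _ _
    | ι v =>
      refine mem_forms_of_mem_adjoin (Algebra.subset_adjoin
        (Or.inr ⟨_, (F.isSmoothCovec_constr v).restr hU, ?_⟩))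
      funext x
      exact ExteriorAlgebra.map_apply_ι _ _
    | mul a b ha hb =>
      have : (fun x : U => F.expand ⟨x.1, hU x.2⟩ (a * b)) =
          (fun x : U => F.expand ⟨x.1, hU x.2⟩ a) * fun x : U => F.expand ⟨x.1, hU x.2⟩ b := by
        funext x
        exact map_mul _ _ _
      rw [this]
      exact mul_mem ha hb
    | add a b ha hb =>
      have : (fun x : U => F.expand ⟨x.1, hU x.2⟩ (a + b)) =
          (fun x : U => F.expand ⟨x.1, hU x.2⟩ a) + fun x : U => F.expand ⟨x.1, hU x.2⟩ b := by
        funext x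
        exact map_add _ _ _
      rw [this]
      exact add_mem ha hb
  induction z using TensorProduct.induction_on with
  | zero => rw [map_zero]; exact zero_mem _
  | add a b ha hb => rw [map_add]; exact add_mem ha hb
  | tmul f w =>
    have h3 : f ⊗ₜ[ℝ] w = (f ⊗ₜ 1) * (1 ⊗ₜ w) := by
      rw [Algebra.TensorProduct.tmul_mul_tmul, mul_one, one_mul]
    rw [h3, map_mul]
    refine mul_mem (mem_forms_of_mem_adjoin (Algebra.subset_adjoin (Or.inl ⟨f.1, f.2, ?_⟩))) (h1 w)
    funext x
    rw [toPi_tmul, map_one, Algebra.smul_def, mul_one]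

/-- Smooth forms over `U` as tensors, by means of a frame. -/
def toForms : E.smoothFun U ⊗[ℝ] ExteriorAlgebra ℝ (ι → ℝ) →ₐ[ℝ] E.shiftObj.func U :=
  (F.toPi hU).codRestrict (E.forms U) (F.toPi_mem hU)

theorem val_toForms_tmul (f : E.smoothFun U) (w : ExteriorAlgebra ℝ (ι → ℝ)) (x : U) :
    E.val (F.toForms hU (f ⊗ₜ w)) x = f.1 x • F.expand ⟨x.1, hU x.2⟩ w :=
  F.toPi_tmul hU f w x

theorem toForms_fun (f : U → ℝ) (hf : E.IsSmoothFun U f) :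
    F.toForms hU ((⟨f, hf⟩ : E.smoothFun U) ⊗ₜ 1) = E.funForm U f hf := by
  ext x
  rw [val_toForms_tmul, map_one, Algebra.smul_def, mul_one, val_funForm]

theorem toForms_covec [DecidableEq ι] (α : ∀ x : U, Module.Dual ℝ (E.fib x.1))
    (hα : E.IsSmoothCovec U α) :
    F.toForms hU (∑ j, (⟨_, F.smooth_apply hU hα j⟩ : E.smoothFun U) ⊗ₜ
      ExteriorAlgebra.ι ℝ (Pi.single j 1)) = E.covecForm U α hα := by
  ext x
  have h1 : E.val (F.toForms hU (∑ j, (⟨_, F.smooth_apply hU hα j⟩ : E.smoothFun U) ⊗ₜ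
      ExteriorAlgebra.ι ℝ (Pi.single j 1))) x = ∑ j, E.val (F.toForms hU
        ((⟨_, F.smooth_apply hU hα j⟩ : E.smoothFun U) ⊗ₜ ExteriorAlgebra.ι ℝ (Pi.single j 1))) x := by
    rw [map_sum]
    exact map_sum (E.valHom x) _ _
  rw [h1, val_covecForm]
  conv_rhs => rw [← F.sum_apply_smul_coord ⟨x.1, hU x.2⟩ (α x), map_sum]
  refine Finset.sum_congr rfl fun j _ => ?_
  rw [val_toForms_tmul, map_smul, ← F.constr_single]
  congr 1
  exact ExteriorAlgebra.map_apply_ι _ _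

theorem toForms_injective : Function.Injective (F.toForms hU) := fun _ _ h =>
  F.toPi_injective hU (congrArg Subtype.val h)

theorem toForms_surjective : Function.Surjective (F.toForms hU) := by
  classical
  intro a
  let b := Module.finBasis ℝ (ExteriorAlgebra ℝ (ι → ℝ))
  -- the coefficients of `a` in a basis of the exterior algebra
  let e : ∀ x : U, ExteriorAlgebra ℝ (ι → ℝ) ≃ₐ[ℝ] E.Ext x.1 := fun x =>
    AlgEquiv.ofBijective _ (F.expand_bijective ⟨x.1, hU x.2⟩)
  let c : ∀ i, U → ℝ := fun i x => b.repr ((e x).symm (E.val a x)) i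
  have hc : ∀ i, E.IsSmoothFun U (c i) := by
    intro i
    refine isSmoothFun_of_locally fun x hx => ?_
    obtain ⟨V, hV, hxV, h1⟩ := a.2 ⟨x, hx⟩
    refine ⟨V, hV, hxV, ?_⟩
    have h2 : Algebra.adjoin ℝ (E.formGenerators V) ≤ (F.toPi (hV.trans hU)).range := by
      refine Algebra.adjoin_le ?_
      rintro _ (⟨f, hf, rfl⟩ | ⟨α, hα, rfl⟩)
      · exact ⟨_, congrArg Subtype.val (F.toForms_fun (hV.trans hU) f hf)⟩
      · exact ⟨_, congrArg Subtype.val (F.toForms_covec (hV.trans hU) α hα)⟩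
    obtain ⟨z, hz⟩ := h2 h1
    have hz' : ∀ y : V, F.toPi (hV.trans hU) z y = E.val a ⟨y.1, hV y.2⟩ := fun y =>
      congrFun hz y
    have h3 : ∀ z : E.smoothFun V ⊗[ℝ] ExteriorAlgebra ℝ (ι → ℝ),
        E.IsSmoothFun V fun y => b.repr ((e ⟨y.1, hV y.2⟩).symm (F.toPi (hV.trans hU) z y)) i := by
      intro z
      induction z using TensorProduct.induction_on with
      | zero => simpa using isSmoothFun_const (0 : ℝ)
      | add z z' h h' => simpa using h.add h'
      | tmul f w =>
        have h4 : ∀ y : V, b.repr ((e ⟨y.1, hV y.2⟩).symm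
            (F.toPi (hV.trans hU) (f ⊗ₜ w) y)) i = f.1 y * b.repr w i := fun y => by
          rw [toPi_tmul, map_smul]
          have : (e ⟨y.1, hV y.2⟩).symm (F.expand ⟨y.1, hU (hV y.2)⟩ w) = w :=
            (e ⟨y.1, hV y.2⟩).symm_apply_apply w
          rw [this]
          simp
        simp only [h4]
        exact IsSmoothFun.mul f.2 (isSmoothFun_const _)
    have h5 := h3 z
    simp only [hz'] at h5
    exact h5
  refine ⟨∑ i, (⟨c i, hc i⟩ : E.smoothFun U) ⊗ₜ b i, func_ext fun x => ?_⟩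
  have h1 : E.val (F.toForms hU (∑ i, (⟨c i, hc i⟩ : E.smoothFun U) ⊗ₜ b i)) x =
      ∑ i, E.val (F.toForms hU ((⟨c i, hc i⟩ : E.smoothFun U) ⊗ₜ b i)) x := by
    rw [map_sum]
    exact map_sum (E.valHom x) _ _
  rw [h1]
  simp only [val_toForms_tmul, c, ← map_smul, ← map_sum, b.sum_repr]
  exact (e x).apply_symm_apply _

/-- Over the domain of a frame, the algebra of forms is the tensor product of the algebra of smooth
functions and an exterior algebra. -/
def formsEquiv : (E.smoothFun U ⊗[ℝ] ExteriorAlgebra ℝ (ι → ℝ)) ≃ₐ[ℝ] E.shiftObj.func U :=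
  AlgEquiv.ofBijective (F.toForms hU) ⟨F.toForms_injective hU, F.toForms_surjective hU⟩

end LocalFrame

end SmoothVB



namespace ExteriorAlgebra

variable {V V' : Type} [AddCommGroup V] [Module ℝ V] [AddCommGroup V'] [Module ℝ V']

/-! ### The `ℤ`-grading of an exterior algebra -/

/-- The elements of degree `k : ℤ`; there are none but `0` for `k < 0`. -/
def intDeg (V : Type) [AddCommGroup V] [Module ℝ V] : ℤ → Submodule ℝ (ExteriorAlgebra ℝ V)
  | Int.ofNat n => ⋀[ℝ]^n V
  | Int.negSucc _ => ⊥

theorem one_mem_intDeg : (1 : ExteriorAlgebra ℝ V) ∈ intDeg V 0 := by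
  change (1 : ExteriorAlgebra ℝ V) ∈ ⋀[ℝ]^0 V
  exact SetLike.GradedOne.one_mem

theorem ι_mem_intDeg (v : V) : ι ℝ v ∈ intDeg V 1 := by
  change ι ℝ v ∈ LinearMap.range (ι ℝ) ^ 1
  rw [pow_one]
  exact ⟨v, rfl⟩

theorem algebraMap_mem_intDeg (r : ℝ) : algebraMap ℝ (ExteriorAlgebra ℝ V) r ∈ intDeg V 0 := by
  rw [Algebra.algebraMap_eq_smul_one]
  exact Submodule.smul_mem _ _ one_mem_intDeg

theorem mul_mem_intDeg {k l : ℤ} {a b : ExteriorAlgebra ℝ V} (ha : a ∈ intDeg V k)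
    (hb : b ∈ intDeg V l) : a * b ∈ intDeg V (k + l) := by
  match k, l, ha, hb with
  | Int.ofNat n, Int.ofNat m, ha, hb =>
    exact SetLike.GradedMul.mul_mem (A := fun i : ℕ => ⋀[ℝ]^i V) ha hb
  | Int.negSucc n, _, ha, _ =>
    rw [show a = 0 from ha, zero_mul]
    exact Submodule.zero_mem _
  | _, Int.negSucc n, _, hb =>
    rw [show b = 0 from hb, mul_zero]
    exact Submodule.zero_mem _

theorem map_mem_intDeg (f : V →ₗ[ℝ] V') {k : ℤ} {a : ExteriorAlgebra ℝ V} (ha : a ∈ intDeg V k) :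
    map f a ∈ intDeg V' k := by
  cases k with
  | ofNat n =>
    change a ∈ LinearMap.range (ι ℝ) ^ n at ha
    change map f a ∈ LinearMap.range (ι ℝ) ^ n
    have h1 : map f a ∈ (LinearMap.range (ι ℝ) ^ n).map (map f).toLinearMap := ⟨a, ha, rfl⟩
    rw [Submodule.map_pow] at h1
    refine SetLike.le_def.1 (pow_le_pow_left' ?_ n) h1
    rintro _ ⟨_, ⟨v, rfl⟩, rfl⟩
    exact ⟨f v, (map_apply_ι _ _).symm⟩
  | negSucc n =>
    rw [show a = 0 from ha, map_zero]
    exact Submodule.zero_mem _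

theorem invol_of_mem_intDeg {k : ℤ} {a : ExteriorAlgebra ℝ V} (ha : a ∈ intDeg V k) :
    invol a = (k.negOnePow : ℤ) • a := by
  cases k with
  | ofNat n =>
    rw [invol_of_mem ha]
    change (-1 : ℝ) ^ n • a = ((Int.negOnePow (n : ℤ) : ℤˣ) : ℤ) • a
    obtain h | h := Nat.even_or_odd n
    · rw [h.neg_one_pow, Int.negOnePow_even _ (by exact_mod_cast h)]
      simp
    · rw [h.neg_one_pow, Int.negOnePow_odd _ (by exact_mod_cast h)]
      simp
  | negSucc n =>
    rw [show a = 0 from ha, map_zero]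
    simp

/-- Graded commutativity of the exterior algebra. -/
theorem mul_comm_of_mem_intDeg {k l : ℤ} {a b : ExteriorAlgebra ℝ V} (ha : a ∈ intDeg V k)
    (hb : b ∈ intDeg V l) : a * b = ((k * l).negOnePow : ℤ) • (b * a) := by
  cases k with
  | ofNat n =>
    have key : ∀ n : ℕ, ∀ a ∈ LinearMap.range (ι ℝ : V →ₗ[ℝ] _) ^ n,
        a * b = ((((n : ℤ) * l).negOnePow : ℤˣ) : ℤ) • (b * a) := by
      intro n a ha
      induction ha using Submodule.pow_induction_on_left' with
      | algebraMap r => simpa using Algebra.commutes r b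
      | add x y i hx hy h1 h2 => rw [add_mul, mul_add, zsmul_add, h1, h2]
      | mem_mul m hm i x hx ih =>
        obtain ⟨v, rfl⟩ := hm
        rw [mul_assoc, ih, mul_smul_comm, ← mul_assoc, ι_mul_eq_invol_mul, invol_of_mem_intDeg hb,
          smul_mul_assoc, smul_mul_assoc, smul_smul, mul_assoc]
        congr 1
        rw [← Units.val_mul, ← Int.negOnePow_add]
        congr 2
        push_cast
        ring
    exact key n a ha
  | negSucc n =>
    rw [show a = 0 from ha, mul_zero, zero_mul]
    simp

/-- The homogeneous component of degree `k : ℤ`. -/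
def intProj (V : Type) [AddCommGroup V] [Module ℝ V] :
    ℤ → ExteriorAlgebra ℝ V →ₗ[ℝ] ExteriorAlgebra ℝ V
  | Int.ofNat n => GradedAlgebra.proj (fun i : ℕ => ⋀[ℝ]^i V) n
  | Int.negSucc _ => 0

theorem intProj_mem (k : ℤ) (a : ExteriorAlgebra ℝ V) : intProj V k a ∈ intDeg V k := by
  cases k with
  | ofNat n =>
    change GradedAlgebra.proj (fun i : ℕ => ⋀[ℝ]^i V) n a ∈ ⋀[ℝ]^n V
    rw [GradedAlgebra.proj_apply]
    exact SetLike.coe_mem _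
  | negSucc n => exact Submodule.zero_mem _

theorem intProj_of_mem {k : ℤ} {a : ExteriorAlgebra ℝ V} (ha : a ∈ intDeg V k) :
    intProj V k a = a := by
  cases k with
  | ofNat n =>
    change GradedAlgebra.proj (fun i : ℕ => ⋀[ℝ]^i V) n a = a
    rw [GradedAlgebra.proj_apply]
    exact DirectSum.decompose_of_mem_same _ ha
  | negSucc n => exact (show a = 0 from ha).symm

theorem intProj_of_mem_ne {k l : ℤ} (h : l ≠ k) {a : ExteriorAlgebra ℝ V} (ha : a ∈ intDeg V l) :
    intProj V k a = 0 := by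
  match k, l, h, ha with
  | Int.ofNat n, Int.ofNat m, h, ha =>
    change GradedAlgebra.proj (fun i : ℕ => ⋀[ℝ]^i V) n a = 0
    rw [GradedAlgebra.proj_apply]
    exact DirectSum.decompose_of_mem_ne (i := m) (j := n) _ ha fun h' => h (by rw [h'])
  | Int.negSucc n, _, _, _ => rfl
  | _, Int.negSucc n, _, ha => rw [show a = 0 from ha, map_zero]

theorem intDeg_induction {P : ExteriorAlgebra ℝ V → Prop} (h0 : P 0)
    (hdeg : ∀ (k : ℤ) a, a ∈ intDeg V k → P a) (hadd : ∀ a b, P a → P b → P (a + b))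
    (a : ExteriorAlgebra ℝ V) : P a := by
  refine DirectSum.Decomposition.inductionOn (fun i : ℕ => ⋀[ℝ]^i V) h0 (fun {i} m => ?_)
    (fun m m' => hadd m m') a
  exact hdeg (Int.ofNat i) _ m.2

theorem map_intProj (f : V →ₗ[ℝ] V') (k : ℤ) (a : ExteriorAlgebra ℝ V) :
    map f (intProj V k a) = intProj V' k (map f a) := by
  induction a using intDeg_induction with
  | h0 => simp
  | hadd a b ha hb => simp only [map_add, ha, hb]
  | hdeg l a ha =>
    by_cases h : l = k
    · subst h
      rw [intProj_of_mem ha, intProj_of_mem (map_mem_intDeg f ha)]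
    · rw [intProj_of_mem_ne h ha, intProj_of_mem_ne h (map_mem_intDeg f ha), map_zero]

theorem intDeg_eq_bot_of_lt [Module.Finite ℝ V] {n : ℕ} (h : Module.finrank ℝ V < n) :
    intDeg V n = ⊥ := by
  have h1 := exteriorPower.finrank_eq (R := ℝ) (M := V) n
  rw [Nat.choose_eq_zero_of_lt h] at h1
  exact Submodule.finrank_eq_zero.1 h1

theorem sum_intProj [Module.Finite ℝ V] {N : ℕ} (h : Module.finrank ℝ V ≤ N)
    (a : ExteriorAlgebra ℝ V) : ∑ n ∈ Finset.range (N + 1), intProj V n a = a := by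
  induction a using intDeg_induction with
  | h0 => simp
  | hadd a b ha hb => simp only [map_add, Finset.sum_add_distrib, ha, hb]
  | hdeg l a ha =>
    match l, ha with
    | Int.negSucc n, ha =>
      rw [show a = 0 from ha]
      simp
    | Int.ofNat m, ha =>
      by_cases hm : m < N + 1
      · rw [Finset.sum_eq_single_of_mem m (Finset.mem_range.2 hm) fun i _ hi => ?_]
        · exact intProj_of_mem (k := (m : ℤ)) ha
        · exact intProj_of_mem_ne (l := (m : ℤ)) (fun h => hi (by exact_mod_cast h.symm)) ha
      · have h2 : a ∈ intDeg V (m : ℤ) := ha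
        rw [intDeg_eq_bot_of_lt (by omega)] at h2
        rw [show a = 0 from h2]
        simp

theorem algebraMapInv_ι (v : V) : algebraMapInv (ι ℝ v) = 0 := by
  simp [algebraMapInv]

theorem eq_algebraMap_of_mem_intDeg_zero {a : ExteriorAlgebra ℝ V} (ha : a ∈ intDeg V 0) :
    a = algebraMap ℝ _ (algebraMapInv a) := by
  change a ∈ LinearMap.range (ι ℝ) ^ 0 at ha
  rw [pow_zero] at ha
  obtain ⟨r, rfl⟩ := Submodule.mem_one.1 ha
  rw [algebraMapInv]
  simp

end ExteriorAlgebra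

/-- A criterion for a family of submodules to be a direct sum decomposition, by means of the
projections to the summands. -/
theorem DirectSum.isInternal_of_proj {ι M : Type} [DecidableEq ι] [AddCommGroup M] [Module ℝ M]
    (A : ι → Submodule ℝ M) (L : ι → M →ₗ[ℝ] M) (hmem : ∀ k a, L k a ∈ A k)
    (hself : ∀ k, ∀ a ∈ A k, L k a = a) (hne : ∀ k l, l ≠ k → ∀ a ∈ A l, L k a = 0)
    (hsum : ∀ a, ∃ s : Finset ι, ∑ k ∈ s, L k a = a) : DirectSum.IsInternal A := by
  constructor
  · rw [injective_iff_map_eq_zero]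
    intro x hx
    have key : ∀ (x : DirectSum ι fun i => A i) k, L k (DirectSum.coeAddMonoidHom A x) = x k := by
      intro x k
      induction x using DirectSum.induction_on with
      | zero => simp
      | add x y hx hy => simp [hx, hy]
      | of i x =>
        rw [DirectSum.coeAddMonoidHom_of]
        by_cases h : i = k
        · subst h
          rw [hself _ _ x.2, DirectSum.of_eq_same]
        · rw [hne k i h _ x.2, DirectSum.of_eq_of_ne _ _ _ (Ne.symm h)]
          rfl
    ext k
    rw [← key x k, hx, map_zero]
    rfl
  · intro a
    obtain ⟨s, hs⟩ := hsum a
    refine ⟨∑ k ∈ s, DirectSum.of (fun i => A i) k ⟨L k a, hmem k a⟩, ?_⟩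
    rw [map_sum]
    refine Eq.trans (Finset.sum_congr rfl fun k _ => ?_) hs
    rw [DirectSum.coeAddMonoidHom_of]



namespace SmoothVB

variable {E : SmoothVB}

/-! ### Homogeneous components of forms -/

theorem extDeg_eq (x : E.base) (k : ℤ) :
    E.extDeg x k = ExteriorAlgebra.intDeg (Module.Dual ℝ (E.fib x)) k := by
  cases k <;> rfl

theorem mem_deg_iff' {U : Opens E.base} {k : ℤ} {a : E.shiftObj.func U} :
    a ∈ E.shiftObj.deg U k ↔ ∀ x, E.val a x ∈ ExteriorAlgebra.intDeg (Module.Dual ℝ (E.fib x.1)) k := by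
  simp only [mem_deg_iff, extDeg_eq]

instance finite_fib (x : E.base) : Module.Finite ℝ (E.fib x) := by
  obtain ⟨W, F, -, hx, -⟩ := E.exists_localFrame x
  exact Module.Finite.of_basis (F.basis ⟨x, hx⟩)

theorem finrank_dual (x : E.base) : Module.finrank ℝ (Module.Dual ℝ (E.fib x)) = E.rank := by
  obtain ⟨W, F, -, hx, -⟩ := E.exists_localFrame x
  rw [Subspace.dual_finrank_eq, Module.finrank_eq_card_basis (F.basis ⟨x, hx⟩), Fintype.card_fin]

theorem funForm_mem_deg {U : Opens E.base} (f : U → ℝ) (hf : E.IsSmoothFun U f) :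
    E.funForm U f hf ∈ E.shiftObj.deg U 0 :=
  mem_deg_iff'.2 fun _ => ExteriorAlgebra.algebraMap_mem_intDeg _

theorem covecForm_mem_deg {U : Opens E.base} (α : ∀ x : U, Module.Dual ℝ (E.fib x.1))
    (hα : E.IsSmoothCovec U α) : E.covecForm U α hα ∈ E.shiftObj.deg U 1 :=
  mem_deg_iff'.2 fun _ => ExteriorAlgebra.ι_mem_intDeg _

/-- Every function on the shifted bundle is, near a given point, a finite sum of products of smooth
functions and constant elements of the exterior algebra of a frame. -/
theorem LocalFrame.exists_eq_sum {W : Opens E.base} {ι : Type} [Fintype ι] (F : LocalFrame E W ι)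
    {U : Opens E.base} (hU : U ≤ W) (a : E.shiftObj.func U) :
    ∃ (n : ℕ) (f : Fin n → E.smoothFun U) (w : Fin n → ExteriorAlgebra ℝ (ι → ℝ)),
      ∀ x : U, E.val a x = ∑ i, (f i).1 x • F.expand ⟨x.1, hU x.2⟩ (w i) := by
  obtain ⟨z, rfl⟩ := F.toForms_surjective hU a
  obtain ⟨n, f, w, rfl⟩ : ∃ (n : ℕ) (f : Fin n → E.smoothFun U)
      (w : Fin n → ExteriorAlgebra ℝ (ι → ℝ)), z = ∑ i, f i ⊗ₜ w i := by
    obtain ⟨n, m⟩ := TensorProduct.exists_finset z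
    obtain ⟨e⟩ : Nonempty (Fin n.card ≃ n) := ⟨n.equivFin.symm⟩
    refine ⟨n.card, fun i => (e i).1.1, fun i => (e i).1.2, m.trans ?_⟩
    rw [← Finset.sum_coe_sort n, ← e.sum_comp]
  refine ⟨n, f, w, fun x => ?_⟩
  rw [map_sum]
  refine (map_sum (E.valHom x) _ _).trans (Finset.sum_congr rfl fun i _ => ?_)
  exact F.val_toForms_tmul hU (f i) (w i) x

/-- A section of the exterior algebra bundle is smooth if it is a sum of products of smooth functions
and constant elements of the exterior algebra of a frame. -/
theorem LocalFrame.mem_forms {W : Opens E.base} {ι : Type} [Fintype ι] (F : LocalFrame E W ι)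
    {U : Opens E.base} (hU : U ≤ W) {η : ∀ x : U, E.Ext x.1} {n : ℕ} (f : Fin n → E.smoothFun U)
    (w : Fin n → ExteriorAlgebra ℝ (ι → ℝ))
    (h : ∀ x : U, η x = ∑ i, (f i).1 x • F.expand ⟨x.1, hU x.2⟩ (w i)) : η ∈ E.forms U := by
  have h1 := F.toPi_mem hU (∑ i, f i ⊗ₜ w i)
  rw [map_sum] at h1
  rw [show η = ∑ i, F.toPi hU (f i ⊗ₜ w i) from ?_]
  · exact h1
  · funext x
    rw [h, Finset.sum_apply]
    simp only [F.toPi_tmul]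

/-- The homogeneous component of degree `k`. -/
def component (E : SmoothVB) (U : Opens E.base) (k : ℤ) : E.shiftObj.func U →ₗ[ℝ] E.shiftObj.func U where
  toFun a := (⟨fun x => ExteriorAlgebra.intProj _ k (E.val a x), by
    refine mem_forms_of_locally fun x hx => ?_
    obtain ⟨W, F, -, hxW, -⟩ := E.exists_localFrame x
    refine ⟨U ⊓ W, inf_le_left, ⟨hx, hxW⟩, ?_⟩
    obtain ⟨n, f, w, h⟩ := F.exists_eq_sum inf_le_right (E.shiftObj.res (inf_le_left : U ⊓ W ≤ U) a)
    refine F.mem_forms inf_le_right f (fun i => ExteriorAlgebra.intProj _ k (w i)) fun y => ?_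
    have h1 := congrArg (ExteriorAlgebra.intProj _ k) (h y)
    rw [map_sum] at h1
    refine h1.trans (Finset.sum_congr rfl fun i _ => ?_)
    rw [map_smul]
    congr 1
    exact (ExteriorAlgebra.map_intProj _ k (w i)).symm⟩ : E.forms U)
  map_add' a b := func_ext fun x => map_add (ExteriorAlgebra.intProj _ k) (E.val a x) (E.val b x)
  map_smul' r a := func_ext fun x => map_smul (ExteriorAlgebra.intProj _ k) r (E.val a x)

theorem component_mem {U : Opens E.base} (k : ℤ) (a : E.shiftObj.func U) :
    E.component U k a ∈ E.shiftObj.deg U k :=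
  mem_deg_iff'.2 fun _ => ExteriorAlgebra.intProj_mem k _

theorem sum_component {U : Opens E.base} (a : E.shiftObj.func U) :
    ∑ n ∈ Finset.range (E.rank + 1), E.component U n a = a := by
  refine func_ext fun x => (map_sum (E.valHom x) _ _).trans ?_
  exact ExteriorAlgebra.sum_intProj (finrank_dual x.1).le _

theorem isInternal_deg (U : Opens E.base) : DirectSum.IsInternal (E.shiftObj.deg U) := by
  refine DirectSum.isInternal_of_proj _ (E.component U) (fun k a => component_mem k a)
    (fun k a ha => func_ext fun x => ?_) (fun k l hkl a ha => func_ext fun x => ?_) fun a => ?_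
  · exact ExteriorAlgebra.intProj_of_mem (mem_deg_iff'.1 ha x)
  · exact ExteriorAlgebra.intProj_of_mem_ne hkl (mem_deg_iff'.1 ha x)
  · refine ⟨(Finset.range (E.rank + 1)).map Nat.castEmbedding, ?_⟩
    rw [Finset.sum_map]
    exact sum_component a

/-! ### Charts of the shifted bundle -/

/-- The superdimension of `[-1]E`: the even coordinates of degree `0` are those of the base, and the
fibre coordinates have degree `1`. -/
def shiftDim (E : SmoothVB) : ℤ → ℕ
  | Int.ofNat 0 => E.dim
  | Int.negSucc 0 => E.rank
  | _ => 0

/-- The fibre coordinates of `[-1]E`. -/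
def fibCoord (E : SmoothVB) (j : Fin E.rank) : SuperCoord E.shiftDim :=
  ⟨⟨Int.negSucc 0, by decide⟩, (j : Fin E.rank)⟩

theorem exists_fibCoord (c : SuperCoord E.shiftDim) : ∃ j, c = E.fibCoord j := by
  obtain ⟨⟨i, hi⟩, j⟩ := c
  match i, hi, j with
  | Int.negSucc 0, _, j => exact ⟨j, rfl⟩
  | Int.ofNat 0, hi, _ => exact absurd rfl hi
  | Int.ofNat (n + 1), _, j => exact Fin.elim0 j
  | Int.negSucc (n + 1), _, j => exact Fin.elim0 j

theorem fibCoord_fst (j : Fin E.rank) : (E.fibCoord j).1.1 = -1 := rfl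

/-- The exterior algebra on the fibre coordinates as an algebra of superpolynomials. -/
def extToPoly (E : SmoothVB) : ExteriorAlgebra ℝ (Fin E.rank → ℝ) →ₐ[ℝ] SuperPoly E.shiftDim :=
  ExteriorAlgebra.lift ℝ ⟨∑ j, (LinearMap.toSpanSingleton ℝ _ (SuperPoly.coord _ (E.fibCoord j))).comp
    (LinearMap.proj j), fun v => by
      have h : ∀ i j, SuperPoly.coord _ (E.fibCoord i) * SuperPoly.coord _ (E.fibCoord j) =
          -(SuperPoly.coord _ (E.fibCoord j) * SuperPoly.coord _ (E.fibCoord i)) := fun i j => by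
        rw [SuperPoly.coord_mul_coord, fibCoord_fst, fibCoord_fst, Int.negOnePow_odd _ (by decide)]
        simp
      have h1 : (∑ j, (LinearMap.toSpanSingleton ℝ _ (SuperPoly.coord _ (E.fibCoord j))).comp
          (LinearMap.proj j)) v = ∑ j, v j • SuperPoly.coord _ (E.fibCoord j) := by
        simp
      rw [h1]
      have h2 : (∑ j, v j • SuperPoly.coord _ (E.fibCoord j)) *
          (∑ j, v j • SuperPoly.coord _ (E.fibCoord j)) =
          -((∑ j, v j • SuperPoly.coord _ (E.fibCoord j)) *
          (∑ j, v j • SuperPoly.coord _ (E.fibCoord j))) := by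
        conv_lhs => rw [Finset.sum_mul_sum, Finset.sum_comm]
        conv_rhs => rw [Finset.sum_mul_sum]
        simp only [← Finset.sum_neg_distrib]
        refine Finset.sum_congr rfl fun i _ => Finset.sum_congr rfl fun j _ => ?_
        rw [smul_mul_smul_comm, smul_mul_smul_comm, h, smul_neg, mul_comm]
      have h3 : (2 : ℝ) • ((∑ j, v j • SuperPoly.coord _ (E.fibCoord j)) *
          (∑ j, v j • SuperPoly.coord _ (E.fibCoord j))) = 0 := by
        rw [two_smul]
        nth_rewrite 1 [h2]
        exact neg_add_cancel _
      exact (smul_eq_zero.1 h3).resolve_left two_ne_zero⟩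

theorem extToPoly_ι (v : Fin E.rank → ℝ) :
    E.extToPoly (ExteriorAlgebra.ι ℝ v) = ∑ j, v j • SuperPoly.coord _ (E.fibCoord j) := by
  rw [extToPoly, ExteriorAlgebra.lift_ι_apply]
  simp

theorem extToPoly_ι_single (j : Fin E.rank) :
    E.extToPoly (ExteriorAlgebra.ι ℝ (Pi.single j 1)) = SuperPoly.coord _ (E.fibCoord j) := by
  rw [extToPoly_ι, Finset.sum_eq_single_of_mem j (Finset.mem_univ j) fun i _ hi => by
    rw [Pi.single_eq_of_ne hi, zero_smul], Pi.single_eq_same, one_smul]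

/-- The index of a fibre coordinate. -/
def fibIndex (E : SmoothVB) (c : SuperCoord E.shiftDim) : Fin E.rank := (exists_fibCoord c).choose

theorem fibCoord_fibIndex (c : SuperCoord E.shiftDim) : E.fibCoord (E.fibIndex c) = c :=
  (exists_fibCoord c).choose_spec.symm

/-- The inverse of `extToPoly`. -/
def polyToExt (E : SmoothVB) : SuperPoly E.shiftDim →ₐ[ℝ] ExteriorAlgebra ℝ (Fin E.rank → ℝ) :=
  SuperPoly.lift (fun c => ExteriorAlgebra.ι ℝ (Pi.single (E.fibIndex c) 1)) fun c d => by
    rw [← fibCoord_fibIndex c, ← fibCoord_fibIndex d, fibCoord_fst, fibCoord_fst,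
      Int.negOnePow_odd _ (by decide)]
    simp only [Units.val_neg, Units.val_one, neg_smul, one_smul]
    exact eq_neg_of_add_eq_zero_left (ExteriorAlgebra.ι_add_mul_swap _ _)

/-- The exterior algebra on the fibre coordinates is the algebra of superpolynomials. -/
def extEquivPoly (E : SmoothVB) : ExteriorAlgebra ℝ (Fin E.rank → ℝ) ≃ₐ[ℝ] SuperPoly E.shiftDim :=
  AlgEquiv.ofAlgHom E.extToPoly E.polyToExt
    (SuperPoly.hom_ext fun c => by
      change E.extToPoly (E.polyToExt _) = _
      rw [polyToExt, SuperPoly.lift_coord, extToPoly_ι_single, fibCoord_fibIndex]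
      rfl)
    (ExteriorAlgebra.hom_ext (LinearMap.pi_ext' fun j => LinearMap.ext_ring (by
      change E.polyToExt (E.extToPoly (ExteriorAlgebra.ι ℝ (Pi.single j 1))) = _
      rw [extToPoly_ι_single, polyToExt, SuperPoly.lift_coord]
      change ExteriorAlgebra.ι ℝ (Pi.single (E.fibIndex (E.fibCoord j)) 1) = ExteriorAlgebra.ι ℝ (Pi.single j 1)
      have h := fibCoord_fibIndex (E.fibCoord j)
      have h' : E.fibIndex (E.fibCoord j) = j := eq_of_heq (Sigma.mk.inj h).2
      rw [h'])))

theorem extEquivPoly_mem_deg {k : ℤ} {a : ExteriorAlgebra ℝ (Fin E.rank → ℝ)} :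
    E.extEquivPoly a ∈ SuperPoly.deg E.shiftDim k ↔ a ∈ ExteriorAlgebra.intDeg _ k := by
  constructor
  · intro h
    have h1 : ∀ x ∈ SuperPoly.deg E.shiftDim k,
        E.extEquivPoly.symm x ∈ ExteriorAlgebra.intDeg (Fin E.rank → ℝ) k := by
      clear h
      intro x hx
      induction hx using Submodule.span_induction with
      | mem x hx =>
        obtain ⟨L, rfl, rfl⟩ := hx
        induction L with
        | nil =>
          simp only [List.map_nil, List.prod_nil, List.sum_nil, map_one]
          exact ExteriorAlgebra.one_mem_intDeg
        | cons c L ih =>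
          simp only [List.map_cons, List.prod_cons, List.sum_cons, map_mul]
          refine ExteriorAlgebra.mul_mem_intDeg ?_ ih
          obtain ⟨j, rfl⟩ := exists_fibCoord c
          rw [fibCoord_fst, neg_neg, ← extToPoly_ι_single]
          have : E.extEquivPoly.symm (E.extToPoly (ExteriorAlgebra.ι ℝ (Pi.single j 1))) =
              ExteriorAlgebra.ι ℝ (Pi.single j 1) :=
            E.extEquivPoly.symm_apply_apply (ExteriorAlgebra.ι ℝ (Pi.single j 1))
          rw [this]
          exact ExteriorAlgebra.ι_mem_intDeg _
      | zero => rw [map_zero]; exact Submodule.zero_mem _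
      | add x y _ _ hx hy => rw [map_add]; exact Submodule.add_mem _ hx hy
      | smul r x _ hx => rw [map_smul]; exact Submodule.smul_mem _ _ hx
    have h2 := h1 _ h
    rwa [AlgEquiv.symm_apply_apply] at h2
  · intro h
    match k, h with
    | Int.negSucc n, h =>
      rw [show a = 0 from h, map_zero]
      exact Submodule.zero_mem _
    | Int.ofNat n, h =>
      change a ∈ LinearMap.range (ExteriorAlgebra.ι ℝ) ^ n at h
      clear * - h
      induction h using Submodule.pow_induction_on_left' with
      | algebraMap r =>
        rw [AlgEquiv.commutes]
        exact SuperPoly.algebraMap_mem_deg r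
      | add x y i hx hy h1 h2 => rw [map_add]; exact Submodule.add_mem _ h1 h2
      | mem_mul m hm i x hx ih =>
        obtain ⟨v, rfl⟩ := hm
        rw [map_mul, show (Int.ofNat i.succ : ℤ) = 1 + Int.ofNat i by
          simp only [Int.ofNat_eq_natCast, Nat.succ_eq_add_one]; push_cast; ring]
        refine SuperPoly.mul_mem_deg ?_ ih
        change E.extToPoly (ExteriorAlgebra.ι ℝ v) ∈ _
        rw [extToPoly_ι]
        refine Submodule.sum_mem _ fun j _ => Submodule.smul_mem _ _ ?_
        simpa [fibCoord_fst] using SuperPoly.prod_coord_mem_deg [E.fibCoord j]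

theorem aug_extEquivPoly (a : ExteriorAlgebra ℝ (Fin E.rank → ℝ)) :
    SuperPoly.aug _ (E.extEquivPoly a) = ExteriorAlgebra.algebraMapInv a := by
  have h : (SuperPoly.aug _).comp E.extToPoly =
      (ExteriorAlgebra.algebraMapInv : ExteriorAlgebra ℝ (Fin E.rank → ℝ) →ₐ[ℝ] ℝ) := by
    refine ExteriorAlgebra.hom_ext (LinearMap.ext fun v => ?_)
    change SuperPoly.aug _ (E.extToPoly (ExteriorAlgebra.ι ℝ v)) =
      ExteriorAlgebra.algebraMapInv (ExteriorAlgebra.ι ℝ v)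
    rw [extToPoly_ι, ExteriorAlgebra.algebraMapInv_ι, map_sum]
    exact Finset.sum_eq_zero fun j _ => by rw [map_smul, SuperPoly.aug_coord, smul_zero]
  exact DFunLike.congr_fun h a

theorem algebraMapInv_exteriorAlgebra_map {V V' : Type} [AddCommGroup V] [Module ℝ V]
    [AddCommGroup V'] [Module ℝ V'] (f : V →ₗ[ℝ] V') (w : ExteriorAlgebra ℝ V) :
    ExteriorAlgebra.algebraMapInv (ExteriorAlgebra.map f w) = ExteriorAlgebra.algebraMapInv w := by
  have h : (ExteriorAlgebra.algebraMapInv).comp (ExteriorAlgebra.map f) =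
      (ExteriorAlgebra.algebraMapInv : ExteriorAlgebra ℝ V →ₐ[ℝ] ℝ) := by
    ext v
    simp [ExteriorAlgebra.algebraMapInv]
  exact DFunLike.congr_fun h w

theorem isSmoothFun_iff_contDiffOn {U : Opens E.base} {x : E.base}
    (hU : (U : Set E.base) ⊆ (chartAt (EuclideanSpace ℝ (Fin E.dim)) x).source) (f : U → ℝ) :
    E.IsSmoothFun U f ↔ ContDiffOn ℝ ∞
      (Function.extend Subtype.val f 0 ∘ (chartAt (EuclideanSpace ℝ (Fin E.dim)) x).symm)
      (chartAt (EuclideanSpace ℝ (Fin E.dim)) x '' U) := by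
  have h := contMDiffOn_iff_of_subset_source' (I := 𝓡 E.dim) (I' := 𝓘(ℝ, ℝ)) (n := ∞)
    (f := Function.extend (Subtype.val : U → E.base) f 0) (s := (U : Set E.base)) (x := x) (y := (0 : ℝ))
    (by simpa using hU) (by intro y _; rw [extChartAt_model_space_eq_id]; trivial)
  unfold IsSmoothFun
  rw [h, extChartAt_model_space_eq_id]
  simp [extChartAt, Function.comp_def]

/-- The identification of the exterior algebra of a fibre given by a frame, as an isomorphism. -/
def LocalFrame.expandEquiv {W : Opens E.base} {ι : Type} [Fintype ι] (F : LocalFrame E W ι) (x : W) :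
    ExteriorAlgebra ℝ (ι → ℝ) ≃ₐ[ℝ] E.Ext x.1 :=
  AlgEquiv.ofBijective (F.expand x) (F.expand_bijective x)

theorem LocalFrame.expandEquiv_symm_expand {W : Opens E.base} {ι : Type} [Fintype ι]
    (F : LocalFrame E W ι) (x : W) (w : ExteriorAlgebra ℝ (ι → ℝ)) :
    (F.expandEquiv x).symm (F.expand x w) = w :=
  (F.expandEquiv x).symm_apply_apply w

theorem LocalFrame.expandEquiv_symm_mem {W : Opens E.base} {ι : Type} [Fintype ι]
    (F : LocalFrame E W ι) (x : W) {k : ℤ} {a : E.Ext x.1} :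
    (F.expandEquiv x).symm a ∈ ExteriorAlgebra.intDeg (ι → ℝ) k ↔
      a ∈ ExteriorAlgebra.intDeg (Module.Dual ℝ (E.fib x.1)) k := by
  obtain ⟨w, rfl⟩ := (F.expandEquiv x).surjective a
  rw [AlgEquiv.symm_apply_apply]
  refine ⟨fun h => ExteriorAlgebra.map_mem_intDeg _ h, fun h => ?_⟩
  have h1 : F.expand x (ExteriorAlgebra.intProj _ k w) = F.expand x w := by
    rw [LocalFrame.expand, ExteriorAlgebra.map_intProj]
    exact ExteriorAlgebra.intProj_of_mem h
  rw [← (F.expand_bijective x).1 h1]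
  exact ExteriorAlgebra.intProj_mem k w

/-- The superpolynomial-valued function which represents a function on `[-1]E` in a frame. -/
def LocalFrame.read {W : Opens E.base} (F : LocalFrame E W (Fin E.rank)) {U : Opens E.base}
    (hU : U ≤ W) : E.shiftObj.func U →ₐ[ℝ] (U → SuperPoly E.shiftDim) :=
  AlgHom.pi fun x => (E.extEquivPoly : _ →ₐ[ℝ] SuperPoly E.shiftDim).comp
    (((F.expandEquiv ⟨x.1, hU x.2⟩).symm : _ →ₐ[ℝ] ExteriorAlgebra ℝ (Fin E.rank → ℝ)).comp
      (E.valHom x))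

theorem LocalFrame.read_apply {W : Opens E.base} (F : LocalFrame E W (Fin E.rank)) {U : Opens E.base}
    (hU : U ≤ W) (a : E.shiftObj.func U) (x : U) :
    F.read hU a x = E.extEquivPoly ((F.expandEquiv ⟨x.1, hU x.2⟩).symm (E.val a x)) := rfl

theorem LocalFrame.read_injective {W : Opens E.base} (F : LocalFrame E W (Fin E.rank))
    {U : Opens E.base} (hU : U ≤ W) : Function.Injective (F.read hU) := fun a b h =>
  func_ext fun y => by
    have h1 := congrFun h y
    rw [F.read_apply, F.read_apply] at h1
    exact (F.expandEquiv _).symm.injective (E.extEquivPoly.injective h1)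

theorem LocalFrame.read_mem_deg {W : Opens E.base} (F : LocalFrame E W (Fin E.rank))
    {U : Opens E.base} (hU : U ≤ W) {k : ℤ} {a : E.shiftObj.func U} :
    a ∈ E.shiftObj.deg U k ↔ ∀ y, F.read hU a y ∈ SuperPoly.deg E.shiftDim k := by
  simp only [mem_deg_iff', F.read_apply, extEquivPoly_mem_deg, F.expandEquiv_symm_mem]

theorem LocalFrame.aug_read {W : Opens E.base} (F : LocalFrame E W (Fin E.rank))
    {U : Opens E.base} (hU : U ≤ W) (a : E.shiftObj.func U) (y : U) :
    E.shiftObj.ev U a y = SuperPoly.aug E.shiftDim (F.read hU a y) := by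
  obtain ⟨w, hw⟩ := (F.expandEquiv ⟨y.1, hU y.2⟩).surjective (E.val a y)
  rw [F.read_apply, ← hw, AlgEquiv.symm_apply_apply, aug_extEquivPoly]
  refine Eq.trans (congrArg ExteriorAlgebra.algebraMapInv hw.symm) ?_
  exact algebraMapInv_exteriorAlgebra_map _ w

theorem LocalFrame.exists_read_eq_iff (x : E.base) {W : Opens E.base}
    (F : LocalFrame E W (Fin E.rank)) {U : Opens E.base} (hW : U ≤ W)
    (hU : (U : Set E.base) ⊆ (chartAt (EuclideanSpace ℝ (Fin E.dim)) x).source) (k : ℤ)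
    (g : U → SuperPoly E.shiftDim) :
    (∃ a ∈ E.shiftObj.deg U k, F.read hW a = g) ↔ (∀ y, g y ∈ SuperPoly.deg E.shiftDim k) ∧
      ∀ y : U, ∃ V : Opens E.base, y.1 ∈ V ∧ V ≤ U ∧
        ∃ (n : ℕ) (f : Fin n → EuclideanSpace ℝ (Fin E.dim) → ℝ)
          (w : Fin n → SuperPoly E.shiftDim),
          (∀ i, ContDiffOn ℝ ∞ (f i) (chartAt (EuclideanSpace ℝ (Fin E.dim)) x '' V)) ∧
          ∀ z : U, z.1 ∈ V →
            g z = ∑ i, f i (chartAt (EuclideanSpace ℝ (Fin E.dim)) x z.1) • w i := by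
  constructor
  · rintro ⟨a, ha, rfl⟩
    refine ⟨(F.read_mem_deg hW).1 ha, fun y => ?_⟩
    obtain ⟨n, f, w, h⟩ := F.exists_eq_sum hW a
    refine ⟨U, y.2, le_rfl, n, fun i => Function.extend Subtype.val (f i).1 0 ∘
      (chartAt (EuclideanSpace ℝ (Fin E.dim)) x).symm, fun i => E.extEquivPoly (w i),
      fun i => (isSmoothFun_iff_contDiffOn hU _).1 (f i).2, fun z _ => ?_⟩
    rw [F.read_apply, h z, map_sum, map_sum]
    refine Finset.sum_congr rfl fun i _ => ?_
    rw [map_smul, map_smul, F.expandEquiv_symm_expand]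
    dsimp only [Function.comp_apply]
    rw [(chartAt (EuclideanSpace ℝ (Fin E.dim)) x).left_inv (hU z.2), extend_apply_of_mem _ z.2]
  · rintro ⟨h1, h2⟩
    let η : ∀ y : U, E.Ext y.1 := fun y => F.expandEquiv ⟨y.1, hW y.2⟩ (E.extEquivPoly.symm (g y))
    have hη : η ∈ E.forms U := by
      refine mem_forms_of_locally fun y hy => ?_
      obtain ⟨V, hyV, hV, n, f, w, hf, h⟩ := h2 ⟨y, hy⟩
      refine ⟨V, hV, hyV, F.mem_forms (hV.trans hW)
        (fun i => ⟨fun z => f i (chartAt (EuclideanSpace ℝ (Fin E.dim)) x z.1), ?_⟩)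
        (fun i => E.extEquivPoly.symm (w i)) fun z => ?_⟩
      · refine (isSmoothFun_iff_contDiffOn (x := x) (fun z hz => hU (hV hz)) _).2 ((hf i).congr ?_)
        rintro _ ⟨z, hz, rfl⟩
        rw [Function.comp_apply, (chartAt (EuclideanSpace ℝ (Fin E.dim)) x).left_inv (hU (hV hz)),
          extend_apply_of_mem _ hz]
      · change F.expandEquiv _ (E.extEquivPoly.symm (g ⟨z.1, hV z.2⟩)) = _
        rw [h ⟨z.1, hV z.2⟩ z.2, map_sum, map_sum]
        refine Finset.sum_congr rfl fun i _ => ?_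
        rw [map_smul, map_smul]
        rfl
    have h3 : F.read hW (⟨η, hη⟩ : E.forms U) = g := funext fun y => by
      refine (congrArg E.extEquivPoly ((F.expandEquiv ⟨y.1, hW y.2⟩).symm_apply_apply _)).trans ?_
      exact E.extEquivPoly.apply_symm_apply _
    exact ⟨(⟨η, hη⟩ : E.forms U), (F.read_mem_deg hW).2 (by rwa [h3]), h3⟩

/-- The chart of `[-1]E` given by a chart of the base and a frame. -/
def superChart (x : E.base) {W : Opens E.base} (F : LocalFrame E W (Fin E.rank)) :
    GradedSpace.Chart E.shiftObj E.shiftDim where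
  toHomeo := (chartAt (EuclideanSpace ℝ (Fin E.dim)) x).restrOpen W W.isOpen
  fn _ hU := F.read fun _ hy => (hU hy).2
  fn_injective _ hU := F.read_injective fun _ hy => (hU hy).2
  fn_res _ _ _ _ := rfl
  fn_deg _ hU k g := F.exists_read_eq_iff x (fun _ hy => (hU hy).2) (fun _ hy => (hU hy).1) k g
  fn_ev _ hU a y := F.aug_read (fun _ hy => (hU hy).2) a y

theorem exists_superChart (x : E.base) :
    ∃ c : GradedSpace.Chart E.shiftObj E.shiftDim, x ∈ c.toHomeo.source := by
  obtain ⟨W, F, -, hx, -⟩ := E.exists_localFrame x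
  exact ⟨superChart x F, mem_chart_source _ x, hx⟩

/-- Functions on the shifted bundle can be glued. -/
theorem exists_glue {ι : Type} (U : ι → Opens E.base) (a : ∀ i, E.shiftObj.func (U i))
    (hcomp : ∀ i j x (hi : x ∈ U i) (hj : x ∈ U j), E.val (a i) ⟨x, hi⟩ = E.val (a j) ⟨x, hj⟩) :
    ∃ b : E.shiftObj.func (⨆ i, U i), ∀ i x (hx : x ∈ U i),
      E.val b ⟨x, le_iSup U i hx⟩ = E.val (a i) ⟨x, hx⟩ := by
  have hex : ∀ x : (⨆ i, U i : Opens E.base), ∃ i, x.1 ∈ U i := fun x => Opens.mem_iSup.1 x.2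
  choose i hi using hex
  let η : ∀ x : (⨆ i, U i : Opens E.base), E.Ext x.1 := fun x => E.val (a (i x)) ⟨x.1, hi x⟩
  have hagree : ∀ j x (hx : x ∈ U j), η ⟨x, le_iSup U j hx⟩ = E.val (a j) ⟨x, hx⟩ :=
    fun j x hx => hcomp _ _ _ _ _
  have hη : η ∈ E.forms (⨆ i, U i) := by
    refine mem_forms_of_locally fun x hx => ⟨U (i ⟨x, hx⟩), le_iSup U _, hi ⟨x, hx⟩, ?_⟩
    have h1 : E.restr (le_iSup U (i ⟨x, hx⟩)) η = (a (i ⟨x, hx⟩)).1 := by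
      funext y
      exact hagree _ _ y.2
    rw [h1]
    exact (a (i ⟨x, hx⟩)).2
  exact ⟨(⟨η, hη⟩ : E.forms _), hagree⟩

theorem sheaf_shiftObj (k : ℤ) {ι : Type} (U : ι → Opens E.base) (a : ∀ i, E.shiftObj.func (U i))
    (ha : ∀ i, a i ∈ E.shiftObj.deg (U i) k)
    (hcomp : ∀ i j, E.shiftObj.res (inf_le_left : U i ⊓ U j ≤ U i) (a i) =
      E.shiftObj.res (inf_le_right : U i ⊓ U j ≤ U j) (a j)) :
    ∃! b : E.shiftObj.func (⨆ i, U i), b ∈ E.shiftObj.deg _ k ∧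
      ∀ i, E.shiftObj.res (le_iSup U i) b = a i := by
  obtain ⟨b, hb⟩ := exists_glue U a fun i j x hi hj =>
    congrArg (fun b => E.val b ⟨x, show x ∈ U i ⊓ U j from ⟨hi, hj⟩⟩) (hcomp i j)
  refine ⟨b, ⟨mem_deg_iff'.2 fun x => ?_, fun i => func_ext fun x => hb i x.1 x.2⟩, ?_⟩
  · obtain ⟨i, hi⟩ := Opens.mem_iSup.1 x.2
    rw [hb i x.1 hi]
    exact mem_deg_iff'.1 (ha i) ⟨x.1, hi⟩
  · rintro c ⟨-, hc⟩
    refine func_ext fun x => ?_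
    obtain ⟨i, hi⟩ := Opens.mem_iSup.1 x.2
    rw [hb i x.1 hi, ← hc i]
    rfl

/-- The shifted bundle `[-1]E` is a supermanifold. -/
theorem isSupermanifold_shiftObj (E : SmoothVB) : E.shiftObj.IsSupermanifold where
  t2 := E.t2
  secondCountable := E.secondCountable
  one_mem _ := mem_deg_iff'.2 fun _ => ExteriorAlgebra.one_mem_intDeg
  mul_mem _ _ _ _ ha _ hb := mem_deg_iff'.2 fun x =>
    ExteriorAlgebra.mul_mem_intDeg (mem_deg_iff'.1 ha x) (mem_deg_iff'.1 hb x)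
  isInternal U := isInternal_deg U
  comm _ _ _ a ha b hb := func_ext fun x => by
    refine (ExteriorAlgebra.mul_comm_of_mem_intDeg (mem_deg_iff'.1 ha x) (mem_deg_iff'.1 hb x)).trans ?_
    exact (map_zsmul (E.valHom x) _ (b * a)).symm
  res_deg h _ _ ha x := ha ⟨x.1, h x.2⟩
  res_ev _ _ _ := rfl
  sheaf k _ U a ha hcomp := sheaf_shiftObj k U a ha hcomp
  locally_superdomain := ⟨E.shiftDim, exists_superChart⟩

end SmoothVB



namespace SmoothVB

variable {E : SmoothVB}

/-! ### Directional derivatives -/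

theorem dirDerivOn_eq {U V : Opens E.base} {f : U → ℝ} {F : E.base → ℝ} (h : V ≤ U)
    (hF : ∀ (x : E.base) (hx : x ∈ V), f ⟨x, h hx⟩ = F x) {x : U} (hx : x.1 ∈ V) (v : E.Tan x.1) :
    E.dirDerivOn f v = E.dirDeriv F v :=
  dirDeriv_congr (extend_eventuallyEq h hF hx) v

theorem dirDerivOn_restr {U V : Opens E.base} (h : V ≤ U) (f : U → ℝ) (x : V) (v : E.Tan x.1) :
    E.dirDerivOn (fun y : V => f ⟨y.1, h y.2⟩) v = E.dirDerivOn (x := ⟨x.1, h x.2⟩) f v := by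
  refine (dirDerivOn_eq h (fun y hy => ?_) (x := ⟨x.1, h x.2⟩) x.2 v).symm
  exact (extend_apply_of_mem (fun y : V => f ⟨y.1, h y.2⟩) hy).symm

theorem dirDeriv_add {f g : E.base → ℝ} {x : E.base} (hf : E.SmoothAt f x) (hg : E.SmoothAt g x)
    (v : E.Tan x) : E.dirDeriv (fun y => f y + g y) v = E.dirDeriv f v + E.dirDeriv g v := by
  have h := (hf.mdifferentiableAt (by simp)).hasMFDerivAt.add
    (hg.mdifferentiableAt (by simp)).hasMFDerivAt
  have h1 := h.mfderiv
  unfold dirDeriv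
  exact DFunLike.congr_fun h1 v

theorem dirDeriv_mul {f g : E.base → ℝ} {x : E.base} (hf : E.SmoothAt f x) (hg : E.SmoothAt g x)
    (v : E.Tan x) :
    E.dirDeriv (fun y => f y * g y) v = E.dirDeriv f v * g x + f x * E.dirDeriv g v := by
  have h := (hf.mdifferentiableAt (by simp)).hasMFDerivAt.mul
    (hg.mdifferentiableAt (by simp)).hasMFDerivAt
  have h1 := DFunLike.congr_fun h.mfderiv v
  unfold dirDeriv
  refine h1.trans ?_
  change f x * _ + g x * _ = _
  rw [add_comm, mul_comm (g x)]
  rfl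

theorem dirDeriv_const (r : ℝ) {x : E.base} (v : E.Tan x) : E.dirDeriv (fun _ => r) v = 0 := by
  unfold dirDeriv
  rw [mfderiv_const]
  rfl

theorem dirDeriv_comp {E' : SmoothVB} (φ : E ⟶ E') {f : E'.base → ℝ} {x : E.base}
    (hf : E'.SmoothAt f (φ.base x)) (v : E.Tan x) :
    E.dirDeriv (fun y => f (φ.base y)) v =
      E'.dirDeriv f (mfderiv (𝓡 E.dim) (𝓡 E'.dim) φ.base x v) := by
  have h := mfderiv_comp x (hf.mdifferentiableAt (by simp))
    ((φ.smooth_base x).mdifferentiableAt (by simp))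
  exact DFunLike.congr_fun h v

theorem IsSmoothFun.exists_eventuallyEq {U : Opens E.base} {f : U → ℝ} (hf : E.IsSmoothFun U f)
    {x : E.base} (hx : x ∈ U) : ∃ (g : E.base → ℝ) (V : Opens E.base) (hV : V ≤ U), x ∈ V ∧
      ContMDiff (𝓡 E.dim) 𝓘(ℝ, ℝ) ∞ g ∧ ∀ (y : E.base) (hy : y ∈ V), f ⟨y, hV hy⟩ = g y := by
  obtain ⟨g, hg, h⟩ := (hf.smoothNear hx).globalize
  obtain ⟨s, hs, hso, hxs⟩ := eventually_nhds_iff.1 h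
  refine ⟨g, U ⊓ ⟨s, hso⟩, inf_le_left, ⟨hx, hxs⟩, hg, fun y hy => ?_⟩
  rw [← hs y hy.2, extend_apply_of_mem]

end SmoothVB

namespace LieAlgebroid
variable {E : SmoothVB} (A : LieAlgebroid E)

/-- The derivative of a smooth function along a section is smooth. -/
theorem contMDiff_dirDeriv_anchor (X : E.Sec) {f : E.base → ℝ}
    (hf : ContMDiff (𝓡 E.dim) 𝓘(ℝ, ℝ) ∞ f) :
    ContMDiff (𝓡 E.dim) 𝓘(ℝ, ℝ) ∞ fun x => E.dirDeriv f (A.anchor x (X x)) := by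
  have h1 : ContMDiff (𝓡 E.dim) (𝓡 E.dim).tangent ∞
      (fun x => (⟨x, A.anchor x (X x)⟩ : TangentBundle (𝓡 E.dim) E.base)) :=
    A.anchor_smooth.comp X.contMDiff
  have h2 := (hf.contMDiff_tangentMap (m := ∞) (by simp)).comp h1
  exact contMDiff_snd_tangentBundle_modelSpace ℝ 𝓘(ℝ, ℝ) |>.comp h2

theorem isSmoothFun_dirDerivOn (X : E.Sec) {U : Opens E.base} {f : U → ℝ} (hf : E.IsSmoothFun U f) :
    E.IsSmoothFun U fun x => E.dirDerivOn f (A.anchor x.1 (X x.1)) := by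
  refine SmoothVB.isSmoothFun_of_locally fun x hx => ?_
  obtain ⟨g, V, hV, hxV, hg, hgf⟩ := hf.exists_eventuallyEq hx
  refine ⟨V, hV, hxV, SmoothVB.isSmoothFun_of_smoothAt
    (F := fun x => E.dirDeriv g (A.anchor x (X x)))
    (fun y _ => A.contMDiff_dirDeriv_anchor X hg y) fun y hy => ?_⟩
  exact SmoothVB.dirDerivOn_eq hV hgf (x := ⟨y, hV hy⟩) hy _

end LieAlgebroid

/-! ### Operators on forms over the domain of a frame -/

namespace ExteriorAlgebra

variable {V V' : Type} [AddCommGroup V] [Module ℝ V] [AddCommGroup V'] [Module ℝ V']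

theorem map_invol (f : V →ₗ[ℝ] V') (a : ExteriorAlgebra ℝ V) : map f (invol a) = invol (map f a) := by
  have h : (map f).comp invol = invol.comp (map f) := by
    refine ExteriorAlgebra.hom_ext (LinearMap.ext fun v => ?_)
    change map f (invol (ι ℝ v)) = invol (map f (ι ℝ v))
    rw [invol_ι, map_apply_ι, invol_ι, map_neg, map_apply_ι]
  exact DFunLike.congr_fun h a

theorem contractLeft_map (f : V →ₗ[ℝ] V') (d : Module.Dual ℝ V') (a : ExteriorAlgebra ℝ V) :
    CliffordAlgebra.contractLeft d (map f a) = map f (CliffordAlgebra.contractLeft (d ∘ₗ f) a) := by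
  induction a using ExteriorAlgebra.induction with
  | algebraMap r =>
    rw [AlgHom.commutes]
    have h1 := CliffordAlgebra.contractLeft_algebraMap (Q := (0 : QuadraticForm ℝ V')) d r
    have h2 := CliffordAlgebra.contractLeft_algebraMap (Q := (0 : QuadraticForm ℝ V)) (d ∘ₗ f) r
    exact h1.trans ((map_zero (map f)).symm.trans (congrArg _ h2.symm))
  | ι v =>
    rw [map_apply_ι]
    have h1 := CliffordAlgebra.contractLeft_ι (Q := (0 : QuadraticForm ℝ V')) d (f v)
    have h2 := CliffordAlgebra.contractLeft_ι (Q := (0 : QuadraticForm ℝ V)) (d ∘ₗ f) v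
    refine h1.trans (Eq.trans ?_ (congrArg (map f) h2.symm))
    exact (AlgHom.commutes (map f) (d (f v))).symm
  | mul a b ha hb => rw [map_mul, contractLeft_mul, ha, hb, contractLeft_mul, map_add, map_mul, map_mul,
      map_invol]
  | add a b ha hb => rw [map_add, map_add, ha, hb, map_add, map_add]

end ExteriorAlgebra

namespace SmoothVB

variable {E : SmoothVB}

theorem contract_ι {x : E.base} (v : E.fib x) (α : Module.Dual ℝ (E.fib x)) :
    E.contract v (ExteriorAlgebra.ι ℝ α) = algebraMap ℝ _ (α v) :=
  CliffordAlgebra.contractLeft_ι (Q := (0 : QuadraticForm ℝ (Module.Dual ℝ (E.fib x)))) _ α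

theorem contract_algebraMap {x : E.base} (v : E.fib x) (r : ℝ) :
    E.contract v (algebraMap ℝ _ r) = 0 :=
  CliffordAlgebra.contractLeft_algebraMap (Q := (0 : QuadraticForm ℝ (Module.Dual ℝ (E.fib x)))) _ r

theorem contract_mul {x : E.base} (v : E.fib x) (a b : E.Ext x) :
    E.contract v (a * b) = E.contract v a * b + ExteriorAlgebra.invol a * E.contract v b :=
  ExteriorAlgebra.contractLeft_mul _ a b

theorem contract_add_left {x : E.base} (v w : E.fib x) (a : E.Ext x) :
    E.contract (v + w) a = E.contract v a + E.contract w a := by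
  unfold contract
  rw [map_add, map_add]
  rfl

theorem contract_smul_left {x : E.base} (r : ℝ) (v : E.fib x) (a : E.Ext x) :
    E.contract (r • v) a = r • E.contract v a := by
  unfold contract
  rw [map_smul, map_smul]
  rfl

theorem contract_sum_left {x : E.base} {κ : Type} (s : Finset κ) (r : κ → ℝ) (v : κ → E.fib x)
    (a : E.Ext x) : E.contract (∑ i ∈ s, r i • v i) a = ∑ i ∈ s, r i • E.contract (v i) a := by
  classical
  induction s using Finset.induction_on with
  | empty =>
    rw [Finset.sum_empty, Finset.sum_empty, ← zero_smul ℝ (0 : E.fib x), contract_smul_left, zero_smul]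
  | insert i s hi ih =>
    rw [Finset.sum_insert hi, Finset.sum_insert hi, contract_add_left, contract_smul_left, ih]

namespace LocalFrame

variable {W : Opens E.base} {ι : Type} [Fintype ι] (F : LocalFrame E W ι) {U : Opens E.base}
  (hU : U ≤ W)

theorem contract_expand [DecidableEq ι] (x : W) (k : ι) (w : ExteriorAlgebra ℝ (ι → ℝ)) :
    E.contract (F.basis x k) (F.expand x w) =
      F.expand x (CliffordAlgebra.contractLeft (LinearMap.proj k : Module.Dual ℝ (ι → ℝ)) w) := by
  unfold contract expand
  rw [ExteriorAlgebra.contractLeft_map]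
  congr 3
  ext j
  simp

theorem expand_mem {k : ℤ} (x : W) {w : ExteriorAlgebra ℝ (ι → ℝ)}
    (hw : w ∈ ExteriorAlgebra.intDeg (ι → ℝ) k) :
    F.expand x w ∈ ExteriorAlgebra.intDeg (Module.Dual ℝ (E.fib x.1)) k :=
  ExteriorAlgebra.map_mem_intDeg _ hw

theorem expand_intProj {k : ℤ} (x : W) (w : ExteriorAlgebra ℝ (ι → ℝ)) :
    F.expand x (ExteriorAlgebra.intProj _ k w) = ExteriorAlgebra.intProj _ k (F.expand x w) :=
  ExteriorAlgebra.map_intProj _ _ _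

/-- The extension of an operator on functions to forms, for which the frame is constant. -/
def extendOp (D : E.smoothFun U →ₗ[ℝ] E.smoothFun U) : E.shiftObj.func U →ₗ[ℝ] E.shiftObj.func U :=
  (F.formsEquiv hU).toLinearMap ∘ₗ D.rTensor _ ∘ₗ (F.formsEquiv hU).symm.toLinearMap

theorem val_toForms_sum {κ : Type} [Fintype κ] (f : κ → E.smoothFun U)
    (w : κ → ExteriorAlgebra ℝ (ι → ℝ)) (x : U) :
    E.val (F.toForms hU (∑ i, f i ⊗ₜ w i)) x = ∑ i, (f i).1 x • F.expand ⟨x.1, hU x.2⟩ (w i) := by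
  rw [map_sum]
  exact (map_sum (E.valHom x) _ _).trans
    (Finset.sum_congr rfl fun i _ => F.val_toForms_tmul hU (f i) (w i) x)

theorem val_extendOp (D : E.smoothFun U →ₗ[ℝ] E.smoothFun U) {a : E.shiftObj.func U} {κ : Type}
    [Fintype κ] (f : κ → E.smoothFun U) (w : κ → ExteriorAlgebra ℝ (ι → ℝ))
    (h : ∀ x : U, E.val a x = ∑ i, (f i).1 x • F.expand ⟨x.1, hU x.2⟩ (w i)) (x : U) :
    E.val (F.extendOp hU D a) x = ∑ i, (D (f i)).1 x • F.expand ⟨x.1, hU x.2⟩ (w i) := by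
  obtain rfl : F.formsEquiv hU (∑ i, f i ⊗ₜ w i) = a :=
    func_ext fun x => (F.val_toForms_sum hU f w x).trans (h x).symm
  change E.val (F.formsEquiv hU (D.rTensor _ ((F.formsEquiv hU).symm (F.formsEquiv hU _)))) x = _
  have h1 : D.rTensor (ExteriorAlgebra ℝ (ι → ℝ)) (∑ i, f i ⊗ₜ w i) = ∑ i, D (f i) ⊗ₜ[ℝ] w i :=
    _root_.map_sum (D.rTensor (ExteriorAlgebra ℝ (ι → ℝ))) (fun i => f i ⊗ₜ w i) Finset.univ
  rw [AlgEquiv.symm_apply_apply, h1]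
  exact F.val_toForms_sum hU (fun i => D (f i)) w x

theorem exists_eq_sum_of_mem_deg {k : ℤ} {a : E.shiftObj.func U} (ha : a ∈ E.shiftObj.deg U k) :
    ∃ (n : ℕ) (f : Fin n → E.smoothFun U) (w : Fin n → ExteriorAlgebra ℝ (ι → ℝ)),
      (∀ i, w i ∈ ExteriorAlgebra.intDeg _ k) ∧
      ∀ x : U, E.val a x = ∑ i, (f i).1 x • F.expand ⟨x.1, hU x.2⟩ (w i) := by
  obtain ⟨n, f, w, h⟩ := F.exists_eq_sum hU a
  refine ⟨n, f, fun i => ExteriorAlgebra.intProj _ k (w i), fun i => ExteriorAlgebra.intProj_mem _ _,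
    fun x => ?_⟩
  rw [← ExteriorAlgebra.intProj_of_mem (mem_deg_iff'.1 ha x), h x, map_sum]
  simp only [map_smul, F.expand_intProj]

theorem sum_smul_expand_mem {k : ℤ} {κ : Type} [Fintype κ] (x : W) (c : κ → ℝ)
    (w : κ → ExteriorAlgebra ℝ (ι → ℝ)) (hw : ∀ i, w i ∈ ExteriorAlgebra.intDeg _ k) :
    ∑ i, c i • F.expand x (w i) ∈ ExteriorAlgebra.intDeg (Module.Dual ℝ (E.fib x.1)) k :=
  Submodule.sum_mem _ fun i _ => Submodule.smul_mem _ _ (F.expand_mem _ (hw i))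

theorem extendOp_mem_deg (D : E.smoothFun U →ₗ[ℝ] E.smoothFun U) {k : ℤ} {a : E.shiftObj.func U}
    (ha : a ∈ E.shiftObj.deg U k) : F.extendOp hU D a ∈ E.shiftObj.deg U k := by
  obtain ⟨n, f, w, hw, h⟩ := F.exists_eq_sum_of_mem_deg hU ha
  have h2 : ∀ x : U, E.val (F.extendOp hU D a) x ∈
      ExteriorAlgebra.intDeg (Module.Dual ℝ (E.fib x.1)) k := by
    intro x
    have h3 := F.sum_smul_expand_mem ⟨x.1, hU x.2⟩ (fun i => (D (f i)).1 x) w hw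
    have h4 := F.val_extendOp hU D f w h x
    generalize E.val (F.extendOp hU D a) x = z at h4 ⊢
    subst h4
    exact h3
  exact mem_deg_iff'.2 h2

theorem val_extendOp_mul (D : E.smoothFun U →ₗ[ℝ] E.smoothFun U)
    (hD : ∀ (f g : E.smoothFun U) (x : U), (D (f * g)).1 x = (D f).1 x * g.1 x + f.1 x * (D g).1 x)
    (a b : E.shiftObj.func U) (x : U) :
    E.val (F.extendOp hU D (a * b)) x =
      E.val (F.extendOp hU D a) x * E.val b x + E.val a x * E.val (F.extendOp hU D b) x := by
  obtain ⟨n, f, w, h⟩ := F.exists_eq_sum hU a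
  obtain ⟨m, g, v, h'⟩ := F.exists_eq_sum hU b
  have e1 : ∀ y : U, E.val (a * b) y = ∑ i : Fin n × Fin m,
      (f i.1 * g i.2).1 y • F.expand ⟨y.1, hU y.2⟩ (w i.1 * v i.2) := fun y => by
    rw [val_mul, h, h', Finset.sum_mul_sum, Fintype.sum_prod_type]
    refine Finset.sum_congr rfl fun i _ => Finset.sum_congr rfl fun j _ => ?_
    rw [smul_mul_smul_comm, map_mul]
    rfl
  have e2 := F.val_extendOp hU D (fun i : Fin n × Fin m => f i.1 * g i.2)
    (fun i => w i.1 * v i.2) e1 x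
  have e3 := F.val_extendOp hU D f w h x
  have e4 := F.val_extendOp hU D g v h' x
  refine e2.trans ?_
  rw [e3, e4, h, h', Fintype.sum_prod_type, Finset.sum_mul_sum, Finset.sum_mul_sum]
  simp only [← Finset.sum_add_distrib]
  refine Finset.sum_congr rfl fun i _ => Finset.sum_congr rfl fun j _ => ?_
  rw [smul_mul_smul_comm, smul_mul_smul_comm, ← add_smul, hD, map_mul]

theorem val_extendOp_funForm (D : E.smoothFun U →ₗ[ℝ] E.smoothFun U) (f : U → ℝ)
    (hf : E.IsSmoothFun U f) (x : U) :
    E.val (F.extendOp hU D (E.funForm U f hf)) x = algebraMap ℝ _ ((D ⟨f, hf⟩).1 x) := by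
  rw [F.val_extendOp hU D (fun _ : Unit => ⟨f, hf⟩) (fun _ => 1) fun y => ?_]
  · simp [Algebra.algebraMap_eq_smul_one]
  · rw [val_funForm]
    simp [Algebra.algebraMap_eq_smul_one]

theorem val_extendOp_covecForm [DecidableEq ι] (D : E.smoothFun U →ₗ[ℝ] E.smoothFun U)
    (α : ∀ x : U, Module.Dual ℝ (E.fib x.1)) (hα : E.IsSmoothCovec U α) (x : U) :
    E.val (F.extendOp hU D (E.covecForm U α hα)) x =
      ∑ j, (D ⟨_, F.smooth_apply hU hα j⟩).1 x •
        ExteriorAlgebra.ι ℝ ((F.basis ⟨x.1, hU x.2⟩).coord j) := by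
  have h1 : ∀ (y : U) j, F.expand ⟨y.1, hU y.2⟩ (ExteriorAlgebra.ι ℝ (Pi.single j 1)) =
      ExteriorAlgebra.ι ℝ ((F.basis ⟨y.1, hU y.2⟩).coord j) := fun y j => by
    rw [← F.constr_single]
    exact ExteriorAlgebra.map_apply_ι _ _
  rw [F.val_extendOp hU D (fun j => ⟨_, F.smooth_apply hU hα j⟩)
    (fun j => ExteriorAlgebra.ι ℝ (Pi.single j 1)) fun y => ?_]
  · simp only [h1]
  · rw [val_covecForm]
    conv_lhs => rw [← F.sum_apply_smul_coord ⟨y.1, hU y.2⟩ (α y), map_sum]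
    simp only [h1, map_smul]

theorem extendOp_res {V : Opens E.base} (h : V ≤ U) (D : E.smoothFun U →ₗ[ℝ] E.smoothFun U)
    (D' : E.smoothFun V →ₗ[ℝ] E.smoothFun V)
    (hD : ∀ (f : E.smoothFun U) (x : V), (D' ⟨_, IsSmoothFun.restr h f.2⟩).1 x = (D f).1 ⟨x.1, h x.2⟩)
    (a : E.shiftObj.func U) :
    F.extendOp (h.trans hU) D' (E.shiftObj.res h a) = E.shiftObj.res h (F.extendOp hU D a) := by
  obtain ⟨n, f, w, h'⟩ := F.exists_eq_sum hU a
  refine func_ext fun x => ?_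
  rw [val_res, F.val_extendOp hU D f w h', F.val_extendOp (h.trans hU) D'
    (fun i => ⟨_, IsSmoothFun.restr h (f i).2⟩) w fun y => h' ⟨y.1, h y.2⟩]
  simp only [hD]

/-- Contraction of forms with an element of the frame. -/
def contractOp [DecidableEq ι] (k : ι) : E.shiftObj.func U →ₗ[ℝ] E.shiftObj.func U where
  toFun a := (⟨fun x => E.contract (F.basis ⟨x.1, hU x.2⟩ k) (E.val a x), by
    obtain ⟨n, f, w, h⟩ := F.exists_eq_sum hU a
    refine F.mem_forms hU f
      (fun i => CliffordAlgebra.contractLeft (LinearMap.proj k : Module.Dual ℝ (ι → ℝ)) (w i)) fun x => ?_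
    simp only [h, map_sum, map_smul, F.contract_expand]⟩ : E.forms U)
  map_add' a b := func_ext fun x => map_add (E.contract _) (E.val a x) (E.val b x)
  map_smul' r a := func_ext fun x => map_smul (E.contract _) r (E.val a x)

end LocalFrame

end SmoothVB



namespace SmoothVB

variable {E : SmoothVB}

theorem contract_mem {x : E.base} (v : E.fib x) {n : ℕ} {a : E.Ext x}
    (ha : a ∈ ExteriorAlgebra.intDeg (Module.Dual ℝ (E.fib x)) ((n + 1 : ℕ) : ℤ)) :
    E.contract v a ∈ ExteriorAlgebra.intDeg (Module.Dual ℝ (E.fib x)) (n : ℤ) :=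
  ExteriorAlgebra.contractLeft_mem _ ha

/-- A `1`-form is determined by its values on a basis. -/
theorem eq_of_contract {ι : Type} [Fintype ι] {x : E.base} (b : Module.Basis ι ℝ (E.fib x))
    {n : ℕ} {a a' : E.Ext x}
    (ha : a ∈ ExteriorAlgebra.intDeg (Module.Dual ℝ (E.fib x)) ((n + 1 : ℕ) : ℤ))
    (ha' : a' ∈ ExteriorAlgebra.intDeg (Module.Dual ℝ (E.fib x)) ((n + 1 : ℕ) : ℤ))
    (h : ∀ j, E.contract (b j) a = E.contract (b j) a') : a = a' := by
  rw [← sub_eq_zero]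
  refine ExteriorAlgebra.eq_zero_of_contractLeft b (n := n) (Submodule.sub_mem _ ha ha') fun j => ?_
  rw [map_sub]
  exact sub_eq_zero.2 (h j)

theorem eq_of_contract_contract {ι : Type} [Fintype ι] {x : E.base} (b : Module.Basis ι ℝ (E.fib x))
    {a a' : E.Ext x} (ha : a ∈ ExteriorAlgebra.intDeg (Module.Dual ℝ (E.fib x)) 2)
    (ha' : a' ∈ ExteriorAlgebra.intDeg (Module.Dual ℝ (E.fib x)) 2)
    (h : ∀ i j, E.contract (b j) (E.contract (b i) a) = E.contract (b j) (E.contract (b i) a')) :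
    a = a' :=
  eq_of_contract b (n := 1) ha ha' fun i =>
    eq_of_contract b (n := 0) (contract_mem (n := 1) _ ha) (contract_mem (n := 1) _ ha') (h i)

theorem eq_of_contract_contract_contract {ι : Type} [Fintype ι] {x : E.base}
    (b : Module.Basis ι ℝ (E.fib x))
    {a a' : E.Ext x} (ha : a ∈ ExteriorAlgebra.intDeg (Module.Dual ℝ (E.fib x)) 3)
    (ha' : a' ∈ ExteriorAlgebra.intDeg (Module.Dual ℝ (E.fib x)) 3)
    (h : ∀ i j k, E.contract (b k) (E.contract (b j) (E.contract (b i) a)) =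
      E.contract (b k) (E.contract (b j) (E.contract (b i) a'))) :
    a = a' :=
  eq_of_contract b (n := 2) ha ha' fun i =>
    eq_of_contract_contract b (contract_mem (n := 2) _ ha) (contract_mem (n := 2) _ ha') (h i)

end SmoothVB

namespace LieAlgebroid

variable {E : SmoothVB} (A : LieAlgebroid E)

/-- The derivative of functions on an open set along a section. -/
def deriv (X : E.Sec) (U : Opens E.base) : E.smoothFun U →ₗ[ℝ] E.smoothFun U where
  toFun f := ⟨fun x => E.dirDerivOn f.1 (A.anchor x.1 (X x.1)), A.isSmoothFun_dirDerivOn X f.2⟩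
  map_add' f g := by
    refine Subtype.ext (funext fun x => ?_)
    refine (SmoothVB.dirDerivOn_eq (F := fun y => Function.extend Subtype.val f.1 0 y +
      Function.extend Subtype.val g.1 0 y) (le_refl U) (fun y hy => ?_) x.2 _).trans ?_
    · rw [SmoothVB.extend_apply_of_mem _ hy, SmoothVB.extend_apply_of_mem _ hy]
      rfl
    · exact SmoothVB.dirDeriv_add (SmoothVB.IsSmoothFun.smoothAt f.2 x.2)
        (SmoothVB.IsSmoothFun.smoothAt g.2 x.2) _
  map_smul' r f := by
    refine Subtype.ext (funext fun x => ?_)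
    refine (SmoothVB.dirDerivOn_eq (F := fun y => r *
      Function.extend Subtype.val f.1 0 y) (le_refl U) (fun y hy => ?_) x.2 _).trans ?_
    · rw [SmoothVB.extend_apply_of_mem _ hy]
      rfl
    · refine (SmoothVB.dirDeriv_mul contMDiffAt_const
        (SmoothVB.IsSmoothFun.smoothAt f.2 x.2) _).trans ?_
      rw [SmoothVB.dirDeriv_const, zero_mul, zero_add]
      rfl

theorem deriv_apply (X : E.Sec) (U : Opens E.base) (f : E.smoothFun U) (x : U) :
    (A.deriv X U f).1 x = E.dirDerivOn f.1 (A.anchor x.1 (X x.1)) := rfl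

theorem deriv_mul (X : E.Sec) (U : Opens E.base) (f g : E.smoothFun U) (x : U) :
    (A.deriv X U (f * g)).1 x = (A.deriv X U f).1 x * g.1 x + f.1 x * (A.deriv X U g).1 x := by
  refine (SmoothVB.dirDerivOn_eq (F := fun y => Function.extend Subtype.val f.1 0 y *
    Function.extend Subtype.val g.1 0 y) (le_refl U) (fun y hy => ?_) x.2 _).trans ?_
  · rw [SmoothVB.extend_apply_of_mem _ hy, SmoothVB.extend_apply_of_mem _ hy]
    rfl
  · refine (SmoothVB.dirDeriv_mul (SmoothVB.IsSmoothFun.smoothAt f.2 x.2)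
      (SmoothVB.IsSmoothFun.smoothAt g.2 x.2) _).trans ?_
    rw [SmoothVB.extend_apply_of_mem _ x.2, SmoothVB.extend_apply_of_mem _ x.2]
    rfl

theorem deriv_restr (X : E.Sec) {U V : Opens E.base} (h : V ≤ U) (f : E.smoothFun U) (x : V) :
    (A.deriv X V ⟨_, SmoothVB.IsSmoothFun.restr h f.2⟩).1 x = (A.deriv X U f).1 ⟨x.1, h x.2⟩ :=
  SmoothVB.dirDerivOn_restr h f.1 x _

/-- A Lie algebroid differential on the forms over the open subsets of `W`. The derivation property
is stated at every point, with the sign given by the grading involution. -/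
structure LocalDifferential (W : Opens E.base) where
  toFun : ∀ U : Opens E.base, U ≤ W → E.shiftObj.func U →ₗ[ℝ] E.shiftObj.func U
  res : ∀ {U V : Opens E.base} (h : V ≤ U) (hU : U ≤ W) (a : E.shiftObj.func U),
    toFun V (h.trans hU) (E.shiftObj.res h a) = E.shiftObj.res h (toFun U hU a)
  leibniz : ∀ (U : Opens E.base) (hU : U ≤ W) (a b : E.shiftObj.func U) (x : U),
    E.val (toFun U hU (a * b)) x = E.val (toFun U hU a) x * E.val b x +
      ExteriorAlgebra.invol (E.val a x) * E.val (toFun U hU b) x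
  map_deg : ∀ (U : Opens E.base) (hU : U ≤ W) (k : ℤ), ∀ a ∈ E.shiftObj.deg U k,
    toFun U hU a ∈ E.shiftObj.deg U (k + 1)
  map_fun : ∀ (U : Opens E.base) (hU : U ≤ W) (f : U → ℝ) (hf : E.IsSmoothFun U f) (x : U)
    (v : E.fib x.1), E.contract v (E.val (toFun U hU (E.funForm U f hf)) x) =
      algebraMap ℝ _ (E.dirDerivOn f (A.anchor x.1 v))
  map_covec : ∀ (U : Opens E.base) (hU : U ≤ W) (α : ∀ x : U, Module.Dual ℝ (E.fib x.1))
    (hα : E.IsSmoothCovec U α) (X Y : E.Sec) (x : U),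
    E.contract (Y x.1) (E.contract (X x.1) (E.val (toFun U hU (E.covecForm U α hα)) x)) =
      algebraMap ℝ _ (E.dirDerivOn (fun y => α y (Y y.1)) (A.anchor x.1 (X x.1)) -
        E.dirDerivOn (fun y => α y (X y.1)) (A.anchor x.1 (Y x.1)) -
        α x (A.bracket X Y x.1))

namespace LocalDifferential

variable {A}

/-- Uniqueness of the Lie algebroid differential. -/
theorem val_eq {W W' : Opens E.base} (D : A.LocalDifferential W) (D' : A.LocalDifferential W')
    {x : E.base} {U : Opens E.base} (hx : x ∈ U) (hU : U ≤ W) (hU' : U ≤ W') (a : E.shiftObj.func U) :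
    E.val (D.toFun U hU a) ⟨x, hx⟩ = E.val (D'.toFun U hU' a) ⟨x, hx⟩ := by
  obtain ⟨W₀, F, Z, hxW₀, hZ⟩ := E.exists_localFrame x
  have key : ∀ (hx : x ∈ U) (hU : U ≤ W) (hU' : U ≤ W'),
      E.val (D.toFun U hU a) ⟨x, hx⟩ = E.val (D'.toFun U hU' a) ⟨x, hx⟩ := by
    refine SmoothVB.func_induction x (P := fun U a => ∀ (hx : x ∈ U) (hU : U ≤ W) (hU' : U ≤ W'),
      E.val (D.toFun U hU a) ⟨x, hx⟩ = E.val (D'.toFun U hU' a) ⟨x, hx⟩) ?_ ?_ ?_ ?_ ?_ hx a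
    · intro U V h hxV a ih hx hU hU'
      have h1 := ih hxV (h.trans hU) (h.trans hU')
      rw [D.res h hU, D'.res h hU'] at h1
      exact h1
    · intro U hx f hf hx hU hU'
      refine SmoothVB.eq_of_contract (F.basis ⟨x, hxW₀⟩) (n := 0) ?_ ?_ fun j => ?_
      · exact SmoothVB.mem_deg_iff'.1 (D.map_deg U hU 0 _ (SmoothVB.funForm_mem_deg f hf)) ⟨x, hx⟩
      · exact SmoothVB.mem_deg_iff'.1 (D'.map_deg U hU' 0 _ (SmoothVB.funForm_mem_deg f hf)) ⟨x, hx⟩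
      · rw [D.map_fun U hU f hf ⟨x, hx⟩, D'.map_fun U hU' f hf ⟨x, hx⟩]
    · intro U hx α hα hx hU hU'
      refine SmoothVB.eq_of_contract_contract (F.basis ⟨x, hxW₀⟩) ?_ ?_ fun i j => ?_
      · exact SmoothVB.mem_deg_iff'.1 (D.map_deg U hU 1 _ (SmoothVB.covecForm_mem_deg α hα)) ⟨x, hx⟩
      · exact SmoothVB.mem_deg_iff'.1 (D'.map_deg U hU' 1 _ (SmoothVB.covecForm_mem_deg α hα)) ⟨x, hx⟩
      · rw [hZ, hZ, D.map_covec U hU α hα _ _ ⟨x, hx⟩, D'.map_covec U hU' α hα _ _ ⟨x, hx⟩]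
    · intro U _ a b ha hb hx hU hU'
      rw [map_add, map_add, SmoothVB.val_add, SmoothVB.val_add, ha hx hU hU', hb hx hU hU']
    · intro U _ a b ha hb hx hU hU'
      rw [D.leibniz, D'.leibniz, ha hx hU hU', hb hx hU hU']
  exact key hx hU hU'

end LocalDifferential

section Frame

variable {W : Opens E.base} {ι : Type} [Fintype ι] (F : E.LocalFrame W ι) (Z : ι → E.Sec)

/-- The structure functions of the bracket in a frame. -/
def structureFun (i j k : ι) (x : W) : ℝ := (F.basis x).coord k (A.bracket (Z i) (Z j) x.1)

theorem isSmoothFun_structureFun (i j k : ι) : E.IsSmoothFun W (A.structureFun F Z i j k) :=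
  (F.smooth_coord k).apply_sec (A.bracket (Z i) (Z j))

theorem structureFun_skew (i j k : ι) (x : W) :
    A.structureFun F Z i j k x = -A.structureFun F Z j i k x := by
  unfold structureFun
  rw [A.bracket_skew]
  exact map_neg ((F.basis x).coord k) _

variable {U : Opens E.base} (hU : U ≤ W)

/-- The covectors of a frame as functions on `[-1]E`. -/
def frameCovec (j : ι) : E.shiftObj.func U :=
  E.covecForm U _ ((F.smooth_coord j).restr hU)

theorem val_frameCovec (j : ι) (x : U) :
    E.val (frameCovec F hU j) x = ExteriorAlgebra.ι ℝ ((F.basis ⟨x.1, hU x.2⟩).coord j) := rfl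

theorem val_sum {κ : Type} (s : Finset κ) (a : κ → E.shiftObj.func U) (x : U) :
    E.val (∑ i ∈ s, a i) x = ∑ i ∈ s, E.val (a i) x := map_sum (E.valHom x) _ _

/-- The differentials of the covectors of a frame. -/
def frameDiff (k : ι) : E.shiftObj.func U :=
  (-1 / 2 : ℝ) • ∑ i, ∑ j, E.funForm U _ ((A.isSmoothFun_structureFun F Z i j k).restr hU) *
    (frameCovec F hU i * frameCovec F hU j)

theorem val_frameDiff (k : ι) (x : U) : E.val (A.frameDiff F Z hU k) x =
    (-1 / 2 : ℝ) • ∑ i, ∑ j, A.structureFun F Z i j k ⟨x.1, hU x.2⟩ •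
      (ExteriorAlgebra.ι ℝ ((F.basis ⟨x.1, hU x.2⟩).coord i) *
        ExteriorAlgebra.ι ℝ ((F.basis ⟨x.1, hU x.2⟩).coord j)) := by
  rw [frameDiff, SmoothVB.val_smul]
  simp only [val_sum, SmoothVB.val_mul, SmoothVB.val_funForm, val_frameCovec, Algebra.smul_def]

variable [DecidableEq ι]

/-- The Lie algebroid differential in a frame. -/
def frameOp : E.shiftObj.func U →ₗ[ℝ] E.shiftObj.func U :=
  ∑ j, (LinearMap.mulLeft ℝ (frameCovec F hU j) ∘ₗ F.extendOp hU (A.deriv (Z j) U) +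
    LinearMap.mulLeft ℝ (A.frameDiff F Z hU j) ∘ₗ F.contractOp hU j)

theorem val_frameOp (a : E.shiftObj.func U) (x : U) : E.val (A.frameOp F Z hU a) x =
    ∑ j, (ExteriorAlgebra.ι ℝ ((F.basis ⟨x.1, hU x.2⟩).coord j) *
        E.val (F.extendOp hU (A.deriv (Z j) U) a) x +
      E.val (A.frameDiff F Z hU j) x * E.contract (F.basis ⟨x.1, hU x.2⟩ j) (E.val a x)) := by
  rw [frameOp, LinearMap.sum_apply, val_sum]
  rfl

end Frame

end LieAlgebroid



namespace SmoothVB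

variable {E : SmoothVB}

theorem contract_mem_int {x : E.base} (v : E.fib x) {k : ℤ} {a : E.Ext x}
    (ha : a ∈ ExteriorAlgebra.intDeg (Module.Dual ℝ (E.fib x)) k) :
    E.contract v a ∈ ExteriorAlgebra.intDeg (Module.Dual ℝ (E.fib x)) (k - 1) := by
  match k, ha with
  | Int.negSucc n, ha =>
    rw [show a = 0 from ha, map_zero]
    exact Submodule.zero_mem _
  | Int.ofNat 0, ha =>
    rw [ExteriorAlgebra.eq_algebraMap_of_mem_intDeg_zero ha, contract_algebraMap]
    exact Submodule.zero_mem _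
  | Int.ofNat (n + 1), ha =>
    have h := contract_mem (n := n) v ha
    rwa [show (Int.ofNat (n + 1) : ℤ) - 1 = (n : ℤ) by simp]

theorem contract_contract_ι_mul_ι {x : E.base} (v w : E.fib x) (α β : Module.Dual ℝ (E.fib x)) :
    E.contract w (E.contract v (ExteriorAlgebra.ι ℝ α * ExteriorAlgebra.ι ℝ β)) =
      algebraMap ℝ _ (α v * β w - β v * α w) := by
  rw [contract_mul, contract_ι, contract_ι, ExteriorAlgebra.invol_ι, map_add, ← Algebra.smul_def,
    map_smul, contract_ι, ← Algebra.commutes, ← Algebra.smul_def, map_smul, map_neg, contract_ι,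
    map_sub, map_mul, map_mul, Algebra.smul_def, Algebra.smul_def, mul_neg, sub_eq_add_neg]

end SmoothVB

namespace LieAlgebroid

variable {E : SmoothVB} (A : LieAlgebroid E)

/-- The derivative of a function on an open set, as a linear function on the fibre. -/
def derivAt {U : Opens E.base} (f : U → ℝ) (x : U) : E.fib x.1 →ₗ[ℝ] ℝ :=
  (show E.Tan x.1 →L[ℝ] ℝ from
    mfderiv (𝓡 E.dim) 𝓘(ℝ, ℝ) (Function.extend Subtype.val f 0) x.1).toLinearMap ∘ₗ A.anchor x.1

theorem derivAt_apply {U : Opens E.base} (f : U → ℝ) (x : U) (v : E.fib x.1) :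
    A.derivAt f x v = E.dirDerivOn f (A.anchor x.1 v) := rfl

theorem derivAt_eq_sum {W : Opens E.base} {ι : Type} [Fintype ι] (F : E.LocalFrame W ι)
    {U : Opens E.base} (hU : U ≤ W) (f : U → ℝ) (x : U) (v : E.fib x.1) :
    E.dirDerivOn f (A.anchor x.1 v) = ∑ j, (F.basis ⟨x.1, hU x.2⟩).coord j v *
      E.dirDerivOn f (A.anchor x.1 (F.basis ⟨x.1, hU x.2⟩ j)) := by
  rw [← derivAt_apply]
  conv_lhs => rw [← (F.basis ⟨x.1, hU x.2⟩).sum_repr v, map_sum]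
  refine Finset.sum_congr rfl fun j _ => ?_
  rw [map_smul]
  rfl

/-- The computation of the differential of a covector in a frame. -/
theorem frame_identity {ι : Type} [Fintype ι] (a b α Xb Ya : ι → ℝ) (z : ι → ι → ℝ)
    (c : ι → ι → ι → ℝ) (hc : ∀ i j k, c i j k = -c j i k) :
    ∑ j, ((∑ k, z j k * (a j * b k - a k * b j)) +
        α j * (-1 / 2 * ∑ i, ∑ l, c i l j * (a i * b l - a l * b i))) =
      ∑ k, ((∑ j, a j * z j k) * b k + α k * Xb k) - ∑ k, ((∑ j, b j * z j k) * a k + α k * Ya k) -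
        (∑ i, ∑ j, a i * b j * (∑ k, α k * c i j k) + ∑ j, Xb j * α j - ∑ j, Ya j * α j) := by
  have e1 : ∀ j, ∑ i, ∑ l, c i l j * (a i * b l - a l * b i) = 2 * ∑ i, ∑ l, a i * b l * c i l j := by
    intro j
    have : ∑ i, ∑ l, c i l j * (a l * b i) = -∑ i, ∑ l, a i * b l * c i l j := by
      rw [Finset.sum_comm]
      simp only [← Finset.sum_neg_distrib]
      refine Finset.sum_congr rfl fun i _ => Finset.sum_congr rfl fun l _ => ?_
      rw [hc]
      ring
    simp only [mul_sub, Finset.sum_sub_distrib, this]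
    simp only [mul_comm (c _ _ _)]
    ring
  have e2 : ∑ j, ∑ k, z j k * (a j * b k) = ∑ k, (∑ j, a j * z j k) * b k := by
    rw [Finset.sum_comm]
    refine Finset.sum_congr rfl fun k _ => ?_
    rw [Finset.sum_mul]
    exact Finset.sum_congr rfl fun j _ => by ring
  have e3 : ∑ j, ∑ k, z j k * (a k * b j) = ∑ k, (∑ j, b j * z j k) * a k := by
    rw [Finset.sum_comm]
    refine Finset.sum_congr rfl fun k _ => ?_
    rw [Finset.sum_mul]
    exact Finset.sum_congr rfl fun j _ => by ring
  have e4 : ∑ i, ∑ j, a i * b j * (∑ k, α k * c i j k) = ∑ k, α k * ∑ i, ∑ j, a i * b j * c i j k := by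
    simp only [Finset.mul_sum]
    rw [Finset.sum_comm' (t' := Finset.univ) (s' := fun _ => Finset.univ) (by simp)]
    rw [Finset.sum_comm]
    calc _ = ∑ i, ∑ k, ∑ j, a i * b j * (α k * c i j k) :=
          Finset.sum_congr rfl fun i _ => Finset.sum_comm
      _ = ∑ k, ∑ i, ∑ j, a i * b j * (α k * c i j k) := Finset.sum_comm
      _ = _ := Finset.sum_congr rfl fun k _ => Finset.sum_congr rfl fun i _ =>
          Finset.sum_congr rfl fun j _ => by ring
  simp only [e1]
  simp only [mul_sub, Finset.sum_add_distrib, Finset.sum_sub_distrib, e2, e3, e4]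
  have e5 : ∑ j, α j * (-1 / 2 * (2 * ∑ i, ∑ l, a i * b l * c i l j)) =
      -∑ k, α k * ∑ i, ∑ j, a i * b j * c i j k := by
    rw [← Finset.sum_neg_distrib]
    exact Finset.sum_congr rfl fun j _ => by ring
  rw [e5]
  simp only [mul_comm (α _) (Xb _), mul_comm (α _) (Ya _)]
  ring

section Frame

variable {W : Opens E.base} (F : E.LocalFrame W (Fin E.rank)) (Z : Fin E.rank → E.Sec)
  {U : Opens E.base} (hU : U ≤ W)

theorem frameDiff_mem (k : Fin E.rank) : A.frameDiff F Z hU k ∈ E.shiftObj.deg U 2 := by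
  refine Submodule.smul_mem _ _ (Submodule.sum_mem _ fun i _ => Submodule.sum_mem _ fun j _ => ?_)
  have h := SmoothVB.isSupermanifold_shiftObj E
  have h1 : frameCovec F hU i * frameCovec F hU j ∈ E.shiftObj.deg U (1 + 1) :=
    h.mul_mem U 1 1 _ (SmoothVB.covecForm_mem_deg _ _) _ (SmoothVB.covecForm_mem_deg _ _)
  exact h.mul_mem U 0 2 _ (SmoothVB.funForm_mem_deg _ _) _ h1

theorem frameOp_mem_deg {k : ℤ} {a : E.shiftObj.func U} (ha : a ∈ E.shiftObj.deg U k) :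
    A.frameOp F Z hU a ∈ E.shiftObj.deg U (k + 1) := by
  have h := SmoothVB.isSupermanifold_shiftObj E
  rw [frameOp, LinearMap.sum_apply]
  refine Submodule.sum_mem _ fun j _ => Submodule.add_mem _ ?_ ?_
  · rw [add_comm]
    exact h.mul_mem U 1 k _ (SmoothVB.covecForm_mem_deg _ _) _ (F.extendOp_mem_deg hU _ ha)
  · rw [show k + 1 = 2 + (k - 1) by ring]
    exact h.mul_mem U 2 (k - 1) _ (A.frameDiff_mem F Z hU j) _ (SmoothVB.mem_deg_iff'.2 fun x =>
      SmoothVB.contract_mem_int _ (SmoothVB.mem_deg_iff'.1 ha x))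

theorem val_frameDiff_commute (k : Fin E.rank) (x : U) (b : E.Ext x.1) :
    E.val (A.frameDiff F Z hU k) x * b = b * E.val (A.frameDiff F Z hU k) x := by
  rw [val_frameDiff, smul_mul_assoc, mul_smul_comm, Finset.sum_mul, Finset.mul_sum]
  congr 1
  refine Finset.sum_congr rfl fun i _ => ?_
  rw [Finset.sum_mul, Finset.mul_sum]
  refine Finset.sum_congr rfl fun j _ => ?_
  rw [smul_mul_assoc, mul_smul_comm, ExteriorAlgebra.ι_mul_ι_commute]

theorem frameOp_leibniz (a b : E.shiftObj.func U) (x : U) :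
    E.val (A.frameOp F Z hU (a * b)) x = E.val (A.frameOp F Z hU a) x * E.val b x +
      ExteriorAlgebra.invol (E.val a x) * E.val (A.frameOp F Z hU b) x := by
  rw [val_frameOp, val_frameOp, val_frameOp, Finset.sum_mul, Finset.mul_sum, ← Finset.sum_add_distrib]
  refine Finset.sum_congr rfl fun j _ => ?_
  rw [F.val_extendOp_mul hU _ (A.deriv_mul (Z j) U), SmoothVB.val_mul, SmoothVB.contract_mul]
  have h1 : ∀ (α : Module.Dual ℝ (E.fib x.1)) (z : E.Ext x.1), ExteriorAlgebra.ι ℝ α * (E.val a x * z) =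
      ExteriorAlgebra.invol (E.val a x) * (ExteriorAlgebra.ι ℝ α * z) := fun α z => by
    rw [← mul_assoc, ExteriorAlgebra.ι_mul_eq_invol_mul, mul_assoc]
  have h2 : ∀ z : E.Ext x.1, E.val (A.frameDiff F Z hU j) x *
      (ExteriorAlgebra.invol (E.val a x) * z) =
      ExteriorAlgebra.invol (E.val a x) * (E.val (A.frameDiff F Z hU j) x * z) := fun z => by
    rw [← mul_assoc, A.val_frameDiff_commute F Z hU j x, mul_assoc]
  simp only [mul_add, add_mul, h1, h2, mul_assoc]
  abel

theorem val_frameOp_funForm (f : U → ℝ) (hf : E.IsSmoothFun U f) (x : U) :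
    E.val (A.frameOp F Z hU (E.funForm U f hf)) x =
      ∑ j, E.dirDerivOn f (A.anchor x.1 (Z j x.1)) •
        ExteriorAlgebra.ι ℝ ((F.basis ⟨x.1, hU x.2⟩).coord j) := by
  rw [val_frameOp]
  refine Finset.sum_congr rfl fun j _ => ?_
  rw [F.val_extendOp_funForm, SmoothVB.val_funForm, SmoothVB.contract_algebraMap, mul_zero, add_zero,
    ← Algebra.commutes, ← Algebra.smul_def]
  rfl

theorem val_frameOp_covecForm (α : ∀ x : U, Module.Dual ℝ (E.fib x.1)) (hα : E.IsSmoothCovec U α)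
    (x : U) : E.val (A.frameOp F Z hU (E.covecForm U α hα)) x =
      ∑ j, ((∑ k, E.dirDerivOn (fun y : U => α y (F.basis ⟨y.1, hU y.2⟩ k))
          (A.anchor x.1 (Z j x.1)) •
        (ExteriorAlgebra.ι ℝ ((F.basis ⟨x.1, hU x.2⟩).coord j) *
          ExteriorAlgebra.ι ℝ ((F.basis ⟨x.1, hU x.2⟩).coord k))) +
        α x (F.basis ⟨x.1, hU x.2⟩ j) • E.val (A.frameDiff F Z hU j) x) := by
  rw [val_frameOp]
  refine Finset.sum_congr rfl fun j _ => ?_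
  rw [F.val_extendOp_covecForm, SmoothVB.val_covecForm, SmoothVB.contract_ι, ← Algebra.commutes,
    ← Algebra.smul_def, Finset.mul_sum]
  simp only [mul_smul_comm]
  rfl

/-- The Lie algebroid differential over the domain of a frame. -/
def frameDifferential (hZ : ∀ y j, F.basis y j = Z j y.1) : A.LocalDifferential W where
  toFun U hU := A.frameOp F Z hU
  res {U V} h hU a := by
    refine SmoothVB.func_ext fun x => ?_
    rw [SmoothVB.val_res, val_frameOp, val_frameOp]
    refine Finset.sum_congr rfl fun j _ => ?_
    rw [F.extendOp_res hU h _ _ fun f x => A.deriv_restr (Z j) h f x,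
      val_frameDiff, val_frameDiff]
    rfl
  leibniz U hU := A.frameOp_leibniz F Z hU
  map_deg U hU k a ha := A.frameOp_mem_deg F Z hU ha
  map_fun U hU f hf x v := by
    rw [val_frameOp_funForm, map_sum, A.derivAt_eq_sum F hU, map_sum]
    refine Finset.sum_congr rfl fun j _ => ?_
    rw [map_smul, SmoothVB.contract_ι, hZ, map_mul, Algebra.smul_def, Algebra.commutes]
  map_covec U hU α hα X Y x := by
    let αj : Fin E.rank → E.smoothFun U := fun j => ⟨_, F.smooth_apply hU hα j⟩
    let crd : E.Sec → Fin E.rank → E.smoothFun U := fun X j =>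
      ⟨_, ((F.smooth_coord j).restr hU).apply_sec X⟩
    have hcrd : ∀ (X : E.Sec) (y : U), X y.1 = ∑ j, (crd X j).1 y • Z j y.1 := fun X y => by
      conv_lhs => rw [← (F.basis ⟨y.1, hU y.2⟩).sum_repr (X y.1)]
      exact Finset.sum_congr rfl fun j _ => by rw [hZ]; rfl
    have hpair : ∀ X : E.Sec, (⟨_, hα.apply_sec X⟩ : E.smoothFun U) = ∑ j, αj j * crd X j := by
      intro X
      refine Subtype.ext (funext fun y => ?_)
      have h1 : (∑ j, αj j * crd X j).1 y = ∑ j, (αj j).1 y * (crd X j).1 y := by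
        rw [AddSubmonoidClass.coe_finsetSum, Finset.sum_apply]
        rfl
      refine Eq.trans ?_ h1.symm
      change α y (X y.1) = _
      rw [hcrd X y, map_sum]
      refine Finset.sum_congr rfl fun j _ => ?_
      rw [map_smul, ← hZ ⟨y.1, hU y.2⟩, smul_eq_mul, mul_comm]
    have hder : ∀ X Y : E.Sec, E.dirDerivOn (fun y : U => α y (Y y.1)) (A.anchor x.1 (X x.1)) =
        ∑ k, ((∑ j, (crd X j).1 x * E.dirDerivOn (αj k).1 (A.anchor x.1 (Z j x.1))) * (crd Y k).1 x +
          (αj k).1 x * (A.deriv X U (crd Y k)).1 x) := by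
      intro X Y
      have h1 : (A.deriv X U ⟨_, hα.apply_sec Y⟩).1 x =
          E.dirDerivOn (fun y : U => α y (Y y.1)) (A.anchor x.1 (X x.1)) := rfl
      rw [← h1, hpair, map_sum, AddSubmonoidClass.coe_finsetSum, Finset.sum_apply]
      refine Finset.sum_congr rfl fun k _ => ?_
      rw [A.deriv_mul, A.deriv_apply X U (αj k), A.derivAt_eq_sum F hU]
      simp only [hZ]
      rfl
    have hbr : A.bracket X Y x.1 = ∑ i, ∑ j, ((crd X i).1 x * (crd Y j).1 x) •
        A.bracket (Z i) (Z j) x.1 + ∑ j, (A.deriv X U (crd Y j)).1 x • Z j x.1 -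
        ∑ i, (A.deriv Y U (crd X i)).1 x • Z i x.1 := by
      have hnear : ∀ X : E.Sec, ∀ᶠ y in 𝓝 x.1, X y =
          ∑ j, Function.extend Subtype.val (crd X j).1 0 y • Z j y := fun X => by
        filter_upwards [U.isOpen.mem_nhds x.2] with y hy
        rw [hcrd X ⟨y, hy⟩]
        exact Finset.sum_congr rfl fun j _ => by rw [SmoothVB.extend_apply_of_mem _ hy]
      have h2 := A.bracket_sum X Y x.1 (fun j => Function.extend Subtype.val (crd X j).1 0) Z
        (fun j => Function.extend Subtype.val (crd Y j).1 0) Z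
        (fun j => SmoothVB.IsSmoothFun.smoothNear (crd X j).2 x.2)
        (fun j => SmoothVB.IsSmoothFun.smoothNear (crd Y j).2 x.2) (hnear X) (hnear Y)
      rw [h2]
      simp only [SmoothVB.extend_apply_of_mem _ x.2]
      rfl
    have hαbr : α x (A.bracket X Y x.1) = ∑ i, ∑ j, (crd X i).1 x * (crd Y j).1 x *
        (∑ k, (αj k).1 x * A.structureFun F Z i j k ⟨x.1, hU x.2⟩) +
        ∑ j, (A.deriv X U (crd Y j)).1 x * (αj j).1 x -
        ∑ i, (A.deriv Y U (crd X i)).1 x * (αj i).1 x := by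
      have h3 : ∀ i j, α x (A.bracket (Z i) (Z j) x.1) =
          ∑ k, (αj k).1 x * A.structureFun F Z i j k ⟨x.1, hU x.2⟩ := fun i j => by
        conv_lhs => rw [← F.sum_apply_smul_coord ⟨x.1, hU x.2⟩ (α x)]
        rw [LinearMap.sum_apply]
        rfl
      have h4 : ∀ i, α x (Z i x.1) = (αj i).1 x := fun i => by rw [← hZ ⟨x.1, hU x.2⟩]
      rw [hbr]
      simp only [map_sub, map_add, map_sum, map_smul, h3, h4, smul_eq_mul]
    rw [val_frameOp_covecForm]
    have hL : ∀ (z : E.Ext x.1), E.contract (Y x.1) (E.contract (X x.1) z) =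
        (E.contract (Y x.1) ∘ₗ E.contract (X x.1)) z := fun _ => rfl
    simp only [val_frameDiff, hL, map_sum, map_add, map_smul]
    simp only [LinearMap.comp_apply, SmoothVB.contract_contract_ι_mul_ι]
    rw [hder X Y, hder Y X, hαbr]
    have h5 := frame_identity (fun j => (crd X j).1 x) (fun j => (crd Y j).1 x) (fun j => (αj j).1 x)
      (fun j => (A.deriv X U (crd Y j)).1 x) (fun j => (A.deriv Y U (crd X j)).1 x)
      (fun j k => E.dirDerivOn (αj k).1 (A.anchor x.1 (Z j x.1)))
      (fun i j k => A.structureFun F Z i j k ⟨x.1, hU x.2⟩) fun i j k => A.structureFun_skew F Z i j k _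
    rw [← h5]
    simp only [Algebra.smul_def, ← map_mul, ← map_sum, ← map_add]
    rfl

end Frame

end LieAlgebroid



/-! ### Existence and uniqueness of the differential -/

namespace GradedSpace

theorem VectorField.ext_toFun {X : GradedSpace} {j : ℤ} {φ ψ : VectorField X j}
    (h : ∀ U a, φ.toFun U a = ψ.toFun U a) : φ = ψ := by
  cases φ
  cases ψ
  congr
  funext U
  exact LinearMap.ext (h U)

end GradedSpace

namespace SmoothVB

variable {E : SmoothVB}

/-- The pointwise form of the derivation property. -/
theorem val_vectorField_mul (d : GradedSpace.VectorField E.shiftObj 1) {U : Opens E.base}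
    (a b : E.shiftObj.func U) (x : U) :
    E.val (d.toFun U (a * b)) x = E.val (d.toFun U a) x * E.val b x +
      ExteriorAlgebra.invol (E.val a x) * E.val (d.toFun U b) x := by
  have h1 : ∀ (k : ℤ) (a : E.shiftObj.func U), a ∈ E.shiftObj.deg U k →
      E.val (d.toFun U (a * b)) x = E.val (d.toFun U a) x * E.val b x +
      ExteriorAlgebra.invol (E.val a x) * E.val (d.toFun U b) x := by
    intro k a ha
    have h2 := d.leibniz U k a ha b
    rw [one_mul] at h2
    rw [ExteriorAlgebra.invol_of_mem_intDeg (mem_deg_iff'.1 ha x), smul_mul_assoc]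
    refine (congrArg (fun c => E.val c x) h2).trans ?_
    exact congrArg (E.val (d.toFun U a) x * E.val b x + ·)
      (map_zsmul (E.valHom x) _ (a * d.toFun U b))
  have h3 := fun n : ℕ => h1 n _ (component_mem (n : ℤ) a)
  conv_lhs => rw [← sum_component a]
  conv_rhs => rw [← sum_component a]
  rw [Finset.sum_mul, map_sum, map_sum, LieAlgebroid.val_sum, LieAlgebroid.val_sum,
    LieAlgebroid.val_sum, map_sum, Finset.sum_mul, Finset.sum_mul, ← Finset.sum_add_distrib]
  exact Finset.sum_congr rfl fun n _ => h3 n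

end SmoothVB

namespace SmoothVB

variable {E : SmoothVB}

theorem leibniz_of_val {U : Opens E.base} (d : E.shiftObj.func U →ₗ[ℝ] E.shiftObj.func U)
    (hd : ∀ (a b : E.shiftObj.func U) (x : U), E.val (d (a * b)) x =
      E.val (d a) x * E.val b x + ExteriorAlgebra.invol (E.val a x) * E.val (d b) x)
    {k : ℤ} {a : E.shiftObj.func U} (ha : a ∈ E.shiftObj.deg U k) (b : E.shiftObj.func U) :
    d (a * b) = d a * b + ((1 * k).negOnePow : ℤ) • (a * d b) := by
  refine func_ext fun x => ?_
  rw [hd, ExteriorAlgebra.invol_of_mem_intDeg (mem_deg_iff'.1 ha x), one_mul, smul_mul_assoc]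
  exact congrArg (E.val (d a) x * E.val b x + ·) (map_zsmul (E.valHom x) _ (a * d b)).symm

end SmoothVB

namespace LieAlgebroid

variable {E : SmoothVB} (A : LieAlgebroid E)

/-- The restriction of a differential to an open set. -/
def IsDifferential.toLocal {A : LieAlgebroid E} {d : GradedSpace.VectorField E.shiftObj 1}
    (hd : A.IsDifferential d) (W : Opens E.base) : A.LocalDifferential W where
  toFun U _ := d.toFun U
  res h _ a := d.res h a
  leibniz _ _ a b x := SmoothVB.val_vectorField_mul d a b x
  map_deg U _ k a ha := d.map_deg U k a ha
  map_fun U _ := hd.map_fun U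
  map_covec U _ := hd.map_covec U

theorem exists_localDifferential (x : E.base) :
    ∃ W : Opens E.base, x ∈ W ∧ Nonempty (A.LocalDifferential W) := by
  obtain ⟨W, F, Z, hx, hZ⟩ := E.exists_localFrame x
  exact ⟨W, hx, ⟨A.frameDifferential F Z hZ⟩⟩

theorem LocalDifferential.val_res_eq {A : LieAlgebroid E} {W W' U V V' : Opens E.base}
    (D : A.LocalDifferential W) (D' : A.LocalDifferential W') (hV : V ≤ U) (hV' : V' ≤ U)
    (hW : V ≤ W) (hW' : V' ≤ W') (a : E.shiftObj.func U) {x : E.base} (hx : x ∈ V) (hx' : x ∈ V') :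
    E.val (D.toFun V hW (E.shiftObj.res hV a)) ⟨x, hx⟩ =
      E.val (D'.toFun V' hW' (E.shiftObj.res hV' a)) ⟨x, hx'⟩ := by
  have h := D.val_eq D' (U := V ⊓ V') ⟨hx, hx'⟩ (inf_le_left.trans hW) (inf_le_right.trans hW')
    (E.shiftObj.res (inf_le_left.trans hV) a)
  have h1 := D.res (inf_le_left : V ⊓ V' ≤ V) hW (E.shiftObj.res hV a)
  have h2 := D'.res (inf_le_right : V ⊓ V' ≤ V') hW' (E.shiftObj.res hV' a)
  have e1 := congrArg (fun c => E.val c (⟨x, hx, hx'⟩ : (V ⊓ V' : Opens E.base))) h1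
  have e2 := congrArg (fun c => E.val c (⟨x, hx, hx'⟩ : (V ⊓ V' : Opens E.base))) h2
  exact e1.symm.trans (h.trans e2)

/-- Existence of the differential: the differentials in local frames agree on overlaps. -/
theorem exists_isDifferential : ∃ d, A.IsDifferential d := by
  choose W hW D using A.exists_localDifferential
  let D' : ∀ x, A.LocalDifferential (W x) := fun x => (D x).some
  have hUW : ∀ (U : Opens E.base) (x : U), x.1 ∈ U ⊓ W x.1 := fun U x => ⟨x.2, hW x.1⟩
  let L : ∀ (U : Opens E.base) (x : U), E.shiftObj.func U →ₗ[ℝ] E.Ext x.1 := fun U x =>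
    (E.valHom ⟨x.1, hUW U x⟩).toLinearMap ∘ₗ (D' x.1).toFun (U ⊓ W x.1) inf_le_right ∘ₗ
      (E.shiftObj.res (inf_le_left : U ⊓ W x.1 ≤ U)).toLinearMap
  let η : ∀ U : Opens E.base, E.shiftObj.func U → ∀ x : U, E.Ext x.1 := fun U a x => L U x a
  have hη : ∀ (U V : Opens E.base) (a : E.shiftObj.func U) (z : E.base) (hV : V ≤ U) (hVz : V ≤ W z)
      (x : V), η U a ⟨x.1, hV x.2⟩ = E.val ((D' z).toFun V hVz (E.shiftObj.res hV a)) x :=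
    fun U V a z hV hVz x => (D' x.1).val_res_eq (D' z) inf_le_left hV inf_le_right hVz a _ _
  have hmem : ∀ U a, η U a ∈ E.forms U := by
    intro U a
    refine SmoothVB.mem_forms_of_locally fun x hx => ⟨U ⊓ W x, inf_le_left, ⟨hx, hW x⟩, ?_⟩
    rw [show E.restr (inf_le_left : U ⊓ W x ≤ U) (η U a) =
      ((D' x).toFun (U ⊓ W x) inf_le_right (E.shiftObj.res inf_le_left a)).1 from
        funext fun y => hη U (U ⊓ W x) a x inf_le_left inf_le_right y]
    exact ((D' x).toFun (U ⊓ W x) inf_le_right (E.shiftObj.res inf_le_left a)).2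
  let d : ∀ U : Opens E.base, E.shiftObj.func U →ₗ[ℝ] E.shiftObj.func U := fun U =>
    { toFun := fun a => (⟨η U a, hmem U a⟩ : E.forms U)
      map_add' := fun a b => SmoothVB.func_ext fun x => map_add (L U x) a b
      map_smul' := fun r a => SmoothVB.func_ext fun x => map_smul (L U x) r a }
  have hd : ∀ (U : Opens E.base) (a : E.shiftObj.func U) (x : U), E.val (d U a) x =
      E.val ((D' x.1).toFun (U ⊓ W x.1) inf_le_right (E.shiftObj.res inf_le_left a))
        ⟨x.1, hUW U x⟩ := fun _ _ _ => rfl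
  have hres : ∀ {U V : Opens E.base} (h : V ≤ U) (a : E.shiftObj.func U),
      d V (E.shiftObj.res h a) = E.shiftObj.res h (d U a) := fun {U V} h a =>
    SmoothVB.func_ext fun x => by
      exact ((D' x.1).val_res_eq (D' x.1) inf_le_left (inf_le_left.trans h) inf_le_right inf_le_right a
        (hUW U ⟨x.1, h x.2⟩) (hUW V x)).symm
  have hdeg : ∀ (U : Opens E.base) (k : ℤ), ∀ a ∈ E.shiftObj.deg U k,
      d U a ∈ E.shiftObj.deg U (k + 1) := fun U k a ha => SmoothVB.mem_deg_iff'.2 fun x => by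
    rw [hd]
    exact SmoothVB.mem_deg_iff'.1 ((D' x.1).map_deg (U ⊓ W x.1) inf_le_right k _
      ((SmoothVB.isSupermanifold_shiftObj E).res_deg inf_le_left k a ha)) ⟨x.1, hUW U x⟩
  have hleib : ∀ (U : Opens E.base) (a b : E.shiftObj.func U) (x : U), E.val (d U (a * b)) x =
      E.val (d U a) x * E.val b x + ExteriorAlgebra.invol (E.val a x) * E.val (d U b) x := by
    intro U a b x
    exact (congrArg (fun c => E.val ((D' x.1).toFun (U ⊓ W x.1) inf_le_right c) ⟨x.1, hUW U x⟩)
      (map_mul (E.shiftObj.res (inf_le_left : U ⊓ W x.1 ≤ U)) a b)).trans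
      ((D' x.1).leibniz (U ⊓ W x.1) inf_le_right _ _ ⟨x.1, hUW U x⟩)
  refine ⟨⟨d, hres, hdeg, fun U k a ha b =>
    SmoothVB.leibniz_of_val (d U) (hleib U) ha b⟩, ?_, ?_⟩
  · intro U f hf x v
    refine ((D' x.1).map_fun (U ⊓ W x.1) inf_le_right _ (hf.restr inf_le_left)
      ⟨x.1, hUW U x⟩ v).trans ?_
    exact congrArg _ (SmoothVB.dirDerivOn_restr (inf_le_left : U ⊓ W x.1 ≤ U) f
      ⟨x.1, hUW U x⟩ (A.anchor x.1 v))
  · intro U α hα X Y x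
    refine ((D' x.1).map_covec (U ⊓ W x.1) inf_le_right _ (hα.restr inf_le_left) X Y
      ⟨x.1, hUW U x⟩).trans ?_
    have h1 := SmoothVB.dirDerivOn_restr (inf_le_left : U ⊓ W x.1 ≤ U) (fun y => α y (Y y.1))
      ⟨x.1, hUW U x⟩ (A.anchor x.1 (X x.1))
    have h2 := SmoothVB.dirDerivOn_restr (inf_le_left : U ⊓ W x.1 ≤ U) (fun y => α y (X y.1))
      ⟨x.1, hUW U x⟩ (A.anchor x.1 (Y x.1))
    exact congrArg _ (congrArg₂ _ (congrArg₂ _ h1 h2) rfl)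

theorem isDifferential_differential : A.IsDifferential A.differential :=
  Classical.epsilon_spec A.exists_isDifferential

/-- The Lie algebroid differential is the only vector field with the defining properties. -/
theorem isDifferential_iff (d : GradedSpace.VectorField E.shiftObj 1) :
    A.IsDifferential d ↔ d = A.differential := by
  constructor
  · intro hd
    refine GradedSpace.VectorField.ext_toFun fun U a => SmoothVB.func_ext fun x => ?_
    exact (hd.toLocal ⊤).val_eq (A.isDifferential_differential.toLocal ⊤) x.2 le_top le_top a
  · rintro rfl
    exact A.isDifferential_differential

/-! ### The differential squares to zero -/

end LieAlgebroid

namespace SmoothVB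

variable {E : SmoothVB}

/-- The grading involution. -/
def involForm (E : SmoothVB) (U : Opens E.base) (a : E.shiftObj.func U) : E.shiftObj.func U :=
  ∑ n ∈ Finset.range (E.rank + 1), (((n : ℤ).negOnePow : ℤˣ) : ℤ) • E.component U (n : ℤ) a

theorem val_involForm {U : Opens E.base} (a : E.shiftObj.func U) (x : U) :
    E.val (E.involForm U a) x = ExteriorAlgebra.invol (E.val a x) := by
  conv_rhs => rw [← sum_component a, LieAlgebroid.val_sum, map_sum]
  rw [involForm, LieAlgebroid.val_sum]
  refine Finset.sum_congr rfl fun n _ => ?_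
  rw [ExteriorAlgebra.invol_of_mem_intDeg (mem_deg_iff'.1 (component_mem (n : ℤ) a) x)]
  exact map_zsmul (E.valHom x) _ _

theorem val_vectorField_involForm (d : GradedSpace.VectorField E.shiftObj 1) {U : Opens E.base}
    (a : E.shiftObj.func U) (x : U) : E.val (d.toFun U (E.involForm U a)) x =
      -ExteriorAlgebra.invol (E.val (d.toFun U a) x) := by
  conv_rhs => rw [← sum_component a, map_sum, LieAlgebroid.val_sum, map_sum]
  rw [involForm, map_sum, LieAlgebroid.val_sum, ← Finset.sum_neg_distrib]
  refine Finset.sum_congr rfl fun n _ => ?_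
  have h1 := d.map_deg U n _ (component_mem (n : ℤ) a)
  rw [ExteriorAlgebra.invol_of_mem_intDeg (mem_deg_iff'.1 h1 x), map_zsmul, Int.negOnePow_succ]
  refine (map_zsmul (E.valHom x) _ _).trans ?_
  rw [Units.val_neg, neg_smul, neg_neg]
  rfl

/-- The square of a vector field of degree `1` is a derivation. -/
theorem val_sq_mul (d : GradedSpace.VectorField E.shiftObj 1) {U : Opens E.base}
    (a b : E.shiftObj.func U) (x : U) : E.val (d.toFun U (d.toFun U (a * b))) x =
      E.val (d.toFun U (d.toFun U a)) x * E.val b x + E.val a x * E.val (d.toFun U (d.toFun U b)) x := by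
  have h1 : d.toFun U (a * b) = d.toFun U a * b + E.involForm U a * d.toFun U b :=
    func_ext fun x => by
      rw [val_vectorField_mul, val_add, val_mul, val_mul, val_involForm]
  rw [h1, map_add, val_add, val_vectorField_mul, val_vectorField_mul, val_vectorField_involForm,
    val_involForm, ExteriorAlgebra.invol_invol]
  rw [neg_mul]
  abel

end SmoothVB



namespace LieAlgebroid

variable {E : SmoothVB} (A : LieAlgebroid E)

theorem deriv_bracket (X Y : E.Sec) (U : Opens E.base) (f : E.smoothFun U) :
    A.deriv (A.bracket X Y) U f = A.deriv X U (A.deriv Y U f) - A.deriv Y U (A.deriv X U f) := by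
  refine Subtype.ext (funext fun x => ?_)
  obtain ⟨g, V, hV, hxV, hg, hgf⟩ := SmoothVB.IsSmoothFun.exists_eventuallyEq f.2 x.2
  have h1 : ∀ (X : E.Sec) (y : E.base) (hy : y ∈ V), (A.deriv X U f).1 ⟨y, hV hy⟩ =
      E.dirDeriv g (A.anchor y (X y)) := fun X y hy =>
    SmoothVB.dirDerivOn_eq hV hgf (x := ⟨y, hV hy⟩) hy _
  have h2 : ∀ X Y : E.Sec, (A.deriv X U (A.deriv Y U f)).1 x =
      E.dirDeriv (fun y => E.dirDeriv g (A.anchor y (Y y))) (A.anchor x.1 (X x.1)) := fun X Y =>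
    SmoothVB.dirDerivOn_eq hV (h1 Y) (x := x) hxV _
  refine (h1 _ x.1 hxV).trans ((A.anchor_bracket X Y g hg x.1).trans ?_)
  exact (congrArg₂ (· - ·) (h2 X Y) (h2 Y X)).symm

theorem isSmoothCovec_derivAt {U : Opens E.base} (f : E.smoothFun U) :
    E.IsSmoothCovec U (A.derivAt f.1) := by
  refine SmoothVB.isSmoothCovec_of_locally fun x hx => ?_
  obtain ⟨W, F, Z, hxW, hZ⟩ := E.exists_localFrame x
  have hV : U ⊓ W ≤ U := inf_le_left
  refine ⟨U ⊓ W, inf_le_left, ⟨hx, hxW⟩, ?_⟩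
  have h1 := SmoothVB.IsSmoothCovec.sum Finset.univ
    (α := fun (j : Fin E.rank) (y : (U ⊓ W : Opens E.base)) =>
      (A.deriv (Z j) U f).1 ⟨y.1, hV y.2⟩ • (F.basis ⟨y.1, y.2.2⟩).coord j) fun j _ =>
    SmoothVB.IsSmoothCovec.smul (SmoothVB.IsSmoothFun.restr hV (A.deriv (Z j) U f).2)
      ((F.smooth_coord j).restr inf_le_right)
  refine (congrArg (E.IsSmoothCovec (U ⊓ W)) (funext fun y => LinearMap.ext fun v => ?_)).mp h1
  have h2 := A.derivAt_eq_sum F inf_le_right (fun z : (U ⊓ W : Opens E.base) => f.1 ⟨z.1, hV z.2⟩) y v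
  refine Eq.trans ?_ (h2.symm.trans (SmoothVB.dirDerivOn_restr hV f.1 y _))
  rw [LinearMap.sum_apply]
  refine Finset.sum_congr rfl fun j _ => ?_
  rw [hZ, SmoothVB.dirDerivOn_restr hV f.1 y, LinearMap.smul_apply, smul_eq_mul, mul_comm]
  rfl

/-- The evaluation of a smooth section of the dual bundle on a section. -/
def pairing {U : Opens E.base} {α : ∀ x : U, Module.Dual ℝ (E.fib x.1)} (hα : E.IsSmoothCovec U α)
    (X : E.Sec) : E.smoothFun U := ⟨_, hα.apply_sec X⟩

theorem pairing_add {U : Opens E.base} {α : ∀ x : U, Module.Dual ℝ (E.fib x.1)}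
    (hα : E.IsSmoothCovec U α) (X Y : E.Sec) : pairing hα (X + Y) = pairing hα X + pairing hα Y :=
  Subtype.ext (funext fun x => map_add (α x) (X x.1) (Y x.1))

theorem pairing_neg {U : Opens E.base} {α : ∀ x : U, Module.Dual ℝ (E.fib x.1)}
    (hα : E.IsSmoothCovec U α) (X : E.Sec) : pairing hα (-X) = -pairing hα X :=
  Subtype.ext (funext fun x => map_neg (α x) (X x.1))

/-- The differential of a `1`-form, as a function of two sections. -/
def diffPairing {U : Opens E.base} {α : ∀ x : U, Module.Dual ℝ (E.fib x.1)} (hα : E.IsSmoothCovec U α)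
    (X Y : E.Sec) : E.smoothFun U :=
  A.deriv X U (pairing hα Y) - A.deriv Y U (pairing hα X) - pairing hα (A.bracket X Y)

end LieAlgebroid

namespace SmoothVB

variable {E : SmoothVB}

/-- The triple contraction of the product of a `2`-form and a `1`-form. -/
theorem contract_three {x : E.base} (u v w : E.fib x) {a : E.Ext x} (β : Module.Dual ℝ (E.fib x))
    (ha : a ∈ ExteriorAlgebra.intDeg (Module.Dual ℝ (E.fib x)) 2) {p q r : ℝ}
    (huv : E.contract v (E.contract u a) = algebraMap ℝ _ p)
    (huw : E.contract w (E.contract u a) = algebraMap ℝ _ q)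
    (hvw : E.contract w (E.contract v a) = algebraMap ℝ _ r) :
    E.contract w (E.contract v (E.contract u (a * ExteriorAlgebra.ι ℝ β))) =
      algebraMap ℝ _ (p * β w - q * β v + r * β u) := by
  have h2 : ExteriorAlgebra.invol a = a := by
    rw [ExteriorAlgebra.invol_of_mem_intDeg ha, show ((2 : ℤ).negOnePow : ℤ) = 1 from rfl, one_smul]
  have h1 : ExteriorAlgebra.invol (E.contract u a) = -E.contract u a := by
    rw [ExteriorAlgebra.invol_of_mem_intDeg (contract_mem_int u ha),
      show ((2 - 1 : ℤ).negOnePow : ℤ) = -1 from rfl, neg_one_smul]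
  have hs : ∀ (z : E.Ext x) (t : ℝ), z * algebraMap ℝ _ t = t • z := fun z t => by
    rw [← Algebra.commutes, ← Algebra.smul_def]
  rw [contract_mul, contract_ι, h2, hs, map_add, contract_mul, contract_ι, h1, hs, map_smul, huv,
    ← Algebra.smul_def, map_add, map_add, map_smul, map_smul, map_smul, map_neg, contract_ι, huw, hvw]
  simp only [map_add, map_sub, map_mul, Algebra.smul_def]
  rw [mul_neg, sub_eq_add_neg, ← Algebra.commutes (β v), ← Algebra.commutes (β u)]

end SmoothVB

namespace LieAlgebroid

variable {E : SmoothVB} (A : LieAlgebroid E)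

theorem contract_differential_covec {d : GradedSpace.VectorField E.shiftObj 1} (hd : A.IsDifferential d)
    {U : Opens E.base} {α : ∀ x : U, Module.Dual ℝ (E.fib x.1)} (hα : E.IsSmoothCovec U α)
    (X Y : E.Sec) (x : U) :
    E.contract (Y x.1) (E.contract (X x.1) (E.val (d.toFun U (E.covecForm U α hα)) x)) =
      algebraMap ℝ _ ((A.diffPairing hα X Y).1 x) := hd.map_covec U α hα X Y x

theorem val_differential_covec_mem (d : GradedSpace.VectorField E.shiftObj 1)
    {U : Opens E.base} {α : ∀ x : U, Module.Dual ℝ (E.fib x.1)} (hα : E.IsSmoothCovec U α) (x : U) :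
    E.val (d.toFun U (E.covecForm U α hα)) x ∈ ExteriorAlgebra.intDeg _ 2 :=
  SmoothVB.mem_deg_iff'.1 (d.map_deg U 1 _ (SmoothVB.covecForm_mem_deg α hα)) x

/-- The value on two sections of the product of two `1`-forms. -/
def wedgePairing {U : Opens E.base} {α β : ∀ x : U, Module.Dual ℝ (E.fib x.1)}
    (hα : E.IsSmoothCovec U α) (hβ : E.IsSmoothCovec U β) (X Y : E.Sec) : E.smoothFun U :=
  pairing hα X * pairing hβ Y - pairing hβ X * pairing hα Y

/-- The formula for the differential of a `2`-form, for the product of two `1`-forms. -/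
theorem contract_differential_mul {d : GradedSpace.VectorField E.shiftObj 1} (hd : A.IsDifferential d)
    {U : Opens E.base} {α β : ∀ x : U, Module.Dual ℝ (E.fib x.1)}
    (hα : E.IsSmoothCovec U α) (hβ : E.IsSmoothCovec U β) (X Y Z : E.Sec) (x : U) :
    E.contract (Z x.1) (E.contract (Y x.1) (E.contract (X x.1)
      (E.val (d.toFun U (E.covecForm U α hα * E.covecForm U β hβ)) x))) =
      algebraMap ℝ _ ((A.deriv X U (wedgePairing hα hβ Y Z) - A.deriv Y U (wedgePairing hα hβ X Z) +
        A.deriv Z U (wedgePairing hα hβ X Y) - wedgePairing hα hβ (A.bracket X Y) Z +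
        wedgePairing hα hβ (A.bracket X Z) Y - wedgePairing hα hβ (A.bracket Y Z) X).1 x) := by
  have h1 : E.val (d.toFun U (E.covecForm U α hα * E.covecForm U β hβ)) x =
      E.val (d.toFun U (E.covecForm U α hα)) x * ExteriorAlgebra.ι ℝ (β x) -
        E.val (d.toFun U (E.covecForm U β hβ)) x * ExteriorAlgebra.ι ℝ (α x) := by
    rw [SmoothVB.val_vectorField_mul, SmoothVB.val_covecForm, SmoothVB.val_covecForm,
      ExteriorAlgebra.invol_ι, neg_mul, ExteriorAlgebra.ι_mul_eq_invol_mul,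
      ExteriorAlgebra.invol_of_mem_intDeg (val_differential_covec_mem d hβ x),
      show ((2 : ℤ).negOnePow : ℤ) = 1 from rfl, one_smul, sub_eq_add_neg]
  have h2 := fun {α : ∀ x : U, Module.Dual ℝ (E.fib x.1)} (hα : E.IsSmoothCovec U α)
      (β : Module.Dual ℝ (E.fib x.1)) =>
    SmoothVB.contract_three (X x.1) (Y x.1) (Z x.1) β (val_differential_covec_mem d hα x)
      (A.contract_differential_covec hd hα X Y x) (A.contract_differential_covec hd hα X Z x)
      (A.contract_differential_covec hd hα Y Z x)
  rw [h1, map_sub, map_sub, map_sub, h2, h2, ← map_sub]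
  refine congrArg _ ?_
  have h3 : ∀ X Y Z : E.Sec, (A.deriv X U (wedgePairing hα hβ Y Z)).1 x =
      (A.deriv X U (pairing hα Y)).1 x * β x (Z x.1) + α x (Y x.1) * (A.deriv X U (pairing hβ Z)).1 x -
      ((A.deriv X U (pairing hβ Y)).1 x * α x (Z x.1) +
        β x (Y x.1) * (A.deriv X U (pairing hα Z)).1 x) := fun X Y Z => by
    have h4 : (A.deriv X U (wedgePairing hα hβ Y Z)).1 x =
        (A.deriv X U (pairing hα Y * pairing hβ Z)).1 x -
          (A.deriv X U (pairing hβ Y * pairing hα Z)).1 x :=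
      congrFun (congrArg Subtype.val (map_sub (A.deriv X U) _ _)) x
    rw [h4, A.deriv_mul, A.deriv_mul]
    rfl
  have h5 : ∀ {α : ∀ x : U, Module.Dual ℝ (E.fib x.1)} (hα : E.IsSmoothCovec U α) (X Y : E.Sec),
      (A.diffPairing hα X Y).1 x = (A.deriv X U (pairing hα Y)).1 x -
        (A.deriv Y U (pairing hα X)).1 x - α x (A.bracket X Y x.1) := fun _ _ _ => rfl
  have h6 : ∀ X Y : E.Sec, (wedgePairing hα hβ X Y).1 x = α x (X x.1) * β x (Y x.1) -
    β x (X x.1) * α x (Y x.1) := fun _ _ => rfl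
  change _ = (A.deriv X U (wedgePairing hα hβ Y Z)).1 x - (A.deriv Y U (wedgePairing hα hβ X Z)).1 x +
    (A.deriv Z U (wedgePairing hα hβ X Y)).1 x - (wedgePairing hα hβ (A.bracket X Y) Z).1 x +
    (wedgePairing hα hβ (A.bracket X Z) Y).1 x - (wedgePairing hα hβ (A.bracket Y Z) X).1 x
  simp only [h3, h5, h6]
  ring

/-- The square of the differential vanishes on functions. -/
theorem differential_sq_fun {d : GradedSpace.VectorField E.shiftObj 1} (hd : A.IsDifferential d)
    {U : Opens E.base} (f : U → ℝ) (hf : E.IsSmoothFun U f) (x : U) :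
    E.val (d.toFun U (d.toFun U (E.funForm U f hf))) x = 0 := by
  obtain ⟨W, F, Z, hxW, hZ⟩ := E.exists_localFrame x.1
  have h1 : d.toFun U (E.funForm U f hf) = E.covecForm U _ (A.isSmoothCovec_derivAt ⟨f, hf⟩) := by
    refine SmoothVB.func_ext fun y => ?_
    obtain ⟨W, F, Z, hyW, hZ⟩ := E.exists_localFrame y.1
    refine SmoothVB.eq_of_contract (F.basis ⟨y.1, hyW⟩) (n := 0)
      (SmoothVB.mem_deg_iff'.1 (d.map_deg U 0 _ (SmoothVB.funForm_mem_deg f hf)) y)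
      (ExteriorAlgebra.ι_mem_intDeg _) fun j => ?_
    rw [SmoothVB.val_covecForm, SmoothVB.contract_ι, hd.map_fun U f hf y]
    rfl
  rw [h1]
  refine SmoothVB.eq_of_contract_contract (F.basis ⟨x.1, hxW⟩) (val_differential_covec_mem d _ x)
    (Submodule.zero_mem _) fun i j => ?_
  rw [hZ, hZ, map_zero, map_zero]
  refine (A.contract_differential_covec hd (A.isSmoothCovec_derivAt ⟨f, hf⟩) (Z i) (Z j) x).trans ?_
  refine (congrArg _ ?_).trans (map_zero (algebraMap ℝ (E.Ext x.1)))
  have h2 : A.diffPairing (A.isSmoothCovec_derivAt ⟨f, hf⟩) (Z i) (Z j) =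
      A.deriv (Z i) U (A.deriv (Z j) U ⟨f, hf⟩) - A.deriv (Z j) U (A.deriv (Z i) U ⟨f, hf⟩) -
        A.deriv (A.bracket (Z i) (Z j)) U ⟨f, hf⟩ := rfl
  rw [h2, A.deriv_bracket, sub_self]
  rfl

/-- The square of the differential vanishes on `1`-forms, by the Jacobi identity. -/
theorem differential_sq_covec {d : GradedSpace.VectorField E.shiftObj 1} (hd : A.IsDifferential d)
    {W U : Opens E.base} (F : E.LocalFrame W (Fin E.rank)) {Z : Fin E.rank → E.Sec}
    (hZ : ∀ y j, F.basis y j = Z j y.1) (hU : U ≤ W)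
    (α : ∀ x : U, Module.Dual ℝ (E.fib x.1)) (hα : E.IsSmoothCovec U α) (x : U) :
    E.val (d.toFun U (d.toFun U (E.covecForm U α hα))) x = 0 := by
  let h : Fin E.rank → Fin E.rank → E.smoothFun U := fun i j =>
    (1 / 2 : ℝ) • A.diffPairing hα (Z i) (Z j)
  have hcov : ∀ j, E.IsSmoothCovec U fun y : U => (F.basis ⟨y.1, hU y.2⟩).coord j := fun j =>
    (F.smooth_coord j).restr hU
  have hβ : ∀ ij : Fin E.rank × Fin E.rank, E.IsSmoothCovec U
      fun y : U => (h ij.1 ij.2).1 y • (F.basis ⟨y.1, hU y.2⟩).coord ij.1 := fun ij =>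
    SmoothVB.IsSmoothCovec.smul (h ij.1 ij.2).2 (hcov ij.1)
  have hskew : ∀ (i j) (y : U), (A.diffPairing hα (Z i) (Z j)).1 y =
      -(A.diffPairing hα (Z j) (Z i)).1 y := fun i j y => by
    change (A.deriv (Z i) U (pairing hα (Z j))).1 y - (A.deriv (Z j) U (pairing hα (Z i))).1 y -
      α y (A.bracket (Z i) (Z j) y.1) = -((A.deriv (Z j) U (pairing hα (Z i))).1 y -
      (A.deriv (Z i) U (pairing hα (Z j))).1 y - α y (A.bracket (Z j) (Z i) y.1))
    have h1 : α y (A.bracket (Z i) (Z j) y.1) = -α y (A.bracket (Z j) (Z i) y.1) := by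
      rw [A.bracket_skew]
      exact map_neg (α y) _
    rw [h1]
    ring
  -- the differential of a `1`-form as a sum of products of `1`-forms
  have hform : d.toFun U (E.covecForm U α hα) = ∑ ij : Fin E.rank × Fin E.rank,
      E.covecForm U _ (hβ ij) * E.covecForm U _ (hcov ij.2) := by
    refine SmoothVB.func_ext fun y => ?_
    have hm : E.val (∑ ij : Fin E.rank × Fin E.rank,
        E.covecForm U _ (hβ ij) * E.covecForm U _ (hcov ij.2)) y ∈ ExteriorAlgebra.intDeg _ 2 :=
      SmoothVB.mem_deg_iff'.1 (Submodule.sum_mem _ fun ij _ =>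
        (SmoothVB.isSupermanifold_shiftObj E).mul_mem U 1 1 _ (SmoothVB.covecForm_mem_deg _ _) _
          (SmoothVB.covecForm_mem_deg _ _)) y
    refine SmoothVB.eq_of_contract_contract (F.basis ⟨y.1, hU y.2⟩)
      (val_differential_covec_mem d hα y) hm fun i j => ?_
    have hL : ∀ (z : E.Ext y.1), E.contract (F.basis ⟨y.1, hU y.2⟩ j)
      (E.contract (F.basis ⟨y.1, hU y.2⟩ i) z) = (E.contract (F.basis ⟨y.1, hU y.2⟩ j) ∘ₗ
        E.contract (F.basis ⟨y.1, hU y.2⟩ i)) z := fun _ => rfl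
    have h2 : E.contract (F.basis ⟨y.1, hU y.2⟩ j) (E.contract (F.basis ⟨y.1, hU y.2⟩ i)
        (E.val (d.toFun U (E.covecForm U α hα)) y)) =
        algebraMap ℝ _ ((A.diffPairing hα (Z i) (Z j)).1 y) := by
      rw [hZ, hZ]
      exact A.contract_differential_covec hd hα (Z i) (Z j) y
    rw [h2, hL, val_sum, map_sum]
    simp only [LinearMap.comp_apply, SmoothVB.val_mul, SmoothVB.val_covecForm,
      SmoothVB.contract_contract_ι_mul_ι, ← map_sum]
    refine congrArg _ ?_
    have h3 : ∀ k l : Fin E.rank, (F.basis ⟨y.1, hU y.2⟩).coord k (F.basis ⟨y.1, hU y.2⟩ l) =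
        if l = k then (1 : ℝ) else 0 := fun k l => by
      rw [Module.Basis.coord_apply, Module.Basis.repr_self, Finsupp.single_apply]
    simp only [LinearMap.smul_apply, h3, Fintype.sum_prod_type, smul_eq_mul]
    simp only [mul_ite, mul_one, mul_zero, ite_mul, zero_mul, one_mul, Finset.sum_sub_distrib,
      Finset.sum_ite_eq, Finset.mem_univ, if_true]
    have h4 : ∀ i j, (h i j).1 y = 1 / 2 * (A.diffPairing hα (Z i) (Z j)).1 y := fun _ _ => rfl
    have h5 : ∀ x x_1 : Fin E.rank, (if j = x then if i = x_1 then (h x x_1).1 y else 0 else 0) =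
        if i = x_1 then (if j = x then (h x x_1).1 y else 0) else 0 := fun k l => by
      split_ifs <;> rfl
    simp only [h5, Finset.sum_ite_eq, Finset.mem_univ, if_true]
    rw [h4, h4, hskew j i]
    ring
  have hpair : ∀ X Y : E.Sec, ∑ ij : Fin E.rank × Fin E.rank,
      wedgePairing (hβ ij) (hcov ij.2) X Y = A.diffPairing hα X Y := by
    intro X Y
    refine Subtype.ext (funext fun y => ?_)
    have h1 := A.contract_differential_covec hd hα X Y y
    have hL : ∀ (z : E.Ext y.1), E.contract (Y y.1) (E.contract (X y.1) z) =
      (E.contract (Y y.1) ∘ₗ E.contract (X y.1)) z := fun _ => rfl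
    rw [hform, hL, val_sum, map_sum] at h1
    simp only [LinearMap.comp_apply, SmoothVB.val_mul, SmoothVB.val_covecForm,
      SmoothVB.contract_contract_ι_mul_ι, ← map_sum] at h1
    refine Eq.trans ?_ ((ExteriorAlgebra.algebraMap_leftInverse (Module.Dual ℝ (E.fib y.1))).injective h1)
    rw [AddSubmonoidClass.coe_finsetSum, Finset.sum_apply]
    rfl
  rw [hform]
  have hm : E.val (d.toFun U (∑ ij : Fin E.rank × Fin E.rank,
        E.covecForm U _ (hβ ij) * E.covecForm U _ (hcov ij.2))) x ∈ ExteriorAlgebra.intDeg _ 3 :=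
    SmoothVB.mem_deg_iff'.1 (d.map_deg U 2 _ (Submodule.sum_mem _ fun ij _ =>
      (SmoothVB.isSupermanifold_shiftObj E).mul_mem U 1 1 _ (SmoothVB.covecForm_mem_deg _ _) _
        (SmoothVB.covecForm_mem_deg _ _))) x
  refine SmoothVB.eq_of_contract_contract_contract (F.basis ⟨x.1, hU x.2⟩) hm
    (Submodule.zero_mem _) fun i j k => ?_
  have hL : ∀ (z : E.Ext x.1), E.contract (Z k x.1) (E.contract (Z j x.1) (E.contract (Z i x.1) z)) =
    (E.contract (Z k x.1) ∘ₗ E.contract (Z j x.1) ∘ₗ E.contract (Z i x.1)) z := fun _ => rfl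
  rw [hZ, hZ, hZ, hL, map_sum, val_sum, map_sum]
  simp only [LinearMap.comp_apply, A.contract_differential_mul hd, map_zero, ← map_sum]
  refine (congrArg _ ?_).trans (map_zero (algebraMap ℝ (E.Ext x.1)))
  generalize Z i = X
  generalize Z j = Y
  generalize Z k = V
  have h1 : ∑ ij : Fin E.rank × Fin E.rank,
      (A.deriv X U (wedgePairing (hβ ij) (hcov ij.2) Y V) -
        A.deriv Y U (wedgePairing (hβ ij) (hcov ij.2) X V) +
        A.deriv V U (wedgePairing (hβ ij) (hcov ij.2) X Y) -
        wedgePairing (hβ ij) (hcov ij.2) (A.bracket X Y) V +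
        wedgePairing (hβ ij) (hcov ij.2) (A.bracket X V) Y -
        wedgePairing (hβ ij) (hcov ij.2) (A.bracket Y V) X) = 0 := by
    simp only [Finset.sum_add_distrib, Finset.sum_sub_distrib, ← map_sum, hpair]
    unfold diffPairing
    have hj : A.bracket (A.bracket X Y) V = A.bracket (A.bracket X V) Y - A.bracket (A.bracket Y V) X := by
      have h2 := A.jacobi X Y V
      rw [A.bracket_skew (A.bracket X Y) V, A.bracket_skew (A.bracket X V) Y,
        A.bracket_skew (A.bracket Y V) X, A.bracket_skew X V, map_neg, eq_neg_of_add_eq_zero_right h2]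
      abel
    simp only [A.deriv_bracket, hj, sub_eq_add_neg, pairing_add, pairing_neg, map_add, map_neg]
    abel
  have h2 := congrFun (congrArg Subtype.val h1) x
  rw [AddSubmonoidClass.coe_finsetSum, Finset.sum_apply] at h2
  exact h2

/-- The Lie algebroid differential is homological. -/
theorem isHomological_differential : A.differential.IsHomological := by
  have hd := A.isDifferential_differential
  intro U a
  refine SmoothVB.func_ext fun x => ?_
  obtain ⟨W, F, Z, hxW, hZ⟩ := E.exists_localFrame x.1
  have key : ∀ hx : x.1 ∈ U, E.val (A.differential.toFun U (A.differential.toFun U a)) ⟨x.1, hx⟩ = 0 := by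
    refine SmoothVB.func_induction x.1 (P := fun U a => ∀ (hx : x.1 ∈ U),
      E.val (A.differential.toFun U (A.differential.toFun U a)) ⟨x.1, hx⟩ = 0) ?_ ?_ ?_ ?_ ?_ x.2 a
    · intro U V h hxV a ih hx
      have h1 := ih hxV
      rw [A.differential.res h, A.differential.res h] at h1
      exact h1
    · intro U hx f hf hx
      exact A.differential_sq_fun hd f hf ⟨x.1, hx⟩
    · intro U hx α hα hx
      have h1 := A.differential_sq_covec hd F hZ (U := U ⊓ W) inf_le_right _
        (hα.restr (inf_le_left : U ⊓ W ≤ U)) ⟨x.1, hx, hxW⟩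
      have h2 : E.covecForm (U ⊓ W) _ (hα.restr (inf_le_left : U ⊓ W ≤ U)) =
        E.shiftObj.res (inf_le_left : U ⊓ W ≤ U) (E.covecForm U α hα) := rfl
      rw [h2] at h1
      have h3 := A.differential.res (inf_le_left : U ⊓ W ≤ U)
      rw [h3, h3] at h1
      exact h1
    · intro U _ a b ha hb hx
      rw [map_add, map_add, SmoothVB.val_add, ha hx, hb hx, add_zero]
    · intro U _ a b ha hb hx
      rw [SmoothVB.val_sq_mul, ha hx, hb hx, zero_mul, mul_zero, add_zero]
  have h1 := key x.2
  exact (congrArg₂ (· + ·) h1 h1).trans (add_zero 0)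

end LieAlgebroid



/-! ### Lie algebroid morphisms relate the differentials -/

namespace SmoothVB

variable {E E' : SmoothVB} (φ : E ⟶ E')

/-- The preimage of an open set under the base map. -/
def preim (U : Opens E'.base) : Opens E.base :=
  ⟨φ.base ⁻¹' U, U.isOpen.preimage φ.smooth_base.continuous⟩

/-- The pullback of functions along `[-1]φ`. -/
def pullForm (U : Opens E'.base) : E'.shiftObj.func U →ₐ[ℝ] E.shiftObj.func (preim φ U) :=
  (shiftMap φ).pull U

theorem val_pullForm {U : Opens E'.base} (a : E'.shiftObj.func U) (x : E.base) (hx : φ.base x ∈ U) :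
    E.val (pullForm φ U a) ⟨x, hx⟩ =
      ExteriorAlgebra.map (φ.fib x).dualMap (E'.val a ⟨φ.base x, hx⟩) := rfl

theorem IsSmoothFun.comp_hom {U : Opens E'.base} {f : U → ℝ} (hf : E'.IsSmoothFun U f) :
    E.IsSmoothFun (preim φ U) fun x => f ⟨φ.base x.1, x.2⟩ :=
  isSmoothFun_of_smoothAt (F := fun y => Function.extend Subtype.val f 0 (φ.base y))
    (fun x hx => ContMDiffAt.comp x (hf.smoothAt hx) (φ.smooth_base x))
    fun _ hx => (extend_apply_of_mem f hx).symm

theorem IsSmoothCovec.comp_hom {U : Opens E'.base} {α : ∀ x : U, Module.Dual ℝ (E'.fib x.1)}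
    (hα : E'.IsSmoothCovec U α) :
    E.IsSmoothCovec (preim φ U) fun x => (φ.fib x.1).dualMap (α ⟨φ.base x.1, x.2⟩) :=
  isSmoothCovec_of_totSmoothAt (F := fun v => covecFun α ⟨φ.base v.1, φ.fib v.1 v.2⟩)
    (fun x hx v => ContMDiffAt.comp (⟨x, v⟩ : E.Tot)
      (hα.totSmoothAt (v := ⟨φ.base x, φ.fib x v⟩) hx) (φ.smooth_tot ⟨x, v⟩))
    fun x hx _ => (covecFun_of_mem α (x := φ.base x) hx _).symm

theorem pullForm_funForm {U : Opens E'.base} (f : U → ℝ) (hf : E'.IsSmoothFun U f) :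
    pullForm φ U (E'.funForm U f hf) = E.funForm (preim φ U) _ (hf.comp_hom φ) :=
  func_ext fun x => (val_pullForm φ _ x.1 x.2).trans (AlgHom.commutes _ _)

theorem pullForm_covecForm {U : Opens E'.base} (α : ∀ x : U, Module.Dual ℝ (E'.fib x.1))
    (hα : E'.IsSmoothCovec U α) :
    pullForm φ U (E'.covecForm U α hα) = E.covecForm (preim φ U) _ (hα.comp_hom φ) :=
  func_ext fun x => (val_pullForm φ _ x.1 x.2).trans (ExteriorAlgebra.map_apply_ι _ _)

theorem contract_map_dualMap {x : E.base} (v : E.fib x) (a : E'.Ext (φ.base x)) :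
    E.contract v (ExteriorAlgebra.map (φ.fib x).dualMap a) =
      ExteriorAlgebra.map (φ.fib x).dualMap (E'.contract (φ.fib x v) a) :=
  ExteriorAlgebra.contractLeft_map _ _ _

end SmoothVB

namespace IsLieAlgebroidHom

open SmoothVB

variable {E E' : SmoothVB} {A : LieAlgebroid E} {A' : LieAlgebroid E'} {φ : E ⟶ E'}

/-- The computation behind `contract_pull_covec`. -/
theorem covec_identity {k : ℕ} (a b H Xb Ya : Fin k → ℝ) (D : Fin k → Fin k → ℝ)
    (B : Fin k → Fin k → ℝ) :
    ∑ i, a i * ∑ j, b j * (D i j - D j i - B i j) =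
      ∑ j, (Xb j * H j + b j * ∑ i, a i * D i j) - ∑ i, (Ya i * H i + a i * ∑ j, b j * D j i) -
      (∑ i, ∑ j, a i * b j * B i j + ∑ j, Xb j * H j - ∑ i, Ya i * H i) := by
  have e1 : ∑ j, b j * ∑ i, a i * D i j = ∑ i, a i * ∑ j, b j * D i j := by
    simp only [Finset.mul_sum]
    rw [Finset.sum_comm]
    exact Finset.sum_congr rfl fun i _ => Finset.sum_congr rfl fun j _ => by ring
  have e2 : ∑ i, ∑ j, a i * b j * B i j = ∑ i, a i * ∑ j, b j * B i j := by
    simp only [Finset.mul_sum, mul_assoc]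
  rw [e2]
  simp only [Finset.sum_add_distrib, mul_sub, Finset.sum_sub_distrib, e1]
  ring

theorem map_differential_fun (hφ : IsLieAlgebroidHom A A' φ)
    {d : GradedSpace.VectorField E.shiftObj 1} {d' : GradedSpace.VectorField E'.shiftObj 1}
    (hd : A.IsDifferential d) (hd' : A'.IsDifferential d') {U : Opens E'.base} (f : U → ℝ)
    (hf : E'.IsSmoothFun U f) (x : E.base) (hx : φ.base x ∈ U) :
    ExteriorAlgebra.map (φ.fib x).dualMap (E'.val (d'.toFun U (E'.funForm U f hf)) ⟨φ.base x, hx⟩) =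
      E.val (d.toFun (preim φ U) (pullForm φ U (E'.funForm U f hf))) ⟨x, hx⟩ := by
  obtain ⟨W, F, Z, hxW, hZ⟩ := E.exists_localFrame x
  rw [pullForm_funForm]
  refine eq_of_contract (F.basis ⟨x, hxW⟩) (n := 0) ?_ ?_ fun j => ?_
  · exact ExteriorAlgebra.map_mem_intDeg _
      (mem_deg_iff'.1 (d'.map_deg U 0 _ (funForm_mem_deg f hf)) ⟨φ.base x, hx⟩)
  · exact mem_deg_iff'.1 (d.map_deg (preim φ U) 0 _ (funForm_mem_deg _ (hf.comp_hom φ))) ⟨x, hx⟩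
  · rw [contract_map_dualMap]
    refine (congrArg _ (hd'.map_fun U f hf ⟨φ.base x, hx⟩ (φ.fib x (F.basis ⟨x, hxW⟩ j)))).trans ?_
    refine ((AlgHom.commutes _ _).trans ?_).trans
      (hd.map_fun (preim φ U) _ (hf.comp_hom φ) ⟨x, hx⟩ (F.basis ⟨x, hxW⟩ j)).symm
    refine congrArg _ ?_
    rw [hφ.anchor]
    refine (dirDeriv_comp φ (hf.smoothAt hx) _).symm.trans ?_
    exact (dirDerivOn_eq (U := preim φ U) (F := fun y => Function.extend Subtype.val f 0 (φ.base y))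
      le_rfl (fun _ hy => (extend_apply_of_mem f hy).symm) (x := ⟨x, hx⟩) hx _).symm

theorem map_differential_covec (hφ : IsLieAlgebroidHom A A' φ)
    {d : GradedSpace.VectorField E.shiftObj 1} {d' : GradedSpace.VectorField E'.shiftObj 1}
    (hd : A.IsDifferential d) (hd' : A'.IsDifferential d') {U : Opens E'.base}
    (α : ∀ x : U, Module.Dual ℝ (E'.fib x.1)) (hα : E'.IsSmoothCovec U α) (x : E.base)
    (hx : φ.base x ∈ U) :
    ExteriorAlgebra.map (φ.fib x).dualMap
        (E'.val (d'.toFun U (E'.covecForm U α hα)) ⟨φ.base x, hx⟩) =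
      E.val (d.toFun (preim φ U) (pullForm φ U (E'.covecForm U α hα))) ⟨x, hx⟩ := by
  obtain ⟨W, F, Z, hxW, hZ⟩ := E.exists_localFrame x
  obtain ⟨Z', c, hspan, -, hc⟩ := E'.exists_frame (φ.base x)
  have tφ := φ.smooth_base.continuous.tendsto x
  rw [pullForm_covecForm]
  refine eq_of_contract_contract (F.basis ⟨x, hxW⟩) ?_ ?_ fun i j => ?_
  · exact ExteriorAlgebra.map_mem_intDeg _
      (mem_deg_iff'.1 (d'.map_deg U 1 _ (covecForm_mem_deg α hα)) ⟨φ.base x, hx⟩)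
  · exact mem_deg_iff'.1 (d.map_deg (preim φ U) 1 _ (covecForm_mem_deg _ (hα.comp_hom φ))) ⟨x, hx⟩
  rw [hZ, hZ]
  refine Eq.trans ?_ (hd.map_covec (preim φ U) _ (hα.comp_hom φ) (Z i) (Z j) ⟨x, hx⟩).symm
  rw [contract_map_dualMap, contract_map_dualMap]
  generalize Z i = X
  generalize Z j = Y
  let C : E.Sec → Fin E'.rank → E.base → ℝ := fun W i y => c i ⟨φ.base y, φ.fib y (W y)⟩
  have hC : ∀ W i, E.SmoothNear (C W i) x := fun W i => smoothNear_coeff φ W (c i)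
    (hc.mono fun y hy => hy i) (Filter.Eventually.of_forall fun _ => rfl)
  have dC : ∀ W : E.Sec, ∀ᶠ y in 𝓝 x, φ.fib y (W y) = ∑ i, C W i y • Z' i (φ.base y) :=
    fun W => (tφ.eventually hspan).mono fun y hy => hy _
  let H : Fin E'.rank → E'.base → ℝ := fun i =>
    Function.extend Subtype.val (fun y : U => α y (Z' i y.1)) 0
  have hH : ∀ i, E'.SmoothNear (H i) (φ.base x) := fun i => (hα.apply_sec (Z' i)).smoothNear hx
  have hHx : ∀ (i) (y : E'.base) (hy : y ∈ U), H i y = α ⟨y, hy⟩ (Z' i y) := fun i y hy =>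
    extend_apply_of_mem (fun y : U => α y (Z' i y.1)) hy
  have e1 : ∀ W : E.Sec, φ.fib x (W x) = ∑ i, C W i x • Z' i (φ.base x) := fun W =>
    (dC W).self_of_nhds
  -- derivatives of the pairing of the pulled back form with a section
  have e2 : ∀ (W : E.Sec) (v : E.Tan x), E.dirDerivOn (x := (⟨x, hx⟩ : preim φ U))
      (fun y : preim φ U => (φ.fib y.1).dualMap (α ⟨φ.base y.1, y.2⟩) (W y.1)) v =
      ∑ i, (E.dirDeriv (C W i) v * H i (φ.base x) +
        C W i x * E'.dirDeriv (H i) (mfderiv (𝓡 E.dim) (𝓡 E'.dim) φ.base x v)) := by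
    intro W v
    rw [← dirDeriv_change φ (C W) H (hC W) hH v]
    refine dirDeriv_congr ?_ v
    filter_upwards [dC W, (preim φ U).isOpen.mem_nhds hx] with y hy hyU
    rw [extend_apply_of_mem _ hyU, LinearMap.dualMap_apply, hy, map_sum]
    refine Finset.sum_congr rfl fun i _ => ?_
    rw [map_smul, smul_eq_mul, hHx i _ hyU]
  have e3 : ∀ W : E.Sec, mfderiv (𝓡 E.dim) (𝓡 E'.dim) φ.base x (A.anchor x (W x)) =
      ∑ i, C W i x • A'.anchor (φ.base x) (Z' i (φ.base x)) := fun W => by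
    rw [← hφ.anchor, e1, A'.anchor_sum]
  have e4 := hφ.bracket x X Y _ _ (C X) Z' (C Y) Z' (hC X) (hC Y) (dC X) (dC Y)
  have e5 : ∀ i j, E'.contract (Z' j (φ.base x)) (E'.contract (Z' i (φ.base x))
      (E'.val (d'.toFun U (E'.covecForm U α hα)) ⟨φ.base x, hx⟩)) = algebraMap ℝ _
      (E'.dirDeriv (H j) (A'.anchor (φ.base x) (Z' i (φ.base x))) -
        E'.dirDeriv (H i) (A'.anchor (φ.base x) (Z' j (φ.base x))) -
        α ⟨φ.base x, hx⟩ (A'.bracket (Z' i) (Z' j) (φ.base x))) := fun i j =>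
    hd'.map_covec U α hα (Z' i) (Z' j) ⟨φ.base x, hx⟩
  rw [e1 X, e1 Y]
  simp only [contract_sum_left, map_sum, map_smul, e5]
  simp only [e2, e3, dirDeriv_sum]
  rw [LinearMap.dualMap_apply, e4]
  simp only [map_add, map_sub, map_sum, map_smul, smul_eq_mul, AlgHom.commutes]
  have e6 : ∀ i, α ⟨φ.base x, hx⟩ (Z' i (φ.base x)) = H i (φ.base x) := fun i => (hHx i _ hx).symm
  simp only [e6]
  have e7 := congrArg (algebraMap ℝ (E.Ext x)) (covec_identity (fun i => C X i x)
    (fun i => C Y i x) (fun i => H i (φ.base x)) (fun j => E.dirDeriv (C Y j) (A.anchor x (X x)))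
    (fun i => E.dirDeriv (C X i) (A.anchor x (Y x)))
    (fun i j => E'.dirDeriv (H j) (A'.anchor (φ.base x) (Z' i (φ.base x))))
    (fun i j => α ⟨φ.base x, hx⟩ (A'.bracket (Z' i) (Z' j) (φ.base x))))
  simp only [map_sum, map_mul, map_sub, map_add] at e7
  simp only [map_sum, map_mul, Algebra.smul_def]
  exact e7

/-- A morphism of Lie algebroids relates the differentials. -/
theorem related (hφ : IsLieAlgebroidHom A A' φ) :
    GradedSpace.Related (X := E.shiftObj) (Y := E'.shiftObj) (shiftMap φ) A.differential
      A'.differential := by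
  have hd := A.isDifferential_differential
  have hd' := A'.isDifferential_differential
  intro U a
  refine func_ext (E := E) (U := preim φ U) fun x => ?_
  have key : ∀ hx : φ.base x.1 ∈ U, ExteriorAlgebra.map (φ.fib x.1).dualMap
      (E'.val (A'.differential.toFun U a) ⟨φ.base x.1, hx⟩) =
      E.val (A.differential.toFun (preim φ U) (pullForm φ U a)) ⟨x.1, hx⟩ := by
    refine func_induction (φ.base x.1) (P := fun U a => ∀ hx : φ.base x.1 ∈ U,
      ExteriorAlgebra.map (φ.fib x.1).dualMap
      (E'.val (A'.differential.toFun U a) ⟨φ.base x.1, hx⟩) =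
      E.val (A.differential.toFun (preim φ U) (pullForm φ U a)) ⟨x.1, hx⟩) ?_ ?_ ?_ ?_ ?_ x.2 a
    · intro U V h hxV a ih hx
      have h1 := ih hxV
      have h2 : pullForm φ V (E'.shiftObj.res h a) =
        E.shiftObj.res (U := preim φ U) (V := preim φ V) (fun _ hy => h hy) (pullForm φ U a) := rfl
      rw [h2, A'.differential.res h] at h1
      have h3 := A.differential.res (U := preim φ U) (V := preim φ V) (fun _ hy => h hy) (pullForm φ U a)
      exact h1.trans (congrArg (fun c => E.val c (⟨x.1, hxV⟩ : preim φ V)) h3)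
    · intro U hxU f hf hx
      exact hφ.map_differential_fun hd hd' f hf x.1 hx
    · intro U hxU α hα hx
      exact hφ.map_differential_covec hd hd' α hα x.1 hx
    · intro U _ a b ha hb hx
      rw [map_add, val_add, map_add, map_add, map_add, val_add, ha hx, hb hx]
    · intro U _ a b ha hb hx
      rw [val_vectorField_mul, map_add, map_mul, map_mul, map_mul, val_vectorField_mul, ha hx, hb hx,
        val_pullForm, val_pullForm, ExteriorAlgebra.map_invol]
  exact key x.2

end IsLieAlgebroidHom



/-! ### Germs of smooth functions and local coordinates -/

namespace SmoothVB

variable {E : SmoothVB}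

/-- The largest open set on which a function is smooth. -/
def smoothDom (E : SmoothVB) (f : E.base → ℝ) : Opens E.base :=
  ⟨interior {y | E.SmoothAt f y}, isOpen_interior⟩

theorem mem_smoothDom {f : E.base → ℝ} {w : E.base} : w ∈ E.smoothDom f ↔ E.SmoothNear f w :=
  mem_interior_iff_mem_nhds

theorem isSmoothFun_smoothDom (f : E.base → ℝ) : E.IsSmoothFun (E.smoothDom f) fun x => f x.1 :=
  isSmoothFun_of_smoothAt (F := f) (fun _ hx => (mem_smoothDom.1 hx).self) fun _ _ => rfl

theorem IsSmoothFun.le_smoothDom {U : Opens E.base} {f : E.base → ℝ}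
    (hf : E.IsSmoothFun U fun x => f x.1) : U ≤ E.smoothDom f := fun x hx => by
  refine mem_smoothDom.2 ?_
  filter_upwards [U.isOpen.mem_nhds hx] with y hy
  exact (hf.smoothAt hy).congr_of_eventuallyEq
    (extend_eventuallyEq (f := fun x : U => f x.1) (F := f) le_rfl (fun _ _ => rfl) hy).symm

theorem SmoothNear.add {f g : E.base → ℝ} {w : E.base} (hf : E.SmoothNear f w)
    (hg : E.SmoothNear g w) : E.SmoothNear (fun y => f y + g y) w := by
  filter_upwards [hf, hg] with y h1 h2 using h1.add h2

theorem SmoothNear.mul {f g : E.base → ℝ} {w : E.base} (hf : E.SmoothNear f w)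
    (hg : E.SmoothNear g w) : E.SmoothNear (fun y => f y * g y) w := by
  filter_upwards [hf, hg] with y h1 h2 using h1.mul h2

theorem smoothNear_const (r : ℝ) (w : E.base) : E.SmoothNear (fun _ => r) w :=
  Filter.Eventually.of_forall fun _ => contMDiffAt_const

theorem SmoothNear.inv {f : E.base → ℝ} {w : E.base} (hf : E.SmoothNear f w) (h : f w ≠ 0) :
    E.SmoothNear (fun y => (f y)⁻¹) w := by
  filter_upwards [hf, hf.self.continuousAt.eventually_ne h] with y h1 h2 using h1.inv₀ h2

theorem SmoothNear.sum {ι : Type} (s : Finset ι) {f : ι → E.base → ℝ} {w : E.base}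
    (hf : ∀ i, E.SmoothNear (f i) w) : E.SmoothNear (fun y => ∑ i ∈ s, f i y) w := by
  classical
  induction s using Finset.induction_on with
  | empty => simpa using smoothNear_const 0 w
  | insert i s hi ih =>
    simp only [Finset.sum_insert hi]
    exact (hf i).add ih

/-- `κ` is a system of coordinates near `w` with values in a normed space, with inverse `σ`. Both
maps are only relevant near `w` and near `κ w`. -/
structure IsCoords {V : Type} [NormedAddCommGroup V] [NormedSpace ℝ V] (E : SmoothVB) (w : E.base)
    (κ : E.base → V) (σ : V → E.base) : Prop where
  smooth : ∀ᶠ y in 𝓝 w, ContMDiffAt (𝓡 E.dim) 𝓘(ℝ, V) ∞ κ y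
  smooth_inv : ∀ᶠ q in 𝓝 (κ w), ContMDiffAt 𝓘(ℝ, V) (𝓡 E.dim) ∞ σ q
  left_inv : ∀ᶠ y in 𝓝 w, σ (κ y) = y
  right_inv : ∀ᶠ q in 𝓝 (κ w), κ (σ q) = q

namespace IsCoords

variable {V : Type} [NormedAddCommGroup V] [NormedSpace ℝ V] {w : E.base} {κ : E.base → V}
  {σ : V → E.base}

theorem tendsto (hc : IsCoords E w κ σ) : Filter.Tendsto κ (𝓝 w) (𝓝 (κ w)) :=
  hc.smooth.self_of_nhds.continuousAt

theorem tendsto_inv (hc : IsCoords E w κ σ) : Filter.Tendsto σ (𝓝 (κ w)) (𝓝 w) := by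
  have h := hc.smooth_inv.self_of_nhds.continuousAt
  rwa [ContinuousAt, hc.left_inv.self_of_nhds] at h

theorem eventually (hc : IsCoords E w κ σ) : ∀ᶠ y in 𝓝 w, IsCoords E y κ σ := by
  filter_upwards [hc.smooth.eventually_nhds, hc.tendsto.eventually hc.smooth_inv.eventually_nhds,
    hc.left_inv.eventually_nhds, hc.tendsto.eventually hc.right_inv.eventually_nhds]
    with y h1 h2 h3 h4 using ⟨h1, h2, h3, h4⟩

theorem smoothGermAt (hc : IsCoords E w κ σ) {f : E.base → ℝ} (hf : E.SmoothNear f w) :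
    SmoothGermAt (fun q => f (σ q)) (κ w) := by
  filter_upwards [hc.smooth_inv, hc.tendsto_inv.eventually hf] with q h1 h2
  exact contMDiffAt_iff_contDiffAt.1 (ContMDiffAt.comp q h2 h1)

theorem smoothNear_comp (hc : IsCoords E w κ σ) {g : V → ℝ} (hg : SmoothGermAt g (κ w)) :
    E.SmoothNear (fun y => g (κ y)) w := by
  filter_upwards [hc.smooth, hc.tendsto.eventually hg] with y h1 h2
  exact ContMDiffAt.comp y h2.contMDiffAt h1

theorem smoothNear_coord [FiniteDimensional ℝ V] {ι : Type} [Fintype ι] (hc : IsCoords E w κ σ)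
    (b : Module.Basis ι ℝ V) (i : ι) : E.SmoothNear (fun y => b.coord i (κ y)) w :=
  hc.smoothNear_comp (g := b.coord i) (Filter.Eventually.of_forall fun _ =>
    (LinearMap.toContinuousLinearMap (b.coord i)).contDiff.contDiffAt)

theorem hadamard [FiniteDimensional ℝ V] {ι : Type} [Fintype ι] (hc : IsCoords E w κ σ)
    (b : Module.Basis ι ℝ V) {f : E.base → ℝ} (hf : E.SmoothNear f w) :
    ∃ G : ι → E.base → ℝ, (∀ i, E.SmoothNear (G i) w) ∧ f =ᶠ[𝓝 w]
      fun y => f w + ∑ i, (b.coord i (κ y) + -b.coord i (κ w)) * G i y := by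
  obtain ⟨G, hG, h⟩ := (hc.smoothGermAt hf).hadamard b
  refine ⟨fun i y => G i (κ y), fun i => hc.smoothNear_comp (Filter.Eventually.of_forall fun x =>
    (hG i).contDiffAt), ?_⟩
  filter_upwards [hc.tendsto.eventually h, hc.left_inv] with y h1 h2
  rw [h2, hc.left_inv.self_of_nhds] at h1
  simpa only [sub_eq_add_neg] using h1

end IsCoords

/-- A `1`-form is the combination of the dual coframe with its values on the frame. -/
theorem LocalFrame.res_covecForm {U W : Opens E.base} {ι : Type} [Fintype ι] (F : LocalFrame E W ι)
    {α : ∀ x : U, Module.Dual ℝ (E.fib x.1)} (hα : E.IsSmoothCovec U α) :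
    E.shiftObj.res (inf_le_left : U ⊓ W ≤ U) (E.covecForm U α hα) =
      ∑ j, E.funForm (U ⊓ W) _ (F.smooth_apply inf_le_right
        (hα.restr (inf_le_left : U ⊓ W ≤ U)) j) *
        E.shiftObj.res (inf_le_right : U ⊓ W ≤ W) (LieAlgebroid.frameCovec F le_rfl j) := by
  refine func_ext fun y => ?_
  rw [LieAlgebroid.val_sum]
  change ExteriorAlgebra.ι ℝ (α ⟨y.1, y.2.1⟩) = ∑ j, algebraMap ℝ (E.Ext y.1) _ *
    ExteriorAlgebra.ι ℝ ((F.basis ⟨y.1, y.2.2⟩).coord j)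
  conv_lhs => rw [← F.sum_apply_smul_coord ⟨y.1, y.2.2⟩ (α ⟨y.1, y.2.1⟩), map_sum]
  refine Finset.sum_congr rfl fun j _ => ?_
  rw [map_smul, Algebra.smul_def]

end SmoothVB

/-! ### Homomorphisms on germs of functions of the shifted bundle -/

open SmoothVB

/-- A degree-preserving homomorphism from the germs at `w` of functions on `[-1]E` to the polynomials
in coordinates of nonzero degree. -/
structure GermHom (E : SmoothVB) (w : E.base) (p : ℤ → ℕ) where
  toFun : ∀ U : Opens E.base, w ∈ U → E.shiftObj.func U →ₐ[ℝ] SuperPoly p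
  res : ∀ {U V : Opens E.base} (h : V ≤ U) (hw : w ∈ V) (a : E.shiftObj.func U),
    toFun V hw (E.shiftObj.res h a) = toFun U (h hw) a
  map_deg : ∀ (U : Opens E.base) (hw : w ∈ U) (k : ℤ), ∀ a ∈ E.shiftObj.deg U k,
    toFun U hw a ∈ SuperPoly.deg p k

namespace GermHom

variable {E : SmoothVB} {w : E.base} {p : ℤ → ℕ} (H : GermHom E w p)

open Classical in
/-- The value on a smooth function, with value `0` for functions that are not smooth near `w`. -/
def fn (f : E.base → ℝ) : SuperPoly p :=
  if hw : w ∈ E.smoothDom f then H.toFun _ hw (E.funForm _ _ (isSmoothFun_smoothDom f)) else 0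

theorem fn_eq {U : Opens E.base} (hw : w ∈ U) {f : E.base → ℝ}
    (hf : E.IsSmoothFun U fun x => f x.1) : H.fn f = H.toFun U hw (E.funForm U _ hf) := by
  rw [fn, dif_pos (hf.le_smoothDom hw), ← H.res hf.le_smoothDom hw]
  rfl

theorem fn_extend {U : Opens E.base} (hw : w ∈ U) (f : U → ℝ) (hf : E.IsSmoothFun U f) :
    H.fn (Function.extend Subtype.val f 0) = H.toFun U hw (E.funForm U f hf) := by
  have h : (fun x : U => Function.extend Subtype.val f 0 x.1) = f :=
    funext fun x => extend_apply_of_mem f x.2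
  rw [H.fn_eq hw (f := Function.extend Subtype.val f 0) (by rwa [h])]
  congr 1
  exact func_ext fun x => congrArg (algebraMap ℝ (E.Ext x.1)) (congrFun h x)

/-- Finitely many germs have representatives on a common neighbourhood. -/
theorem exists_nhd {f : E.base → ℝ} (hf : E.SmoothNear f w) {s : Set E.base} (hs : s ∈ 𝓝 w) :
    ∃ U : Opens E.base, w ∈ U ∧ (U : Set E.base) ⊆ s ∧ E.IsSmoothFun U fun x => f x.1 := by
  obtain ⟨u, hu, huo, hwu⟩ := mem_nhds_iff.1 (Filter.inter_mem hs hf)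
  exact ⟨⟨u, huo⟩, hwu, fun x hx => (hu hx).1,
    isSmoothFun_of_smoothAt (F := f) (fun x hx => (hu hx).2) fun _ _ => rfl⟩

theorem fn_congr {f g : E.base → ℝ} (hf : E.SmoothNear f w) (h : f =ᶠ[𝓝 w] g) :
    H.fn f = H.fn g := by
  obtain ⟨U, hw, hs, h1⟩ := exists_nhd hf h
  have h2 : (fun x : U => f x.1) = fun x => g x.1 := funext fun x => hs x.2
  rw [H.fn_eq hw h1, H.fn_eq hw (f := g) (h2 ▸ h1)]
  congr 1
  exact func_ext fun x => congrArg (algebraMap ℝ (E.Ext x.1)) (congrFun h2 x)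

theorem fn_add {f g : E.base → ℝ} (hf : E.SmoothNear f w) (hg : E.SmoothNear g w) :
    H.fn (fun y => f y + g y) = H.fn f + H.fn g := by
  obtain ⟨U, hw, hs, h1⟩ := exists_nhd hf hg
  have h2 : E.IsSmoothFun U fun x => g x.1 :=
    isSmoothFun_of_smoothAt (F := g) (fun x hx => hs hx) fun _ _ => rfl
  rw [H.fn_eq hw h1, H.fn_eq hw h2, H.fn_eq hw (h1.add h2), ← map_add]
  congr 1
  exact func_ext fun x => map_add (algebraMap ℝ (E.Ext x.1)) _ _

theorem fn_mul {f g : E.base → ℝ} (hf : E.SmoothNear f w) (hg : E.SmoothNear g w) :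
    H.fn (fun y => f y * g y) = H.fn f * H.fn g := by
  obtain ⟨U, hw, hs, h1⟩ := exists_nhd hf hg
  have h2 : E.IsSmoothFun U fun x => g x.1 :=
    isSmoothFun_of_smoothAt (F := g) (fun x hx => hs hx) fun _ _ => rfl
  rw [H.fn_eq hw h1, H.fn_eq hw h2, H.fn_eq hw (h1.mul h2), ← map_mul]
  congr 1
  exact func_ext fun x => map_mul (algebraMap ℝ (E.Ext x.1)) _ _

theorem fn_const (r : ℝ) : H.fn (fun _ => r) = algebraMap ℝ _ r := by
  rw [H.fn_eq (U := ⊤) trivial (isSmoothFun_const r)]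
  exact AlgHom.commutes _ r

theorem fn_sum {ι : Type} (s : Finset ι) {f : ι → E.base → ℝ}
    (hf : ∀ i, E.SmoothNear (f i) w) : H.fn (fun y => ∑ i ∈ s, f i y) = ∑ i ∈ s, H.fn (f i) := by
  classical
  induction s using Finset.induction_on with
  | empty => simpa using H.fn_const 0
  | insert i s hi ih =>
    simp only [Finset.sum_insert hi]
    rw [H.fn_add (hf i) (SmoothNear.sum s hf), ih]

theorem fn_mem (f : E.base → ℝ) : H.fn f ∈ SuperPoly.degZero p := by
  unfold fn
  split_ifs with h
  · exact H.map_deg _ _ 0 _ (funForm_mem_deg _ _)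
  · exact Subalgebra.zero_mem _

/-- Homomorphisms on germs are compatible with evaluation: a function that does not vanish at `w` is
invertible near `w`. -/
theorem evalAt_fn {f : E.base → ℝ} (hf : E.SmoothNear f w) (a) :
    SuperPoly.evalAt a (H.fn f) = f w := by
  by_contra hne
  let r := SuperPoly.evalAt a (H.fn f)
  have h1 : E.SmoothNear (fun y => f y + -r) w := hf.add (smoothNear_const _ _)
  have h2 : f w + -r ≠ 0 := fun h => hne (by linarith)
  have h3 : (fun y => (f y + -r) * (f y + -r)⁻¹) =ᶠ[𝓝 w] fun _ => 1 := by
    filter_upwards [h1.self.continuousAt.eventually_ne h2] with y hy using mul_inv_cancel₀ hy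
  have h4 := H.fn_congr (h1.mul (h1.inv h2)) h3
  rw [H.fn_mul h1 (h1.inv h2), H.fn_add hf (smoothNear_const _ _), H.fn_const, H.fn_const] at h4
  have h5 := congrArg (SuperPoly.evalAt a) h4
  rw [map_mul, map_add, AlgHom.commutes, AlgHom.commutes] at h5
  simp only [Algebra.algebraMap_self, RingHom.id_apply] at h5
  rw [show SuperPoly.evalAt a (H.fn f) + -r = 0 from add_neg_cancel _, zero_mul] at h5
  exact zero_ne_one h5

/-- The increment of a function, as an element of the commutative ring of elements of degree `0`. -/
def incr (f : E.base → ℝ) : SuperPoly.degZero p :=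
  ⟨H.fn f, H.fn_mem f⟩ - algebraMap ℝ _ (f w)

theorem coe_incr (f : E.base → ℝ) : (H.incr f : SuperPoly p) = H.fn f - algebraMap ℝ _ (f w) := rfl

theorem evalAt_incr {f : E.base → ℝ} (hf : E.SmoothNear f w) (a) :
    SuperPoly.evalAt a (H.incr f : SuperPoly p) = 0 := by
  rw [coe_incr, map_sub, H.evalAt_fn hf, AlgHom.commutes]
  exact sub_self _

theorem _root_.SuperPoly.isNilpotent_of_evalAt {x : SuperPoly.degZero p}
    (h : ∀ a, SuperPoly.evalAt a (x : SuperPoly p) = 0) : IsNilpotent x := by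
  obtain ⟨S, hS⟩ := SuperPoly.exists_finset_mem_adjoin (x : SuperPoly p)
  exact ⟨2 ^ S.card, Subtype.ext (SuperPoly.pow_eq_zero_of_evalAt S hS h)⟩

/-- A homomorphism on germs of functions is determined by its values on coordinates. -/
theorem fn_eq_of_coords {V : Type} [NormedAddCommGroup V] [NormedSpace ℝ V] [FiniteDimensional ℝ V]
    {ι : Type} [Fintype ι] {κ : E.base → V} {σ : V → E.base} (hc : IsCoords E w κ σ)
    (b : Module.Basis ι ℝ V) {H H' : GermHom E w p}
    (h : ∀ i, H.fn (fun y => b.coord i (κ y)) = H'.fn (fun y => b.coord i (κ y)))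
    {f : E.base → ℝ} (hf : E.SmoothNear f w) : H.fn f = H'.fn f := by
  let n : ι → SuperPoly.degZero p := fun i => H.incr fun y => b.coord i (κ y)
  let J : Ideal (SuperPoly.degZero p) := Ideal.span (Set.range n)
  have hJ : IsNilpotent J := by
    rw [Ideal.FG.isNilpotent_iff_le_nilradical (Submodule.fg_span (Set.finite_range n))]
    refine Ideal.span_le.2 ?_
    rintro _ ⟨i, rfl⟩
    exact SuperPoly.isNilpotent_of_evalAt (H.evalAt_incr (hc.smoothNear_coord b i))
  obtain ⟨K, hK⟩ := hJ
  have key : ∀ k : ℕ, ∀ f : E.base → ℝ, E.SmoothNear f w →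
      (⟨H.fn f, H.fn_mem f⟩ - ⟨H'.fn f, H'.fn_mem f⟩ : SuperPoly.degZero p) ∈ J ^ k := by
    intro k
    induction k with
    | zero => intro f _; simp
    | succ k ih =>
      intro f hf
      obtain ⟨G, hG, hfG⟩ := hc.hadamard b hf
      have hd : ∀ i, E.SmoothNear (fun y => b.coord i (κ y) + -b.coord i (κ w)) w := fun i =>
        (hc.smoothNear_coord b i).add (smoothNear_const _ _)
      have h1 : ∀ H₁ : GermHom E w p, (∀ i, H₁.fn (fun y => b.coord i (κ y)) =
          H.fn (fun y => b.coord i (κ y))) → H₁.fn f = algebraMap ℝ _ (f w) +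
          ∑ i, (n i : SuperPoly p) * H₁.fn (G i) := by
        intro H₁ h₁
        rw [H₁.fn_congr hf hfG, H₁.fn_add (smoothNear_const _ _)
          (SmoothNear.sum _ fun i => (hd i).mul (hG i)), H₁.fn_const,
          H₁.fn_sum _ fun i => (hd i).mul (hG i)]
        refine congrArg _ (Finset.sum_congr rfl fun i _ => ?_)
        rw [H₁.fn_mul (hd i) (hG i), H₁.fn_add (hc.smoothNear_coord b i) (smoothNear_const _ _),
          H₁.fn_const, h₁, map_neg, ← sub_eq_add_neg]
        rfl
      have h2 : (⟨H.fn f, H.fn_mem f⟩ - ⟨H'.fn f, H'.fn_mem f⟩ : SuperPoly.degZero p) =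
          ∑ i, n i * (⟨H.fn (G i), H.fn_mem _⟩ - ⟨H'.fn (G i), H'.fn_mem _⟩) := by
        refine Subtype.ext ?_
        rw [AddSubmonoidClass.coe_finsetSum]
        change H.fn f - H'.fn f = ∑ i, (n i : SuperPoly p) * (H.fn (G i) - H'.fn (G i))
        rw [h1 H fun _ => rfl, h1 H' fun i => (h i).symm]
        simp only [mul_sub, Finset.sum_sub_distrib]
        abel
      rw [h2, pow_succ']
      exact Ideal.sum_mem _ fun i _ => Ideal.mul_mem_mul (Ideal.subset_span ⟨i, rfl⟩) (ih _ (hG i))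
  have h3 := key K f hf
  rw [hK] at h3
  exact congrArg Subtype.val (sub_eq_zero.1 ((Submodule.mem_bot _).1 h3))

/-- A homomorphism on germs is determined by its values on coordinates and on a coframe. -/
theorem eq_of_coords {V : Type} [NormedAddCommGroup V] [NormedSpace ℝ V] [FiniteDimensional ℝ V]
    {ι : Type} [Fintype ι] {κ : E.base → V} {σ : V → E.base} (hc : IsCoords E w κ σ)
    (b : Module.Basis ι ℝ V) {H H' : GermHom E w p}
    (h : ∀ i, H.fn (fun y => b.coord i (κ y)) = H'.fn (fun y => b.coord i (κ y)))
    {W : Opens E.base} {ι' : Type} [Fintype ι'] (F : LocalFrame E W ι') (hw : w ∈ W)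
    (h' : ∀ j, H.toFun W hw (LieAlgebroid.frameCovec F le_rfl j) =
      H'.toFun W hw (LieAlgebroid.frameCovec F le_rfl j))
    {U : Opens E.base} (hwU : w ∈ U) (a : E.shiftObj.func U) : H.toFun U hwU a = H'.toFun U hwU a := by
  have hfun : ∀ (U : Opens E.base) (hwU : w ∈ U) (f : U → ℝ) (hf : E.IsSmoothFun U f),
      H.toFun U hwU (E.funForm U f hf) = H'.toFun U hwU (E.funForm U f hf) := fun U hwU f hf => by
    rw [← H.fn_extend hwU f hf, ← H'.fn_extend hwU f hf]
    exact fn_eq_of_coords hc b h (hf.smoothNear hwU)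
  have key : ∀ hwU : w ∈ U, H.toFun U hwU a = H'.toFun U hwU a := by
    refine func_induction w (P := fun U a => ∀ hwU : w ∈ U, H.toFun U hwU a = H'.toFun U hwU a)
      ?_ ?_ ?_ ?_ ?_ hwU a
    · intro U V h hV a ih hwU
      have h1 := ih hV
      rwa [H.res h hV, H'.res h hV] at h1
    · intro U _ f hf hwU
      exact hfun U hwU f hf
    · intro U _ α hα hwU
      have hw' : w ∈ U ⊓ W := ⟨hwU, hw⟩
      have h2 := H.res (inf_le_left : U ⊓ W ≤ U) hw' (E.covecForm U α hα)
      have h3 := H'.res (inf_le_left : U ⊓ W ≤ U) hw' (E.covecForm U α hα)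
      refine h2.symm.trans (Eq.trans ?_ h3)
      rw [F.res_covecForm hα, map_sum, map_sum]
      refine Finset.sum_congr rfl fun j _ => ?_
      rw [map_mul, map_mul, H.res, H'.res, h', hfun]
    · intro U _ a b ha hb hwU
      rw [map_add, map_add, ha hwU, hb hwU]
    · intro U _ a b ha hb hwU
      rw [map_mul, map_mul, ha hwU, hb hwU]
  exact key hwU

/-- Homomorphisms on germs are compatible with the evaluation at `w`. -/
theorem aug_toFun {U : Opens E.base} (hw : w ∈ U) (a : E.shiftObj.func U) :
    SuperPoly.aug p (H.toFun U hw a) = ExteriorAlgebra.algebraMapInv (E.val a ⟨w, hw⟩) := by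
  have key : ∀ hw : w ∈ U, SuperPoly.aug p (H.toFun U hw a) =
      ExteriorAlgebra.algebraMapInv (E.val a ⟨w, hw⟩) := by
    refine func_induction w (P := fun U a => ∀ hw : w ∈ U, SuperPoly.aug p (H.toFun U hw a) =
      ExteriorAlgebra.algebraMapInv (E.val a ⟨w, hw⟩)) ?_ ?_ ?_ ?_ ?_ hw a
    · intro U V h hV a ih hw
      have h1 := ih hV
      rw [H.res h hV] at h1
      exact h1
    · intro U _ f hf hw
      rw [← H.fn_extend hw f hf, SuperPoly.aug_eq_evalAt, H.evalAt_fn (hf.smoothNear hw),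
        extend_apply_of_mem f hw, val_funForm, AlgHom.commutes]
      rfl
    · intro U _ α hα hw
      rw [val_covecForm, ExteriorAlgebra.algebraMapInv_ι]
      exact SuperPoly.aug_eq_zero_of_mem_deg one_ne_zero (H.map_deg U hw 1 _ (covecForm_mem_deg α hα))
    · intro U _ a b ha hb hw
      rw [map_add, map_add, val_add, map_add, ha hw, hb hw]
    · intro U _ a b ha hb hw
      rw [map_mul, map_mul, val_mul, map_mul, ha hw, hb hw]
  exact key hw

end GermHom



open SmoothVB

/-! ### Construction of homomorphisms on germs -/

namespace SuperPoly

variable {p : ℤ → ℕ}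

theorem commute_of_mem_degZero {x : SuperPoly p} (hx : x ∈ degZero p) (y : SuperPoly p) :
    Commute x y := by
  have hy : y ∈ Algebra.adjoin ℝ (Set.range (coord p)) := by rw [adjoin_coord]; trivial
  induction hy using Algebra.adjoin_induction with
  | mem y hy =>
    obtain ⟨c, rfl⟩ := hy
    have h := prod_coord_mem_deg [c]
    simp only [List.map_cons, List.map_nil, List.prod_cons, List.prod_nil, mul_one] at h
    exact commute_of_mem_deg_zero hx h
  | algebraMap r => exact (Algebra.commutes r x).symm
  | add y z _ _ h1 h2 => exact h1.add_right h2
  | mul y z _ _ h1 h2 => exact h1.mul_right h2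

theorem mul_self_of_mem_deg_one {x : SuperPoly p} (hx : x ∈ deg p 1) : x * x = 0 := by
  have h := mul_comm_of_mem_deg hx hx
  rw [show ((1 * 1 : ℤ).negOnePow : ℤ) = -1 from rfl, neg_one_smul] at h
  have h2 : (2 : ℝ) • (x * x) = 0 := by
    rw [two_smul]
    nth_rw 1 [h]
    exact neg_add_cancel _
  exact (smul_eq_zero.1 h2).resolve_left two_ne_zero

variable {ι' : Type} [Fintype ι']

theorem linearCombination_mem {θ : ι' → SuperPoly p} (hθ : ∀ j, θ j ∈ deg p 1) (v : ι' → ℝ) :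
    Fintype.linearCombination ℝ θ v ∈ deg p 1 := by
  rw [Fintype.linearCombination_apply]
  exact Submodule.sum_mem _ fun j _ => Submodule.smul_mem _ _ (hθ j)

/-- The substitution of elements of degree `1` for the generators of an exterior algebra. -/
def extLift (θ : ι' → SuperPoly p) (hθ : ∀ j, θ j ∈ deg p 1) :
    ExteriorAlgebra ℝ (ι' → ℝ) →ₐ[ℝ] SuperPoly p :=
  ExteriorAlgebra.lift ℝ ⟨Fintype.linearCombination ℝ θ,
    fun v => mul_self_of_mem_deg_one (linearCombination_mem hθ v)⟩

theorem extLift_ι (θ : ι' → SuperPoly p) (hθ : ∀ j, θ j ∈ deg p 1) (v : ι' → ℝ) :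
    extLift θ hθ (ExteriorAlgebra.ι ℝ v) = ∑ j, v j • θ j := by
  rw [extLift, ExteriorAlgebra.lift_ι_apply, Fintype.linearCombination_apply]

theorem extLift_mem_deg (θ : ι' → SuperPoly p) (hθ : ∀ j, θ j ∈ deg p 1) {k : ℤ}
    {a : ExteriorAlgebra ℝ (ι' → ℝ)} (ha : a ∈ ExteriorAlgebra.intDeg (ι' → ℝ) k) :
    extLift θ hθ a ∈ deg p k := by
  have key : ∀ (n : ℕ) (a : ExteriorAlgebra ℝ (ι' → ℝ)),
      a ∈ LinearMap.range (ExteriorAlgebra.ι ℝ (M := ι' → ℝ)) ^ n → extLift θ hθ a ∈ deg p (n : ℤ) := by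
    intro n a ha
    induction ha using Submodule.pow_induction_on_left' with
    | algebraMap r =>
      rw [AlgHom.commutes]
      exact algebraMap_mem_deg r
    | add x y i _ _ h1 h2 =>
      rw [map_add]
      exact Submodule.add_mem _ h1 h2
    | mem_mul m hm i x _ h1 =>
      obtain ⟨v, rfl⟩ := hm
      rw [map_mul]
      have h2 : extLift θ hθ (ExteriorAlgebra.ι ℝ v) ∈ deg p 1 := by
        rw [extLift, ExteriorAlgebra.lift_ι_apply]
        exact linearCombination_mem hθ v
      have h3 := mul_mem_deg h2 h1
      rwa [show (1 : ℤ) + (i : ℤ) = ((i + 1 : ℕ) : ℤ) by push_cast; ring] at h3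
  match k, ha with
  | Int.negSucc n, ha =>
    rw [show a = 0 from ha, map_zero]
    exact Submodule.zero_mem _
  | Int.ofNat n, ha => exact key n a ha

end SuperPoly

theorem Ideal.span_range_pow_eq_bot {R : Type} [CommRing R] {ι : Type} [Fintype ι] {n : ι → R} {M : ℕ}
    (h : ∀ i, n i ^ M = 0) : Ideal.span (Set.range n) ^ (Fintype.card ι * M + 1) = ⊥ := by
  classical
  have key : ∀ s : Finset ι, Ideal.span (n '' s) ^ (s.card * M + 1) = ⊥ := by
    intro s
    induction s using Finset.induction_on with
    | empty => simp
    | insert i s hi ih =>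
      rw [Finset.coe_insert, Set.image_insert_eq, Ideal.span_insert, Finset.card_insert_of_notMem hi,
        eq_bot_iff, show (s.card + 1) * M + 1 = M + (s.card * M + 1) by ring]
      refine Ideal.sup_pow_add_le_pow_sup_pow.trans ?_
      rw [ih, Ideal.span_singleton_pow, h, sup_bot_eq, Ideal.span_singleton_eq_bot.2 rfl]
  have h1 := key Finset.univ
  rwa [Finset.coe_univ, Set.image_univ, Finset.card_univ] at h1

namespace GermHom

variable {E : SmoothVB} {w : E.base} {p : ℤ → ℕ} {V : Type} [NormedAddCommGroup V]
  [NormedSpace ℝ V] {ι : Type} [Fintype ι] {κ : E.base → V} {σ : V → E.base}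
  (hc : IsCoords E w κ σ) (b : Module.Basis ι ℝ V) {W : Opens E.base} {ι' : Type} [Fintype ι']
  (F : LocalFrame E W ι') (hw : w ∈ W) (n : ι → SuperPoly.degZero p) {N : ℕ}
  (hN : Ideal.span (Set.range n) ^ (N + 2) = ⊥) (θ : ι' → SuperPoly p)
  (hθ : ∀ j, θ j ∈ SuperPoly.deg p 1)

/-- The Taylor expansion of smooth functions at nilpotent increments of the coordinates. -/
def taylorHom {U : Opens E.base} (hwU : w ∈ U) : E.smoothFun U →ₐ[ℝ] SuperPoly.degZero p :=
  have hs : ∀ f : E.smoothFun U, SmoothGermAt (fun q => Function.extend Subtype.val f.1 0 (σ q)) (κ w) :=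
    fun f => hc.smoothGermAt (IsSmoothFun.smoothNear f.2 hwU)
  have hU : ∀ᶠ q in 𝓝 (κ w), σ q ∈ U := hc.tendsto_inv.eventually (U.isOpen.mem_nhds hwU)
  have hconst : ∀ r : ℝ, taylorEval b n (κ w) (N + 2) (fun q => Function.extend Subtype.val
      (algebraMap ℝ (E.smoothFun U) r).1 0 (σ q)) = algebraMap ℝ _ r := fun r => by
    rw [← taylorEval_const b n (q := κ w) (N + 1) r]
    exact taylorEval_congr b n _ (by
      filter_upwards [hU] with q hq
      exact extend_apply_of_mem _ hq)
  { toFun := fun f => taylorEval b n (κ w) (N + 2) fun q => Function.extend Subtype.val f.1 0 (σ q)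
    map_one' := by simpa using hconst 1
    map_zero' := by simpa using hconst 0
    map_mul' := fun f g => by
      rw [← taylorEval_mul b n hN (hs f) (hs g)]
      exact taylorEval_congr b n _ (by
        filter_upwards [hU] with q hq
        rw [extend_apply_of_mem _ hq, extend_apply_of_mem _ hq, extend_apply_of_mem _ hq]
        rfl)
    map_add' := fun f g => by
      rw [← taylorEval_add b n _ (hs f) (hs g)]
      exact taylorEval_congr b n _ (by
        filter_upwards [hU] with q hq
        rw [extend_apply_of_mem _ hq, extend_apply_of_mem _ hq, extend_apply_of_mem _ hq]
        rfl)
    commutes' := hconst }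

theorem taylorHom_eq {U : Opens E.base} (hwU : w ∈ U) (f : E.smoothFun U) {g : E.base → ℝ}
    (h : ∀ᶠ y in 𝓝 w, Function.extend Subtype.val f.1 0 y = g y) :
    taylorHom hc b n hN hwU f = taylorEval b n (κ w) (N + 2) fun q => g (σ q) :=
  taylorEval_congr b n _ (hc.tendsto_inv.eventually h)

/-- The homomorphism on forms over the domain of a frame which is given by Taylor expansion on
functions and by substitution on the frame. -/
def onForms {U : Opens E.base} (hwU : w ∈ U) (hU : U ≤ W) : E.shiftObj.func U →ₐ[ℝ] SuperPoly p :=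
  (Algebra.TensorProduct.lift ((SuperPoly.degZero p).val.comp (taylorHom hc b n hN hwU))
    (SuperPoly.extLift θ hθ) fun f _ =>
      SuperPoly.commute_of_mem_degZero (taylorHom hc b n hN hwU f).2 _).comp
    (F.formsEquiv hU).symm.toAlgHom

theorem onForms_eq_sum {U : Opens E.base} (hwU : w ∈ U) (hU : U ≤ W) {a : E.shiftObj.func U} {m : Type}
    [Fintype m] (f : m → E.smoothFun U) (v : m → ExteriorAlgebra ℝ (ι' → ℝ))
    (h : ∀ x : U, E.val a x = ∑ i, (f i).1 x • F.expand ⟨x.1, hU x.2⟩ (v i)) :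
    onForms hc b F n hN θ hθ hwU hU a =
      ∑ i, (taylorHom hc b n hN hwU (f i) : SuperPoly p) * SuperPoly.extLift θ hθ (v i) := by
  obtain rfl : F.formsEquiv hU (∑ i, f i ⊗ₜ v i) = a :=
    func_ext fun x => (F.val_toForms_sum hU f v x).trans (h x).symm
  have h1 : (F.formsEquiv hU).symm.toAlgHom (F.formsEquiv hU (∑ i, f i ⊗ₜ v i)) = ∑ i, f i ⊗ₜ v i :=
    AlgEquiv.symm_apply_apply _ _
  rw [onForms, AlgHom.comp_apply, h1, map_sum]
  exact Finset.sum_congr rfl fun i _ => Algebra.TensorProduct.lift_tmul _ _ _ _ _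

theorem onForms_res {U U' : Opens E.base} (h : U' ≤ U) (hwU : w ∈ U') (hU : U ≤ W)
    (a : E.shiftObj.func U) : onForms hc b F n hN θ hθ hwU (h.trans hU) (E.shiftObj.res h a) =
      onForms hc b F n hN θ hθ (h hwU) hU a := by
  obtain ⟨m, f, v, h1⟩ := F.exists_eq_sum hU a
  rw [onForms_eq_sum hc b F n hN θ hθ (h hwU) hU f v h1,
    onForms_eq_sum hc b F n hN θ hθ hwU (h.trans hU) (fun i => ⟨_, IsSmoothFun.restr h (f i).2⟩) v
      fun x => h1 ⟨x.1, h x.2⟩]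
  refine Finset.sum_congr rfl fun i _ => ?_
  congr 2
  refine taylorHom_eq hc b n hN hwU _ ?_
  filter_upwards [U'.isOpen.mem_nhds hwU] with y hy
  rw [extend_apply_of_mem _ hy, extend_apply_of_mem _ (h hy)]

/-- The homomorphism on germs with prescribed values on coordinates and on a frame. -/
def ofTaylor : GermHom E w p where
  toFun U hwU := (onForms hc b F n hN θ hθ (U := U ⊓ W) ⟨hwU, hw⟩ inf_le_right).comp
    (E.shiftObj.res (inf_le_left : U ⊓ W ≤ U))
  res {U U'} h hwU a := onForms_res hc b F n hN θ hθ
    (le_inf (inf_le_left.trans h) inf_le_right : U' ⊓ W ≤ U ⊓ W) ⟨hwU, hw⟩ inf_le_right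
    (E.shiftObj.res (inf_le_left : U ⊓ W ≤ U) a)
  map_deg U hwU k a ha := by
    have h1 := (isSupermanifold_shiftObj E).res_deg (inf_le_left : U ⊓ W ≤ U) k a ha
    obtain ⟨m, f, v, hv, h⟩ := F.exists_eq_sum_of_mem_deg (U := U ⊓ W) inf_le_right h1
    refine (congrArg (· ∈ SuperPoly.deg p k)
      (onForms_eq_sum hc b F n hN θ hθ (U := U ⊓ W) ⟨hwU, hw⟩ inf_le_right f v h)).mpr ?_
    refine Submodule.sum_mem _ fun i _ => ?_
    rw [← zero_add k]
    exact SuperPoly.mul_mem_deg (taylorHom hc b n hN _ (f i)).2 (SuperPoly.extLift_mem_deg θ hθ (hv i))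

theorem ofTaylor_apply {U : Opens E.base} (hwU : w ∈ U) (a : E.shiftObj.func U) :
    (ofTaylor hc b F hw n hN θ hθ).toFun U hwU a =
      onForms hc b F n hN θ hθ (U := U ⊓ W) ⟨hwU, hw⟩ inf_le_right
        (E.shiftObj.res (inf_le_left : U ⊓ W ≤ U) a) := rfl

theorem ofTaylor_fn {f : E.base → ℝ} (hf : E.SmoothNear f w) :
    (ofTaylor hc b F hw n hN θ hθ).fn f = (taylorEval b n (κ w) (N + 2) fun q => f (σ q) :
      SuperPoly.degZero p) := by
  obtain ⟨U, hwU, -, h1⟩ := exists_nhd hf Filter.univ_mem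
  have hwU' : w ∈ U ⊓ W := ⟨hwU, hw⟩
  have h2 := h1.restr (inf_le_left : U ⊓ W ≤ U)
  rw [GermHom.fn_eq _ hwU h1, ofTaylor_apply]
  rw [onForms_eq_sum hc b F n hN θ hθ hwU' inf_le_right (fun _ : Unit => ⟨_, h2⟩) (fun _ => 1)
    fun x => ?_]
  · rw [Fintype.sum_unique, map_one, mul_one]
    congr 1
    refine taylorHom_eq hc b n hN hwU' _ ?_
    filter_upwards [(U ⊓ W).isOpen.mem_nhds hwU'] with y hy
    exact extend_apply_of_mem _ hy
  · rw [Fintype.sum_unique, map_one]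
    exact Algebra.algebraMap_eq_smul_one (A := E.Ext x.1) (f x.1)

theorem ofTaylor_coord [FiniteDimensional ℝ V] (i : ι) :
    (ofTaylor hc b F hw n hN θ hθ).fn (fun y => b.coord i (κ y)) =
      algebraMap ℝ _ (b.coord i (κ w)) + n i := by
  rw [ofTaylor_fn hc b F hw n hN θ hθ (hc.smoothNear_coord b i),
    taylorEval_congr b n (g := b.coord i) _ (hc.right_inv.mono fun q hq => congrArg _ hq),
    taylorEval_coord]
  rfl

theorem ofTaylor_frame (j : ι') :
    (ofTaylor hc b F hw n hN θ hθ).toFun W hw (LieAlgebroid.frameCovec F le_rfl j) = θ j := by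
  classical
  have hw' : w ∈ W ⊓ W := ⟨hw, hw⟩
  rw [ofTaylor_apply, onForms_eq_sum hc b F n hN θ hθ hw' inf_le_right (fun _ : Unit => 1)
    (fun _ => ExteriorAlgebra.ι ℝ (Pi.single j 1)) fun x => ?_]
  · rw [Fintype.sum_unique, map_one, SuperPoly.extLift_ι]
    simp [Pi.single_apply]
  · rw [Fintype.sum_unique]
    refine Eq.trans ?_ (one_smul ℝ _).symm
    exact ((ExteriorAlgebra.map_apply_ι _ _).trans
      (congrArg (ExteriorAlgebra.ι ℝ) (F.constr_single ⟨x.1, x.2.2⟩ j))).symm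

end GermHom



open SmoothVB

/-! ### Smooth families -/

section SmoothVia

variable {T : Type} [TopologicalSpace T] {Q : Type} [NormedAddCommGroup Q] [NormedSpace ℝ Q]
  {φ : T → Q} {t : T}

/-- The function `u` is, near `t`, a smooth function of `φ`. -/
def SmoothVia (φ : T → Q) (u : T → ℝ) (t : T) : Prop :=
  ∃ g : Q → ℝ, SmoothGermAt g (φ t) ∧ u =ᶠ[𝓝 t] fun y => g (φ y)

theorem smoothVia_const (r : ℝ) : SmoothVia φ (fun _ => r) t :=
  ⟨fun _ => r, Filter.Eventually.of_forall fun _ => contDiffAt_const, Filter.EventuallyEq.rfl⟩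

theorem SmoothVia.mul {u v : T → ℝ} (hu : SmoothVia φ u t) (hv : SmoothVia φ v t) :
    SmoothVia φ (fun y => u y * v y) t := by
  obtain ⟨g, hg, hu⟩ := hu
  obtain ⟨g', hg', hv⟩ := hv
  exact ⟨_, hg.mul hg', hu.mul hv⟩

theorem SmoothVia.comp {V : Type} [NormedAddCommGroup V] [NormedSpace ℝ V] {ι : Type} [Fintype ι]
    (b : Module.Basis ι ℝ V) {ψ : T → V}
    (hψ : ∀ i, SmoothVia φ (fun y => b.coord i (ψ y)) t) {f : V → ℝ} (hf : SmoothGermAt f (ψ t)) :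
    SmoothVia φ (fun y => f (ψ y)) t := by
  choose g hg h using hψ
  have hsum : ∀ y, (∀ i, b.coord i (ψ y) = g i (φ y)) → ∑ i, g i (φ y) • b i = ψ y := fun y hy => by
    rw [← b.sum_repr (ψ y)]
    exact Finset.sum_congr rfl fun i _ => by rw [← hy i]; rfl
  have hs : ∀ᶠ q in 𝓝 (φ t), ContDiffAt ℝ ∞ (fun q => ∑ i, g i q • b i) q := by
    filter_upwards [Filter.eventually_all.2 hg] with q hq
    exact ContDiffAt.sum fun i _ => (hq i).smul contDiffAt_const
  have ht := hsum t fun i => (h i).self_of_nhds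
  refine ⟨fun q => f (∑ i, g i q • b i), ?_, ?_⟩
  · have hc : Filter.Tendsto (fun q => ∑ i, g i q • b i) (𝓝 (φ t)) (𝓝 (ψ t)) := by
      have := hs.self_of_nhds.continuousAt
      rwa [ContinuousAt, ht] at this
    filter_upwards [hs, hc.eventually hf] with q h1 h2
    exact ContDiffAt.comp q h2 h1
  · filter_upwards [Filter.eventually_all.2 h] with y hy
    rw [hsum y hy]

variable {A : Type} [Ring A] [Algebra ℝ A]

/-- The function `G` is, near `t`, of the form `∑ uᵢ wᵢ` with smooth functions `uᵢ` of `φ` and with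
constant vectors `wᵢ`. -/
def PolySmoothAt (φ : T → Q) (G : T → A) (t : T) : Prop :=
  ∃ (m : Type) (_ : Fintype m) (u : m → T → ℝ) (w : m → A), (∀ i, SmoothVia φ (u i) t) ∧
    ∀ᶠ y in 𝓝 t, G y = ∑ i, u i y • w i

namespace PolySmoothAt

theorem congr {G G' : T → A} (h : PolySmoothAt φ G t) (hG : G' =ᶠ[𝓝 t] G) : PolySmoothAt φ G' t := by
  obtain ⟨m, _, u, w, hu, h⟩ := h
  exact ⟨m, _, u, w, hu, hG.trans h⟩

theorem smul_const {u : T → ℝ} (hu : SmoothVia φ u t) (w : A) : PolySmoothAt φ (fun y => u y • w) t :=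
  ⟨Unit, inferInstance, fun _ => u, fun _ => w, fun _ => hu, Filter.Eventually.of_forall fun _ => by simp⟩

theorem algebraMap {u : T → ℝ} (hu : SmoothVia φ u t) :
    PolySmoothAt φ (fun y => algebraMap ℝ A (u y)) t :=
  (smul_const hu (1 : A)).congr (Filter.Eventually.of_forall fun _ => Algebra.algebraMap_eq_smul_one _)

theorem const (w : A) : PolySmoothAt φ (fun _ => w) t :=
  (smul_const (smoothVia_const 1) w).congr (Filter.Eventually.of_forall fun _ => (one_smul ℝ w).symm)

theorem add {G G' : T → A} (h : PolySmoothAt φ G t) (h' : PolySmoothAt φ G' t) :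
    PolySmoothAt φ (fun y => G y + G' y) t := by
  obtain ⟨m, _, u, w, hu, h⟩ := h
  obtain ⟨m', _, u', w', hu', h'⟩ := h'
  refine ⟨m ⊕ m', inferInstance, Sum.elim u u', Sum.elim w w', ?_, ?_⟩
  · rintro (i | i)
    exacts [hu i, hu' i]
  · filter_upwards [h, h'] with y h1 h2
    rw [h1, h2, Fintype.sum_sum_type]
    rfl

theorem mul {G G' : T → A} (h : PolySmoothAt φ G t) (h' : PolySmoothAt φ G' t) :
    PolySmoothAt φ (fun y => G y * G' y) t := by
  obtain ⟨m, _, u, w, hu, h⟩ := h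
  obtain ⟨m', _, u', w', hu', h'⟩ := h'
  refine ⟨m × m', inferInstance, fun i y => u i.1 y * u' i.2 y, fun i => w i.1 * w' i.2,
    fun i => (hu _).mul (hu' _), ?_⟩
  filter_upwards [h, h'] with y h1 h2
  rw [h1, h2, Finset.sum_mul_sum, Fintype.sum_prod_type]
  simp only [smul_mul_smul_comm]

theorem sum {ι : Type} (s : Finset ι) {G : ι → T → A} (h : ∀ i ∈ s, PolySmoothAt φ (G i) t) :
    PolySmoothAt φ (fun y => ∑ i ∈ s, G i y) t := by
  classical
  induction s using Finset.induction_on with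
  | empty => simpa using const (φ := φ) (t := t) (0 : A)
  | insert i s hi ih =>
    simp only [Finset.sum_insert hi]
    exact (h i (Finset.mem_insert_self i s)).add (ih fun j hj => h j (Finset.mem_insert_of_mem hj))

theorem smul {u : T → ℝ} (hu : SmoothVia φ u t) {G : T → A} (h : PolySmoothAt φ G t) :
    PolySmoothAt φ (fun y => u y • G y) t :=
  ((algebraMap hu).mul h).congr (Filter.Eventually.of_forall fun _ => Algebra.smul_def _ _)

theorem sub {G G' : T → A} (h : PolySmoothAt φ G t) (h' : PolySmoothAt φ G' t) :
    PolySmoothAt φ (fun y => G y - G' y) t :=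
  (h.add (h'.smul (smoothVia_const (-1)))).congr (Filter.Eventually.of_forall fun y => by simp [sub_eq_add_neg])

end PolySmoothAt

variable {p : ℤ → ℕ}

/-- The substitution of a smooth family for the generators of an exterior algebra depends smoothly
on the parameter. -/
theorem PolySmoothAt.extLift {ι' : Type} [Fintype ι'] {θ : T → ι' → SuperPoly p}
    (hθ : ∀ y j, θ y j ∈ SuperPoly.deg p 1) (h : ∀ j, PolySmoothAt φ (fun y => θ y j) t)
    (v : ExteriorAlgebra ℝ (ι' → ℝ)) :
    PolySmoothAt φ (fun y => SuperPoly.extLift (θ y) (hθ y) v) t := by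
  induction v using ExteriorAlgebra.induction with
  | algebraMap r => simpa only [AlgHom.commutes] using const _
  | ι v =>
    simp only [SuperPoly.extLift_ι]
    exact sum _ fun j _ => (h j).smul (smoothVia_const _)
  | mul a b ha hb => simpa only [map_mul] using ha.mul hb
  | add a b ha hb => simpa only [map_add] using ha.add hb

theorem PolySmoothAt.taylorCoeff {V : Type} [NormedAddCommGroup V] [NormedSpace ℝ V] {ι : Type}
    [Fintype ι] (b : Module.Basis ι ℝ V) {ψ : T → V}
    (hψ : ∀ i, SmoothVia φ (fun y => b.coord i (ψ y)) t) {n : T → ι → SuperPoly.degZero p}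
    (hn : ∀ i, PolySmoothAt φ (fun y => (n y i : SuperPoly p)) t) (k : ℕ) {f : V → ℝ}
    (hf : SmoothGermAt f (ψ t)) :
    PolySmoothAt φ (fun y => (_root_.taylorCoeff b (n y) (ψ y) k f).1) t := by
  induction k generalizing f with
  | zero => exact algebraMap (SmoothVia.comp b hψ hf)
  | succ k ih =>
    refine ((sum Finset.univ fun i _ => (hn i).mul (ih (hf.fderiv_apply (b i)))).smul
      (smoothVia_const ((k : ℝ) + 1)⁻¹)).congr (Filter.Eventually.of_forall fun y => ?_)
    change (((k : ℝ) + 1)⁻¹ • ∑ i, n y i * _root_.taylorCoeff b (n y) (ψ y) k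
      (fun x => fderiv ℝ f x (b i)) : SuperPoly.degZero p).1 = _
    rw [show ∀ (r : ℝ) (x : SuperPoly.degZero p), (r • x : SuperPoly.degZero p).1 = r • x.1 from
      fun _ _ => rfl, AddSubmonoidClass.coe_finsetSum]
    rfl

/-- A smooth family of nilpotent elements of degree `0` is uniformly nilpotent. -/
theorem PolySmoothAt.exists_pow_eq_bot {ι : Type} [Fintype ι] {n : T → ι → SuperPoly.degZero p}
    (hn : ∀ i, PolySmoothAt φ (fun y => (n y i : SuperPoly p)) t)
    (h : ∀ y i a, SuperPoly.evalAt a (n y i : SuperPoly p) = 0) :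
    ∃ N : ℕ, ∀ᶠ y in 𝓝 t, Ideal.span (Set.range (n y)) ^ (N + 2) = ⊥ := by
  classical
  choose m hm u w hu hG using hn
  have h1 : ∀ i, ∃ S : Finset (SuperCoord p), ∀ j, w i j ∈ Algebra.adjoin ℝ (SuperPoly.coord p '' S) := by
    intro i
    let e := Fintype.equivFin (m i)
    obtain ⟨S, hS⟩ := SuperPoly.exists_finset_forall_mem_adjoin fun k => w i (e.symm k)
    exact ⟨S, fun j => by simpa using hS (e j)⟩
  choose S hS using h1
  let S' : Finset (SuperCoord p) := Finset.univ.biUnion S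
  refine ⟨Fintype.card ι * 2 ^ S'.card, ?_⟩
  filter_upwards [Filter.eventually_all.2 hG] with y hy
  have h2 : ∀ i, n y i ^ 2 ^ S'.card = 0 := fun i => by
    refine Subtype.ext (SuperPoly.pow_eq_zero_of_evalAt S' ?_ (h y i))
    rw [hy i]
    refine Subalgebra.sum_mem _ fun j _ => Subalgebra.smul_mem _ ?_ _
    refine Algebra.adjoin_mono ?_ (hS i j)
    refine Set.image_mono ?_
    exact_mod_cast Finset.subset_biUnion_of_mem S (Finset.mem_univ i)
  have h3 := Ideal.span_range_pow_eq_bot h2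
  rw [show Fintype.card ι * 2 ^ S'.card + 2 = Fintype.card ι * 2 ^ S'.card + 1 + 1 from rfl,
    pow_succ, h3, Ideal.bot_mul]

end SmoothVia

namespace GermHom

variable {T : Type} [TopologicalSpace T] {Q : Type} [NormedAddCommGroup Q] [NormedSpace ℝ Q]
  {φ : T → Q} {t : T} {E : SmoothVB} {p : ℤ → ℕ} {z : T → E.base}

/-- A family of homomorphisms on germs depends smoothly on the parameter. -/
def IsSmoothFamilyAt (φ : T → Q) (H : ∀ y, GermHom E (z y) p) (t : T) : Prop :=
  ∀ U : Opens E.base, z t ∈ U → ∀ a : E.shiftObj.func U, ∃ G : T → SuperPoly p, PolySmoothAt φ G t ∧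
    ∀ᶠ y in 𝓝 t, ∀ hy : z y ∈ U, (H y).toFun U hy a = G y

theorem IsSmoothFamilyAt.fn {H : ∀ y, GermHom E (z y) p} (h : IsSmoothFamilyAt φ H t)
    (hz : ContinuousAt z t) {f : E.base → ℝ} (hf : E.SmoothNear f (z t)) :
    PolySmoothAt φ (fun y => (H y).fn f) t := by
  obtain ⟨U, hw, -, hU⟩ := exists_nhd hf Filter.univ_mem
  obtain ⟨G, hG, h1⟩ := h U hw (E.funForm U _ hU)
  refine hG.congr ?_
  filter_upwards [h1, hz.eventually (U.isOpen.mem_nhds hw)] with y h2 hy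
  rw [(H y).fn_eq hy hU, h2 hy]

/-- The value at a moving point of a smooth function depends smoothly on the parameter, if the
homomorphism on germs does. -/
theorem smoothVia_of_fn {H : ∀ y, GermHom E (z y) p} (hz : ContinuousAt z t) {f : E.base → ℝ}
    (hf : E.SmoothNear f (z t)) (h : PolySmoothAt φ (fun y => (H y).fn f) t) :
    SmoothVia φ (fun y => f (z y)) t := by
  obtain ⟨m, _, u, w, hu, h⟩ := h
  choose g hg h1 using hu
  refine ⟨fun q => ∑ i, g i q * SuperPoly.evalAt 0 (w i), ?_, ?_⟩
  · filter_upwards [Filter.eventually_all.2 hg] with q hq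
    exact ContDiffAt.sum fun i _ => (hq i).mul contDiffAt_const
  · filter_upwards [h, Filter.eventually_all.2 h1, hz.eventually hf.eventually_nhds] with y h2 h3 h4
    rw [← (H y).evalAt_fn h4 0, h2, map_sum]
    refine Finset.sum_congr rfl fun i _ => ?_
    rw [map_smul, h3 i]
    rfl

/-- A family of homomorphisms on germs depends smoothly on the parameter if its values on coordinates
and on a frame do. -/
theorem isSmoothFamilyAt_of_coords {V : Type} [NormedAddCommGroup V] [NormedSpace ℝ V]
    [FiniteDimensional ℝ V] {ι : Type} [Fintype ι] {κ : E.base → V} {σ : V → E.base}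
    (hz : ContinuousAt z t)
    (hc : IsCoords E (z t) κ σ) (b : Module.Basis ι ℝ V) {H : ∀ y, GermHom E (z y) p}
    (h : ∀ i, PolySmoothAt φ (fun y => (H y).fn fun x => b.coord i (κ x)) t)
    {W : Opens E.base} {ι' : Type} [Fintype ι'] (F : LocalFrame E W ι') (hw : z t ∈ W)
    (h' : ∀ j, ∃ G : T → SuperPoly p, PolySmoothAt φ G t ∧ ∀ᶠ y in 𝓝 t, ∀ hy : z y ∈ W,
      (H y).toFun W hy (LieAlgebroid.frameCovec F le_rfl j) = G y) :
    IsSmoothFamilyAt φ H t := by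
  classical
  intro U hwU a
  have hψ : ∀ i, SmoothVia φ (fun y => b.coord i (κ (z y))) t := fun i =>
    smoothVia_of_fn (f := fun x => b.coord i (κ x)) hz (hc.smoothNear_coord b i) (h i)
  have hc' : ∀ᶠ y in 𝓝 t, IsCoords E (z y) κ σ := hz.eventually hc.eventually
  -- outside of the domain of the coordinates, the increments are replaced by `0`
  let n : T → ι → SuperPoly.degZero p := fun y i =>
    if IsCoords E (z y) κ σ then (H y).incr fun x => b.coord i (κ x) else 0
  have hn : ∀ i, PolySmoothAt φ (fun y => (n y i : SuperPoly p)) t := fun i => by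
    refine ((h i).sub (PolySmoothAt.algebraMap (hψ i))).congr ?_
    filter_upwards [hc'] with y hy
    simp only [n, if_pos hy]
    rfl
  have hn0 : ∀ y i c, SuperPoly.evalAt c (n y i : SuperPoly p) = 0 := fun y i c => by
    by_cases hy : IsCoords E (z y) κ σ
    · simp only [n, if_pos hy]
      exact (H y).evalAt_incr (hy.smoothNear_coord b i) c
    · simp only [n, if_neg hy]
      exact map_zero _
  obtain ⟨N, hN⟩ := PolySmoothAt.exists_pow_eq_bot hn hn0
  let θ : T → ι' → SuperPoly p := fun y j =>
    if hy : z y ∈ W then (H y).toFun W hy (LieAlgebroid.frameCovec F le_rfl j) else 0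
  have hθ : ∀ y j, θ y j ∈ SuperPoly.deg p 1 := fun y j => by
    by_cases hy : z y ∈ W
    · simp only [θ, dif_pos hy]
      exact (H y).map_deg W hy 1 _ (covecForm_mem_deg _ _)
    · simp only [θ, dif_neg hy]
      exact Submodule.zero_mem _
  have hW : ∀ᶠ y in 𝓝 t, z y ∈ W := hz.eventually (W.isOpen.mem_nhds hw)
  have hθs : ∀ j, PolySmoothAt φ (fun y => θ y j) t := fun j => by
    obtain ⟨G, hG, h1⟩ := h' j
    refine hG.congr ?_
    filter_upwards [h1, hW] with y h2 hy
    simp only [θ, dif_pos hy]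
    exact h2 hy
  obtain ⟨m, f, v, hv⟩ := F.exists_eq_sum (U := U ⊓ W) inf_le_right
    (E.shiftObj.res (inf_le_left : U ⊓ W ≤ U) a)
  let g : Fin m → E.base → ℝ := fun i => Function.extend Subtype.val (f i).1 0
  refine ⟨fun y => ∑ i, (taylorEval b (n y) (κ (z y)) (N + 2) fun q => g i (σ q) :
    SuperPoly.degZero p).1 * SuperPoly.extLift (θ y) (hθ y) (v i), ?_, ?_⟩
  · refine PolySmoothAt.sum _ fun i _ => PolySmoothAt.mul ?_ (PolySmoothAt.extLift hθ hθs (v i))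
    have hg : SmoothGermAt (fun q => g i (σ q)) (κ (z t)) :=
      hc.smoothGermAt (IsSmoothFun.smoothNear (f i).2 ⟨hwU, hw⟩)
    refine (PolySmoothAt.sum (Finset.range (N + 2)) fun k _ =>
      PolySmoothAt.taylorCoeff b hψ hn k hg).congr (Filter.Eventually.of_forall fun y => ?_)
    exact AddSubmonoidClass.coe_finsetSum (S := SuperPoly.degZero p) _ _
  · filter_upwards [hc', hN, hW] with y hcy hNy hWy hyU
    rw [GermHom.eq_of_coords hcy b (H' := ofTaylor hcy b F hWy (n y) hNy (θ y) (hθ y)) ?_ F hWy ?_ hyU a,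
      ofTaylor_apply, onForms_eq_sum hcy b F (n y) hNy (θ y) (hθ y) (U := U ⊓ W) ⟨hyU, hWy⟩ inf_le_right f v hv]
    · rfl
    · intro i
      rw [ofTaylor_coord]
      simp only [n, if_pos hcy, coe_incr]
      exact (add_sub_cancel _ _).symm
    · intro j
      rw [ofTaylor_frame]
      simp only [θ, dif_pos hWy]

end GermHom



/-! ### Bundle maps and test objects -/

namespace SmoothVB

variable {E E' E'' : SmoothVB}

/-- The map of total spaces. -/
def tot (f : E ⟶ E') (v : E.Tot) : E'.Tot := ⟨f.base v.1, f.fib v.1 v.2⟩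

theorem tot_comp (f : E ⟶ E') (g : E' ⟶ E'') (v : E.Tot) : tot (f ≫ g) v = tot g (tot f v) := rfl

theorem hom_ext_tot {f g : E ⟶ E'} (h : ∀ v, tot f v = tot g v) : f = g := by
  obtain ⟨fb, ff, hf, hf'⟩ := f
  obtain ⟨gb, gf, hg, hg'⟩ := g
  have h1 : fb = gb := funext fun x => congrArg TotalSpace.proj (h ⟨x, 0⟩)
  subst h1
  have h2 : ff = gf := funext fun x => LinearMap.ext fun v => by
    have h3 := h ⟨x, v⟩
    simpa [tot] using h3
  subst h2
  rfl

/-- The trivial bundle of rank `r` over an open subset of a Euclidean space. -/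
abbrev trivialVB {n : ℕ} (O : Opens (EuclideanSpace ℝ (Fin n))) (r : ℕ) : SmoothVB where
  base := O
  dim := n
  rank := r
  fib := Bundle.Trivial O (EuclideanSpace ℝ (Fin r))

/-- A smooth map to the base of a bundle, as a bundle map from a bundle of rank `0`. -/
def baseHom {n : ℕ} {O : Opens (EuclideanSpace ℝ (Fin n))} (x : O → E.base)
    (hx : ContMDiff (𝓡 n) (𝓡 E.dim) ∞ x) : trivialVB O 0 ⟶ E where
  base := x
  fib _ := 0
  smooth_base := hx
  smooth_tot := by
    have h1 : ContMDiff (𝓡 E.dim) ((𝓡 E.dim).prod 𝓘(ℝ, E.Fm)) ∞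
        (fun y => (⟨y, 0⟩ : E.Tot)) := Bundle.contMDiff_zeroSection ℝ E.fib
    have h2 : ContMDiff ((𝓡 (trivialVB O 0).dim).prod 𝓘(ℝ, (trivialVB O 0).Fm))
        (𝓡 (trivialVB O 0).dim) ∞ (fun v : (trivialVB O 0).Tot => v.1) := Bundle.contMDiff_proj _
    exact h1.comp (hx.comp h2)

/-- The trivial bundle of rank one over a point. -/
abbrev lineVB : SmoothVB := trivialVB (⊤ : Opens (EuclideanSpace ℝ (Fin 0))) 1

/-- The fibre coordinate of the trivial bundle of rank one. -/
def lineCoord (x : lineVB.base) : lineVB.fib x →ₗ[ℝ] ℝ :=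
  (EuclideanSpace.proj (𝕜 := ℝ) (0 : Fin 1)).toLinearMap

/-- A vector, as a bundle map from the trivial bundle of rank one over a point. -/
def vecHom (a : E.Tot) : lineVB ⟶ E where
  base _ := a.1
  fib x := (LinearMap.toSpanSingleton ℝ (E.fib a.1) a.2).comp (lineCoord x)
  smooth_base := contMDiff_const
  smooth_tot := by
    intro v
    rw [Bundle.contMDiffAt_totalSpace]
    refine ⟨contMDiffAt_const, ?_⟩
    have h1 : ContMDiffAt ((𝓡 lineVB.dim).prod 𝓘(ℝ, lineVB.Fm)) 𝓘(ℝ, lineVB.Fm) ∞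
        (fun w : lineVB.Tot => w.2) v := (Bundle.contMDiffAt_totalSpace.1
          (contMDiffAt_id (x := v))).2
    let e := trivializationAt E.Fm E.fib a.1
    have ha : a.1 ∈ e.baseSet := FiberBundle.mem_baseSet_trivializationAt E.Fm E.fib a.1
    have h2 : ContDiff ℝ ∞ fun w : EuclideanSpace ℝ (Fin 1) => w 0 • (e a).2 :=
      (EuclideanSpace.proj (𝕜 := ℝ) (0 : Fin 1)).contDiff.smul contDiff_const
    refine (h2.contMDiff.contMDiffAt.comp v h1).congr_of_eventuallyEq
      (Filter.Eventually.of_forall fun w => ?_)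
    have h3 := (e.linear ℝ ha).map_smul (lineCoord _ w.2) a.2
    exact h3

theorem vecHom_tot (a : E.Tot) (v : lineVB.Tot) : tot (vecHom a) v = ⟨a.1, lineCoord _ v.2 • a.2⟩ := rfl

theorem vecHom_comp (a : E.Tot) (f : E ⟶ E') : vecHom a ≫ f = vecHom (tot f a) := by
  refine hom_ext_tot fun v => ?_
  rw [tot_comp, vecHom_tot, vecHom_tot]
  simp only [tot, map_smul]
  rfl

/-- The generator of the trivial line bundle. -/
def lineGen : lineVB.Tot := ⟨⟨0, trivial⟩, EuclideanSpace.single 0 1⟩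

theorem vecHom_lineGen (a : E.Tot) : tot (vecHom a) lineGen = a := by
  have h : lineCoord lineGen.1 lineGen.2 = 1 := by
    change (EuclideanSpace.single 0 1 : EuclideanSpace ℝ (Fin 1)) 0 = 1
    simp
  rw [vecHom_tot, h, one_smul]

end SmoothVB

/-! ### Fibre products of vector bundles -/

namespace IsFibreProduct

open SmoothVB

variable {W X Y Z : SmoothVB} {p1 : W ⟶ X} {p2 : W ⟶ Y} {s : X ⟶ Z} {t : Y ⟶ Z}
  (hW : IsFibreProduct (fun _ => True) p1 p2 s t)

include hW

theorem tot_comm (v : W.Tot) : tot s (tot p1 v) = tot t (tot p2 v) :=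
  congrArg (fun f => tot f v) hW.1

theorem exists_tot {a : X.Tot} {b : Y.Tot} (h : tot s a = tot t b) :
    ∃ c, tot p1 c = a ∧ tot p2 c = b := by
  obtain ⟨z, ⟨h1, h2⟩, -⟩ := hW.2 _ trivial (vecHom a) (vecHom b) (by
    rw [vecHom_comp, vecHom_comp, h])
  exact ⟨tot z lineGen, by rw [← tot_comp, h1, vecHom_lineGen], by rw [← tot_comp, h2, vecHom_lineGen]⟩

theorem tot_injective {c c' : W.Tot} (h1 : tot p1 c = tot p1 c') (h2 : tot p2 c = tot p2 c') :
    c = c' := by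
  obtain ⟨z, -, hz⟩ := hW.2 _ trivial (vecHom (tot p1 c)) (vecHom (tot p2 c)) (by
    rw [vecHom_comp, vecHom_comp, hW.tot_comm])
  have h := (hz (vecHom c) ⟨vecHom_comp _ _, vecHom_comp _ _⟩).trans
    (hz (vecHom c') ⟨by rw [vecHom_comp, h1], by rw [vecHom_comp, h2]⟩).symm
  rw [← vecHom_lineGen c, h, vecHom_lineGen]

theorem base_comm (w : W.base) : s.base (p1.base w) = t.base (p2.base w) :=
  congrArg TotalSpace.proj (hW.tot_comm ⟨w, 0⟩)

theorem exists_base {x : X.base} {y : Y.base} (h : s.base x = t.base y) :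
    ∃ w, p1.base w = x ∧ p2.base w = y := by
  have h1 : tot s ⟨x, 0⟩ = tot t ⟨y, 0⟩ := by
    unfold tot
    simp only [map_zero]
    rw [h]
  obtain ⟨c, h2, h3⟩ := hW.exists_tot h1
  exact ⟨c.1, congrArg TotalSpace.proj h2, congrArg TotalSpace.proj h3⟩

theorem base_injective {w w' : W.base} (h1 : p1.base w = p1.base w') (h2 : p2.base w = p2.base w') :
    w = w' := by
  refine congrArg TotalSpace.proj (hW.tot_injective (c := ⟨w, 0⟩) (c' := ⟨w', 0⟩) ?_ ?_)
  · unfold tot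
    simp only [map_zero]
    rw [h1]
  · unfold tot
    simp only [map_zero]
    rw [h2]

theorem exists_fib {w : W.base} {e : X.fib (p1.base w)} {f : Y.fib (p2.base w)}
    (h : tot s ⟨_, e⟩ = tot t ⟨_, f⟩) : ∃ v : W.fib w, p1.fib w v = e ∧ p2.fib w v = f := by
  obtain ⟨⟨w', v⟩, h1, h2⟩ := hW.exists_tot h
  obtain rfl : w' = w := hW.base_injective (congrArg TotalSpace.proj h1) (congrArg TotalSpace.proj h2)
  exact ⟨v, by simpa [tot] using h1, by simpa [tot] using h2⟩

theorem fib_eq_zero {w : W.base} {v : W.fib w} (h1 : p1.fib w v = 0) (h2 : p2.fib w v = 0) : v = 0 := by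
  have h := hW.tot_injective (c := ⟨w, v⟩) (c' := ⟨w, 0⟩) (by simp [tot, h1]) (by simp [tot, h2])
  simpa using h

theorem fib_surj {w : W.base} (ht : Function.Surjective (t.fib (p2.base w))) :
    Function.Surjective (p1.fib w) := by
  intro e
  have h : ∃ f : Y.fib (p2.base w), tot s ⟨_, e⟩ = tot t ⟨_, f⟩ := by
    unfold tot
    dsimp only
    generalize s.fib (p1.base w) e = g
    revert g
    rw [hW.base_comm w]
    intro g
    obtain ⟨f, rfl⟩ := ht g
    exact ⟨f, rfl⟩
  obtain ⟨f, hf⟩ := h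
  obtain ⟨v, hv, -⟩ := hW.exists_fib hf
  exact ⟨v, hv⟩

/-- Pairs of smooth maps with open subsets of Euclidean spaces as sources. -/
theorem exists_smooth {n : ℕ} {O : Opens (EuclideanSpace ℝ (Fin n))} {x : O → X.base}
    (hx : ContMDiff (𝓡 n) (𝓡 X.dim) ∞ x) {y : O → Y.base} (hy : ContMDiff (𝓡 n) (𝓡 Y.dim) ∞ y)
    (h : ∀ q, s.base (x q) = t.base (y q)) :
    ∃ z : O → W.base, ContMDiff (𝓡 n) (𝓡 W.dim) ∞ z ∧ (∀ q, p1.base (z q) = x q) ∧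
      ∀ q, p2.base (z q) = y q := by
  obtain ⟨z, ⟨h1, h2⟩, -⟩ := hW.2 _ trivial (baseHom x hx) (baseHom y hy) (hom_ext_tot fun v => by
    have h1 : ∀ q, tot s ⟨x q, 0⟩ = tot t ⟨y q, 0⟩ := fun q => by
      unfold tot
      simp only [map_zero]
      rw [h]
    exact h1 v.1)
  exact ⟨z.base, z.smooth_base, fun q => congrArg (fun f : trivialVB O 0 ⟶ _ => f.base q) h1,
    fun q => congrArg (fun f : trivialVB O 0 ⟶ _ => f.base q) h2⟩

omit hW

end IsFibreProduct



/-! ### Adapted coordinates for submersions and their fibre products -/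

namespace SmoothVB

variable {E E' : SmoothVB}

namespace IsCoords

theorem of_mem_maximalAtlas {w : E.base} {e : OpenPartialHomeomorph E.base (EuclideanSpace ℝ (Fin E.dim))}
    (he : e ∈ IsManifold.maximalAtlas (𝓡 E.dim) ∞ E.base) (hw : w ∈ e.source) :
    IsCoords E w e e.symm where
  smooth := by
    filter_upwards [e.open_source.mem_nhds hw] with y hy
    exact (contMDiffOn_of_mem_maximalAtlas he).contMDiffAt (e.open_source.mem_nhds hy)
  smooth_inv := by
    filter_upwards [e.open_target.mem_nhds (e.map_source hw)] with y hy
    exact (contMDiffOn_symm_of_mem_maximalAtlas he).contMDiffAt (e.open_target.mem_nhds hy)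
  left_inv := e.eventually_left_inverse hw
  right_inv := e.eventually_right_inverse (e.map_source hw)

theorem chartAt (w : E.base) : IsCoords E w (chartAt (EuclideanSpace ℝ (Fin E.dim)) w)
    (chartAt (EuclideanSpace ℝ (Fin E.dim)) w).symm :=
  of_mem_maximalAtlas (IsManifold.chart_mem_maximalAtlas w) (mem_chart_source _ w)

variable {V V' : Type} [NormedAddCommGroup V] [NormedSpace ℝ V] [NormedAddCommGroup V']
  [NormedSpace ℝ V'] {w : E.base} {κ : E.base → V} {σ : V → E.base}

theorem comp_equiv (hc : IsCoords E w κ σ) (e : V ≃L[ℝ] V') :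
    IsCoords E w (fun y => e (κ y)) fun q => σ (e.symm q) where
  smooth := hc.smooth.mono fun y hy => e.contDiff.contMDiff.contMDiffAt.comp y hy
  smooth_inv := by
    have h : Filter.Tendsto e.symm (𝓝 (e (κ w))) (𝓝 (κ w)) :=
      e.symm.continuous.tendsto' _ _ (e.symm_apply_apply _)
    filter_upwards [h.eventually hc.smooth_inv] with q hq
    exact ContMDiffAt.comp q hq e.symm.contDiff.contMDiff.contMDiffAt
  left_inv := hc.left_inv.mono fun y hy => by simpa using hy
  right_inv := by
    have h : Filter.Tendsto e.symm (𝓝 (e (κ w))) (𝓝 (κ w)) :=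
      e.symm.continuous.tendsto' _ _ (e.symm_apply_apply _)
    filter_upwards [h.eventually hc.right_inv] with q hq
    simp [hq]

theorem congr (hc : IsCoords E w κ σ) {κ' : E.base → V} (h : κ' =ᶠ[𝓝 w] κ) : IsCoords E w κ' σ := by
  have hw : κ' w = κ w := h.self_of_nhds
  refine ⟨?_, hw ▸ hc.smooth_inv, ?_, ?_⟩
  · filter_upwards [hc.smooth, h.eventually_nhds] with y h1 h2 using h1.congr_of_eventuallyEq h2
  · filter_upwards [hc.left_inv, h] with y h1 h2 using by rw [h2, h1]
  · rw [hw]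
    filter_upwards [hc.right_inv, hc.tendsto_inv.eventually h] with q h1 h2 using by rw [h2, h1]

end IsCoords

/-- Near `h`, the base map of `t` is a projection in suitable coordinates: some coordinates on the
base of the target, composed with `t`, are part of a system of coordinates. -/
def LocallyProj (t : E ⟶ E') (h : E.base) : Prop :=
  ∃ (κ : E'.base → EuclideanSpace ℝ (Fin E'.dim)) (σ : EuclideanSpace ℝ (Fin E'.dim) → E'.base)
    (k : ℕ) (y : E.base → EuclideanSpace ℝ (Fin k))
    (τ : EuclideanSpace ℝ (Fin E'.dim) × EuclideanSpace ℝ (Fin k) → E.base),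
    IsCoords E' (t.base h) κ σ ∧ IsCoords E h (fun h' => (κ (t.base h'), y h')) τ

theorem IsSurjSubmersion.locallyProj {t : E ⟶ E'} (ht : IsSurjSubmersion t) (h : E.base) :
    LocallyProj t h := by
  have hs : Manifold.IsSubmersionAt (𝓡 E.dim) (𝓡 E'.dim) ∞ t.base h := ht.submersion.isSubmersionAt h
  let F := hs.complement
  let e : EuclideanSpace ℝ (Fin E.dim) ≃L[ℝ] EuclideanSpace ℝ (Fin E'.dim) × F := hs.equiv
  have hfin : FiniteDimensional ℝ F :=
    Module.Finite.of_surjective ((LinearMap.snd ℝ _ F).comp e.toLinearEquiv.toLinearMap)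
      (Prod.snd_surjective.comp e.surjective)
  let e' : F ≃L[ℝ] EuclideanSpace ℝ (Fin (Module.finrank ℝ F)) :=
    ContinuousLinearEquiv.ofFinrankEq (by simp)
  have hc := IsCoords.of_mem_maximalAtlas hs.domChart_mem_maximalAtlas hs.mem_domChart_source
  have hc' := IsCoords.of_mem_maximalAtlas hs.codChart_mem_maximalAtlas hs.mem_codChart_source
  refine ⟨_, _, Module.finrank ℝ F, fun y => e' (e (hs.domChart y)).2, _, hc',
    (hc.comp_equiv (e.trans ((ContinuousLinearEquiv.refl ℝ _).prodCongr e'))).congr ?_⟩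
  filter_upwards [hs.domChart.open_source.mem_nhds hs.mem_domChart_source] with y hy
  have h0 : hs.domChart y ∈ (hs.domChart.extend (𝓡 E.dim)).target := by
    rw [OpenPartialHomeomorph.extend_target]
    simpa using hs.domChart.map_source hy
  have h1 := hs.writtenInCharts h0
  simp only [Function.comp_apply, OpenPartialHomeomorph.extend_coe, OpenPartialHomeomorph.extend_coe_symm,
    modelWithCornersSelf_coe, modelWithCornersSelf_coe_symm, id_eq, hs.domChart.left_inv hy] at h1
  exact Prod.ext h1 rfl

open Classical in
theorem contMDiffAt_extend_opens {n : ℕ} {O : Opens (EuclideanSpace ℝ (Fin n))} {z : O → E.base}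
    (hz : ContMDiff (𝓡 n) (𝓡 E.dim) ∞ z) (w : E.base) {q : EuclideanSpace ℝ (Fin n)} (hq : q ∈ O) :
    ContMDiffAt (𝓡 n) (𝓡 E.dim) ∞ (fun q => if h : q ∈ O then z ⟨q, h⟩ else w) q := by
  refine (contMDiffAt_subtype_iff (U := O) (x := ⟨q, hq⟩)).1 ?_
  refine (hz ⟨q, hq⟩).congr_of_eventuallyEq (Filter.Eventually.of_forall fun x => ?_)
  exact dif_pos x.2

end SmoothVB

namespace IsFibreProduct

open SmoothVB

variable {W X Y Z : SmoothVB} {p1 : W ⟶ X} {p2 : W ⟶ Y} {s : X ⟶ Z} {t : Y ⟶ Z}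

/-- Coordinates on a fibre product: coordinates of the first component together with the coordinates
along the fibres of the second component. -/
theorem exists_isCoords (hW : IsFibreProduct (fun _ => True) p1 p2 s t) {w : W.base}
    {κX : X.base → EuclideanSpace ℝ (Fin X.dim)} {σX : EuclideanSpace ℝ (Fin X.dim) → X.base}
    (hX : IsCoords X (p1.base w) κX σX) {κ : Z.base → EuclideanSpace ℝ (Fin Z.dim)}
    {σ : EuclideanSpace ℝ (Fin Z.dim) → Z.base} (hZ : IsCoords Z (t.base (p2.base w)) κ σ) {k : ℕ}
    {y : Y.base → EuclideanSpace ℝ (Fin k)}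
    {τ : EuclideanSpace ℝ (Fin Z.dim) × EuclideanSpace ℝ (Fin k) → Y.base}
    (hY : IsCoords Y (p2.base w) (fun h => (κ (t.base h), y h)) τ) :
    ∃ ρ, IsCoords W w (fun w' => (κX (p1.base w'), y (p2.base w'))) ρ := by
  classical
  let V := EuclideanSpace ℝ (Fin X.dim) × EuclideanSpace ℝ (Fin k)
  let L : EuclideanSpace ℝ (Fin (X.dim + k)) ≃L[ℝ] V := ContinuousLinearEquiv.ofFinrankEq (by simp [V])
  let κW : W.base → V := fun w' => (κX (p1.base w'), y (p2.base w'))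
  have hX0 : σX (κX (p1.base w)) = p1.base w := hX.left_inv.self_of_nhds
  have hw0 := hW.base_comm w
  -- the two components of the inverse
  let f : V → X.base := fun r => σX r.1
  let g : V → EuclideanSpace ℝ (Fin Z.dim) × EuclideanSpace ℝ (Fin k) := fun r => (κ (s.base (f r)), r.2)
  have hf0 : f (κW w) = p1.base w := hX0
  have hg0 : g (κW w) = (κ (t.base (p2.base w)), y (p2.base w)) := by
    simp only [g, hf0, hw0]
    rfl
  have hfs : ∀ᶠ r in 𝓝 (κW w), ContMDiffAt 𝓘(ℝ, V) (𝓡 X.dim) ∞ f r := by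
    filter_upwards [(continuous_fst.tendsto (κW w)).eventually hX.smooth_inv] with r hr
    exact ContMDiffAt.comp r hr contDiff_fst.contMDiff.contMDiffAt
  have hft : Filter.Tendsto f (𝓝 (κW w)) (𝓝 (p1.base w)) := by
    have := hfs.self_of_nhds.continuousAt
    rwa [ContinuousAt, hf0] at this
  have hsft : Filter.Tendsto (fun r => s.base (f r)) (𝓝 (κW w)) (𝓝 (t.base (p2.base w))) := by
    rw [← hw0]
    exact (s.smooth_base.continuous.tendsto _).comp hft
  have hgs : ∀ᶠ r in 𝓝 (κW w), ContMDiffAt 𝓘(ℝ, V)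
      𝓘(ℝ, EuclideanSpace ℝ (Fin Z.dim) × EuclideanSpace ℝ (Fin k)) ∞ g r := by
    filter_upwards [hfs, hsft.eventually hZ.smooth] with r h1 h2
    have h3 : ContMDiffAt 𝓘(ℝ, V) (𝓡 Z.dim) ∞ (fun r => κ (s.base (f r))) r :=
      ContMDiffAt.comp r h2 (ContMDiffAt.comp r (s.smooth_base (f r)) h1)
    rw [contMDiffAt_iff_contDiffAt] at h3 ⊢
    exact h3.prodMk contDiff_snd.contDiffAt
  have hgt : Filter.Tendsto g (𝓝 (κW w)) (𝓝 (κ (t.base (p2.base w)), y (p2.base w))) := by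
    have := hgs.self_of_nhds.continuousAt
    rwa [ContinuousAt, hg0] at this
  have hτs : ∀ᶠ r in 𝓝 (κW w), ContMDiffAt 𝓘(ℝ, V) (𝓡 Y.dim) ∞ (fun r => τ (g r)) r := by
    filter_upwards [hgs, hgt.eventually hY.smooth_inv] with r h1 h2 using ContMDiffAt.comp r h2 h1
  have hτt : Filter.Tendsto (fun r => τ (g r)) (𝓝 (κW w)) (𝓝 (p2.base w)) := hY.tendsto_inv.comp hgt
  have hst : ∀ᶠ r in 𝓝 (κW w), s.base (f r) = t.base (τ (g r)) ∧ y (τ (g r)) = r.2 := by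
    filter_upwards [hgt.eventually hY.right_inv, hsft.eventually hZ.left_inv,
      ((t.smooth_base.continuous.tendsto _).comp hτt).eventually hZ.left_inv] with r h1 h2 h3
    refine ⟨?_, congrArg Prod.snd h1⟩
    exact h2.symm.trans ((congrArg σ (congrArg Prod.fst h1).symm).trans h3)
  obtain ⟨O, hO, hOo, hwO⟩ := eventually_nhds_iff.1 (hfs.and (hτs.and hst))
  let O' : Opens (EuclideanSpace ℝ (Fin (X.dim + k))) := ⟨L ⁻¹' O, hOo.preimage L.continuous⟩
  have hLs : ∀ q : O', ContMDiffAt (𝓡 (X.dim + k)) 𝓘(ℝ, V) ∞ (fun q : O' => L q.1) q := fun q =>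
    ContMDiffAt.comp q L.contDiff.contMDiff.contMDiffAt (contMDiff_subtype_val q)
  obtain ⟨z, hz, hz1, hz2⟩ := hW.exists_smooth (O := O') (x := fun q => f (L q.1))
    (y := fun q => τ (g (L q.1))) (fun q => ContMDiffAt.comp (I' := 𝓘(ℝ, V)) (g := f) q (hO _ q.2).1 (hLs q))
    (fun q => ContMDiffAt.comp (I' := 𝓘(ℝ, V)) (g := fun r => τ (g r)) q (hO _ q.2).2.1 (hLs q)) fun q => (hO _ q.2).2.2.1
  have hmem : ∀ r, r ∈ O → L.symm r ∈ O' := fun r hr => by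
    change L (L.symm r) ∈ O
    rwa [L.apply_symm_apply]
  let z' : EuclideanSpace ℝ (Fin (X.dim + k)) → W.base := fun q => if h : q ∈ O' then z ⟨q, h⟩ else w
  have hz1' : ∀ r ∈ O, p1.base (z' (L.symm r)) = f r := fun r hr => by
    simp only [z', dif_pos (hmem r hr), hz1, L.apply_symm_apply]
  have hz2' : ∀ r ∈ O, p2.base (z' (L.symm r)) = τ (g r) := fun r hr => by
    simp only [z', dif_pos (hmem r hr), hz2, L.apply_symm_apply]
  have hκW : ∀ᶠ w' in 𝓝 w, ContMDiffAt (𝓡 W.dim) 𝓘(ℝ, V) ∞ κW w' := by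
    filter_upwards [(p1.smooth_base.continuous.tendsto w).eventually hX.smooth,
      (p2.smooth_base.continuous.tendsto w).eventually hY.smooth] with w' h1 h2
    have h2' : ContMDiffAt (𝓡 Y.dim) 𝓘(ℝ, EuclideanSpace ℝ (Fin k)) ∞ y (p2.base w') :=
      (contDiff_snd (𝕜 := ℝ) (E := EuclideanSpace ℝ (Fin Z.dim))
        (F := EuclideanSpace ℝ (Fin k))).contMDiff.contMDiffAt.comp (p2.base w') h2
    have h3 := ContMDiffAt.comp w' h1 (p1.smooth_base w')
    have h4 := ContMDiffAt.comp w' h2' (p2.smooth_base w')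
    exact h3.prodMk_space h4
  have hOn : ∀ᶠ r in 𝓝 (κW w), r ∈ O := hOo.mem_nhds hwO
  refine ⟨fun r => z' (L.symm r), hκW, ?_, ?_, ?_⟩
  · filter_upwards [hOn] with r hr
    exact ContMDiffAt.comp r (contMDiffAt_extend_opens hz w (hmem r hr)) L.symm.contDiff.contMDiff.contMDiffAt
  · filter_upwards [(hκW.self_of_nhds.continuousAt).eventually hOn,
      (p1.smooth_base.continuous.tendsto w).eventually hX.left_inv,
      (p2.smooth_base.continuous.tendsto w).eventually hY.left_inv] with w' h1 h2 h3
    refine hW.base_injective ((hz1' _ h1).trans h2) ((hz2' _ h1).trans ?_)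
    change τ (κ (s.base (σX (κX (p1.base w')))), y (p2.base w')) = _
    rw [h2, hW.base_comm]
    exact h3
  · filter_upwards [hOn, (continuous_fst.tendsto (κW w)).eventually hX.right_inv] with r hr h1
    refine Prod.ext ?_ ?_
    · exact (congrArg κX (hz1' r hr)).trans h1
    · exact (congrArg y (hz2' r hr)).trans (hO r hr).2.2.2

theorem locallyProj (hW : IsFibreProduct (fun _ => True) p1 p2 s t) {w : W.base}
    (h : LocallyProj t (p2.base w)) : LocallyProj p1 w := by
  obtain ⟨κ, σ, k, y, τ, hZ, hY⟩ := h
  obtain ⟨ρ, hρ⟩ := hW.exists_isCoords (IsCoords.chartAt (p1.base w)) hZ hY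
  exact ⟨_, _, k, _, ρ, IsCoords.chartAt (p1.base w), hρ⟩

end IsFibreProduct



/-! ### Local frames from coframes -/

namespace SmoothVB

variable {E : SmoothVB}

theorem IsSmoothFun.inv {U : Opens E.base} {f : U → ℝ} (hf : E.IsSmoothFun U f) (h : ∀ x, f x ≠ 0) :
    E.IsSmoothFun U fun x => (f x)⁻¹ :=
  isSmoothFun_of_smoothAt (F := fun y => (Function.extend Subtype.val f 0 y)⁻¹)
    (fun x hx => (hf.smoothAt hx).inv₀ (by rw [extend_apply_of_mem f hx]; exact h _))
    fun x hx => by rw [extend_apply_of_mem f hx]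

theorem IsSmoothFun.continuous {U : Opens E.base} {f : U → ℝ} (hf : E.IsSmoothFun U f) :
    Continuous f := by
  have h := continuousOn_iff_continuous_domRestrict.1 (ContMDiffOn.continuousOn hf)
  refine h.congr fun x => ?_
  exact extend_apply_of_mem f x.2

theorem finrank_fib (x : E.base) : Module.finrank ℝ (E.fib x) = E.rank := by
  obtain ⟨W, F, -, hx, -⟩ := E.exists_localFrame x
  rw [Module.finrank_eq_card_basis (F.basis ⟨x, hx⟩), Fintype.card_fin]

instance (x : E.base) : Module.Finite ℝ (E.fib x) := by
  obtain ⟨W, F, -, hx, -⟩ := E.exists_localFrame x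
  exact Module.Finite.of_basis (F.basis ⟨x, hx⟩)

/-- Smooth sections of the dual bundle that form a basis at a point are the coordinates of a local
frame near this point. -/
theorem exists_localFrame_of_covecs {ι : Type} [Fintype ι] {U : Opens E.base} {w : E.base} (hw : w ∈ U)
    {δ : ι → ∀ x : U, Module.Dual ℝ (E.fib x.1)} (hδ : ∀ j, E.IsSmoothCovec U (δ j))
    (hb : Function.Bijective fun (v : E.fib w) j => δ j ⟨w, hw⟩ v) :
    ∃ (W : Opens E.base) (hW : W ≤ U) (F : LocalFrame E W ι), w ∈ W ∧
      ∀ (x : W) j, (F.basis x).coord j = δ j ⟨x.1, hW x.2⟩ := by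
  classical
  obtain ⟨W₀, F₀', -, hw₀, -⟩ := E.exists_localFrame w
  let Δ : ∀ x : U, E.fib x.1 →ₗ[ℝ] ι → ℝ := fun x => LinearMap.pi fun j => δ j x
  have hcard : Fintype.card (Fin E.rank) = Fintype.card ι := by
    have h := (LinearEquiv.ofBijective (Δ ⟨w, hw⟩) hb).finrank_eq
    rwa [finrank_fib, Module.finrank_fintype_fun_eq_card, ← Fintype.card_fin E.rank] at h
  let e := Fintype.equivOfCardEq hcard
  let B : ∀ x : W₀, Module.Basis ι ℝ (E.fib x.1) := fun x => (F₀'.basis x).reindex e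
  have hB : ∀ {U' : Opens E.base} (h : U' ≤ W₀) {α : ∀ x : U', Module.Dual ℝ (E.fib x.1)},
      E.IsSmoothCovec U' α → ∀ j, E.IsSmoothFun U' fun x => α x (B ⟨x.1, h x.2⟩ j) := by
    intro U' h α hα j
    simpa only [B, Module.Basis.reindex_apply] using F₀'.smooth_apply h hα (e.symm j)
  let D : ∀ x : (U ⊓ W₀ : Opens E.base), Matrix ι ι ℝ := fun x j i => δ j ⟨x.1, x.2.1⟩ (B ⟨x.1, x.2.2⟩ i)
  have hDs : ∀ j i, E.IsSmoothFun (U ⊓ W₀) fun x => D x j i := fun j i =>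
    hB inf_le_right ((hδ j).restr inf_le_left) i
  have hmul : ∀ x (c : ι → ℝ), (D x).mulVec c = Δ ⟨x.1, x.2.1⟩ (∑ i, c i • B ⟨x.1, x.2.2⟩ i) := by
    intro x c
    ext j
    simp only [Matrix.mulVec, dotProduct, D, Δ, LinearMap.pi_apply, map_sum, map_smul, smul_eq_mul, mul_comm]
  have hdet : ∀ x, (D x).det ≠ 0 ↔ Function.Injective (Δ ⟨x.1, x.2.1⟩) := by
    intro x
    rw [Ne, ← Matrix.exists_mulVec_eq_zero_iff, injective_iff_map_eq_zero]
    constructor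
    · intro h v hv
      by_contra hne
      refine h ⟨(B ⟨x.1, x.2.2⟩).repr v, fun h0 => hne ?_, ?_⟩
      · rw [← (B ⟨x.1, x.2.2⟩).sum_repr v]
        simp [h0]
      · rw [hmul, (B ⟨x.1, x.2.2⟩).sum_repr v, hv]
    · rintro h ⟨c, hc, h0⟩
      rw [hmul] at h0
      have h1 := h _ h0
      exact hc (funext (Fintype.linearIndependent_iff.1 (B ⟨x.1, x.2.2⟩).linearIndependent c h1))
  have hdets : E.IsSmoothFun (U ⊓ W₀) fun x => (D x).det := by
    let M : Matrix ι ι (E.smoothFun (U ⊓ W₀)) := fun j i => ⟨_, hDs j i⟩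
    have h : (fun x => (D x).det) = (M.det).1 := funext fun x =>
      ((((Pi.evalRingHom (fun _ => ℝ) x).comp (E.smoothFun (U ⊓ W₀)).val.toRingHom)).map_det M).symm
    rw [h]
    exact M.det.2
  have hopen : IsOpen {x : (U ⊓ W₀ : Opens E.base) | (D x).det ≠ 0} :=
    isOpen_ne_fun hdets.continuous continuous_const
  let W : Opens E.base := ⟨Subtype.val '' {x : (U ⊓ W₀ : Opens E.base) | (D x).det ≠ 0},
    (U ⊓ W₀).isOpen.isOpenMap_subtype_val _ hopen⟩
  have hWle : W ≤ U ⊓ W₀ := by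
    rintro _ ⟨x, -, rfl⟩
    exact x.2
  have hWd : ∀ x : W, (D ⟨x.1, hWle x.2⟩).det ≠ 0 := by
    rintro ⟨_, x, hx, rfl⟩
    exact hx
  have hwW : w ∈ W := ⟨⟨w, hw, hw₀⟩, (hdet _).2 hb.1, rfl⟩
  let eq : ∀ x : W, E.fib x.1 ≃ₗ[ℝ] (ι → ℝ) := fun x =>
    LinearMap.linearEquivOfInjective (Δ ⟨x.1, (hWle x.2).1⟩) ((hdet ⟨x.1, hWle x.2⟩).1 (hWd x)) (by
      rw [finrank_fib, Module.finrank_fintype_fun_eq_card, ← hcard, Fintype.card_fin])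
  have heq : ∀ (x : W) v j, eq x v j = δ j ⟨x.1, (hWle x.2).1⟩ v := fun _ _ _ => rfl
  let M : Matrix ι ι (E.smoothFun W) := fun j i => ⟨_, (hDs j i).restr hWle⟩
  let evx : ∀ x : W, E.smoothFun W →+* ℝ := fun x =>
    (Pi.evalRingHom (fun _ => ℝ) x).comp (E.smoothFun W).val.toRingHom
  have hMdet : ∀ x, evx x M.det = (D ⟨x.1, hWle x.2⟩).det := fun x => (evx x).map_det M
  have hunit : IsUnit M.det := by
    refine IsUnit.of_mul_eq_one (⟨_, IsSmoothFun.inv M.det.2 fun x => ?_⟩ : E.smoothFun W) (Subtype.ext (funext fun x => ?_))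
    · exact (hMdet x).trans_ne (hWd x)
    · exact mul_inv_cancel₀ ((hMdet x).trans_ne (hWd x))
  have hbasis : ∀ (x : W) j, Module.Basis.ofEquivFun (eq x) j =
      ∑ i, evx x (M⁻¹ i j) • B ⟨x.1, (hWle x.2).2⟩ i := by
    intro x j
    refine (eq x).injective ?_
    rw [Module.Basis.coe_ofEquivFun, LinearEquiv.apply_symm_apply]
    ext l
    rw [heq, map_sum]
    have h1 := congrArg (evx x) (congrFun (congrFun (Matrix.mul_nonsing_inv M hunit) l) j)
    rw [Matrix.mul_apply, map_sum] at h1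
    have h2 : evx x ((1 : Matrix ι ι (E.smoothFun W)) l j) = (Function.update 0 j 1 : ι → ℝ) l := by
      by_cases hlj : l = j
      · subst hlj
        simp
      · rw [Matrix.one_apply_ne hlj, map_zero, Function.update_of_ne hlj]
        rfl
    rw [h2] at h1
    refine h1.symm.trans (Finset.sum_congr rfl fun i _ => ?_)
    rw [map_mul, map_smul, smul_eq_mul, mul_comm]
    rfl
  refine ⟨W, fun x hx => (hWle hx).1, ⟨fun x => Module.Basis.ofEquivFun (eq x), fun j => ?_, ?_⟩, hwW, ?_⟩
  · exact (hδ j).restr fun x hx => (hWle hx).1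
  · intro U' h α hα j
    have h1 : (fun x : U' => α x (Module.Basis.ofEquivFun (eq ⟨x.1, h x.2⟩) j)) =
        fun x : U' => ∑ i, (M⁻¹ i j).1 ⟨x.1, h x.2⟩ * α x (B ⟨x.1, (hWle (h x.2)).2⟩ i) := by
      funext x
      rw [hbasis, map_sum]
      refine Finset.sum_congr rfl fun i _ => ?_
      rw [map_smul]
      rfl
    rw [h1]
    exact IsSmoothFun.sum _ fun i _ => (IsSmoothFun.restr h (M⁻¹ i j).2).mul
      (hB (fun x hx => (hWle (h hx)).2) hα i)
  · intro x j
    ext v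
    rfl

/-- The pullback of a coframe along a fibrewise surjective bundle map is part of a coframe. -/
theorem exists_localFrame_extending {E' : SmoothVB} (t : E ⟶ E') {w : E.base}
    (ht : Function.Surjective (t.fib w)) {W' : Opens E'.base} {ι : Type} [Fintype ι]
    (F' : LocalFrame E' W' ι) (hw : t.base w ∈ W') :
    ∃ (J : Type) (_ : Fintype J) (W : Opens E.base) (hW : W ≤ preim t W') (F : LocalFrame E W (ι ⊕ J)),
      w ∈ W ∧ ∀ (x : W) i, (F.basis x).coord (Sum.inl i) =
        (t.fib x.1).dualMap ((F'.basis ⟨t.base x.1, hW x.2⟩).coord i) := by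
  classical
  have hli : LinearIndependent ℝ fun i => (t.fib w).dualMap ((F'.basis ⟨t.base w, hw⟩).coord i) :=
    (F'.basis ⟨t.base w, hw⟩).linearIndependent_coord.map' _
      (LinearMap.ker_eq_bot.2 (LinearMap.dualMap_injective_of_surjective ht))
  let J : Type := Module.Basis.sumExtendIndex hli
  let B : Module.Basis (ι ⊕ J) ℝ (Module.Dual ℝ (E.fib w)) := Module.Basis.sumExtend hli
  have hB : ∀ i, B (Sum.inl i) = (t.fib w).dualMap ((F'.basis ⟨t.base w, hw⟩).coord i) := fun i => by
    simp [B, Module.Basis.sumExtend]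
    rfl
  have : Finite (ι ⊕ J) := Module.Finite.finite_basis B
  have : Finite J := Finite.sum_right ι
  have := Fintype.ofFinite J
  obtain ⟨W₀, F₀, -, hw₀, -⟩ := E.exists_localFrame w
  let v : J → Fin E.rank → ℝ := fun j => ((F₀.basis ⟨w, hw₀⟩).constr ℝ).symm (B (Sum.inr j))
  let δ : ι ⊕ J → ∀ x : (preim t W' ⊓ W₀ : Opens E.base), Module.Dual ℝ (E.fib x.1) := fun j x =>
    Sum.elim (fun i => (t.fib x.1).dualMap ((F'.basis ⟨t.base x.1, x.2.1⟩).coord i))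
      (fun j => (F₀.basis ⟨x.1, x.2.2⟩).constr ℝ (v j)) j
  have hwU : w ∈ preim t W' ⊓ W₀ := ⟨hw, hw₀⟩
  have hδw : ∀ j, δ j ⟨w, hwU⟩ = B j := by
    rintro (i | j)
    · exact (hB i).symm
    · exact LinearEquiv.apply_symm_apply _ _
  obtain ⟨W, hW, F, hwW, hF⟩ := exists_localFrame_of_covecs hwU (δ := δ) (by
    rintro (i | j)
    · exact IsSmoothCovec.restr (U := preim t W') inf_le_left ((F'.smooth_coord i).comp_hom t)
    · exact IsSmoothCovec.restr (U := W₀) inf_le_right (F₀.isSmoothCovec_constr (v j))) (by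
    simp only [hδw]
    have hinj : Function.Injective (LinearMap.pi fun j => B j : E.fib w →ₗ[ℝ] ι ⊕ J → ℝ) := by
      rw [injective_iff_map_eq_zero]
      intro u hu
      rw [← Module.forall_dual_apply_eq_zero_iff ℝ u]
      intro f
      rw [← B.sum_repr f, LinearMap.sum_apply]
      refine Finset.sum_eq_zero fun j _ => ?_
      have h1 : B j u = 0 := congrFun hu j
      rw [LinearMap.smul_apply, h1, smul_zero]
    refine (LinearMap.linearEquivOfInjective _ hinj ?_).bijective
    rw [Module.finrank_fintype_fun_eq_card, ← Module.finrank_eq_card_basis B, Subspace.dual_finrank_eq])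
  exact ⟨J, this, W, fun x hx => (hW hx).1, F, hwW, fun x i => hF x (Sum.inl i)⟩

end SmoothVB

namespace IsFibreProduct

open SmoothVB

variable {W X Y Z : SmoothVB} {p1 : W ⟶ X} {p2 : W ⟶ Y} {s : X ⟶ Z} {t : Y ⟶ Z}

/-- A coframe on a fibre product: a coframe on the first factor, together with the part of a coframe
on the second factor that is complementary to a coframe on the base. -/
theorem exists_localFrame (hW : IsFibreProduct (fun _ => True) p1 p2 s t) {w : W.base}
    {UX : Opens X.base} {ι : Type} [Fintype ι] (FX : LocalFrame X UX ι) (hX : p1.base w ∈ UX)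
    {UZ : Opens Z.base} {ι' : Type} [Fintype ι'] (FZ : LocalFrame Z UZ ι') {J : Type} [Fintype J]
    (ht : Function.Surjective (t.fib (p2.base w)))
    {UY : Opens Y.base} (hUY : UY ≤ preim t UZ) (FY : LocalFrame Y UY (ι' ⊕ J)) (hY : p2.base w ∈ UY)
    (hFY : ∀ (x : UY) i, (FY.basis x).coord (Sum.inl i) =
        (t.fib x.1).dualMap ((FZ.basis ⟨t.base x.1, hUY x.2⟩).coord i)) :
    ∃ (U : Opens W.base) (hU1 : U ≤ preim p1 UX) (hU2 : U ≤ preim p2 UY) (F : LocalFrame W U (ι ⊕ J)),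
      w ∈ U ∧ (∀ (x : U) i, (F.basis x).coord (Sum.inl i) =
        (p1.fib x.1).dualMap ((FX.basis ⟨p1.base x.1, hU1 x.2⟩).coord i)) ∧
      ∀ (x : U) j, (F.basis x).coord (Sum.inr j) =
        (p2.fib x.1).dualMap ((FY.basis ⟨p2.base x.1, hU2 x.2⟩).coord (Sum.inr j)) := by
  classical
  let δ : ι ⊕ J → ∀ x : (preim p1 UX ⊓ preim p2 UY : Opens W.base), Module.Dual ℝ (W.fib x.1) := fun j x =>
    Sum.elim (fun i => (p1.fib x.1).dualMap ((FX.basis ⟨p1.base x.1, x.2.1⟩).coord i))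
      (fun j => (p2.fib x.1).dualMap ((FY.basis ⟨p2.base x.1, x.2.2⟩).coord (Sum.inr j))) j
  have hwU : w ∈ preim p1 UX ⊓ preim p2 UY := ⟨hX, hY⟩
  let bX := FX.basis ⟨p1.base w, hX⟩
  let bY := FY.basis ⟨p2.base w, hY⟩
  let bZ := FZ.basis ⟨t.base (p2.base w), hUY hY⟩
  have hYl : ∀ (f : Y.fib (p2.base w)) i, bY.coord (Sum.inl i) f = bZ.coord i (t.fib _ f) := fun f i =>
    LinearMap.congr_fun (hFY ⟨p2.base w, hY⟩ i) f
  have hb : Function.Bijective fun (v : W.fib w) j => δ j ⟨w, hwU⟩ v := by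
    constructor
    · refine (injective_iff_map_eq_zero
        (LinearMap.pi fun j => δ j ⟨w, hwU⟩ : W.fib w →ₗ[ℝ] ι ⊕ J → ℝ)).2 fun v hv => ?_
      have h1 : p1.fib w v = 0 := bX.ext_elem fun i => by
        rw [map_zero]
        exact congrFun hv (Sum.inl i)
      have h2 : t.fib _ (p2.fib w v) = 0 := by
        have h3 := hW.tot_comm ⟨w, v⟩
        unfold tot at h3
        dsimp only at h3
        rw [h1, map_zero, hW.base_comm] at h3
        simpa using h3.symm
      refine hW.fib_eq_zero h1 (bY.ext_elem fun j => ?_)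
      rw [map_zero]
      rcases j with i | j
      · refine (hYl _ i).trans ?_
        rw [h2, map_zero]
        rfl
      · exact congrFun hv (Sum.inr j)
    · intro c
      obtain ⟨v₀, hv₀⟩ := hW.fib_surj ht (∑ i, c (Sum.inl i) • bX i)
      let k : Y.fib (p2.base w) := ∑ j, (c (Sum.inr j) - bY.coord (Sum.inr j) (p2.fib w v₀)) • bY (Sum.inr j)
      have hk : t.fib _ k = 0 := bZ.ext_elem fun i => by
        rw [map_zero]
        refine (hYl k i).symm.trans ?_
        simp [k]
      obtain ⟨v, hv1, hv2⟩ := hW.exists_fib (w := w) (e := p1.fib w v₀) (f := p2.fib w v₀ + k) (by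
        have h3 := hW.tot_comm ⟨w, v₀⟩
        unfold tot at h3 ⊢
        dsimp only at h3 ⊢
        rw [map_add, hk, add_zero]
        exact h3)
      refine ⟨v, funext ?_⟩
      rintro (i | j)
      · change bX.coord i (p1.fib w v) = _
        rw [hv1, hv₀]
        simp [Finsupp.single_apply]
      · change bY.coord (Sum.inr j) (p2.fib w v) = _
        rw [hv2]
        simp [k, Finsupp.single_apply]
  obtain ⟨U, hU, F, hwU', hF⟩ := exists_localFrame_of_covecs hwU (δ := δ) (by
    rintro (i | j)
    · exact IsSmoothCovec.restr (U := preim p1 UX) inf_le_left ((FX.smooth_coord i).comp_hom p1)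
    · exact IsSmoothCovec.restr (U := preim p2 UY) inf_le_right ((FY.smooth_coord (Sum.inr j)).comp_hom p2))
    hb
  exact ⟨U, fun x hx => (hU hx).1, fun x hx => (hU hx).2, F, hwU', fun x i => hF x (Sum.inl i),
    fun x j => hF x (Sum.inr j)⟩

end IsFibreProduct



open SmoothVB LieAlgebroid

/-! ### Homomorphisms on germs of functions of a fibre product -/

namespace GermHom

variable {E E' E'' : SmoothVB} {w : E.base} {p : ℤ → ℕ} (H : GermHom E w p)

/-- The composition of a homomorphism on germs with the pullback along a bundle map. -/
def comap (φ : E ⟶ E') : GermHom E' (φ.base w) p where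
  toFun U hw := (H.toFun (preim φ U) hw).comp (pullForm φ U)
  res {_ V} h hw a := (congrArg (H.toFun (preim φ V) hw) ((shiftMap φ).pull_res h a)).trans
    (H.res (fun _ hx => h hx) hw _)
  map_deg U hw k a ha := H.map_deg _ hw k _ ((shiftMap φ).pull_deg U k a ha)

theorem comap_toFun (φ : E ⟶ E') {U : Opens E'.base} (hw : φ.base w ∈ U) (a : E'.shiftObj.func U) :
    (H.comap φ).toFun U hw a = H.toFun (preim φ U) hw (pullForm φ U a) := rfl

theorem comap_congr {φ φ' : E ⟶ E'} (h : φ = φ') {U : Opens E'.base} (hw : φ.base w ∈ U)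
    (hw' : φ'.base w ∈ U) (a : E'.shiftObj.func U) :
    (H.comap φ).toFun U hw a = (H.comap φ').toFun U hw' a := by
  subst h
  rfl

theorem comap_comp (φ : E ⟶ E') (ψ : E' ⟶ E'') {U : Opens E''.base} (hw : ψ.base (φ.base w) ∈ U)
    (a : E''.shiftObj.func U) :
    ((H.comap φ).comap ψ).toFun U hw a = (H.comap (φ ≫ ψ)).toFun U hw a := by
  refine congrArg (H.toFun (preim φ (preim ψ U)) hw) (func_ext fun x => ?_)
  exact (map_dualMap_comp (φ.fib x.1) (ψ.fib (φ.base x.1)) _).symm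

theorem comap_square {E₁ E₂ : SmoothVB} {p1 : E ⟶ E₁} {p2 : E ⟶ E₂} {s : E₁ ⟶ E'} {t : E₂ ⟶ E'}
    (h : p1 ≫ s = p2 ≫ t) {U : Opens E'.base} (hw : s.base (p1.base w) ∈ U)
    (hw' : t.base (p2.base w) ∈ U) (a : E'.shiftObj.func U) :
    ((H.comap p1).comap s).toFun U hw a = ((H.comap p2).comap t).toFun U hw' a := by
  rw [comap_comp, comap_comp]
  exact H.comap_congr h hw hw' a

theorem comap_fn (φ : E ⟶ E') {f : E'.base → ℝ} (hf : E'.SmoothNear f (φ.base w)) :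
    (H.comap φ).fn f = H.fn fun x => f (φ.base x) := by
  obtain ⟨U, hw, -, hU⟩ := exists_nhd hf Filter.univ_mem
  rw [(H.comap φ).fn_eq hw hU, comap_toFun, pullForm_funForm]
  exact (H.fn_eq (U := preim φ U) (f := fun x => f (φ.base x)) hw (hU.comp_hom φ)).symm

/-- Homomorphisms on germs at equal points that agree on forms agree on functions. -/
theorem fn_eq_fn {w' : E.base} {H' : GermHom E w' p} (hww : w = w')
    (h : ∀ (U : Opens E.base) (hw : w ∈ U) (hw' : w' ∈ U) a, H.toFun U hw a = H'.toFun U hw' a)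
    {f : E.base → ℝ} (hf : E.SmoothNear f w) : H.fn f = H'.fn f := by
  subst hww
  obtain ⟨U, hw, -, hU⟩ := exists_nhd hf Filter.univ_mem
  rw [H.fn_eq hw hU, H'.fn_eq hw hU, h U hw hw]

end GermHom

/-- Coordinates and frames near a point of a fibre product `W` of `X` and `Y` over `Z` and near its
images, adapted to the projections: the coordinates and the coframe of `W` consist of those of `X`
and of a part of those of `Y`, and the rest of the coordinates and of the coframe of `Y` comes from
`Z`. -/
structure AdaptedChart {W X Y Z : SmoothVB} (p1 : W ⟶ X) (p2 : W ⟶ Y) (t : Y ⟶ Z) (w : W.base) where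
  (κX : X.base → EuclideanSpace ℝ (Fin X.dim))
  (σX : EuclideanSpace ℝ (Fin X.dim) → X.base)
  coordsX : IsCoords X (p1.base w) κX σX
  (κZ : Z.base → EuclideanSpace ℝ (Fin Z.dim))
  (σZ : EuclideanSpace ℝ (Fin Z.dim) → Z.base)
  coordsZ : IsCoords Z (t.base (p2.base w)) κZ σZ
  k : ℕ
  y : Y.base → EuclideanSpace ℝ (Fin k)
  (τ : EuclideanSpace ℝ (Fin Z.dim) × EuclideanSpace ℝ (Fin k) → Y.base)
  coordsY : IsCoords Y (p2.base w) (fun h => (κZ (t.base h), y h)) τ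
  (ρ : EuclideanSpace ℝ (Fin X.dim) × EuclideanSpace ℝ (Fin k) → W.base)
  coords : IsCoords W w (fun w' => (κX (p1.base w'), y (p2.base w'))) ρ
  {UX : Opens X.base}
  FX : LocalFrame X UX (Fin X.rank)
  memX : p1.base w ∈ UX
  {UZ : Opens Z.base}
  FZ : LocalFrame Z UZ (Fin Z.rank)
  J : Type
  [fintypeJ : Fintype J]
  {UY : Opens Y.base}
  FY : LocalFrame Y UY (Fin Z.rank ⊕ J)
  memY : p2.base w ∈ UY
  leY : UY ≤ preim t UZ
  frameY : ∀ i, frameCovec FY le_rfl (Sum.inl i) =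
    Y.shiftObj.res leY (pullForm t UZ (frameCovec FZ le_rfl i))
  {U : Opens W.base}
  F : LocalFrame W U (Fin X.rank ⊕ J)
  mem : w ∈ U
  le1 : U ≤ preim p1 UX
  le2 : U ≤ preim p2 UY
  frame_inl : ∀ i, frameCovec F le_rfl (Sum.inl i) =
    W.shiftObj.res le1 (pullForm p1 UX (frameCovec FX le_rfl i))
  frame_inr : ∀ j, frameCovec F le_rfl (Sum.inr j) =
    W.shiftObj.res le2 (pullForm p2 UY (frameCovec FY le_rfl (Sum.inr j)))

attribute [instance] AdaptedChart.fintypeJ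

theorem IsFibreProduct.exists_adaptedChart {W X Y Z : SmoothVB} {p1 : W ⟶ X} {p2 : W ⟶ Y} {s : X ⟶ Z}
    {t : Y ⟶ Z} (hW : IsFibreProduct (fun _ => True) p1 p2 s t) {w : W.base}
    (ht : LocallyProj t (p2.base w)) (ht' : Function.Surjective (t.fib (p2.base w))) :
    Nonempty (AdaptedChart p1 p2 t w) := by
  obtain ⟨κ, σ, k, y, τ, hZ, hY⟩ := ht
  obtain ⟨ρ, hρ⟩ := hW.exists_isCoords (IsCoords.chartAt (p1.base w)) hZ hY
  obtain ⟨UX, FX, -, hUX, -⟩ := X.exists_localFrame (p1.base w)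
  obtain ⟨UZ, FZ, -, hUZ, -⟩ := Z.exists_localFrame (t.base (p2.base w))
  obtain ⟨J, _, UY, hUY, FY, hwY, hFY⟩ := exists_localFrame_extending t ht' FZ hUZ
  obtain ⟨U, hU1, hU2, F, hwU, hF1, hF2⟩ := hW.exists_localFrame FX hUX FZ ht' hUY FY hwY hFY
  exact ⟨{
    κX := _
    σX := _
    coordsX := IsCoords.chartAt (p1.base w)
    κZ := κ
    σZ := σ
    coordsZ := hZ
    k := k
    y := y
    τ := τ
    coordsY := hY
    ρ := ρ
    coords := hρ
    FX := FX
    memX := hUX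
    FZ := FZ
    J := J
    FY := FY
    memY := hwY
    leY := hUY
    frameY := fun i => func_ext fun x =>
      (congrArg (ExteriorAlgebra.ι ℝ) (hFY x i)).trans (ExteriorAlgebra.map_apply_ι _ _).symm
    F := F
    mem := hwU
    le1 := hU1
    le2 := hU2
    frame_inl := fun i => func_ext fun x =>
      (congrArg (ExteriorAlgebra.ι ℝ) (hF1 x i)).trans (ExteriorAlgebra.map_apply_ι _ _).symm
    frame_inr := fun j => func_ext fun x =>
      (congrArg (ExteriorAlgebra.ι ℝ) (hF2 x j)).trans (ExteriorAlgebra.map_apply_ι _ _).symm }⟩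

namespace AdaptedChart

variable {W X Y Z : SmoothVB} {p1 : W ⟶ X} {p2 : W ⟶ Y} {s : X ⟶ Z} {t : Y ⟶ Z} {w : W.base}
  {p : ℤ → ℕ} (c : AdaptedChart p1 p2 t w)

/-- The standard basis of a Euclidean space. -/
abbrev stdBasis (n : ℕ) : Module.Basis (Fin n) ℝ (EuclideanSpace ℝ (Fin n)) :=
  (EuclideanSpace.basisFun (Fin n) ℝ).toBasis

/-- The basis of the space of coordinates of a fibre product. -/
abbrev prodBasis (n k : ℕ) : Module.Basis (Fin n ⊕ Fin k) ℝ
    (EuclideanSpace ℝ (Fin n) × EuclideanSpace ℝ (Fin k)) := (stdBasis n).prod (stdBasis k)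

theorem coord_inl {n k : ℕ} (i : Fin n) (v : EuclideanSpace ℝ (Fin n) × EuclideanSpace ℝ (Fin k)) :
    (prodBasis n k).coord (Sum.inl i) v = (stdBasis n).coord i v.1 := by simp

theorem coord_inr {n k : ℕ} (i : Fin k) (v : EuclideanSpace ℝ (Fin n) × EuclideanSpace ℝ (Fin k)) :
    (prodBasis n k).coord (Sum.inr i) v = (stdBasis k).coord i v.2 := by simp

theorem smoothNear_y (j : Fin c.k) : Y.SmoothNear (fun h => (stdBasis c.k).coord j (c.y h)) (p2.base w) := by
  simpa only [coord_inr] using c.coordsY.smoothNear_coord (prodBasis _ c.k) (Sum.inr j)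

theorem fn_coord_inl (H : GermHom W w p) (i : Fin X.dim) :
    H.fn (fun w' => (prodBasis X.dim c.k).coord (Sum.inl i) (c.κX (p1.base w'), c.y (p2.base w'))) =
      (H.comap p1).fn fun x => (stdBasis X.dim).coord i (c.κX x) := by
  rw [GermHom.comap_fn _ _ (c.coordsX.smoothNear_coord _ i)]
  simp only [coord_inl]

theorem fn_coord_inr (H : GermHom W w p) (j : Fin c.k) :
    H.fn (fun w' => (prodBasis X.dim c.k).coord (Sum.inr j) (c.κX (p1.base w'), c.y (p2.base w'))) =
      (H.comap p2).fn fun x => (stdBasis c.k).coord j (c.y x) := by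
  rw [GermHom.comap_fn _ _ (c.smoothNear_y j)]
  simp only [coord_inr]

theorem frameCovec_inl {w' : W.base} (hw : w' ∈ c.U) (H : GermHom W w' p) (i : Fin X.rank) :
    H.toFun c.U hw (frameCovec c.F le_rfl (Sum.inl i)) =
      (H.comap p1).toFun c.UX (c.le1 hw) (frameCovec c.FX le_rfl i) := by
  rw [c.frame_inl, H.res c.le1 hw]
  rfl

theorem frameCovec_inr {w' : W.base} (hw : w' ∈ c.U) (H : GermHom W w' p) (j : c.J) :
    H.toFun c.U hw (frameCovec c.F le_rfl (Sum.inr j)) =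
      (H.comap p2).toFun c.UY (c.le2 hw) (frameCovec c.FY le_rfl (Sum.inr j)) := by
  rw [c.frame_inr, H.res c.le2 hw]
  rfl

include c in
/-- A homomorphism on germs on a fibre product is determined by its components. -/
theorem germHom_ext {H H' : GermHom W w p}
    (h1 : ∀ U hw a, (H.comap p1).toFun U hw a = (H'.comap p1).toFun U hw a)
    (h2 : ∀ U hw a, (H.comap p2).toFun U hw a = (H'.comap p2).toFun U hw a)
    {U : Opens W.base} (hw : w ∈ U) (a : W.shiftObj.func U) : H.toFun U hw a = H'.toFun U hw a := by
  refine GermHom.eq_of_coords c.coords (prodBasis X.dim c.k) ?_ c.F c.mem ?_ hw a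
  · rintro (i | j)
    · rw [c.fn_coord_inl, c.fn_coord_inl]
      exact GermHom.fn_eq_fn _ rfl (fun U hw _ a => h1 U hw a) (c.coordsX.smoothNear_coord _ i)
    · rw [c.fn_coord_inr, c.fn_coord_inr]
      exact GermHom.fn_eq_fn _ rfl (fun U hw _ a => h2 U hw a) (c.smoothNear_y j)
  · rintro (i | j)
    · rw [c.frameCovec_inl, c.frameCovec_inl]
      exact h1 _ _ _
    · rw [c.frameCovec_inr, c.frameCovec_inr]
      exact h2 _ _ _

include c in
/-- Compatible homomorphisms on germs on the factors define a homomorphism on germs on the fibre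
product. -/
theorem exists_germHom (hst : p1 ≫ s = p2 ≫ t) (A : GermHom X (p1.base w) p) (B : GermHom Y (p2.base w) p)
    (hAB : ∀ (U : Opens Z.base) (h1 : s.base (p1.base w) ∈ U) (h2 : t.base (p2.base w) ∈ U) a,
      (A.comap s).toFun U h1 a = (B.comap t).toFun U h2 a) :
    ∃ H : GermHom W w p, (∀ U hw a, (H.comap p1).toFun U hw a = A.toFun U hw a) ∧
      ∀ U hw a, (H.comap p2).toFun U hw a = B.toFun U hw a := by
  have hbase : s.base (p1.base w) = t.base (p2.base w) := congrArg (fun f : W ⟶ Z => f.base w) hst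
  let n : Fin X.dim ⊕ Fin c.k → SuperPoly.degZero p :=
    Sum.elim (fun i => A.incr fun x => (stdBasis X.dim).coord i (c.κX x))
      fun j => B.incr fun h => (stdBasis c.k).coord j (c.y h)
  obtain ⟨N, hN⟩ : IsNilpotent (Ideal.span (Set.range n)) := by
    rw [Ideal.FG.isNilpotent_iff_le_nilradical (Submodule.fg_span (Set.finite_range n))]
    refine Ideal.span_le.2 ?_
    rintro _ ⟨i | j, rfl⟩
    · exact SuperPoly.isNilpotent_of_evalAt (A.evalAt_incr (c.coordsX.smoothNear_coord _ i))
    · exact SuperPoly.isNilpotent_of_evalAt (B.evalAt_incr (c.smoothNear_y j))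
  have hN' : Ideal.span (Set.range n) ^ (N + 2) = ⊥ := by
    rw [pow_add, hN]
    exact Ideal.bot_mul _
  let θ : Fin X.rank ⊕ c.J → SuperPoly p :=
    Sum.elim (fun i => A.toFun c.UX c.memX (frameCovec c.FX le_rfl i))
      fun j => B.toFun c.UY c.memY (frameCovec c.FY le_rfl (Sum.inr j))
  have hθ : ∀ j, θ j ∈ SuperPoly.deg p 1 := by
    rintro (i | j)
    · exact A.map_deg _ _ 1 _ (covecForm_mem_deg _ _)
    · exact B.map_deg _ _ 1 _ (covecForm_mem_deg _ _)
  let H : GermHom W w p := GermHom.ofTaylor c.coords (prodBasis X.dim c.k) c.F c.mem n hN' θ hθ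
  have hcoord : ∀ i, H.fn (fun w' => (prodBasis X.dim c.k).coord i (c.κX (p1.base w'), c.y (p2.base w'))) =
      algebraMap ℝ _ ((prodBasis X.dim c.k).coord i (c.κX (p1.base w), c.y (p2.base w))) + n i := fun i =>
    GermHom.ofTaylor_coord c.coords (prodBasis X.dim c.k) c.F c.mem n hN' θ hθ i
  have hframe : ∀ j, H.toFun c.U c.mem (frameCovec c.F le_rfl j) = θ j := fun j =>
    GermHom.ofTaylor_frame c.coords (prodBasis X.dim c.k) c.F c.mem n hN' θ hθ j
  have hA : ∀ U hw a, (H.comap p1).toFun U hw a = A.toFun U hw a := by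
    intro U hw a
    refine GermHom.eq_of_coords c.coordsX (stdBasis X.dim) (fun i => ?_) c.FX c.memX (fun i => ?_) hw a
    · rw [← c.fn_coord_inl, hcoord, coord_inl]
      exact add_sub_cancel _ _
    · exact (c.frameCovec_inl c.mem H i).symm.trans (hframe _)
  have hZ : ∀ (U : Opens Z.base) (h2 : t.base (p2.base w) ∈ U) a,
      ((H.comap p2).comap t).toFun U h2 a = (B.comap t).toFun U h2 a := fun U h2 a => by
    have h1 : s.base (p1.base w) ∈ U := hbase ▸ h2
    rw [← H.comap_square hst h1 h2, ← hAB U h1 h2]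
    exact hA _ _ _
  refine ⟨H, hA, fun U hw a => ?_⟩
  refine GermHom.eq_of_coords c.coordsY (prodBasis Z.dim c.k) ?_ c.FY c.memY ?_ hw a
  · rintro (i | j)
    · have h1 := c.coordsZ.smoothNear_coord (stdBasis Z.dim) i
      simp only [coord_inl]
      rw [← GermHom.comap_fn (H.comap p2) t h1, ← GermHom.comap_fn B t h1]
      exact GermHom.fn_eq_fn _ rfl (fun U hw _ a => hZ U hw a) h1
    · simp only [coord_inr]
      rw [← c.fn_coord_inr, hcoord, coord_inr]
      exact add_sub_cancel _ _
  · rintro (i | j)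
    · rw [c.frameY, GermHom.res, GermHom.res]
      exact hZ c.UZ (c.leY c.memY) _
    · exact (c.frameCovec_inr c.mem H j).symm.trans (hframe _)

end AdaptedChart

/-- A family of homomorphisms on germs on a fibre product depends smoothly on the parameter if its
components do. -/
theorem AdaptedChart.isSmoothFamilyAt {W X Y Z : SmoothVB} {p1 : W ⟶ X} {p2 : W ⟶ Y} {t : Y ⟶ Z}
    {p : ℤ → ℕ} {T : Type} [TopologicalSpace T] {Q : Type} [NormedAddCommGroup Q] [NormedSpace ℝ Q]
    {φ : T → Q} {q : T} {z : T → W.base} (c : AdaptedChart p1 p2 t (z q))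
    (hz : ContinuousAt z q) {H : ∀ y, GermHom W (z y) p}
    (h1 : GermHom.IsSmoothFamilyAt φ (fun y => (H y).comap p1) q)
    (h2 : GermHom.IsSmoothFamilyAt φ (fun y => (H y).comap p2) q) :
    GermHom.IsSmoothFamilyAt φ H q := by
  have hz1 : ContinuousAt (fun y => p1.base (z y)) q :=
    (p1.smooth_base.continuous.tendsto _).comp hz
  have hz2 : ContinuousAt (fun y => p2.base (z y)) q :=
    (p2.smooth_base.continuous.tendsto _).comp hz
  refine GermHom.isSmoothFamilyAt_of_coords hz c.coords (prodBasis X.dim c.k) ?_ c.F c.mem ?_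
  · rintro (i | j)
    · refine (h1.fn hz1 (c.coordsX.smoothNear_coord (stdBasis _) i)).congr ?_
      filter_upwards [hz1.eventually (c.coordsX.smoothNear_coord (stdBasis _) i).eventually_nhds] with y hy
      rw [GermHom.comap_fn _ _ hy]
      simp only [coord_inl]
    · refine (h2.fn hz2 (c.smoothNear_y j)).congr ?_
      filter_upwards [hz2.eventually (c.smoothNear_y j).eventually_nhds] with y hy
      rw [GermHom.comap_fn _ _ hy]
      simp only [coord_inr]
  · rintro (i | j)
    · obtain ⟨G, hG, h⟩ := h1 c.UX c.memX (frameCovec c.FX le_rfl i)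
      refine ⟨G, hG, h.mono fun y hy hyU => ?_⟩
      rw [c.frameCovec_inl]
      exact hy _
    · obtain ⟨G, hG, h⟩ := h2 c.UY c.memY (frameCovec c.FY le_rfl (Sum.inr j))
      refine ⟨G, hG, h.mono fun y hy hyU => ?_⟩
      rw [c.frameCovec_inr]
      exact hy _



open SmoothVB

/-! ### Gluing of functions on supermanifolds -/

/-- A homomorphism of algebras whose values lie in the image of an injective homomorphism factors
through the latter. -/
theorem AlgHom.exists_factor {A B C : Type} [Ring A] [Ring B] [Ring C] [Algebra ℝ A] [Algebra ℝ B]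
    [Algebra ℝ C] {Ψ : B →ₐ[ℝ] C} (hΨ : Function.Injective Ψ) {Φ : A →ₐ[ℝ] C}
    (h : ∀ a, ∃ b, Ψ b = Φ a) : ∃ L : A →ₐ[ℝ] B, ∀ a, Ψ (L a) = Φ a := by
  refine ⟨((AlgEquiv.ofInjective Ψ hΨ).symm : _ →ₐ[ℝ] B).comp (Φ.codRestrict Ψ.range h), fun a => ?_⟩
  exact congrArg Subtype.val ((AlgEquiv.ofInjective Ψ hΨ).apply_symm_apply (Φ.codRestrict Ψ.range h a))

namespace GradedSpace.IsSupermanifold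

variable {T : GradedSpace} (hT : T.IsSupermanifold)

include hT

theorem exists_glue {ι : Type} {N : Opens T.carrier} {U : ι → Opens T.carrier} (hU : ∀ i, U i ≤ N)
    (hN : N ≤ ⨆ i, U i) (k : ℤ) (a : ∀ i, T.func (U i)) (ha : ∀ i, a i ∈ T.deg (U i) k)
    (hcompat : ∀ i j, T.res (inf_le_left : U i ⊓ U j ≤ U i) (a i) = T.res inf_le_right (a j)) :
    ∃ b ∈ T.deg N k, ∀ i, T.res (hU i) b = a i := by
  obtain rfl : N = ⨆ i, U i := le_antisymm hN (iSup_le hU)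
  obtain ⟨b, ⟨h1, h2⟩, -⟩ := hT.sheaf k ι U a ha hcompat
  exact ⟨b, h1, h2⟩

theorem eq_zero_of_mem_deg {ι : Type} {N : Opens T.carrier} {U : ι → Opens T.carrier} (hU : ∀ i, U i ≤ N)
    (hN : N ≤ ⨆ i, U i) {k : ℤ} {b : T.func N} (hb : b ∈ T.deg N k) (h : ∀ i, T.res (hU i) b = 0) :
    b = 0 := by
  obtain rfl : N = ⨆ i, U i := le_antisymm hN (iSup_le hU)
  exact (hT.sheaf k ι U (fun _ => 0) (fun _ => Submodule.zero_mem _) fun i j => by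
    rw [map_zero, map_zero]).unique ⟨hb, h⟩ ⟨Submodule.zero_mem _, fun i => map_zero _⟩

/-- Functions are determined by their restrictions to the members of an open cover. -/
theorem eq_of_res {ι : Type} {N : Opens T.carrier} {U : ι → Opens T.carrier} (hU : ∀ i, U i ≤ N)
    (hN : N ≤ ⨆ i, U i) {a b : T.func N} (h : ∀ i, T.res (hU i) a = T.res (hU i) b) : a = b := by
  classical
  obtain ⟨d, hd⟩ := (hT.isInternal N).surjective (a - b)
  suffices h0 : d = 0 by
    rw [h0, map_zero] at hd
    exact sub_eq_zero.1 hd.symm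
  refine DFinsupp.ext fun k => Subtype.ext ?_
  refine hT.eq_zero_of_mem_deg hU hN (d k).2 fun i => ?_
  -- the components of the restriction are the restrictions of the components
  let r : ∀ k, T.deg N k →+ T.deg (U i) k := fun k =>
    { toFun := fun x => ⟨T.res (hU i) x.1, hT.res_deg (hU i) k _ x.2⟩
      map_zero' := Subtype.ext (map_zero _)
      map_add' := fun x y => Subtype.ext (map_add _ _ _) }
  have h1 : ∀ d : DirectSum ℤ fun k => T.deg N k,
      DirectSum.coeAddMonoidHom (T.deg (U i)) (DFinsupp.mapRange.addMonoidHom r d) =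
        T.res (hU i) (DirectSum.coeAddMonoidHom (T.deg N) d) := by
    intro d
    induction d using DirectSum.induction_on with
    | zero => rw [map_zero, map_zero, map_zero, map_zero]
    | of k x =>
      rw [DirectSum.coeAddMonoidHom_of]
      have h2 : DFinsupp.mapRange.addMonoidHom r (DirectSum.of (fun k => T.deg N k) k x) =
          DirectSum.of (fun k => T.deg (U i) k) k (r k x) := DFinsupp.mapRange_single (hf := fun i => map_zero (r i))
      rw [h2, DirectSum.coeAddMonoidHom_of]
      rfl
    | add x y hx hy => rw [map_add, map_add, map_add, map_add, hx, hy]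
  have h3 : DFinsupp.mapRange.addMonoidHom r d = 0 := by
    refine (hT.isInternal (U i)).injective ?_
    rw [map_zero, h1, hd, map_sub, h i, sub_self]
  exact congrArg Subtype.val (DFunLike.congr_fun h3 k)

omit hT

end GradedSpace.IsSupermanifold

/-! ### Pullbacks of forms to open parts of supermanifolds -/

/-- The preimage of an open set under a continuous map. -/
def preimC {T B : Type} [TopologicalSpace T] [TopologicalSpace B] {z : T → B} (hz : Continuous z)
    (U : Opens B) : Opens T := ⟨z ⁻¹' U, U.isOpen.preimage hz⟩

/-- A pullback of forms, along the continuous map `z`, to functions on the open part `O` of `T`: a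
morphism from this open part to `[-1]E`. -/
structure PullOn (T : GradedSpace) (E : SmoothVB) {z : T.carrier → E.base} (hz : Continuous z)
    (O : Opens T.carrier) where
  toFun : ∀ U : Opens E.base, E.shiftObj.func U →ₐ[ℝ] T.func (preimC hz U ⊓ O)
  res : ∀ {U V : Opens E.base} (h : V ≤ U) (a : E.shiftObj.func U),
    toFun V (E.shiftObj.res h a) = T.res (inf_le_inf_right O fun _ hx => h hx) (toFun U a)
  deg : ∀ (U : Opens E.base) (k : ℤ), ∀ a ∈ E.shiftObj.deg U k, toFun U a ∈ T.deg (preimC hz U ⊓ O) k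

namespace PullOn

variable {T : GradedSpace} {E E' : SmoothVB} {z : T.carrier → E.base} {hz : Continuous z}
  {O : Opens T.carrier} {p : ℤ → ℕ}

/-- Restriction to a smaller open part. -/
def restrict (hT : T.IsSupermanifold) (P : PullOn T E hz O) {O' : Opens T.carrier} (h : O' ≤ O) :
    PullOn T E hz O' where
  toFun U := (T.res (inf_le_inf_left _ h)).comp (P.toFun U)
  res h' a := by
    rw [AlgHom.comp_apply, P.res h', T.res_res, AlgHom.comp_apply, T.res_res]
  deg U k a ha := hT.res_deg _ k _ (P.deg U k a ha)

/-- The composition with a bundle map. -/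
def comap (P : PullOn T E hz O) (φ : E ⟶ E') :
    PullOn T E' (φ.smooth_base.continuous.comp hz) O where
  toFun U := (P.toFun (preim φ U)).comp (pullForm φ U)
  res {_ V} h a := (congrArg (P.toFun (preim φ V)) ((shiftMap φ).pull_res h a)).trans (P.res _ _)
  deg U k a ha := P.deg _ k _ ((shiftMap φ).pull_deg U k a ha)

/-- The restriction of a morphism to an open part. -/
def ofHom (hT : T.IsSupermanifold) (f : T ⟶ E.shiftObj) (hz : Continuous z) (h : ∀ y, f.base y = z y)
    (O : Opens T.carrier) : PullOn T E hz O where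
  toFun U := (T.res (fun y hy => by
    change f.base y ∈ U
    rw [h y]
    exact hy.1 : preimC hz U ⊓ O ≤ preimC f.continuous_base U)).comp (f.pull U)
  res {_ V} h' a := by
    change T.res _ (f.pull V (E.shiftObj.res h' a)) = T.res _ (T.res _ (f.pull _ a))
    exact ((congrArg (T.res _) (f.pull_res h' a)).trans (T.res_res _ _ _)).trans (T.res_res _ _ _).symm
  deg U k a ha := hT.res_deg _ k _ (f.pull_deg U k a ha)

theorem subset_source (hz : Continuous z) {c : T.Chart p} (hO : (O : Set T.carrier) ⊆ c.toHomeo.source)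
    (U : Opens E.base) : ((preimC hz U ⊓ O : Opens T.carrier) : Set T.carrier) ⊆ c.toHomeo.source :=
  fun _ hx => hO hx.2

/-- The homomorphism on germs at `z y` that is given by the expression in a chart around `y`. -/
def germ (P : PullOn T E hz O) (c : T.Chart p) (hO : (O : Set T.carrier) ⊆ c.toHomeo.source) (y : O) :
    GermHom E (z y) p where
  toFun U hw := (Pi.evalAlgHom ℝ (fun _ : (preimC hz U ⊓ O : Opens T.carrier) => SuperPoly p)
    ⟨y.1, hw, y.2⟩).comp
    ((c.fn (preimC hz U ⊓ O) (subset_source hz hO U)).comp (P.toFun U))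
  res {U V} h hw a := by
    exact (congrFun (congrArg (c.fn _ (subset_source hz hO V)) (P.res h a)) ⟨y.1, hw, y.2⟩).trans
      (c.fn_res _ (subset_source hz hO U) _ _)
  map_deg U hw k a ha := ((c.fn_deg _ _ k _).1 ⟨_, P.deg U k a ha, rfl⟩).1 _

theorem ext_of_germ {P P' : PullOn T E hz O} (c : T.Chart p)
    (hO : (O : Set T.carrier) ⊆ c.toHomeo.source)
    (h : ∀ (y : O) U hw a, (P.germ c hO y).toFun U hw a = (P'.germ c hO y).toFun U hw a)
    (U : Opens E.base) (a : E.shiftObj.func U) : P.toFun U a = P'.toFun U a :=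
  c.fn_injective _ (subset_source hz hO U) (funext fun y => h ⟨y.1, y.2.2⟩ U y.2.1 a)

theorem isSmoothFamilyAt_germ (P : PullOn T E hz O) (c : T.Chart p)
    (hO : (O : Set T.carrier) ⊆ c.toHomeo.source) (y : O) :
    GermHom.IsSmoothFamilyAt (fun y : O => c.toHomeo y.1) (P.germ c hO) y := by
  intro U hw a
  have hhom : ∀ (k : ℤ), ∀ a ∈ E.shiftObj.deg U k, ∃ G : O → SuperPoly p,
      PolySmoothAt (fun y : O => c.toHomeo y.1) G y ∧
      ∀ᶠ y' : O in 𝓝 y, ∀ hy : z y'.1 ∈ U, (P.germ c hO y').toFun U hy a = G y' := by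
    intro k a ha
    obtain ⟨-, h⟩ := (c.fn_deg _ (subset_source hz hO U) k _).1 ⟨_, P.deg U k a ha, rfl⟩
    obtain ⟨V, hyV, hVU, n, f, v, hf, hG⟩ := h ⟨y.1, hw, y.2⟩
    have hVo : IsOpen (c.toHomeo '' V) := c.toHomeo.isOpen_image_of_subset_source V.isOpen
      fun x hx => hO (hVU hx).2
    refine ⟨fun y' => ∑ i, f i (c.toHomeo y'.1) • v i, ⟨Fin n, inferInstance, _, v,
      fun i => ⟨f i, ContDiffAt.smoothGermAt_of_isOpen (hVo.mem_nhds ⟨_, hyV, rfl⟩) (hf i),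
        Filter.EventuallyEq.rfl⟩, Filter.Eventually.of_forall fun _ => rfl⟩, ?_⟩
    filter_upwards [(V.isOpen.preimage continuous_subtype_val).mem_nhds hyV] with y' hy' hy
    exact hG ⟨y'.1, hy, y'.2⟩ hy'
  choose G hG h using fun n : ℕ => hhom n _ (component_mem (n : ℤ) a)
  refine ⟨fun y' => ∑ n ∈ Finset.range (E.rank + 1), G n y', PolySmoothAt.sum _ fun n _ => hG n, ?_⟩
  filter_upwards [(Finset.range (E.rank + 1)).eventually_all.2 fun n _ => h n] with y' h1 hy
  conv_lhs => rw [← sum_component a]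
  rw [map_sum]
  exact Finset.sum_congr rfl fun n hn => h1 n hn hy

/-- A smooth family of homomorphisms on germs defines a pullback to the domain of a chart. -/
theorem exists_of_germs (c : T.Chart p) (hO : (O : Set T.carrier) ⊆ c.toHomeo.source)
    (H : ∀ y : O, GermHom E (z y) p)
    (hH : ∀ y, GermHom.IsSmoothFamilyAt (fun y : O => c.toHomeo y.1) H y) :
    ∃ P : PullOn T E hz O, ∀ (y : O) U hw a, (P.germ c hO y).toFun U hw a = (H y).toFun U hw a := by
  let Φ : ∀ U : Opens E.base, E.shiftObj.func U →ₐ[ℝ] ((preimC hz U ⊓ O : Opens T.carrier) → SuperPoly p) :=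
    fun U => AlgHom.pi fun y => (H ⟨y.1, y.2.2⟩).toFun U y.2.1
  have hhom : ∀ (U : Opens E.base) (k : ℤ), ∀ a ∈ E.shiftObj.deg U k,
      ∃ b ∈ T.deg (preimC hz U ⊓ O) k, c.fn _ (subset_source hz hO U) b = Φ U a := by
    intro U k a ha
    refine (c.fn_deg _ (subset_source hz hO U) k _).2 ⟨fun y => (H _).map_deg _ _ k a ha, fun y => ?_⟩
    let y₀ : O := ⟨y.1, y.2.2⟩
    obtain ⟨G, ⟨m, _, u, v, hu, hGv⟩, hG⟩ := hH y₀ U y.2.1 a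
    choose g hg hug using hu
    have hcont : ContinuousAt (fun y : O => c.toHomeo y.1) y₀ :=
      ContinuousAt.comp (g := c.toHomeo) (f := Subtype.val) (x := y₀)
        (c.toHomeo.continuousAt (hO y.2.2)) continuous_subtype_val.continuousAt
    have hUn : ∀ᶠ y' in 𝓝 y₀, z y'.1 ∈ U :=
      (U.isOpen.preimage (hz.comp continuous_subtype_val)).mem_nhds y.2.1
    obtain ⟨S, hS, hSo, hyS⟩ := eventually_nhds_iff.1 (hG.and (hGv.and ((Filter.eventually_all.2 hug).and
      (hUn.and (hcont.eventually (Filter.eventually_all.2 hg))))))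
    let V : Opens T.carrier := ⟨Subtype.val '' S, O.isOpen.isOpenMap_subtype_val _ hSo⟩
    let e := Fintype.equivFin m
    refine ⟨V, ⟨y₀, hyS, rfl⟩, ?_, Fintype.card m, fun i => g (e.symm i), fun i => v (e.symm i), ?_, ?_⟩
    · rintro _ ⟨y', hy', rfl⟩
      exact ⟨(hS _ hy').2.2.2.1, y'.2⟩
    · rintro i _ ⟨_, ⟨y', hy', rfl⟩, rfl⟩
      exact ((hS _ hy').2.2.2.2 _).contDiffWithinAt
    · rintro y' ⟨y'', hy'', hyy⟩
      obtain rfl : y'' = ⟨y'.1, y'.2.2⟩ := Subtype.ext hyy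
      obtain ⟨h1, h2, h3, -⟩ := hS _ hy''
      refine (h1 y'.2.1).trans (h2.trans ?_)
      rw [← e.symm.sum_comp]
      refine Finset.sum_congr rfl fun i _ => ?_
      rw [h3]
  have hex : ∀ (U : Opens E.base) a, ∃ b, c.fn (preimC hz U ⊓ O) (subset_source hz hO U) b = Φ U a := by
    intro U a
    choose b _ hb using fun n : ℕ => hhom U n _ (component_mem (n : ℤ) a)
    refine ⟨∑ n ∈ Finset.range (E.rank + 1), b n, ?_⟩
    conv_rhs => rw [← sum_component a]
    rw [map_sum, map_sum]
    exact Finset.sum_congr rfl fun n _ => hb n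
  choose L hL using fun U => AlgHom.exists_factor (c.fn_injective (preimC hz U ⊓ O) (subset_source hz hO U)) (hex U)
  refine ⟨⟨L, fun {U V} h a => ?_, fun U k a ha => ?_⟩, fun y U hw a => ?_⟩
  · refine c.fn_injective _ (subset_source hz hO V) (funext fun y => ?_)
    exact ((congrFun (hL V _) y).trans ((H ⟨y.1, y.2.2⟩).res h y.2.1 a)).trans
      ((congrFun (hL U a) ⟨y.1, h y.2.1, y.2.2⟩).symm.trans 
        (c.fn_res (inf_le_inf_right O fun _ hx => h hx) (subset_source hz hO U) (L U a) y).symm)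
  · obtain ⟨b, hb, h1⟩ := hhom U k a ha
    rwa [c.fn_injective _ (subset_source hz hO U) ((hL U a).trans h1.symm)]
  · exact congrFun (hL U a) ⟨y.1, hw, y.2⟩

end PullOn



open SmoothVB

namespace PullOn

variable {T : GradedSpace} {E E' : SmoothVB} {z : T.carrier → E.base} {hz : Continuous z}
  {O : Opens T.carrier} {p : ℤ → ℕ}

theorem ofHom_congr (hT : T.IsSupermanifold) {f f' : T ⟶ E.shiftObj} (hf : f = f')
    (h : ∀ y, f.base y = z y) (h' : ∀ y, f'.base y = z y) (U : Opens E.base) (a : E.shiftObj.func U) :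
    (ofHom hT f hz h O).toFun U a = (ofHom hT f' hz h' O).toFun U a := by
  subst hf
  rfl

theorem germ_ofHom_congr (hT : T.IsSupermanifold) {f f' : T ⟶ E.shiftObj} (hf : f = f')
    {z' : T.carrier → E.base} {hz' : Continuous z'}
    (h : ∀ y, f.base y = z y) (h' : ∀ y, f'.base y = z' y) (c : T.Chart p)
    (hO : (O : Set T.carrier) ⊆ c.toHomeo.source) (y : O) (U : Opens E.base) (hw : z y ∈ U)
    (hw' : z' y ∈ U) (a : E.shiftObj.func U) :
    ((ofHom hT f hz h O).germ c hO y).toFun U hw a =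
      ((ofHom hT f' hz' h' O).germ c hO y).toFun U hw' a := by
  subst hf
  obtain rfl : z = z' := funext fun y => (h y).symm.trans (h' y)
  rfl

/-- A morphism to `[-1]E` is determined by its restrictions to an open cover. -/
theorem hom_ext (hT : T.IsSupermanifold) {ι : Type} {O : ι → Opens T.carrier}
    (hO : ∀ y, ∃ i, y ∈ O i) {f g : T ⟶ E.shiftObj} (hf : ∀ y, f.base y = z y)
    (hg : ∀ y, g.base y = z y) (h : ∀ i U a, (ofHom hT f hz hf (O i)).toFun U a =
      (ofHom hT g hz hg (O i)).toFun U a) : f = g := by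
  obtain ⟨b, hb, pull, h1, h2, h3⟩ := f
  obtain ⟨b', hb', pull', h1', h2', h3'⟩ := g
  obtain rfl : b = z := funext hf
  obtain rfl : b' = b := funext hg
  refine GradedSpace.Hom.ext' rfl fun U a => heq_of_eq ?_
  refine hT.eq_of_res (U := fun i => preimC hz U ⊓ O i) (fun i => inf_le_left) (fun y hy => ?_)
    fun i => h i U a
  obtain ⟨i, hi⟩ := hO y
  exact Opens.mem_iSup.2 ⟨i, hy, hi⟩

theorem ev (P : PullOn T E hz O) (c : T.Chart p) (hO : (O : Set T.carrier) ⊆ c.toHomeo.source)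
    {U : Opens E.base} (a : E.shiftObj.func U) (y : (preimC hz U ⊓ O : Opens T.carrier)) :
    T.ev _ (P.toFun U a) y = E.shiftObj.ev U a ⟨z y.1, y.2.1⟩ :=
  (c.fn_ev _ (subset_source hz hO U) _ _).trans ((P.germ c hO ⟨y.1, y.2.2⟩).aug_toFun y.2.1 a)

/-- Compatible pullbacks on the domains of charts that cover a supermanifold are the restrictions
of a morphism. -/
theorem exists_glue (hT : T.IsSupermanifold) {ι : Type} {c : ι → T.Chart p} {O : ι → Opens T.carrier}
    (hO : ∀ i, (O i : Set T.carrier) ⊆ (c i).toHomeo.source) (hcov : ∀ y, ∃ i, y ∈ O i)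
    (P : ∀ i, PullOn T E hz (O i))
    (hP : ∀ i j U a, ((P i).restrict hT (inf_le_left : O i ⊓ O j ≤ O i)).toFun U a =
      ((P j).restrict hT inf_le_right).toFun U a) :
    ∃ (f : T ⟶ E.shiftObj) (h : ∀ y, f.base y = z y),
      ∀ i U a, (ofHom hT f hz h (O i)).toFun U a = (P i).toFun U a := by
  have hle : ∀ (U : Opens E.base), preimC hz U ≤ ⨆ i, preimC hz U ⊓ O i := fun U y hy => by
    obtain ⟨i, hi⟩ := hcov y
    exact Opens.mem_iSup.2 ⟨i, hy, hi⟩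
  have hext : ∀ {U : Opens E.base} {a b : T.func (preimC hz U)},
      (∀ i, T.res (inf_le_left : preimC hz U ⊓ O i ≤ _) a = T.res inf_le_left b) → a = b :=
    fun {U a b} h => hT.eq_of_res (fun i => inf_le_left) (hle U) h
  have hhom : ∀ (U : Opens E.base) (k : ℤ), ∀ a ∈ E.shiftObj.deg U k, ∃ b ∈ T.deg (preimC hz U) k,
      ∀ i, T.res (inf_le_left : preimC hz U ⊓ O i ≤ _) b = (P i).toFun U a := by
    intro U k a ha
    refine hT.exists_glue (fun i => inf_le_left) (hle U) k _ (fun i => (P i).deg U k a ha) fun i j => ?_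
    have hij : (preimC hz U ⊓ O i) ⊓ (preimC hz U ⊓ O j) ≤ preimC hz U ⊓ (O i ⊓ O j) :=
      fun y hy => ⟨hy.1.1, hy.1.2, hy.2.2⟩
    exact (T.res_res _ hij _).symm.trans ((congrArg (T.res hij) (hP i j U a)).trans (T.res_res _ _ _))
  have hex : ∀ (U : Opens E.base) (a : E.shiftObj.func U), ∃ b : T.func (preimC hz U),
      ∀ i, T.res (inf_le_left : preimC hz U ⊓ O i ≤ _) b = (P i).toFun U a := by
    intro U a
    choose b _ hb using fun n : ℕ => hhom U n _ (component_mem (n : ℤ) a)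
    refine ⟨∑ n ∈ Finset.range (E.rank + 1), b n, fun i => ?_⟩
    conv_rhs => rw [← sum_component a]
    rw [map_sum, map_sum]
    exact Finset.sum_congr rfl fun n _ => hb n i
  choose L hL using fun U => AlgHom.exists_factor
    (Ψ := AlgHom.pi fun i => T.res (inf_le_left : preimC hz U ⊓ O i ≤ preimC hz U))
    (Φ := AlgHom.pi fun i => (P i).toFun U) (fun a b h => hext fun i => congrFun h i)
    fun a => (hex U a).imp fun b hb => funext hb
  have hL' : ∀ (U : Opens E.base) (a : E.shiftObj.func U) i,
      T.res (inf_le_left : preimC hz U ⊓ O i ≤ _) (L U a) = (P i).toFun U a :=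
    fun U a i => congrFun (hL U a) i
  refine ⟨⟨z, hz, L, fun {U V} h a => hext fun i => ?_, fun U k a ha => ?_, fun U a y hy => ?_⟩,
    fun _ => rfl, fun i U a => hL' U a i⟩
  · refine (hL' V _ i).trans (((P i).res h a).trans ?_)
    exact (congrArg (T.res _) (hL' U a i).symm).trans ((T.res_res _ _ _).trans (T.res_res _ _ _).symm)
  · obtain ⟨b, hb, h1⟩ := hhom U k a ha
    exact (hext fun i => (hL' U a i).trans (h1 i).symm : L U a = b) ▸ hb
  · obtain ⟨i, hi⟩ := hcov y
    refine (hT.res_ev (inf_le_left : preimC hz U ⊓ O i ≤ _) (L U a) ⟨y, hy, hi⟩).symm.trans ?_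
    rw [hL' U a i]
    exact (P i).ev (c i) (hO i) a ⟨y, hy, hi⟩

end PullOn

/-! ### The functor `[-1]` preserves fibre products of bundles along submersions -/

namespace IsFibreProduct

variable {W X Y Z : SmoothVB} {p1 : W ⟶ X} {p2 : W ⟶ Y} {s : X ⟶ Z} {t : Y ⟶ Z}

/-- A map to a fibre product is continuous if its components are. -/
theorem continuousAt (hW : IsFibreProduct (fun _ => True) p1 p2 s t) {S : Type} [TopologicalSpace S]
    {z : S → W.base} {q : S} (c : AdaptedChart p1 p2 t (z q))
    (h1 : ContinuousAt (fun y => p1.base (z y)) q) (h2 : ContinuousAt (fun y => p2.base (z y)) q) :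
    ContinuousAt z q := by
  have hy : ContinuousAt c.y (p2.base (z q)) := c.coordsY.smooth.self_of_nhds.continuousAt.snd
  have hx : ContinuousAt c.κX (p1.base (z q)) := c.coordsX.smooth.self_of_nhds.continuousAt
  have hr : ContinuousAt (fun y => (c.κX (p1.base (z y)), c.y (p2.base (z y)))) q :=
    (ContinuousAt.comp (f := fun y => p1.base (z y)) hx h1).prodMk
      (ContinuousAt.comp (f := fun y => p2.base (z y)) hy h2)
  have hρ : ContinuousAt c.ρ (c.κX (p1.base (z q)), c.y (p2.base (z q))) :=
    c.coords.smooth_inv.self_of_nhds.continuousAt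
  have hρr : ContinuousAt (fun y => c.ρ (c.κX (p1.base (z y)), c.y (p2.base (z y)))) q :=
    ContinuousAt.comp (g := c.ρ) (f := fun y => (c.κX (p1.base (z y)), c.y (p2.base (z y)))) hρ hr
  have hq : c.ρ (c.κX (p1.base (z q)), c.y (p2.base (z q))) = z q := c.coords.left_inv.self_of_nhds
  have hρr' : Filter.Tendsto (fun y => c.ρ (c.κX (p1.base (z y)), c.y (p2.base (z y)))) (𝓝 q)
      (𝓝 (z q)) := hρr.tendsto.mono_right (le_of_eq (congrArg 𝓝 hq))
  refine hρr'.congr' ?_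
  -- near `q` the map is given in coordinates by its components
  filter_upwards [hr.eventually c.coords.right_inv, h1.eventually c.coordsX.left_inv,
    h2.eventually c.coordsY.left_inv,
    (((p1.smooth_base.continuous.tendsto _).comp hρr').eventually c.coordsX.left_inv),
    (((p2.smooth_base.continuous.tendsto _).comp hρr').eventually c.coordsY.left_inv)]
    with y e1 e2 e3 e4 e5
  have e6 := Prod.ext_iff.1 e1
  dsimp only [Function.comp_apply] at e4 e5 e6
  have e7 : p1.base (c.ρ (c.κX (p1.base (z y)), c.y (p2.base (z y)))) = p1.base (z y) := by
    rw [← e4, e6.1, e2]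
  refine hW.base_injective e7 ?_
  rw [← e5, e6.2, ← hW.base_comm, e7, hW.base_comm, e3]

variable {T : GradedSpace} {p : ℤ → ℕ} {z : T.carrier → W.base} {hz : Continuous z} {O : Opens T.carrier}

/-- Over the domain of a chart of `T`, a morphism to a fibre product of bundles is determined by its
composites with the two projections: on germs it is determined by its values on coordinates and
coframes, which come from the two factors. -/
theorem pullOn_ext (c : T.Chart p) (hO : (O : Set T.carrier) ⊆ c.toHomeo.source)
    (hc : ∀ w, Nonempty (AdaptedChart p1 p2 t w)) {P P' : PullOn T W hz O}
    (h1 : ∀ U a, (P.comap p1).toFun U a = (P'.comap p1).toFun U a)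
    (h2 : ∀ U a, (P.comap p2).toFun U a = (P'.comap p2).toFun U a) (U : Opens W.base)
    (a : W.shiftObj.func U) : P.toFun U a = P'.toFun U a := by
  refine PullOn.ext_of_germ c hO (fun y U hw a => ?_) U a
  obtain ⟨d⟩ := hc (z y)
  refine d.germHom_ext (fun U hw a => ?_) (fun U hw a => ?_) hw a
  · exact congrArg (fun b => c.fn _ (PullOn.subset_source hz hO (preim p1 U)) b ⟨y.1, hw, y.2⟩) (h1 U a)
  · exact congrArg (fun b => c.fn _ (PullOn.subset_source hz hO (preim p2 U)) b ⟨y.1, hw, y.2⟩) (h2 U a)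

/-- The germ homomorphisms of `x` and `y` at a point agree over the base of the fibre product and
hence come from one on `[-1]W`; over the domain of a chart of `T` these assemble to a morphism. -/
theorem exists_pullOn (hT : T.IsSupermanifold) (c : T.Chart p)
    (hO : (O : Set T.carrier) ⊆ c.toHomeo.source) (hc : ∀ w, Nonempty (AdaptedChart p1 p2 t w))
    (hst : p1 ≫ s = p2 ≫ t) {x : T ⟶ X.shiftObj} {y : T ⟶ Y.shiftObj}
    (hxy : x ≫ shiftMap s = y ≫ shiftMap t) (hx : ∀ q, x.base q = p1.base (z q))
    (hy : ∀ q, y.base q = p2.base (z q)) :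
    ∃ P : PullOn T W hz O,
      (∀ U a, (P.comap p1).toFun U a =
        (PullOn.ofHom hT x (p1.smooth_base.continuous.comp hz) hx O).toFun U a) ∧
      ∀ U a, (P.comap p2).toFun U a =
        (PullOn.ofHom hT y (p2.smooth_base.continuous.comp hz) hy O).toFun U a := by
  let A := PullOn.ofHom hT x (p1.smooth_base.continuous.comp hz) hx O
  let B := PullOn.ofHom hT y (p2.smooth_base.continuous.comp hz) hy O
  have hex : ∀ q : O, ∃ H : GermHom W (z q) p,
      (∀ U hw a, (H.comap p1).toFun U hw a = (A.germ c hO q).toFun U hw a) ∧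
      ∀ U hw a, (H.comap p2).toFun U hw a = (B.germ c hO q).toFun U hw a := fun q => by
    obtain ⟨d⟩ := hc (z q)
    refine d.exists_germHom hst (A.germ c hO q) (B.germ c hO q) fun U h1 h2 a => ?_
    exact PullOn.germ_ofHom_congr hT hxy (z := s.base ∘ p1.base ∘ z) (z' := t.base ∘ p2.base ∘ z)
      (hz := s.smooth_base.continuous.comp (p1.smooth_base.continuous.comp hz))
      (hz' := t.smooth_base.continuous.comp (p2.smooth_base.continuous.comp hz))
      (fun q => congrArg s.base (hx q)) (fun q => congrArg t.base (hy q)) c hO q U h1 h2 a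
  choose H h1 h2 using hex
  obtain ⟨P, hP⟩ := PullOn.exists_of_germs (hz := hz) c hO H fun q => by
    obtain ⟨d⟩ := hc (z q)
    refine AdaptedChart.isSmoothFamilyAt (z := fun q : O => z q) d
      (hz.comp continuous_subtype_val).continuousAt (fun U hw a => ?_) (fun U hw a => ?_)
    · obtain ⟨G, hG, h⟩ := A.isSmoothFamilyAt_germ c hO q U hw a
      exact ⟨G, hG, h.mono fun q' hq' hU => (h1 q' U hU a).trans (hq' hU)⟩
    · obtain ⟨G, hG, h⟩ := B.isSmoothFamilyAt_germ c hO q U hw a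
      exact ⟨G, hG, h.mono fun q' hq' hU => (h2 q' U hU a).trans (hq' hU)⟩
  refine ⟨P, PullOn.ext_of_germ (P := P.comap p1) (P' := A) c hO fun q U hw a => ?_,
    PullOn.ext_of_germ (P := P.comap p2) (P' := B) c hO fun q U hw a => ?_⟩
  · exact (hP q (preim p1 U) hw (pullForm p1 U a)).trans (h1 q U hw a)
  · exact (hP q (preim p2 U) hw (pullForm p2 U a)).trans (h2 q U hw a)

/-- The functor `[-1]` sends fibre products of bundles along fibrewise surjective submersions to
fibre products of supermanifolds. -/
theorem shiftMap (hW : IsFibreProduct (fun _ => True) p1 p2 s t) (ht : ∀ h, LocallyProj t h)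
    (ht' : ∀ h, Function.Surjective (t.fib h)) :
    IsFibreProduct (C := GradedSpace) GradedSpace.IsSupermanifold (X := X.shiftObj) (Y := Y.shiftObj)
      (W := W.shiftObj) (Z := Z.shiftObj) (SmoothVB.shiftMap p1) (SmoothVB.shiftMap p2)
      (SmoothVB.shiftMap s) (SmoothVB.shiftMap t) := by
  have hc : ∀ w, Nonempty (AdaptedChart p1 p2 t w) := fun w => hW.exists_adaptedChart (ht _) (ht' _)
  refine ⟨?_, fun T hT x y hxy => ?_⟩
  · exact (shiftMap_comp p1 s).symm.trans ((congrArg SmoothVB.shiftMap hW.1).trans (shiftMap_comp p2 t))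
  obtain ⟨p, hp⟩ := hT.locally_superdomain
  choose c hcs using hp
  let O : T.carrier → Opens T.carrier := fun q => ⟨(c q).toHomeo.source, (c q).toHomeo.open_source⟩
  have hO : ∀ q, (O q : Set T.carrier) ⊆ (c q).toHomeo.source := fun q => subset_rfl
  have hcov : ∀ q, ∃ i, q ∈ O i := fun q => ⟨q, hcs q⟩
  have hbase : ∀ q, s.base (x.base q) = t.base (y.base q) := fun q =>
    congrArg (fun f : T ⟶ Z.shiftObj => f.base q) hxy
  choose z hzx hzy using fun q => hW.exists_base (hbase q)
  have hz : Continuous z := continuous_iff_continuousAt.2 fun q => by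
    obtain ⟨d⟩ := hc (z q)
    refine hW.continuousAt d ?_ ?_
    · simp only [hzx]
      exact x.continuous_base.continuousAt
    · simp only [hzy]
      exact y.continuous_base.continuousAt
  have hx : ∀ q, x.base q = p1.base (z q) := fun q => (hzx q).symm
  have hy : ∀ q, y.base q = p2.base (z q) := fun q => (hzy q).symm
  choose P hP1 hP2 using fun i => exists_pullOn (hz := hz) hT (c i) (hO i) hc hW.1 hxy hx hy
  obtain ⟨f, hf, hfP⟩ := PullOn.exists_glue hT hO hcov P fun i j => by
    refine pullOn_ext (c j) (inf_le_right : O i ⊓ O j ≤ O j) hc (fun U a => ?_) fun U a => ?_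
    · exact (congrArg (T.res _) (hP1 i U a)).trans ((T.res_res _ _ _).trans
        ((T.res_res _ _ _).symm.trans (congrArg (T.res _) (hP1 j U a)).symm))
    · exact (congrArg (T.res _) (hP2 i U a)).trans ((T.res_res _ _ _).trans
        ((T.res_res _ _ _).symm.trans (congrArg (T.res _) (hP2 j U a)).symm))
  refine ⟨f, ⟨?_, ?_⟩, fun g hg => ?_⟩
  · exact PullOn.hom_ext (hz := p1.smooth_base.continuous.comp hz) hT hcov
      (fun q => congrArg p1.base (hf q)) hx fun i U a =>
        (hfP i (preim p1 U) (pullForm p1 U a)).trans (hP1 i U a)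
  · exact PullOn.hom_ext (hz := p2.smooth_base.continuous.comp hz) hT hcov
      (fun q => congrArg p2.base (hf q)) hy fun i U a =>
        (hfP i (preim p2 U) (pullForm p2 U a)).trans (hP2 i U a)
  · have hgz : ∀ q, g.base q = z q := fun q => by
      refine hW.base_injective ?_ ?_
      · rw [hzx, ← hg.1]
        rfl
      · rw [hzy, ← hg.2]
        rfl
    refine PullOn.hom_ext (hz := hz) hT hcov hgz hf fun i => ?_
    refine pullOn_ext (c i) (hO i) hc (fun U a => ?_) fun U a => ?_
    · exact (PullOn.ofHom_congr (hz := p1.smooth_base.continuous.comp hz) hT hg.1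
        (fun q => congrArg p1.base (hgz q)) hx U a).trans
        ((hP1 i U a).symm.trans (hfP i (preim p1 U) (pullForm p1 U a)).symm)
    · exact (PullOn.ofHom_congr (hz := p2.smooth_base.continuous.comp hz) hT hg.2
        (fun q => congrArg p2.base (hgz q)) hy U a).trans
        ((hP2 i U a).symm.trans (hfP i (preim p2 U) (pullForm p2 U a)).symm)

end IsFibreProduct



open SmoothVB

/-! ### Tangent vectors of `[-1]E` -/

namespace SmoothVB

variable {E E' : SmoothVB}

/-- The function on the base underlying a function on `[-1]E`. -/
def evalFun {U : Opens E.base} (a : E.shiftObj.func U) (y : U) : ℝ :=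
  ExteriorAlgebra.algebraMapInv (E.val a y)

theorem evalFun_add {U : Opens E.base} (a b : E.shiftObj.func U) (y : U) :
    evalFun (a + b) y = evalFun a y + evalFun b y :=
  map_add (ExteriorAlgebra.algebraMapInv : E.Ext y.1 →ₐ[ℝ] ℝ) _ _

theorem evalFun_mul {U : Opens E.base} (a b : E.shiftObj.func U) (y : U) :
    evalFun (a * b) y = evalFun a y * evalFun b y :=
  map_mul (ExteriorAlgebra.algebraMapInv : E.Ext y.1 →ₐ[ℝ] ℝ) _ _

theorem evalFun_smul {U : Opens E.base} (r : ℝ) (a : E.shiftObj.func U) (y : U) :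
    evalFun (r • a) y = r * evalFun a y :=
  map_smul (ExteriorAlgebra.algebraMapInv : E.Ext y.1 →ₐ[ℝ] ℝ) _ _

theorem smoothAt_evalFun {x : E.base} {U : Opens E.base} (hx : x ∈ U) (a : E.shiftObj.func U) :
    E.SmoothAt (Function.extend Subtype.val (evalFun a) 0) x := by
  have key : ∀ _ : x ∈ U, E.SmoothAt (Function.extend Subtype.val (evalFun a) 0) x := by
    refine func_induction x (P := fun U a => ∀ _ : x ∈ U,
      E.SmoothAt (Function.extend Subtype.val (evalFun a) 0) x) ?_ ?_ ?_ ?_ ?_ hx a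
    · intro U V h hV a ih hx
      refine (ih hV).congr_of_eventuallyEq (extend_eventuallyEq h (fun y hy => ?_) hV)
      exact (extend_apply_of_mem (evalFun (E.shiftObj.res h a)) hy).symm
    · intro U _ f hf hx
      refine (hf.smoothAt hx).congr_of_eventuallyEq (extend_eventuallyEq le_rfl (fun y hy => ?_) hx)
      refine Eq.trans ?_ (extend_apply_of_mem f hy).symm
      exact AlgHom.commutes ExteriorAlgebra.algebraMapInv (f ⟨y, hy⟩)
    · intro U _ α hα hx
      refine ContMDiffAt.congr_of_eventuallyEq contMDiffAt_const
        (extend_eventuallyEq (F := fun _ => (0 : ℝ)) le_rfl (fun y hy => ?_) hx)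
      exact ExteriorAlgebra.lift_ι_apply ℝ 0 _ (α ⟨y, hy⟩)
    · intro U _ a b ha hb hx
      refine ((ha hx).add (hb hx)).congr_of_eventuallyEq (extend_eventuallyEq le_rfl (fun y hy => ?_) hx)
      rw [Pi.add_apply, extend_apply_of_mem _ hy, extend_apply_of_mem _ hy]
      exact evalFun_add a b _
    · intro U _ a b ha hb hx
      refine ((ha hx).mul (hb hx)).congr_of_eventuallyEq (extend_eventuallyEq le_rfl (fun y hy => ?_) hx)
      rw [Pi.mul_apply, extend_apply_of_mem _ hy, extend_apply_of_mem _ hy]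
      exact evalFun_mul a b _
  exact key hx

theorem dirDeriv_mfderiv {V : Type} [NormedAddCommGroup V] [NormedSpace ℝ V] {σ : V → E.base} {p : V}
    {x : E.base} (hx : σ p = x) {g : E.base → ℝ} (hg : E.SmoothAt g x)
    (hσ : ContMDiffAt 𝓘(ℝ, V) (𝓡 E.dim) ∞ σ p) (q : V) :
    E.dirDeriv (x := x) g (mfderiv 𝓘(ℝ, V) (𝓡 E.dim) σ p q) = fderiv ℝ (g ∘ σ) p q := by
  subst hx
  have h := mfderiv_comp p (hg.mdifferentiableAt (by simp)) (hσ.mdifferentiableAt (by simp))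
  rw [mfderiv_eq_fderiv] at h
  rw [h]
  rfl

theorem algebraMapInv_invol {x : E.base} (a : E.Ext x) :
    ExteriorAlgebra.algebraMapInv (ExteriorAlgebra.invol a) = ExteriorAlgebra.algebraMapInv a := by
  induction a using ExteriorAlgebra.induction with
  | algebraMap r => rw [AlgHom.commutes]
  | ι w => simp [ExteriorAlgebra.algebraMapInv]
  | mul a c ha hc => rw [map_mul, map_mul, ha, hc, map_mul]
  | add a c ha hc => rw [map_add, map_add, ha, hc, map_add]

/-- The tangent vector of `[-1]E` that is given by a tangent vector of the base, which
differentiates functions, and a vector in the fibre, which is contracted with `1`-forms. -/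
def tangentVector (E : SmoothVB) (x : E.base) (u : E.Tan x) (e : E.fib x) :
    GradedSpace.TangentVector E.shiftObj x where
  toFun U hx :=
    { toFun := fun a => E.dirDerivOn (x := ⟨x, hx⟩) (evalFun a) u +
        ExteriorAlgebra.algebraMapInv (E.contract e (E.val a ⟨x, hx⟩))
      map_add' := fun a b => by
        have h : E.dirDerivOn (x := ⟨x, hx⟩) (evalFun (a + b)) u =
            E.dirDerivOn (x := ⟨x, hx⟩) (evalFun a) u +
            E.dirDerivOn (x := ⟨x, hx⟩) (evalFun b) u := by
          refine (dirDerivOn_eq le_rfl (fun y hy => ?_) hx u).trans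
            (dirDeriv_add (smoothAt_evalFun hx a) (smoothAt_evalFun hx b) u)
          rw [extend_apply_of_mem _ hy, extend_apply_of_mem _ hy]
          exact evalFun_add a b _
        rw [h, show E.val (a + b) ⟨x, hx⟩ = E.val a ⟨x, hx⟩ + E.val b ⟨x, hx⟩ from rfl, map_add, map_add]
        ring
      map_smul' := fun r a => by
        have h : E.dirDerivOn (x := ⟨x, hx⟩) (evalFun (r • a)) u =
            r * E.dirDerivOn (x := ⟨x, hx⟩) (evalFun a) u := by
          refine (dirDerivOn_eq le_rfl (fun y hy => ?_) hx u).trans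
            ((dirDeriv_mul (f := fun _ => r) contMDiffAt_const (smoothAt_evalFun hx a) u).trans ?_)
          · rw [extend_apply_of_mem _ hy]
            exact evalFun_smul r a _
          · rw [dirDeriv_const, zero_mul, zero_add]
            rfl
        rw [h, show E.val (r • a) ⟨x, hx⟩ = r • E.val a ⟨x, hx⟩ from rfl, map_smul, map_smul,
          RingHom.id_apply, smul_eq_mul, smul_eq_mul, mul_add] }
  res {U V} h hx a := congrArg (· + _) (dirDerivOn_restr h (evalFun a) ⟨x, hx⟩ u)
  leibniz U hx a b := by
    have h : E.dirDerivOn (x := ⟨x, hx⟩) (evalFun (a * b)) u =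
        E.dirDerivOn (x := ⟨x, hx⟩) (evalFun a) u * evalFun b ⟨x, hx⟩ +
        evalFun a ⟨x, hx⟩ * E.dirDerivOn (x := ⟨x, hx⟩) (evalFun b) u := by
      refine (dirDerivOn_eq le_rfl (fun y hy => ?_) hx u).trans
        ((dirDeriv_mul (smoothAt_evalFun hx a) (smoothAt_evalFun hx b) u).trans ?_)
      · rw [extend_apply_of_mem _ hy, extend_apply_of_mem _ hy]
        exact evalFun_mul a b _
      · rw [extend_apply_of_mem _ hx, extend_apply_of_mem _ hx]
        rfl
    have h' : ExteriorAlgebra.algebraMapInv (E.contract e (E.val (a * b) ⟨x, hx⟩)) =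
        ExteriorAlgebra.algebraMapInv (E.contract e (E.val a ⟨x, hx⟩)) * evalFun b ⟨x, hx⟩ +
        evalFun a ⟨x, hx⟩ * ExteriorAlgebra.algebraMapInv (E.contract e (E.val b ⟨x, hx⟩)) := by
      refine (congrArg ExteriorAlgebra.algebraMapInv (contract_mul e (E.val a ⟨x, hx⟩) (E.val b ⟨x, hx⟩))).trans ?_
      rw [map_add, map_mul, map_mul, algebraMapInv_invol]
      rfl
    change E.dirDerivOn (x := ⟨x, hx⟩) (evalFun (a * b)) u + ExteriorAlgebra.algebraMapInv _ =
      (E.dirDerivOn (x := ⟨x, hx⟩) (evalFun a) u + ExteriorAlgebra.algebraMapInv _) *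
        evalFun b ⟨x, hx⟩ + evalFun a ⟨x, hx⟩ * (E.dirDerivOn (x := ⟨x, hx⟩) (evalFun b) u + ExteriorAlgebra.algebraMapInv _)
    rw [h, h']
    ring

theorem tangentVector_toFun {x : E.base} (u : E.Tan x) (e : E.fib x) {U : Opens E.base} (hx : x ∈ U)
    (a : E.shiftObj.func U) : (E.tangentVector x u e).toFun U hx a =
      E.dirDerivOn (x := ⟨x, hx⟩) (evalFun a) u +
        ExteriorAlgebra.algebraMapInv (E.contract e (E.val a ⟨x, hx⟩)) := rfl

/-- The tangent map of `[-1]φ`. -/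
theorem tangentVector_pullForm (φ : E ⟶ E') {x : E.base} (u : E.Tan x) (e : E.fib x)
    {U : Opens E'.base} (hx : φ.base x ∈ U) (a : E'.shiftObj.func U) :
    (E.tangentVector x u e).toFun (preim φ U) hx (pullForm φ U a) =
      (E'.tangentVector (φ.base x) (mfderiv (𝓡 E.dim) (𝓡 E'.dim) φ.base x u) (φ.fib x e)).toFun
        U hx a := by
  refine congrArg₂ (fun r s : ℝ => r + s) ?_ ?_
  · refine (dirDerivOn_eq (x := ⟨x, hx⟩) le_rfl (fun y hy => ?_) hx u).trans
      (dirDeriv_comp φ (smoothAt_evalFun hx a) u)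
    rw [extend_apply_of_mem _ (show φ.base y ∈ U from hy)]
    exact (shiftMap φ).pull_ev U a y hy
  · rw [val_pullForm, contract_map_dualMap, algebraMapInv_map]

end SmoothVB

namespace GradedSpace.TangentVector

variable {E : SmoothVB} {x : E.base} (v v' : TangentVector E.shiftObj x)

theorem toFun_one {U : Opens E.base} (hx : x ∈ U) : v.toFun U hx 1 = 0 := by
  have h := v.leibniz U hx 1 1
  rw [mul_one, map_one (E.shiftObj.ev U), Pi.one_apply, mul_one, one_mul] at h
  exact left_eq_add.1 h

variable {v v'} {V : Type} [NormedAddCommGroup V] [NormedSpace ℝ V] [FiniteDimensional ℝ V]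
  {ι : Type} [Fintype ι] {κ : E.base → V} {σ : V → E.base}

theorem toFun_funForm_eq_of_coords (hc : IsCoords E x κ σ) (b : Module.Basis ι ℝ V)
    (h : ∀ (W : Opens E.base) (hx : x ∈ W) i
      (hs : E.IsSmoothFun W fun y => b.coord i (κ y.1) + -b.coord i (κ x)),
      v.toFun W hx (E.funForm W _ hs) = v'.toFun W hx (E.funForm W _ hs))
    {U : Opens E.base} (hx : x ∈ U) (f : U → ℝ) (hf : E.IsSmoothFun U f) :
    v.toFun U hx (E.funForm U f hf) = v'.toFun U hx (E.funForm U f hf) := by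
  obtain ⟨G, hG, hfG⟩ := hc.hadamard b (hf.smoothNear hx)
  have hd : ∀ i, E.SmoothNear (fun y => b.coord i (κ y) + -b.coord i (κ x)) x := fun i =>
    (hc.smoothNear_coord b i).add (smoothNear_const _ _)
  obtain ⟨S, hS, hSo, hxS⟩ := eventually_nhds_iff.1 (hfG.and ((Filter.eventually_all.2 hG).and
    (Filter.eventually_all.2 hd)))
  let W : Opens E.base := U ⊓ ⟨S, hSo⟩
  have hxW : x ∈ W := ⟨hx, hxS⟩
  have hsd : ∀ i, E.IsSmoothFun W fun y => b.coord i (κ y.1) + -b.coord i (κ x) := fun i =>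
    isSmoothFun_of_smoothAt (F := fun y => b.coord i (κ y) + -b.coord i (κ x))
      (fun y hy => (hS y hy.2).2.2 i) fun _ _ => rfl
  have hsG : ∀ i, E.IsSmoothFun W fun y => G i y.1 := fun i =>
    isSmoothFun_of_smoothAt (F := G i) (fun y hy => (hS y hy.2).2.1 i) fun _ _ => rfl
  have h1 : E.shiftObj.res (inf_le_left : W ≤ U) (E.funForm U f hf) =
      f ⟨x, hx⟩ • (1 : E.shiftObj.func W) + ∑ i, E.funForm W _ (hsd i) * E.funForm W _ (hsG i) := by
    refine func_ext fun y => ?_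
    have h2 := (hS y y.2.2).1
    rw [extend_apply_of_mem f y.2.1, extend_apply_of_mem f hx] at h2
    have h3 : E.val (f ⟨x, hx⟩ • (1 : E.shiftObj.func W) +
        ∑ i, E.funForm W _ (hsd i) * E.funForm W _ (hsG i)) y = f ⟨x, hx⟩ • (1 : E.Ext y.1) +
        E.val (∑ i, E.funForm W _ (hsd i) * E.funForm W _ (hsG i)) y := rfl
    rw [h3, LieAlgebroid.val_sum]
    change algebraMap ℝ (E.Ext y.1) (f ⟨y.1, y.2.1⟩) = _ + ∑ i, algebraMap ℝ (E.Ext y.1) _ *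
      algebraMap ℝ (E.Ext y.1) _
    rw [h2, map_add, map_sum, ← Algebra.algebraMap_eq_smul_one]
    simp only [map_mul]
  have h4 : ∀ v : TangentVector E.shiftObj x, v.toFun U hx (E.funForm U f hf) =
      ∑ i, v.toFun W hxW (E.funForm W _ (hsd i)) *
        evalFun (E.funForm W _ (hsG i)) ⟨x, hxW⟩ := fun v => by
    have h5 : ∀ i, evalFun (E.funForm W _ (hsd i)) ⟨x, hxW⟩ = 0 := fun i =>
      (AlgHom.commutes ExteriorAlgebra.algebraMapInv _).trans (add_neg_cancel _)
    refine (v.res (inf_le_left : W ≤ U) hxW (E.funForm U f hf)).symm.trans ?_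
    refine (congrArg (v.toFun W hxW) h1).trans ?_
    rw [map_add, map_smul, toFun_one, smul_zero, zero_add, map_sum]
    refine Finset.sum_congr rfl fun i _ => ?_
    refine (v.leibniz W hxW _ _).trans ?_
    exact (congrArg (_ + · * _) (h5 i)).trans (by rw [zero_mul, add_zero]; rfl)
  rw [h4, h4]
  exact Finset.sum_congr rfl fun i _ => congrArg (· * _) (h W hxW i (hsd i))

/-- A tangent vector is determined by its values on coordinates and on a coframe. -/
theorem toFun_eq_of_coords (hc : IsCoords E x κ σ) (b : Module.Basis ι ℝ V)
    (h : ∀ (W : Opens E.base) (hx : x ∈ W) i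
      (hs : E.IsSmoothFun W fun y => b.coord i (κ y.1) + -b.coord i (κ x)),
      v.toFun W hx (E.funForm W _ hs) = v'.toFun W hx (E.funForm W _ hs))
    {W : Opens E.base} {ι' : Type} [Fintype ι'] (F : LocalFrame E W ι') (hw : x ∈ W)
    (h' : ∀ j, v.toFun W hw (LieAlgebroid.frameCovec F le_rfl j) =
      v'.toFun W hw (LieAlgebroid.frameCovec F le_rfl j))
    {U : Opens E.base} (hx : x ∈ U) (a : E.shiftObj.func U) : v.toFun U hx a = v'.toFun U hx a := by
  have key : ∀ hx : x ∈ U, v.toFun U hx a = v'.toFun U hx a := by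
    refine func_induction x (P := fun U a => ∀ hx : x ∈ U, v.toFun U hx a = v'.toFun U hx a)
      ?_ ?_ ?_ ?_ ?_ hx a
    · intro U V h hV a ih hx
      exact (v.res h hV a).symm.trans ((ih hV).trans (v'.res h hV a))
    · intro U _ f hf hx
      exact toFun_funForm_eq_of_coords hc b h hx f hf
    · intro U _ α hα hx
      have hw' : x ∈ U ⊓ W := ⟨hx, hw⟩
      refine (v.res (inf_le_left : U ⊓ W ≤ U) hw' (E.covecForm U α hα)).symm.trans
        (Eq.trans ?_ (v'.res (inf_le_left : U ⊓ W ≤ U) hw' (E.covecForm U α hα)))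
      refine (congrArg (v.toFun _ hw') (F.res_covecForm hα)).trans
        (Eq.trans ?_ (congrArg (v'.toFun _ hw') (F.res_covecForm hα)).symm)
      rw [map_sum, map_sum]
      refine Finset.sum_congr rfl fun j _ => ?_
      refine (v.leibniz _ hw' _ _).trans (Eq.trans ?_ (v'.leibniz _ hw' _ _).symm)
      congr 1
      · exact congrArg (· * _) (toFun_funForm_eq_of_coords hc b h hw' _ _)
      · exact congrArg (_ * ·) ((v.res (inf_le_right : U ⊓ W ≤ W) hw' _).trans
          ((h' j).trans (v'.res (inf_le_right : U ⊓ W ≤ W) hw' _).symm))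
    · intro U _ a b ha hb hx
      rw [map_add, map_add, ha hx, hb hx]
    · intro U _ a b ha hb hx
      refine (v.leibniz _ hx _ _).trans (Eq.trans ?_ (v'.leibniz _ hx _ _).symm)
      rw [ha hx, hb hx]
  exact key hx

/-- Every tangent vector of `[-1]E` is given by a tangent vector of the base and a vector in the
fibre. -/
theorem exists_eq_tangentVector (v : TangentVector E.shiftObj x) : ∃ (u : E.Tan x) (e : E.fib x),
    ∀ (U : Opens E.base) (hx : x ∈ U) a, v.toFun U hx a = (E.tangentVector x u e).toFun U hx a := by
  obtain ⟨W, F, -, hW, -⟩ := E.exists_localFrame x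
  have hc := IsCoords.chartAt x
  let b := AdaptedChart.stdBasis E.dim
  have hd : ∀ i, E.SmoothNear (fun y => b.coord i (chartAt _ x y) + -b.coord i (chartAt _ x x)) x :=
    fun i => (hc.smoothNear_coord b i).add (smoothNear_const _ _)
  choose N hxN _ hN using fun i => GermHom.exists_nhd (hd i) Filter.univ_mem
  let q : EuclideanSpace ℝ (Fin E.dim) := ∑ i, v.toFun (N i) (hxN i) (E.funForm (N i) _ (hN i)) • b i
  let u : E.Tan x := mfderiv 𝓘(ℝ, EuclideanSpace ℝ (Fin E.dim)) (𝓡 E.dim)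
    (chartAt (EuclideanSpace ℝ (Fin E.dim)) x).symm (chartAt _ x x) q
  let e : E.fib x := ∑ j, v.toFun W hW (LieAlgebroid.frameCovec F le_rfl j) • F.basis ⟨x, hW⟩ j
  refine ⟨u, e, fun U hx a => toFun_eq_of_coords hc b (fun W hx i hs => ?_) F hW (fun j => ?_) hx a⟩
  · have hxN' : x ∈ W ⊓ N i := ⟨hx, hxN i⟩
    have h1 : v.toFun W hx (E.funForm W _ hs) = v.toFun (N i) (hxN i) (E.funForm (N i) _ (hN i)) :=
      (v.res (inf_le_left : W ⊓ N i ≤ W) hxN' (E.funForm W _ hs)).symm.trans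
        (v.res (inf_le_right : W ⊓ N i ≤ N i) hxN' (E.funForm (N i) _ (hN i)))
    have h2 : E.dirDeriv (fun y => b.coord i (chartAt _ x y) + -b.coord i (chartAt _ x x)) u =
        b.coord i q := by
      refine (dirDeriv_mfderiv hc.left_inv.self_of_nhds (hd i).self hc.smooth_inv.self_of_nhds q).trans ?_
      have h3 : (fun y => b.coord i (chartAt _ x y) + -b.coord i (chartAt _ x x)) ∘
          (chartAt (EuclideanSpace ℝ (Fin E.dim)) x).symm =ᶠ[𝓝 (chartAt _ x x)]
          fun y => LinearMap.toContinuousLinearMap (b.coord i) y + -b.coord i (chartAt _ x x) :=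
        hc.right_inv.mono fun y hy => by simp [hy]
      rw [h3.fderiv_eq, fderiv_add_const, ContinuousLinearMap.fderiv]
      rfl
    have h4 : b.coord i q = v.toFun (N i) (hxN i) (E.funForm (N i) _ (hN i)) := by
      rw [Module.Basis.coord_apply, Module.Basis.repr_sum_self]
    rw [h1, ← h4, ← h2, tangentVector_toFun]
    have h5 : ExteriorAlgebra.algebraMapInv (E.contract e (E.val (E.funForm W _ hs) ⟨x, hx⟩)) = 0 :=
      (congrArg _ (contract_algebraMap e _)).trans (map_zero _)
    rw [h5, add_zero]
    refine (dirDerivOn_eq (x := ⟨x, hx⟩) le_rfl (fun y hy => ?_) hx u).symm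
    exact AlgHom.commutes ExteriorAlgebra.algebraMapInv _
  · rw [tangentVector_toFun]
    have h1 : E.dirDerivOn (x := ⟨x, hW⟩) (evalFun (LieAlgebroid.frameCovec F le_rfl j)) u = 0 := by
      refine (dirDerivOn_eq (x := ⟨x, hW⟩) (F := fun _ => (0 : ℝ)) le_rfl (fun y hy => ?_) hW u).trans
        (dirDeriv_const _ _)
      exact ExteriorAlgebra.lift_ι_apply ℝ 0 _ _
    have h2 : E.contract e (E.val (LieAlgebroid.frameCovec F le_rfl j) ⟨x, hW⟩) =
        algebraMap ℝ _ ((F.basis ⟨x, hW⟩).coord j e) := contract_ι _ _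
    rw [h1, h2, zero_add, AlgHom.commutes, Module.Basis.coord_apply, Module.Basis.repr_sum_self]
    rfl

end GradedSpace.TangentVector

namespace SmoothVB

variable {E E' : SmoothVB}

theorem LocallyProj.mfderiv_surjective {φ : E ⟶ E'} {x : E.base} (h : LocallyProj φ x) :
    Function.Surjective (mfderiv (𝓡 E.dim) (𝓡 E'.dim) φ.base x) := by
  obtain ⟨κ, σ, k, y, τ, hZ, hY⟩ := h
  -- a local section of the base map through `x`
  let r : E'.base → E.base := fun z => τ (κ z, y x)
  have hr : r (φ.base x) = x := hY.left_inv.self_of_nhds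
  have hκ : ContMDiffAt (𝓡 E'.dim) 𝓘(ℝ, EuclideanSpace ℝ (Fin E'.dim)) ∞ κ (φ.base x) :=
    hZ.smooth.self_of_nhds
  have hκ' : ContMDiffAt (𝓡 E'.dim) 𝓘(ℝ, EuclideanSpace ℝ (Fin E'.dim) × EuclideanSpace ℝ (Fin k)) ∞
      (fun z => (κ z, y x)) (φ.base x) := hκ.prodMk_space contMDiffAt_const
  have hrs : ContMDiffAt (𝓡 E'.dim) (𝓡 E.dim) ∞ r (φ.base x) :=
    ContMDiffAt.comp (g := τ) (f := fun z => (κ z, y x)) _ hY.smooth_inv.self_of_nhds hκ'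
  have hφr : φ.base ∘ r =ᶠ[𝓝 (φ.base x)] id := by
    have h1 : Filter.Tendsto (fun z => φ.base (r z)) (𝓝 (φ.base x)) (𝓝 (φ.base x)) := by
      have := (φ.smooth_base.continuous.continuousAt (x := r (φ.base x))).comp hrs.continuousAt
      rw [ContinuousAt, Function.comp_apply, hr] at this
      exact this
    filter_upwards [hκ'.continuousAt.eventually hY.right_inv, hZ.left_inv, h1.eventually hZ.left_inv]
      with z h2 h3 h4
    have h5 : κ (φ.base (r z)) = κ z := congrArg Prod.fst h2
    rw [Function.comp_apply, id, ← h4, h5, h3]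
  have h1 : (mfderiv (𝓡 E.dim) (𝓡 E'.dim) φ.base (r (φ.base x))).comp
      (mfderiv (𝓡 E'.dim) (𝓡 E.dim) r (φ.base x)) = mfderiv (𝓡 E'.dim) (𝓡 E'.dim) id (φ.base x) := by
    rw [← hφr.mfderiv_eq]
    exact (mfderiv_comp _ ((φ.smooth_base _).mdifferentiableAt (by simp))
      (hrs.mdifferentiableAt (by simp))).symm
  rw [mfderiv_id, hr] at h1
  exact fun w => ⟨_, DFunLike.congr_fun h1 w⟩

/-- The functor `[-1]` sends surjective submersions to surjective submersions. -/
theorem IsSurjSubmersion.shiftMap {φ : E ⟶ E'} (hφ : IsSurjSubmersion φ) :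
    GradedSpace.IsSurjSubmersion (X := E.shiftObj) (Y := E'.shiftObj) (SmoothVB.shiftMap φ) where
  surj := hφ.surj
  tangent_surj x w := by
    obtain ⟨u', e', h⟩ := w.exists_eq_tangentVector
    obtain ⟨u, rfl⟩ := (hφ.locallyProj x).mfderiv_surjective u'
    obtain ⟨e, rfl⟩ := hφ.fib_surj x e'
    exact ⟨E.tangentVector x u e, fun U hx a =>
      (tangentVector_pullForm φ u e hx a).trans (h U hx a).symm⟩

end SmoothVB



open SmoothVB

/-! ### `[-1]` of groupoid objects -/

namespace SmoothVB

variable {E E' : SmoothVB}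

theorem val_pull_congr {f g : E.shiftObj ⟶ E'.shiftObj} (h : f = g) {U : Opens E'.base}
    (a : E'.shiftObj.func U) {x : E.base} (hx : f.base x ∈ U) (hx' : g.base x ∈ U) :
    E.val (f.pull U a) ⟨x, hx⟩ = E.val (g.pull U a) ⟨x, hx'⟩ := by
  subst h
  rfl

/-- The functor `[-1]` is faithful on bundles: a bundle map is determined by the pullback of
functions and of `1`-forms. -/
theorem shiftMap_injective {φ ψ : E ⟶ E'} (h : shiftMap φ = shiftMap ψ) : φ = ψ := by
  have hb : φ.base = ψ.base := congrArg GradedSpace.Hom.base h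
  have hval := fun (U : Opens E'.base) (a : E'.shiftObj.func U) (x : E.base) (hx : φ.base x ∈ U)
    (hx' : ψ.base x ∈ U) => val_pull_congr (E := E) (E' := E') h a hx hx'
  clear h
  obtain ⟨b, f, h1, h2⟩ := φ
  obtain ⟨b', g, h1', h2'⟩ := ψ
  dsimp only at hb
  subst hb
  have hfg : f = g := by
    funext x
    obtain ⟨W, F, -, hW, -⟩ := E'.exists_localFrame (b x)
    refine LinearMap.ext fun v => (F.basis ⟨b x, hW⟩).ext_elem fun j => ?_
    have h3 : ExteriorAlgebra.map (f x).dualMap (ExteriorAlgebra.ι ℝ ((F.basis ⟨b x, hW⟩).coord j)) =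
        ExteriorAlgebra.map (g x).dualMap (ExteriorAlgebra.ι ℝ ((F.basis ⟨b x, hW⟩).coord j)) :=
      hval W (LieAlgebroid.frameCovec F le_rfl j) x hW hW
    rw [ExteriorAlgebra.map_apply_ι, ExteriorAlgebra.map_apply_ι, ExteriorAlgebra.ι_inj] at h3
    exact DFunLike.congr_fun h3 v
  subst hfg
  rfl

end SmoothVB

theorem SmoothVB.shift_map_comp {X Y Z : SmoothVB} {f : X ⟶ Y} {g : Y ⟶ Z} {k : X ⟶ Z}
    (h : f ≫ g = k) : shift.map f ≫ shift.map g = shift.map k := by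
  rw [← Functor.map_comp, h]

theorem SmoothVB.shift_map_square {X Y Z Z' : SmoothVB} {f : X ⟶ Y} {g : Y ⟶ Z} {f' : X ⟶ Z'}
    {g' : Z' ⟶ Z} (h : f ≫ g = f' ≫ g') :
    shift.map f ≫ shift.map g = shift.map f' ≫ shift.map g' := by
  rw [← Functor.map_comp, h, Functor.map_comp]

/-- A morphism to `[-1]` of a fibre product with components induced by bundle maps is induced by a
bundle map. -/
theorem IsFibreProduct.exists_eq_shiftMap {E W X Y Z : SmoothVB} {p1 : W ⟶ X} {p2 : W ⟶ Y} {s : X ⟶ Z}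
    {t : Y ⟶ Z} (hW : IsFibreProduct (fun _ => True) p1 p2 s t)
    (hW' : IsFibreProduct (C := GradedSpace) GradedSpace.IsSupermanifold (shift.map p1) (shift.map p2)
      (shift.map s) (shift.map t))
    {a : E ⟶ X} {b : E ⟶ Y} (hab : a ≫ s = b ≫ t) {c : shift.obj E ⟶ shift.obj W}
    (h1 : c ≫ shift.map p1 = shift.map a) (h2 : c ≫ shift.map p2 = shift.map b) :
    ∃ c' : E ⟶ W, c' ≫ p1 = a ∧ c' ≫ p2 = b ∧ c = shift.map c' := by
  obtain ⟨c', ⟨h1', h2'⟩, -⟩ := hW.2 E trivial a b hab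
  refine ⟨c', h1', h2', (hW'.2 _ (isSupermanifold_shiftObj E) (shift.map a) (shift.map b) 
    (shift_map_square hab)).unique ⟨h1, h2⟩ ⟨shift_map_comp h1', shift_map_comp h2'⟩⟩

/-- The functor `[-1]` sends groupoid objects in vector bundles whose target map is a surjective
submersion to groupoid objects in supermanifolds: it preserves the fibre products that occur. -/
theorem GroupoidDiagram.IsGroupoidObject.shift {D : GroupoidDiagram SmoothVB}
    (hD : D.IsGroupoidObject fun _ => True) (ht : IsSurjSubmersion D.t) :
    ((GroupoidDiagram.map SmoothVB.shift).obj D).IsGroupoidObject GradedSpace.IsSupermanifold := by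
  have h2 := hD.fibreProduct2.shiftMap ht.locallyProj ht.fib_surj
  have h3 := hD.fibreProduct3.shiftMap (fun w => hD.fibreProduct2.locallyProj (ht.locallyProj _))
    fun w => hD.fibreProduct2.fib_surj (ht.fib_surj _)
  have key : ∀ {E : SmoothVB} {a b : E ⟶ D.G} (_ : a ≫ D.s = b ≫ D.t)
      {c : SmoothVB.shift.obj E ⟶ SmoothVB.shift.obj D.G2},
      c ≫ SmoothVB.shift.map D.p1 = SmoothVB.shift.map a →
      c ≫ SmoothVB.shift.map D.p2 = SmoothVB.shift.map b →
      ∃ c' : E ⟶ D.G2, c' ≫ D.p1 = a ∧ c' ≫ D.p2 = b ∧ c = SmoothVB.shift.map c' :=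
    fun hab _ h h' => hD.fibreProduct2.exists_eq_shiftMap h2 hab h h'
  exact {
    mem_G := isSupermanifold_shiftObj D.G
    mem_M := isSupermanifold_shiftObj D.M
    mem_G2 := isSupermanifold_shiftObj D.G2
    mem_G3 := isSupermanifold_shiftObj D.G3
    fibreProduct2 := h2
    fibreProduct3 := h3
    m_s := shift_map_square hD.m_s
    m_t := shift_map_square hD.m_t
    e_s := (shift_map_comp hD.e_s).trans (SmoothVB.shift.map_id _)
    e_t := (shift_map_comp hD.e_t).trans (SmoothVB.shift.map_id _)
    i_s := shift_map_comp hD.i_s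
    i_t := shift_map_comp hD.i_t
    assoc := fun c d h1 h2 h3 h4 => by
      have e1 : (D.q12 ≫ D.m) ≫ D.s = (D.q23 ≫ D.p2) ≫ D.t := by
        rw [Category.assoc, hD.m_s, Category.assoc, ← hD.fibreProduct2.1, ← Category.assoc,
          hD.fibreProduct3.1, Category.assoc]
      have e2 : (D.q12 ≫ D.p1) ≫ D.s = (D.q23 ≫ D.m) ≫ D.t := by
        rw [Category.assoc, hD.fibreProduct2.1, Category.assoc, hD.m_t, ← Category.assoc,
          hD.fibreProduct3.1, Category.assoc]
      obtain ⟨c', h5, h6, rfl⟩ := key e1 (c := c) (h1.trans (shift_map_comp rfl)) (h2.trans (shift_map_comp rfl))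
      obtain ⟨d', h7, h8, rfl⟩ := key e2 (c := d) (h3.trans (shift_map_comp rfl)) (h4.trans (shift_map_comp rfl))
      exact shift_map_square (hD.assoc c' d' h5 h6 h7 h8)
    mul_one := fun c h1 h2 => by
      have e1 : 𝟙 D.G ≫ D.s = (D.s ≫ D.e) ≫ D.t := by
        rw [Category.assoc, hD.e_t, Category.id_comp, Category.comp_id]
      obtain ⟨c', h3, h4, rfl⟩ := key e1 (c := c) (h1.trans (SmoothVB.shift.map_id _).symm)
        (h2.trans (shift_map_comp rfl))
      exact (shift_map_comp (hD.mul_one c' h3 h4)).trans (SmoothVB.shift.map_id _)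
    one_mul := fun c h1 h2 => by
      have e1 : (D.t ≫ D.e) ≫ D.s = 𝟙 D.G ≫ D.t := by
        rw [Category.assoc, hD.e_s, Category.id_comp, Category.comp_id]
      obtain ⟨c', h3, h4, rfl⟩ := key e1 (c := c) (h1.trans (shift_map_comp rfl))
        (h2.trans (SmoothVB.shift.map_id _).symm)
      exact (shift_map_comp (hD.one_mul c' h3 h4)).trans (SmoothVB.shift.map_id _)
    mul_inv := fun c h1 h2 => by
      have e1 : 𝟙 D.G ≫ D.s = D.i ≫ D.t := by rw [hD.i_t, Category.id_comp]
      obtain ⟨c', h3, h4, rfl⟩ := key e1 (c := c) (h1.trans (SmoothVB.shift.map_id _).symm) h2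
      exact shift_map_square (hD.mul_inv c' h3 h4)
    inv_mul := fun c h1 h2 => by
      have e1 : D.i ≫ D.s = 𝟙 D.G ≫ D.t := by rw [hD.i_s, Category.id_comp]
      obtain ⟨c', h3, h4, rfl⟩ := key e1 (c := c) h1 (h2.trans (SmoothVB.shift.map_id _).symm)
      exact shift_map_square (hD.inv_mul c' h3 h4) }

namespace LAGroupoid

theorem isQGroupoid (Γ : LAGroupoid) :
    IsQGroupoid Γ.shiftDiag Γ.algG.differential Γ.algM.differential where
  isSupergroupoid :=
    { isGroupoidObject := Γ.isGroupoidObject.shift Γ.t_submersion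
      s_submersion := Γ.s_submersion.shiftMap
      t_submersion := Γ.t_submersion.shiftMap }
  homological := Γ.algG.isHomological_differential
  multiplicative := ⟨Γ.algG2.differential, Γ.p1_hom.related, Γ.p2_hom.related, Γ.m_hom.related⟩
  base_homological := Γ.algM.isHomological_differential
  s_related := Γ.s_hom.related
  t_related := Γ.t_hom.related

end LAGroupoid

theorem mainTheorem1 :
    (∀ (E : SmoothVB) (A : LieAlgebroid E) (d : GradedSpace.VectorField E.shiftObj 1),
      A.IsDifferential d ↔ d = A.differential) ∧
    ∃ (hobj : ∀ Γ : LAGroupoid, IsQGroupoid Γ.shiftDiag Γ.algG.differential Γ.algM.differential)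
      (hmap : ∀ (Γ Γ' : LAGroupoid) (f : Γ ⟶ Γ'),
        GradedSpace.Related (LAGroupoid.shiftDiagMap f).f1
          Γ.algG.differential Γ'.algG.differential ∧
        GradedSpace.Related (LAGroupoid.shiftDiagMap f).f0
          Γ.algM.differential Γ'.algM.differential),
      (LAGroupoid.shiftFunctor hobj hmap).Faithful := by
  refine ⟨fun E A d => A.isDifferential_iff d, LAGroupoid.isQGroupoid,
    fun Γ Γ' f => ⟨f.2.1.related, f.2.2.related⟩, ⟨fun {Γ Γ' f g} h => Subtype.ext ?_⟩⟩
  have h' : LAGroupoid.shiftDiagMap f = LAGroupoid.shiftDiagMap g := congrArg Subtype.val h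
  exact GroupoidDiagram.Hom.ext (shiftMap_injective (congrArg GroupoidDiagram.Hom.f1 h'))
    (shiftMap_injective (congrArg GroupoidDiagram.Hom.f0 h'))
    (shiftMap_injective (congrArg GroupoidDiagram.Hom.f2 h'))

end
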